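/- Let $(M_0,\omega_0),(M_1,\omega_1),(M_2,\omega_2)$ be symplectic manifolds (finite-dimensional, Hausdorff, second countable, without boundary), and write $M^-$ for $M$ with the form $-\omega$. Let $$L_0\subset M_0,\quad L_{01}\subset M_0^-\times M_1,\quad L_{12}\subset M_1^-\times M_2,\quad L_2\subset M_2^-$$ be compact Lagrangian submanifolds such that the geometric composition $$L_{02}:=L_{01}\circ L_{12}=\{(x_0,x_2)\mid \exists x_1\in M_1:\ (x_0,x_1)\in L_{01},\ (x_1,x_2)\in L_{12}\}$$ is embedded, i.e. $L_{01}\times L_{12}$ is transverse to $M_0\times\Delta_{M_1}\times M_2$ and the projection of their intersection to $M_0\times M_2$ is injective. For $j=0,2$ fix a compact set $K_j\subset M_j$ whose interior contains $L_j$ (if $M_j$ is compact one may take $K_j=M_j$), and let $\mathcal H_j$ be the space of smooth functions on $[0,1]\times M_j$ supported in $[0,1]\times K_j$, with the $C^\infty$ topology. For a time-dependent Hamiltonian $H$ let $\phi^{H}$ be the time-$1$ flow of its Hamiltonian vector field. Then there is a dense open subset $\mathrm{Ham}\subset \mathcal H_0\times\mathcal H_2$ such that for every $(H_0,H_2)\in\mathrm{Ham}$,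 with $H_1\equiv 0$ on $M_1$, the time-$1$ flows $\phi^{H_j}$ exist for $j=0,1,2$, and the defining equations of both sets $$L_0\times_{\phi^{H_0}}L_{02}\times_{\phi^{H_2}}L_2=\{(m_0,m_2)\mid m_0\in L_0,\ (\phi^{H_0}(m_0),m_2)\in L_{02},\ \phi^{H_2}(m_2)\in L_2\},$$ $$L_0\times_{\phi^{H_0}}L_{01}\times_{\phi^{H_1}}L_{12}\times_{\phi^{H_2}}L_2=\{(m_0,m_1,m_2)\mid m_0\in L_0,\ (\phi^{H_0}(m_0),m_1)\in L_{01},\ (\phi^{H_1}(m_1),m_2)\in L_{12},\ \phi^{H_2}(m_2)\in L_2\}$$ are transversal. That is, writing the Lagrangian submanifolds locally as zero sets $\{\psi=0\}$ of submersions, at every point of the set the linearization of the resulting system of equations (for the first set $\psi_0(m_0)=0$, $\psi_{02}(\phi^{H_0}(m_0),m_2)=0$, $\psi_2(\phi^{H_2}(m_2))=0$, and analogously for the second) is surjective. -/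

import Mathlib

open Set Topology Manifold
open scoped ContDiff

noncomputable section

section Submanifolds

variable {E : Type*} [NormedAddCommGroup E] [NormedSpace ℝ E] {H : Type*} [TopologicalSpace H]
  (I : ModelWithCorners ℝ E H) {M : Type*} [TopologicalSpace M] [ChartedSpace H M]

/-- `ψ` is a local defining map of codimension `k` for `L ⊆ M` near `x`: on some open neighbourhood
`U` of `x` it is a smooth submersion to `ℝᵏ` with `L ∩ U = U ∩ ψ⁻¹(0)`. -/
def IsLocalDefiningMap (L : Set M) (x : M) {k : ℕ} (ψ : M → (Fin k → ℝ)) : Prop :=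
  ∃ U : Set M, IsOpen U ∧ x ∈ U ∧ ContMDiffOn I 𝓘(ℝ, Fin k → ℝ) ∞ ψ U ∧
    (∀ y ∈ U, Function.Surjective (mfderiv I 𝓘(ℝ, Fin k → ℝ) ψ y)) ∧
    ∀ y ∈ U, y ∈ L ↔ ψ y = 0

/-- `L ⊆ M` is an embedded submanifold (without boundary) of codimension `k`. -/
def IsEmbeddedSubmanifold (k : ℕ) (L : Set M) : Prop :=
  ∀ x ∈ L, ∃ ψ : M → (Fin k → ℝ), IsLocalDefiningMap I L x ψ

/-- `v` lies in the tangent space `T_x L = ker dψ_x`, with `ψ` a local defining map of `L` near `x`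
(the kernel does not depend on the choice of `ψ`). -/
def IsTangentTo (L : Set M) (x : M) (v : TangentSpace I x) : Prop :=
  ∃ (k : ℕ) (ψ : M → (Fin k → ℝ)), IsLocalDefiningMap I L x ψ ∧
    mfderiv I 𝓘(ℝ, Fin k → ℝ) ψ x v = 0

/-- The submanifolds `A` and `B` intersect transversally: `T_p A + T_p B = T_p M` for `p ∈ A ∩ B`. -/
def SubmanifoldsTransverse (A B : Set M) : Prop :=
  ∀ p ∈ A ∩ B, ∀ w : TangentSpace I p, ∃ u v : TangentSpace I p,
    IsTangentTo I A p u ∧ IsTangentTo I B p v ∧ u + v = w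

/-- A field of alternating bilinear forms on the tangent spaces of `M`. -/
abbrev TwoForm (M : Type*) [TopologicalSpace M] [ChartedSpace H M] :=
  ∀ x : M, (TangentSpace I x) [⋀^Fin 2]→L[ℝ] ℝ

variable {I}

/-- `L` is a Lagrangian submanifold of `(M, Ω)`: an embedded submanifold of half the dimension of `M`
on whose tangent spaces `Ω` vanishes. -/
def IsLagrangian (Ω : TwoForm I M) (L : Set M) : Prop :=
  (∃ k : ℕ, 2 * k = Module.finrank ℝ E ∧ IsEmbeddedSubmanifold I k L) ∧
    ∀ x ∈ L, ∀ u v : TangentSpace I x, IsTangentTo I L x u → IsTangentTo I L x v →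
      Ω x ![u, v] = 0

end Submanifolds

section Symplectic

variable {E : Type*} [NormedAddCommGroup E] [NormedSpace ℝ E]
  {M : Type*} [TopologicalSpace M] [ChartedSpace E M]

/-- The expression of `Ω` in the chart at `c`, i.e. its pullback under the inverse chart. -/
def TwoForm.inChart (Ω : TwoForm 𝓘(ℝ, E) M) (c : M) (y : E) : E [⋀^Fin 2]→L[ℝ] ℝ :=
  (Ω ((extChartAt 𝓘(ℝ, E) c).symm y)).compContinuousLinearMap
    (mfderiv 𝓘(ℝ, E) 𝓘(ℝ, E) (extChartAt 𝓘(ℝ, E) c).symm y)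

/-- `Ω` is a symplectic form: smooth, closed and nondegenerate. -/
structure IsSymplecticForm (Ω : TwoForm 𝓘(ℝ, E) M) : Prop where
  smooth : ∀ c : M, ContDiffOn ℝ ∞ (Ω.inChart c) (extChartAt 𝓘(ℝ, E) c).target
  closed : ∀ c : M, ∀ y ∈ (extChartAt 𝓘(ℝ, E) c).target, extDeriv (Ω.inChart c) y = 0
  nondegenerate : ∀ (x : M) (u : TangentSpace 𝓘(ℝ, E) x),
    (∀ v : TangentSpace 𝓘(ℝ, E) x, Ω x ![u, v] = 0) → u = 0

/-- `γ` is an integral curve on `[0,1]` of the Hamiltonian vector field of the time-dependent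
function `H`: at each time `t ∈ [0,1]` its velocity is the vector `X` with `Ω(X, ·) = d(H t)`. -/
def IsHamiltonianTrajectory (Ω : TwoForm 𝓘(ℝ, E) M) (H : ℝ → M → ℝ) (γ : ℝ → M) : Prop :=
  ∀ t ∈ Icc (0 : ℝ) 1, ∃ X : TangentSpace 𝓘(ℝ, E) (γ t),
    (∀ v : TangentSpace 𝓘(ℝ, E) (γ t),
      Ω (γ t) ![X, v] = mfderiv 𝓘(ℝ, E) 𝓘(ℝ, ℝ) (H t) (γ t) v) ∧
    HasMFDerivWithinAt 𝓘(ℝ, ℝ) 𝓘(ℝ, E) γ (Icc 0 1) t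
      ((1 : ℝ →L[ℝ] ℝ).smulRight X)

/-- `φ` is the time `1` flow of the time-dependent Hamiltonian `H`. -/
def IsTimeOneFlow (Ω : TwoForm 𝓘(ℝ, E) M) (H : ℝ → M → ℝ) (φ : M → M) : Prop :=
  ∀ x : M, ∃ γ : ℝ → M, IsHamiltonianTrajectory Ω H γ ∧ γ 0 = x ∧ γ 1 = φ x

/-- Smooth functions on `[0,1] × M` that are supported in `[0,1] × K`. The derivatives are taken
within `[0,1] × M ⊆ ℝ × M`, for which `H` is extended to `ℝ × M` by clamping the time to `[0,1]`
(the values outside `[0,1]` are immaterial). -/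
structure Hamiltonian (E : Type*) [NormedAddCommGroup E] [NormedSpace ℝ E]
    {M : Type*} [TopologicalSpace M] [ChartedSpace E M] (K : Set M) where
  toFun : Icc (0 : ℝ) 1 → M → ℝ
  smooth : ContMDiffOn (𝓘(ℝ, ℝ).prod 𝓘(ℝ, E)) 𝓘(ℝ, ℝ) ∞
    (fun p : ℝ × M => toFun (projIcc 0 1 zero_le_one p.1) p.2) (Icc (0 : ℝ) 1 ×ˢ univ)
  support_subset : ∀ t x, x ∉ K → toFun t x = 0

namespace Hamiltonian

variable {K : Set M}

/-- The extension to real times by clamping; only times in `[0,1]` are used. -/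
def extend (F : Hamiltonian E K) (t : ℝ) (x : M) : ℝ :=
  F.toFun (projIcc 0 1 zero_le_one t) x

/-- The domain `[0,1] × (target of the chart at c)` in `ℝ × E`. -/
def chartDomain (E : Type*) [NormedAddCommGroup E] [NormedSpace ℝ E]
    {M : Type*} [TopologicalSpace M] [ChartedSpace E M] (c : M) : Set (ℝ × E) :=
  Icc (0 : ℝ) 1 ×ˢ (extChartAt 𝓘(ℝ, E) c).target

/-- The `k`-th derivative of `F`, expressed in the chart at `c`. -/
def chartDeriv (c : M) (k : ℕ) (F : Hamiltonian E K) (p : ℝ × E) :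
    ContinuousMultilinearMap ℝ (fun _ : Fin k => ℝ × E) ℝ :=
  iteratedFDerivWithin ℝ k (fun q : ℝ × E => F.extend q.1 ((extChartAt 𝓘(ℝ, E) c).symm q.2))
    (chartDomain E c) p

/-- The `C^∞` topology: uniform convergence of the derivatives of all orders, in each chart, on
compact subsets of `[0,1] × (target of the chart)`. -/
instance : TopologicalSpace (Hamiltonian E K) :=
  ⨅ (c : M) (k : ℕ), TopologicalSpace.induced
    (fun F => UniformOnFun.ofFun {C : Set (ℝ × E) | IsCompact C ∧ C ⊆ chartDomain E c}
      (chartDeriv c k F)) inferInstance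

end Hamiltonian

end Symplectic

section Correspondences

variable {M₀ M₁ M₂ : Type*}

/-- The fibre product `L₀₁ ×_{M₁} L₁₂`, i.e. `(L₀₁ × L₁₂) ∩ (M₀ × Δ × M₂)`. -/
def fibreProduct (L₀₁ : Set (M₀ × M₁)) (L₁₂ : Set (M₁ × M₂)) : Set ((M₀ × M₁) × (M₁ × M₂)) :=
  (L₀₁ ×ˢ L₁₂) ∩ {p | p.1.2 = p.2.1}

/-- The geometric composition `L₀₁ ∘ L₁₂`. -/
def geometricComposition (L₀₁ : Set (M₀ × M₁)) (L₁₂ : Set (M₁ × M₂)) : Set (M₀ × M₂) :=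
  {p | ∃ x₁ : M₁, (p.1, x₁) ∈ L₀₁ ∧ (x₁, p.2) ∈ L₁₂}

/-- The set `L₀ ×_{φ₀} L₀₂ ×_{φ₂} L₂`. -/
def perturbedTriple (φ₀ : M₀ → M₀) (φ₂ : M₂ → M₂)
    (L₀ : Set M₀) (L₀₂ : Set (M₀ × M₂)) (L₂ : Set M₂) : Set (M₀ × M₂) :=
  {m | m.1 ∈ L₀ ∧ (φ₀ m.1, m.2) ∈ L₀₂ ∧ φ₂ m.2 ∈ L₂}

/-- The set `L₀ ×_{φ₀} L₀₁ ×_{φ₁} L₁₂ ×_{φ₂} L₂`. -/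
def perturbedQuadruple (φ₀ : M₀ → M₀) (φ₁ : M₁ → M₁) (φ₂ : M₂ → M₂)
    (L₀ : Set M₀) (L₀₁ : Set (M₀ × M₁)) (L₁₂ : Set (M₁ × M₂)) (L₂ : Set M₂) :
    Set (M₀ × M₁ × M₂) :=
  {m | m.1 ∈ L₀ ∧ (φ₀ m.1, m.2.1) ∈ L₀₁ ∧ (φ₁ m.2.1, m.2.2) ∈ L₁₂ ∧ φ₂ m.2.2 ∈ L₂}

variable {E₀ E₁ E₂ : Type*} [NormedAddCommGroup E₀] [NormedSpace ℝ E₀]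
  [NormedAddCommGroup E₁] [NormedSpace ℝ E₁] [NormedAddCommGroup E₂] [NormedSpace ℝ E₂]
  [TopologicalSpace M₀] [ChartedSpace E₀ M₀] [TopologicalSpace M₁] [ChartedSpace E₁ M₁]
  [TopologicalSpace M₂] [ChartedSpace E₂ M₂]

/-- The form `(-ω₀) × ω₁` of `M₀⁻ × M₁`, that is `pr₁^* ω₁ - pr₀^* ω₀`. -/
def correspondenceForm (ω₀ : TwoForm 𝓘(ℝ, E₀) M₀) (ω₁ : TwoForm 𝓘(ℝ, E₁) M₁) :
    TwoForm (𝓘(ℝ, E₀).prod 𝓘(ℝ, E₁)) (M₀ × M₁) := fun p =>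
  (ω₁ p.2).compContinuousLinearMap
      (mfderiv (𝓘(ℝ, E₀).prod 𝓘(ℝ, E₁)) 𝓘(ℝ, E₁) (Prod.snd : M₀ × M₁ → M₁) p) -
    (ω₀ p.1).compContinuousLinearMap
      (mfderiv (𝓘(ℝ, E₀).prod 𝓘(ℝ, E₁)) 𝓘(ℝ, E₀) (Prod.fst : M₀ × M₁ → M₀) p)

variable (E₀ E₁ E₂) in
/-- The composition `L₀₁ ∘ L₁₂` is embedded: `L₀₁ × L₁₂` is transverse to `M₀ × Δ × M₂`, and the
projection of `L₀₁ ×_{M₁} L₁₂` to `M₀ × M₂` is injective. -/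
def IsEmbeddedComposition (L₀₁ : Set (M₀ × M₁)) (L₁₂ : Set (M₁ × M₂)) : Prop :=
  SubmanifoldsTransverse
      ((𝓘(ℝ, E₀).prod 𝓘(ℝ, E₁)).prod (𝓘(ℝ, E₁).prod 𝓘(ℝ, E₂)))
      (L₀₁ ×ˢ L₁₂) {p : (M₀ × M₁) × (M₁ × M₂) | p.1.2 = p.2.1} ∧
    InjOn (fun p : (M₀ × M₁) × (M₁ × M₂) => (p.1.1, p.2.2)) (fibreProduct L₀₁ L₁₂)

variable (E₀ E₂) in
/-- The defining equations `ψ₀(m₀) = 0`, `ψ₀₂(φ₀(m₀), m₂) = 0`, `ψ₂(φ₂(m₂)) = 0` of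
`L₀ ×_{φ₀} L₀₂ ×_{φ₂} L₂` are transversal: at each solution their joint linearization is onto.
Here the `ψ`s are local defining maps of `L₀`, `L₀₂`, `L₂`, on whose choice this does not depend. -/
def TripleTransversal (φ₀ : M₀ → M₀) (φ₂ : M₂ → M₂)
    (L₀ : Set M₀) (L₀₂ : Set (M₀ × M₂)) (L₂ : Set M₂) : Prop :=
  ∀ m ∈ perturbedTriple φ₀ φ₂ L₀ L₀₂ L₂,
    ∃ (a b c : ℕ) (ψ₀ : M₀ → (Fin a → ℝ)) (ψ₀₂ : M₀ × M₂ → (Fin b → ℝ)) (ψ₂ : M₂ → (Fin c → ℝ)),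
      IsLocalDefiningMap 𝓘(ℝ, E₀) L₀ m.1 ψ₀ ∧
      IsLocalDefiningMap (𝓘(ℝ, E₀).prod 𝓘(ℝ, E₂)) L₀₂ (φ₀ m.1, m.2) ψ₀₂ ∧
      IsLocalDefiningMap 𝓘(ℝ, E₂) L₂ (φ₂ m.2) ψ₂ ∧
      ∃ D, HasMFDerivAt (𝓘(ℝ, E₀).prod 𝓘(ℝ, E₂))
          𝓘(ℝ, (Fin a → ℝ) × (Fin b → ℝ) × (Fin c → ℝ))
          (fun p : M₀ × M₂ => (ψ₀ p.1, ψ₀₂ (φ₀ p.1, p.2), ψ₂ (φ₂ p.2))) m D ∧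
        Function.Surjective D

variable (E₀ E₁ E₂) in
/-- The defining equations `ψ₀(m₀) = 0`, `ψ₀₁(φ₀(m₀), m₁) = 0`, `ψ₁₂(φ₁(m₁), m₂) = 0`,
`ψ₂(φ₂(m₂)) = 0` of `L₀ ×_{φ₀} L₀₁ ×_{φ₁} L₁₂ ×_{φ₂} L₂` are transversal. -/
def QuadrupleTransversal (φ₀ : M₀ → M₀) (φ₁ : M₁ → M₁) (φ₂ : M₂ → M₂)
    (L₀ : Set M₀) (L₀₁ : Set (M₀ × M₁)) (L₁₂ : Set (M₁ × M₂)) (L₂ : Set M₂) : Prop :=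
  ∀ m ∈ perturbedQuadruple φ₀ φ₁ φ₂ L₀ L₀₁ L₁₂ L₂,
    ∃ (a b c d : ℕ) (ψ₀ : M₀ → (Fin a → ℝ)) (ψ₀₁ : M₀ × M₁ → (Fin b → ℝ))
      (ψ₁₂ : M₁ × M₂ → (Fin c → ℝ)) (ψ₂ : M₂ → (Fin d → ℝ)),
      IsLocalDefiningMap 𝓘(ℝ, E₀) L₀ m.1 ψ₀ ∧
      IsLocalDefiningMap (𝓘(ℝ, E₀).prod 𝓘(ℝ, E₁)) L₀₁ (φ₀ m.1, m.2.1) ψ₀₁ ∧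
      IsLocalDefiningMap (𝓘(ℝ, E₁).prod 𝓘(ℝ, E₂)) L₁₂ (φ₁ m.2.1, m.2.2) ψ₁₂ ∧
      IsLocalDefiningMap 𝓘(ℝ, E₂) L₂ (φ₂ m.2.2) ψ₂ ∧
      ∃ D, HasMFDerivAt (𝓘(ℝ, E₀).prod (𝓘(ℝ, E₁).prod 𝓘(ℝ, E₂)))
          𝓘(ℝ, (Fin a → ℝ) × (Fin b → ℝ) × (Fin c → ℝ) × (Fin d → ℝ))
          (fun p : M₀ × M₁ × M₂ =>
            (ψ₀ p.1, ψ₀₁ (φ₀ p.1, p.2.1), ψ₁₂ (φ₁ p.2.1, p.2.2), ψ₂ (φ₂ p.2.2))) m D ∧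
        Function.Surjective D

end Correspondences

end

/-! `Ham` consists of the pairs for which the four-term system is transversal. Transversality of the
three-term system then follows, so only one system has to be perturbed.

From four terms to three. Let A and B be the differentials of defining maps of L₀₁ and L₁₂ at
composable points. Transversality to the diagonal says that (w₀, w₁, w₂) ↦ (A(w₀, w₁), B(w₁, w₂)) is
onto (`SubmanifoldsTransverse.exists_preimage`). Isotropy of both correspondences and nondegeneracy
of ω₁ make w₁ ↦ (A(0, w₁), B(w₁, 0)) injective (`IsLagrangian.eq_zero_of_mfderiv_eq_zero`). The
implicit function theorem therefore eliminates the middle variable (`exists_elimination`). Since the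
middle point is unique and L₀₁, L₁₂ are compact, the result is a defining map of L₀₂, with
differential the quotient of (A, B) by the middle directions
(`exists_isLocalDefiningMap_geometricComposition`). A surjective linearization of the four-term
system descends to this quotient (`QuadrupleTransversal.tripleTransversal`).

Openness. All solutions lie in one compact set that does not depend on the Hamiltonians, the
time-one flow and its space derivative depend continuously on the Hamiltonian
(`Hamiltonian.mjointC1At_flow`), and surjectivity of a linear map is an open condition. The space of
Hamiltonians is used only as a topological space. Hence the ODE theory is developed for families
that are continuous in a topological parameter and C¹ in space and in a finite-dimensional parameter
(`JointC1At`, `IsCompactC1Field.exists_flow`, `IsRegularField.mjointC1At_flow`).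

Density. Given H, finitely many Fᵢ are found such that varying s in H + ∑ sᵢ Fᵢ moves the end point
in all directions, for all relevant initial points (`Hamiltonian.exists_isSpanningAt_of_isCompact`).
They have the form β(t) fᵢ(x), with β a bump of unit mass on [1 - δ, 1]. Rescaling this interval to
[0, 1] gives the field δ X_H + σ' X_f, where σ is a smooth step. It makes sense at δ = 0, where the
end point varies by X_f at the end point q of the unperturbed trajectory; these vectors span, and
spanning persists for small δ > 0 (`Hamiltonian.exists_isSpanningAt`). With s as additional unknown
the four-term system becomes a submersion (`IsDefiningAt.surjective_fderiv`), so for almost every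
small s it is transversal in the original unknowns. The Lagrangian condition makes the number of
equations equal to the number of unknowns, so C¹ regularity and the equidimensional case of Sard's
theorem suffice (`eventually_ae_surjective_fderiv_comp_inl`). Letting s tend to 0 gives density. -/

noncomputable section

set_option maxSynthPendingDepth 3

/-! ### Families of maps that are C¹ in space and continuous in a parameter -/

section JointlyC1

variable {P : Type*} [TopologicalSpace P]
  {E : Type*} [NormedAddCommGroup E] [NormedSpace ℝ E]
  {F : Type*} [NormedAddCommGroup F] [NormedSpace ℝ F]
  {G : Type*} [NormedAddCommGroup G] [NormedSpace ℝ G]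

/-- The family `g p : E → F` with topological parameter `p` is jointly continuous at `(p₀, x₀)`,
is differentiable near that point, and its derivative is jointly continuous at that point. -/
structure JointC1At (g : P → E → F) (p₀ : P) (x₀ : E) : Prop where
  continuousAt : ContinuousAt (fun q : P × E => g q.1 q.2) (p₀, x₀)
  differentiableAt : ∀ᶠ q in 𝓝 (p₀, x₀), DifferentiableAt ℝ (g q.1) q.2
  continuousAt_fderiv : ContinuousAt (fun q : P × E => fderiv ℝ (g q.1) q.2) (p₀, x₀)

lemma JointC1At.of_hasFDerivAt {g : P → E → F} {g' : P → E → E →L[ℝ] F} {p₀ : P} {x₀ : E}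
    (hc : ContinuousAt (fun q : P × E => g q.1 q.2) (p₀, x₀))
    (hd : ∀ᶠ q in 𝓝 (p₀, x₀), HasFDerivAt (g q.1) (g' q.1 q.2) q.2)
    (hc' : ContinuousAt (fun q : P × E => g' q.1 q.2) (p₀, x₀)) : JointC1At g p₀ x₀ :=
  ⟨hc, hd.mono fun _ h => h.differentiableAt, hc'.congr (hd.mono fun _ h => h.fderiv.symm)⟩

lemma JointC1At.congr {g h : P → E → F} {p₀ : P} {x₀ : E} (hg : JointC1At g p₀ x₀)
    (hgh : ∀ᶠ q in 𝓝 (p₀, x₀), h q.1 q.2 = g q.1 q.2) : JointC1At h p₀ x₀ := by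
  have key : ∀ᶠ q in 𝓝 (p₀, x₀), h q.1 =ᶠ[𝓝 q.2] g q.1 := by
    filter_upwards [eventually_eventually_nhds.2 hgh] with q hq
    have : Filter.Tendsto (fun x => (q.1, x)) (𝓝 q.2) (𝓝 q) := by
      have : Continuous (fun x : E => (q.1, x)) := by fun_prop
      exact this.tendsto q.2
    exact this.eventually hq
  refine ⟨hg.continuousAt.congr (hgh.mono fun q hq => hq.symm), ?_,
    hg.continuousAt_fderiv.congr (key.mono fun q hq => hq.fderiv_eq.symm)⟩
  filter_upwards [key, hg.differentiableAt] with q h1 h2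
  exact h1.differentiableAt_iff.2 h2

lemma JointC1At.comp {g : P → E → F} {h : P → F → G} {p₀ : P} {x₀ : E}
    (hh : JointC1At h p₀ (g p₀ x₀)) (hg : JointC1At g p₀ x₀) :
    JointC1At (fun p x => h p (g p x)) p₀ x₀ := by
  have ht : ContinuousAt (fun q : P × E => (q.1, g q.1 q.2)) (p₀, x₀) :=
    continuousAt_fst.prodMk hg.continuousAt
  refine .of_hasFDerivAt (g' := fun p x => (fderiv ℝ (h p) (g p x)).comp (fderiv ℝ (g p) x)) ?_ ?_ ?_
  · exact ContinuousAt.comp (g := fun q : P × F => h q.1 q.2)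
      (f := fun q : P × E => (q.1, g q.1 q.2)) hh.continuousAt ht
  · filter_upwards [hg.differentiableAt, ht.eventually hh.differentiableAt] with q h1 h2
    exact HasFDerivAt.comp q.2 h2.hasFDerivAt h1.hasFDerivAt
  · have h1 : ContinuousAt (fun q : P × E => fderiv ℝ (h q.1) (g q.1 q.2)) (p₀, x₀) :=
      ContinuousAt.comp (g := fun q : P × F => fderiv ℝ (h q.1) q.2)
        (f := fun q : P × E => (q.1, g q.1 q.2)) hh.continuousAt_fderiv ht
    exact h1.clm_comp hg.continuousAt_fderiv

lemma JointC1At.of_contDiffAt {g : E → F} {p₀ : P} {x₀ : E} (hg : ContDiffAt ℝ 1 g x₀) :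
    JointC1At (fun _ : P => g) p₀ x₀ := by
  refine ⟨ContinuousAt.comp (g := g) (f := fun q : P × E => q.2) hg.continuousAt continuousAt_snd,
    ?_, ?_⟩
  · have := hg.eventually (by simp)
    exact continuousAt_snd.eventually (f := fun q : P × E => q.2)
      (this.mono fun y hy => hy.differentiableAt (by simp))
  · exact ContinuousAt.comp (g := fderiv ℝ g) (f := fun q : P × E => q.2)
      (hg.fderiv_right (m := 0) (by simp)).continuousAt continuousAt_snd

lemma JointC1At.prodMk {g : P → E → F} {h : P → E → G} {p₀ : P} {x₀ : E}
    (hg : JointC1At g p₀ x₀) (hh : JointC1At h p₀ x₀) :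
    JointC1At (fun p x => (g p x, h p x)) p₀ x₀ := by
  refine .of_hasFDerivAt (g' := fun p x => (fderiv ℝ (g p) x).prod (fderiv ℝ (h p) x))
    (hg.continuousAt.prodMk hh.continuousAt) ?_ ?_
  · filter_upwards [hg.differentiableAt, hh.differentiableAt] with q h1 h2
    exact h1.hasFDerivAt.prodMk h2.hasFDerivAt
  · exact (ContinuousLinearMap.prodₗᵢ (𝕜 := ℝ) ℝ).continuous.continuousAt.comp
      (hg.continuousAt_fderiv.prodMk hh.continuousAt_fderiv)

/-- Pull-back of the parameter along a continuous map. -/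
lemma JointC1At.comp_param {Q : Type*} [TopologicalSpace Q] {g : P → E → F} {u : Q → P}
    {q₀ : Q} {x₀ : E} (hg : JointC1At g (u q₀) x₀) (hu : ContinuousAt u q₀) :
    JointC1At (fun q => g (u q)) q₀ x₀ := by
  have ht : ContinuousAt (fun q : Q × E => (u q.1, q.2)) (q₀, x₀) :=
    (hu.comp continuousAt_fst).prodMk continuousAt_snd
  exact ⟨ContinuousAt.comp (g := fun q : P × E => g q.1 q.2)
      (f := fun q : Q × E => (u q.1, q.2)) hg.continuousAt ht, ht.eventually hg.differentiableAt,
    ContinuousAt.comp (g := fun q : P × E => fderiv ℝ (g q.1) q.2)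
      (f := fun q : Q × E => (u q.1, q.2)) hg.continuousAt_fderiv ht⟩

/-- Freezing the parameter turns joint continuity of the derivative into ordinary C¹ regularity,
which is what the inverse function theorem needs. -/
lemma contDiffAt_one_of_jointC1At {g : P → E → F} {p₀ : P} {x₀ : E}
    (hg : ∀ᶠ x in 𝓝 x₀, JointC1At g p₀ x) : ContDiffAt ℝ 1 (g p₀) x₀ := by
  have hm : ∀ x : E, Filter.Tendsto (fun y : E => (p₀, y)) (𝓝 x) (𝓝 (p₀, x)) := fun x =>
    (show Continuous (fun y : E => (p₀, y)) by fun_prop).tendsto x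
  obtain ⟨u, hu, huo, hxu⟩ := eventually_nhds_iff.1 hg
  have : ContDiffOn ℝ 1 (g p₀) u := by
    rw [show (1 : WithTop ℕ∞) = 0 + 1 from rfl, contDiffOn_succ_iff_fderiv_of_isOpen huo]
    refine ⟨fun x hx => ((hm x).eventually (hu x hx).differentiableAt).self_of_nhds.differentiableWithinAt,
      by simp, ?_⟩
    rw [contDiffOn_zero]
    intro x hx
    have := (hu x hx).continuousAt_fderiv.tendsto.comp (hm x)
    exact ContinuousAt.continuousWithinAt this
  exact this.contDiffAt (huo.mem_nhds hxu)

end JointlyC1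

/-! ### Grönwall and compactness estimates -/

section Gronwall

variable {Z : Type*} [NormedAddCommGroup Z] [NormedSpace ℝ Z]

lemma hasDerivWithinAt_Ici_of_Icc {y : ℝ → Z} {v : Z} {a b t : ℝ} (ht : t ∈ Ico a b)
    (h : HasDerivWithinAt y v (Icc a b) t) : HasDerivWithinAt y v (Ici t) t :=
  h.mono_of_mem_nhdsWithin (Icc_mem_nhdsGE_of_mem ht)

/-- The assumptions K ≥ 1 and length at most 1 absorb the usual Grönwall bound into a single factor
exp K, so that every later estimate has the same shape. -/
lemma norm_le_exp_mul_of_norm_deriv_le {y y' : ℝ → Z} {a b K ε : ℝ} (hK : 1 ≤ K) (hε : 0 ≤ ε)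
    (hab : b - a ≤ 1) (hy : ∀ t ∈ Icc a b, HasDerivWithinAt y (y' t) (Icc a b) t)
    (bound : ∀ t ∈ Icc a b, ‖y' t‖ ≤ K * ‖y t‖ + ε) :
    ∀ t ∈ Icc a b, ‖y t‖ ≤ Real.exp K * (‖y a‖ + ε) := by
  intro t ht
  have h := norm_le_gronwallBound_of_norm_deriv_right_le
    (fun t ht => (hy t ht).continuousWithinAt)
    (fun t ht => hasDerivWithinAt_Ici_of_Icc ht (hy t (Ico_subset_Icc_self ht))) le_rfl
    (fun t ht => bound t (Ico_subset_Icc_self ht)) t ht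
  rw [gronwallBound_of_K_ne_0 (by positivity)] at h
  beta_reduce at h
  have h1 : Real.exp (K * (t - a)) ≤ Real.exp K := by
    apply Real.exp_le_exp.2
    nlinarith [ht.1, ht.2]
  have h2 : ε / K ≤ ε := div_le_self hε hK
  have h3 : 0 ≤ ε / K := by positivity
  have h4 : 1 ≤ Real.exp (K * (t - a)) := Real.one_le_exp (by nlinarith [ht.1])
  have h5 : 0 < Real.exp K := Real.exp_pos _
  calc ‖y t‖ ≤ _ := h
    _ ≤ ‖y a‖ * Real.exp K + ε / K * Real.exp K := by
      gcongr
      linarith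
    _ ≤ ‖y a‖ * Real.exp K + ε * Real.exp K := by gcongr
    _ = _ := by ring

end Gronwall

section Tube

variable {P Y W : Type*} [TopologicalSpace P] [TopologicalSpace Y] [PseudoMetricSpace W]

/-- A tube lemma: the distance to the value at `p₀` is continuous and vanishes on `{p₀} × C`. The
parameter space need not be metric. -/
lemma eventually_forall_dist_lt_of_isCompact {F : P → Y → W} {C : Set Y} (hC : IsCompact C)
    (hF : Continuous fun q : P × Y => F q.1 q.2) (p₀ : P) {ε : ℝ} (hε : 0 < ε) :
    ∀ᶠ p in 𝓝 p₀, ∀ y ∈ C, dist (F p y) (F p₀ y) < ε := by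
  refine hC.eventually_forall_of_forall_eventually fun y _ => ?_
  have h1 : Continuous fun q : P × Y => dist (F q.1 q.2) (F p₀ q.2) :=
    hF.dist (hF.comp (continuous_const.prodMk continuous_snd))
  have := h1.tendsto (p₀, y)
  simp only [dist_self] at this
  exact this.eventually (gt_mem_nhds hε)

end Tube

/-! ### Flows of compactly supported C¹ fields on a normed space -/

section EuclideanFlow

variable {P : Type*} [TopologicalSpace P] {Z : Type*} [NormedAddCommGroup Z] [NormedSpace ℝ Z]

/-- A family of time-dependent vector fields on `Z`, supported in a fixed compact set, that is
jointly continuous along with its spatial derivative. -/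
structure IsCompactC1Field (G : P → ℝ → Z → Z) (C : Set Z) : Prop where
  isCompact : IsCompact C
  continuous : Continuous fun q : P × ℝ × Z => G q.1 q.2.1 q.2.2
  differentiable : ∀ p t, Differentiable ℝ (G p t)
  continuous_fderiv : Continuous fun q : P × ℝ × Z => fderiv ℝ (G q.1 q.2.1) q.2.2
  eq_zero : ∀ p t, ∀ z ∉ C, G p t z = 0

namespace IsCompactC1Field

variable {G : P → ℝ → Z → Z} {C : Set Z}

omit [NormedSpace ℝ Z] in
lemma eventually_bound {W : Type*} [NormedAddCommGroup W] {N : P → ℝ → Z → W} (hC : IsCompact C)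
    (hN : Continuous fun q : P × ℝ × Z => N q.1 q.2.1 q.2.2)
    (h0 : ∀ p t, ∀ z ∉ C, N p t z = 0) (p₀ : P) :
    ∃ K, 1 ≤ K ∧ ∀ᶠ p in 𝓝 p₀, ∀ t ∈ Icc (0 : ℝ) 1, ∀ z, ‖N p t z‖ ≤ K := by
  have hcomp : IsCompact (Icc (0 : ℝ) 1 ×ˢ C) := isCompact_Icc.prod hC
  obtain ⟨B, hB⟩ := hcomp.exists_bound_of_continuousOn
    (f := fun y : ℝ × Z => N p₀ y.1 y.2) (hN.comp (continuous_const.prodMk continuous_id)).continuousOn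
  refine ⟨max 1 (B + 1), le_max_left _ _, ?_⟩
  filter_upwards [eventually_forall_dist_lt_of_isCompact (F := fun p (y : ℝ × Z) => N p y.1 y.2)
    hcomp hN p₀ one_pos] with p hp t ht z
  by_cases hz : z ∈ C
  · have h1 := hp (t, z) ⟨ht, hz⟩
    have h2 := hB (t, z) ⟨ht, hz⟩
    simp only [dist_eq_norm] at h1 h2
    have := norm_le_norm_add_norm_sub' (N p t z) (N p₀ t z)
    exact le_trans (by linarith) (le_max_right _ _)
  · rw [h0 p t z hz, norm_zero]; positivity

lemma fderiv_eq_zero [T2Space Z] (hG : IsCompactC1Field G C) (p : P) (t : ℝ) {z : Z} (hz : z ∉ C) :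
    fderiv ℝ (G p t) z = 0 := by
  have : G p t =ᶠ[𝓝 z] fun _ => 0 := by
    filter_upwards [hG.isCompact.isClosed.isOpen_compl.mem_nhds hz] with w hw
    exact hG.eq_zero p t w hw
  rw [this.fderiv_eq]
  simp

lemma exists_bound (hG : IsCompactC1Field G C) (p₀ : P) :
    ∃ K, 1 ≤ K ∧ ∃ V, IsOpen V ∧ p₀ ∈ V ∧ ∀ p ∈ V, ∀ t ∈ Icc (0 : ℝ) 1, ∀ z,
      ‖G p t z‖ ≤ K ∧ ‖fderiv ℝ (G p t) z‖ ≤ K := by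
  obtain ⟨K₁, h1, h1'⟩ := eventually_bound hG.isCompact hG.continuous hG.eq_zero p₀
  obtain ⟨K₂, h2, h2'⟩ := eventually_bound hG.isCompact hG.continuous_fderiv
    (fun p t z hz => hG.fderiv_eq_zero p t hz) p₀
  obtain ⟨V, hV, hVo, hpV⟩ := eventually_nhds_iff.1 (h1'.and h2')
  exact ⟨max K₁ K₂, le_max_of_le_left h1, V, hVo, hpV, fun p hp t ht z =>
    ⟨((hV p hp).1 t ht z).trans (le_max_left _ _), ((hV p hp).2 t ht z).trans (le_max_right _ _)⟩⟩

lemma norm_sub_le (hG : IsCompactC1Field G C) {p : P} {t K : ℝ}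
    (hK : ∀ z, ‖fderiv ℝ (G p t) z‖ ≤ K) (z w : Z) : ‖G p t z - G p t w‖ ≤ K * ‖z - w‖ :=
  Convex.norm_image_sub_le_of_norm_fderiv_le (s := univ)
    (fun x _ => hG.differentiable p t x) (fun x _ => hK x) convex_univ trivial trivial

lemma lipschitzWith (hG : IsCompactC1Field G C) {p : P} {t K : ℝ} (hK0 : 0 ≤ K)
    (hK : ∀ z, ‖fderiv ℝ (G p t) z‖ ≤ K) : LipschitzWith K.toNNReal (G p t) :=
  LipschitzWith.of_dist_le_mul fun z w => by
    rw [dist_eq_norm, dist_eq_norm, Real.coe_toNNReal K hK0]; exact hG.norm_sub_le hK z w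

lemma exists_integralCurve [CompleteSpace Z] (hG : IsCompactC1Field G C) {p : P} {K : ℝ}
    (hK1 : 1 ≤ K)
    (hK : ∀ t ∈ Icc (0 : ℝ) 1, ∀ z, ‖G p t z‖ ≤ K ∧ ‖fderiv ℝ (G p t) z‖ ≤ K)
    {t₀ t₁ : ℝ} (h0 : 0 ≤ t₀) (h01 : t₀ ≤ t₁) (h1 : t₁ ≤ 1) (z : Z) :
    ∃ α : ℝ → Z, α t₀ = z ∧ IsIntegralCurveOn α (G p) (Icc t₀ t₁) := by
  have hsub : ∀ t ∈ Icc t₀ t₁, t ∈ Icc (0 : ℝ) 1 := fun t ht => ⟨h0.trans ht.1, ht.2.trans h1⟩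
  have hK0 : 0 ≤ K := by linarith
  -- Speed at most K over time at most 1 keeps the curve in the ball of radius K, so that radius is
  -- admissible without shortening the interval.
  have hpl : IsPicardLindelof (G p) (tmin := t₀) (tmax := t₁) ⟨t₀, left_mem_Icc.2 h01⟩ z
      K.toNNReal 0 K.toNNReal K.toNNReal := by
    refine ⟨fun t ht => (hG.lipschitzWith hK0 fun z => (hK t (hsub t ht) z).2).lipschitzOnWith,
      fun x _ => ?_, fun t ht x _ => by
        rw [Real.coe_toNNReal K hK0]; exact (hK t (hsub t ht) x).1, ?_⟩
    · exact (hG.continuous.comp (g := fun q : P × ℝ × Z => G q.1 q.2.1 q.2.2)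
        (f := fun t : ℝ => (p, t, x)) (by fun_prop)).continuousOn
    · simp only [sub_self, NNReal.coe_zero, sub_zero, Real.coe_toNNReal K hK0]
      rw [max_eq_left (by linarith)]
      nlinarith
  exact hpl.exists_eq_forall_mem_Icc_hasDerivWithinAt (by simp)

omit [TopologicalSpace P] in
lemma norm_curve_sub_le {p : P} {K : ℝ}
    (hK : ∀ t ∈ Icc (0 : ℝ) 1, ∀ z, ‖G p t z‖ ≤ K)
    {t₀ t₁ : ℝ} (h0 : 0 ≤ t₀) (h1 : t₁ ≤ 1) {α : ℝ → Z}
    (hα : IsIntegralCurveOn α (G p) (Icc t₀ t₁)) {t : ℝ} (ht : t ∈ Icc t₀ t₁) :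
    ‖α t - α t₀‖ ≤ K * (t - t₀) :=
  norm_image_sub_le_of_norm_deriv_le_segment' (f' := fun t => G p t (α t)) hα
    (fun s hs => hK s ⟨h0.trans hs.1, hs.2.le.trans h1⟩ _) t ht

/-- Existence of the linearized flow along a curve, for short times. -/
lemma exists_linearized [CompleteSpace Z] (hG : IsCompactC1Field G C) {p : P} {K : ℝ}
    (hK1 : 1 ≤ K) (hK : ∀ t ∈ Icc (0 : ℝ) 1, ∀ z, ‖fderiv ℝ (G p t) z‖ ≤ K)
    {t₀ t₁ : ℝ} (h0 : 0 ≤ t₀) (h01 : t₀ ≤ t₁) (h1 : t₁ ≤ 1) (hτ : 2 * K * (t₁ - t₀) ≤ 1)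
    {α : ℝ → Z} (hα : ContinuousOn α (Icc t₀ t₁)) :
    ∃ W : ℝ → Z →L[ℝ] Z, W t₀ = ContinuousLinearMap.id ℝ Z ∧
      IsIntegralCurveOn W (fun t B => (fderiv ℝ (G p t) (α t)).comp B) (Icc t₀ t₁) := by
  have hsub : ∀ t ∈ Icc t₀ t₁, t ∈ Icc (0 : ℝ) 1 := fun t ht => ⟨h0.trans ht.1, ht.2.trans h1⟩
  have hK0 : 0 ≤ K := by linarith
  -- On the ball of radius 1 about the identity one has ‖B‖ ≤ 2, so the speed is at most 2K. This is
  -- where the smallness of the interval is needed.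
  have hpl : IsPicardLindelof (fun t (B : Z →L[ℝ] Z) => (fderiv ℝ (G p t) (α t)).comp B)
      (tmin := t₀) (tmax := t₁) ⟨t₀, left_mem_Icc.2 h01⟩ (ContinuousLinearMap.id ℝ Z)
      1 0 (2 * K).toNNReal K.toNNReal := by
    refine ⟨fun t ht => ?_, fun B _ => ?_, fun t ht B hB => ?_, ?_⟩
    · refine (LipschitzWith.of_dist_le_mul fun A B => ?_).lipschitzOnWith
      rw [dist_eq_norm, dist_eq_norm, ← ContinuousLinearMap.comp_sub, Real.coe_toNNReal K hK0]
      exact (ContinuousLinearMap.opNorm_comp_le _ _).trans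
        (mul_le_mul_of_nonneg_right (hK t (hsub t ht) _) (norm_nonneg _))
    · refine ContinuousOn.clm_comp ?_ continuousOn_const
      exact hG.continuous_fderiv.comp_continuousOn
        (f := fun t : ℝ => (p, t, α t)) (continuousOn_const.prodMk (continuousOn_id.prodMk hα))
    · have h2 : ‖B‖ ≤ 2 := by
        have := norm_le_norm_add_norm_sub' B (ContinuousLinearMap.id ℝ Z)
        have h3 : ‖B - ContinuousLinearMap.id ℝ Z‖ ≤ 1 := by simpa [dist_eq_norm] using hB
        linarith [ContinuousLinearMap.norm_id_le (𝕜 := ℝ) (E := Z)]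
      refine (ContinuousLinearMap.opNorm_comp_le _ _).trans ?_
      have := hK t (hsub t ht) (α t)
      rw [Real.coe_toNNReal _ (by positivity)]
      nlinarith [norm_nonneg B, norm_nonneg (fderiv ℝ (G p t) (α t))]
    · simp only [sub_self, NNReal.coe_zero, sub_zero, NNReal.coe_one,
        Real.coe_toNNReal (2 * K) (by positivity)]
      rw [max_eq_left (by linarith)]
      exact hτ
  exact hpl.exists_eq_forall_mem_Icc_hasDerivWithinAt (by simp)

/-- Joint continuity of the spatial derivative, uniformly along a curve. -/
lemma eventually_fderiv_along (hG : IsCompactC1Field G C) (p₀ : P) {t₀ t₁ : ℝ}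
    {α : ℝ → Z} (hα : ContinuousOn α (Icc t₀ t₁)) {ε : ℝ} (hε : 0 < ε) :
    ∀ᶠ q in 𝓝 (p₀, (0 : Z)), ∀ t ∈ Icc t₀ t₁,
      ‖fderiv ℝ (G q.1 t) (α t + q.2) - fderiv ℝ (G p₀ t) (α t)‖ < ε := by
  have hc : Continuous fun t : Icc t₀ t₁ => α t := continuousOn_iff_continuous_domRestrict.1 hα
  have := eventually_forall_dist_lt_of_isCompact (P := P × Z) (Y := Icc t₀ t₁)
    (F := fun q t => fderiv ℝ (G q.1 t) (α t + q.2)) isCompact_univ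
    (hG.continuous_fderiv.comp
      (f := fun r : (P × Z) × Icc t₀ t₁ => (r.1.1, (r.2 : ℝ), α r.2 + r.1.2))
      (continuous_fst.fst.prodMk ((continuous_subtype_val.comp continuous_snd).prodMk
        ((hc.comp continuous_snd).add continuous_fst.snd))))
    (p₀, 0) hε
  filter_upwards [this] with q hq t ht
  have := hq ⟨t, ht⟩ trivial
  simpa [dist_eq_norm] using this

end IsCompactC1Field

end EuclideanFlow

namespace IsCompactC1Field

variable {P : Type*} [TopologicalSpace P] {Z : Type*} [NormedAddCommGroup Z] [NormedSpace ℝ Z]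
  {G : P → ℝ → Z → Z} {C : Set Z}

section

variable {V : Set P} {K t₀ t₁ : ℝ} {α : P → Z → ℝ → Z} {W : P → Z → ℝ → Z →L[ℝ] Z}

/-- The difference of two integral curves grows at most by K times itself plus the distance between
the two fields. That distance is uniformly small because both fields vanish off one compact set. -/
lemma eventually_curve_near (hG : IsCompactC1Field G C) (hK1 : 1 ≤ K) (hV : IsOpen V)
    (hK : ∀ p ∈ V, ∀ t ∈ Icc (0 : ℝ) 1, ∀ z, ‖fderiv ℝ (G p t) z‖ ≤ K)
    (h0 : 0 ≤ t₀) (h1 : t₁ ≤ 1)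
    (hα0 : ∀ p ∈ V, ∀ z, α p z t₀ = z)
    (hα : ∀ p ∈ V, ∀ z, IsIntegralCurveOn (α p z) (G p) (Icc t₀ t₁))
    {p₀ : P} (hp₀ : p₀ ∈ V) (z₀ : Z) {ε : ℝ} (hε : 0 < ε) :
    ∀ᶠ q in 𝓝 (p₀, z₀), ∀ t ∈ Icc t₀ t₁, ‖α q.1 q.2 t - α p₀ z₀ t‖ < ε := by
  have hsub : ∀ t ∈ Icc t₀ t₁, t ∈ Icc (0 : ℝ) 1 := fun t ht => ⟨h0.trans ht.1, ht.2.trans h1⟩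
  -- Initial points and fields are each allowed an error `e`; Grönwall then gives 2 e exp K = ε / 2.
  set e := ε / (4 * Real.exp K) with he
  have he0 : 0 < e := by positivity
  have hcomp : IsCompact (Icc (0 : ℝ) 1 ×ˢ C) := isCompact_Icc.prod hG.isCompact
  have ev1 : ∀ᶠ p in 𝓝 p₀, ∀ t ∈ Icc (0 : ℝ) 1, ∀ w, ‖G p t w - G p₀ t w‖ ≤ e := by
    filter_upwards [eventually_forall_dist_lt_of_isCompact (F := fun p (y : ℝ × Z) => G p y.1 y.2)
      hcomp hG.continuous p₀ he0] with p hp t ht w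
    by_cases hw : w ∈ C
    · simpa [dist_eq_norm] using (hp (t, w) ⟨ht, hw⟩).le
    · simp [hG.eq_zero _ _ w hw, he0.le]
  have ev2 : ∀ᶠ z in 𝓝 z₀, ‖z - z₀‖ < e := by
    filter_upwards [Metric.ball_mem_nhds z₀ he0] with z hz
    simpa [dist_eq_norm] using hz
  rw [nhds_prod_eq]
  filter_upwards [(ev1.and (hV.mem_nhds hp₀)).prod_mk ev2] with q ⟨⟨hq1, hqV⟩, hq2⟩ t ht
  have := norm_le_exp_mul_of_norm_deriv_le (y := fun t => α q.1 q.2 t - α p₀ z₀ t) hK1 he0.le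
    (by linarith : t₁ - t₀ ≤ 1)
    (fun t ht => (hα q.1 hqV q.2 t ht).sub (hα p₀ hp₀ z₀ t ht)) (fun t ht => by
      have h1 := hq1 t (hsub t ht) (α q.1 q.2 t)
      have h2 := hG.norm_sub_le (hK p₀ hp₀ t (hsub t ht)) (α q.1 q.2 t) (α p₀ z₀ t)
      calc _ = ‖(G q.1 t (α q.1 q.2 t) - G p₀ t (α q.1 q.2 t)) +
            (G p₀ t (α q.1 q.2 t) - G p₀ t (α p₀ z₀ t))‖ := by rw [sub_add_sub_cancel]
        _ ≤ _ := (norm_add_le _ _).trans (by linarith)) t ht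
  rw [hα0 q.1 hqV, hα0 p₀ hp₀] at this
  calc _ ≤ _ := this
    _ < Real.exp K * (e + e) := by gcongr
    _ = ε / 2 := by rw [he]; field_simp; ring
    _ < ε := by linarith

/-- Grönwall is applied to the remainder β z - β z₀ - B (z - z₀). Its inhomogeneous term is the
error of the first-order expansion of the field, which the mean value inequality bounds by ε ‖β z -
β z₀‖. -/
lemma hasFDerivAt_flow (hG : IsCompactC1Field G C) (hK1 : 1 ≤ K)
    {p : P} (hK : ∀ t ∈ Icc (0 : ℝ) 1, ∀ z, ‖fderiv ℝ (G p t) z‖ ≤ K)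
    (h0 : 0 ≤ t₀) (h01 : t₀ ≤ t₁) (h1 : t₁ ≤ 1) {β : Z → ℝ → Z}
    (hβ0 : ∀ z, β z t₀ = z) (hβ : ∀ z, IsIntegralCurveOn (β z) (G p) (Icc t₀ t₁))
    (z₀ : Z) {B : ℝ → Z →L[ℝ] Z} (hB0 : B t₀ = ContinuousLinearMap.id ℝ Z)
    (hB : IsIntegralCurveOn B (fun t A => (fderiv ℝ (G p t) (β z₀ t)).comp A) (Icc t₀ t₁)) :
    HasFDerivAt (fun z => β z t₁) (B t₁) z₀ := by
  have hsub : ∀ t ∈ Icc t₀ t₁, t ∈ Icc (0 : ℝ) 1 := fun t ht => ⟨h0.trans ht.1, ht.2.trans h1⟩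
  have hlip : ∀ z, ∀ t ∈ Icc t₀ t₁, ‖β z t - β z₀ t‖ ≤ Real.exp K * ‖z - z₀‖ := by
    intro z t ht
    have := norm_le_exp_mul_of_norm_deriv_le (y := fun t => β z t - β z₀ t) hK1 le_rfl
      (by linarith : t₁ - t₀ ≤ 1) (fun t ht => (hβ z t ht).sub (hβ z₀ t ht)) (fun t ht => by
        simpa using hG.norm_sub_le (hK t (hsub t ht)) (β z t) (β z₀ t)) t ht
    simpa [hβ0] using this
  rw [hasFDerivAt_iff_isLittleO, Asymptotics.isLittleO_iff]
  intro c hc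
  -- One factor exp K comes from the Lipschitz dependence on the initial point, the other from
  -- Grönwall.
  set ε := c / (Real.exp K * Real.exp K) with hε
  have hε0 : 0 < ε := by positivity
  have hcont : ContinuousOn (β z₀) (Icc t₀ t₁) := fun t ht => (hβ z₀ t ht).continuousWithinAt
  have ev := hG.eventually_fderiv_along p hcont hε0
  rw [nhds_prod_eq] at ev
  have ev' := ev.curry.self_of_nhds
  obtain ⟨η, hη, hη'⟩ := Metric.eventually_nhds_iff.1 ev'
  have evz : ∀ᶠ z in 𝓝 z₀, ‖z - z₀‖ < η / Real.exp K := by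
    filter_upwards [Metric.ball_mem_nhds z₀ (by positivity : 0 < η / Real.exp K)] with z hz
    simpa [dist_eq_norm] using hz
  filter_upwards [evz] with z hz
  have hδ : ∀ t ∈ Icc t₀ t₁, ‖β z t - β z₀ t‖ < η := fun t ht => (hlip z t ht).trans_lt (by
    rw [lt_div_iff₀ (Real.exp_pos _)] at hz; linarith)
  have := norm_le_exp_mul_of_norm_deriv_le
    (y := fun t => β z t - β z₀ t - B t (z - z₀)) (ε := ε * (Real.exp K * ‖z - z₀‖)) hK1
    (by positivity) (by linarith : t₁ - t₀ ≤ 1)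
    (fun t ht => ((hβ z t ht).sub (hβ z₀ t ht)).sub ((hB t ht).clm_apply
      (hasDerivWithinAt_const _ _ (z - z₀)))) (fun t ht => by
        have hmv := Convex.norm_image_sub_le_of_norm_fderiv_le' (f := G p t)
          (φ := fderiv ℝ (G p t) (β z₀ t)) (C := ε) (s := Metric.ball (β z₀ t) η)
          (x := β z₀ t) (y := β z t) (fun x _ => hG.differentiable p t x)
          (fun x hx => by
            have := hη' (y := x - β z₀ t) (by simpa [dist_eq_norm] using hx) t ht
            simpa using this.le)
          (convex_ball _ _) (Metric.mem_ball_self hη)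
          (by simpa [dist_eq_norm] using hδ t ht)
        have h2 := hlip z t ht
        have h3 := (fderiv ℝ (G p t) (β z₀ t)).le_opNorm (β z t - β z₀ t - B t (z - z₀))
        have h4 := hK t (hsub t ht) (β z₀ t)
        calc _ = ‖(G p t (β z t) - G p t (β z₀ t) -
                fderiv ℝ (G p t) (β z₀ t) (β z t - β z₀ t)) +
              fderiv ℝ (G p t) (β z₀ t) (β z t - β z₀ t - B t (z - z₀))‖ := by
              congr 1
              simp only [map_sub, map_zero, ContinuousLinearMap.comp_apply, add_zero]
              abel
          _ ≤ ε * ‖β z t - β z₀ t‖ + K * ‖β z t - β z₀ t - B t (z - z₀)‖ :=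
            (norm_add_le _ _).trans (add_le_add hmv (h3.trans (by gcongr)))
          _ ≤ _ := by rw [add_comm]; gcongr) t₁ (right_mem_Icc.2 h01)
  simp only [hβ0, hB0, ContinuousLinearMap.id_apply, sub_self, norm_zero, zero_add] at this
  refine this.trans (le_of_eq ?_)
  rw [hε]; field_simp

/-- Two linearized flows solve linear equations whose coefficients are uniformly close, since the
curves they are taken along are uniformly close. Grönwall compares them. -/
lemma continuousAt_linearized (hG : IsCompactC1Field G C) (hK1 : 1 ≤ K) (hV : IsOpen V)
    (hK : ∀ p ∈ V, ∀ t ∈ Icc (0 : ℝ) 1, ∀ z, ‖fderiv ℝ (G p t) z‖ ≤ K)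
    (h0 : 0 ≤ t₀) (h01 : t₀ ≤ t₁) (h1 : t₁ ≤ 1)
    (hα0 : ∀ p ∈ V, ∀ z, α p z t₀ = z)
    (hα : ∀ p ∈ V, ∀ z, IsIntegralCurveOn (α p z) (G p) (Icc t₀ t₁))
    (hW0 : ∀ p ∈ V, ∀ z, W p z t₀ = ContinuousLinearMap.id ℝ Z)
    (hW : ∀ p ∈ V, ∀ z, IsIntegralCurveOn (W p z)
      (fun t A => (fderiv ℝ (G p t) (α p z t)).comp A) (Icc t₀ t₁))
    {p₀ : P} (hp₀ : p₀ ∈ V) (z₀ : Z) :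
    ContinuousAt (fun q : P × Z => W q.1 q.2 t₁) (p₀, z₀) := by
  have hsub : ∀ t ∈ Icc t₀ t₁, t ∈ Icc (0 : ℝ) 1 := fun t ht => ⟨h0.trans ht.1, ht.2.trans h1⟩
  have hbd : ∀ t ∈ Icc t₀ t₁, ‖W p₀ z₀ t‖ ≤ Real.exp K := by
    intro t ht
    have := norm_le_exp_mul_of_norm_deriv_le (y := W p₀ z₀) hK1 le_rfl
      (by linarith : t₁ - t₀ ≤ 1) (hW p₀ hp₀ z₀) (fun t ht => by
        rw [add_zero]
        exact (ContinuousLinearMap.opNorm_comp_le _ _).trans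
          (mul_le_mul_of_nonneg_right (hK p₀ hp₀ t (hsub t ht) _) (norm_nonneg _))) t ht
    rw [hW0 p₀ hp₀, add_zero] at this
    exact this.trans (mul_le_of_le_one_right (Real.exp_pos _).le ContinuousLinearMap.norm_id_le)
  rw [Metric.continuousAt_iff']
  intro c hc
  set ε := c / (2 * (Real.exp K * Real.exp K)) with hε
  have hε0 : 0 < ε := by positivity
  have hcont : ContinuousOn (α p₀ z₀) (Icc t₀ t₁) :=
    fun t ht => (hα p₀ hp₀ z₀ t ht).continuousWithinAt
  have ev := hG.eventually_fderiv_along p₀ hcont hε0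
  rw [nhds_prod_eq, Filter.eventually_prod_iff] at ev
  obtain ⟨pa, ha, pb, hb, hab⟩ := ev
  obtain ⟨η, hη, hη'⟩ := Metric.eventually_nhds_iff.1 hb
  have evp : ∀ᶠ q in 𝓝 (p₀, z₀), pa q.1 ∧ q.1 ∈ V :=
    (continuous_fst.tendsto (p₀, z₀)).eventually (ha.and (hV.mem_nhds hp₀))
  filter_upwards [hG.eventually_curve_near hK1 hV hK h0 h1 hα0 hα hp₀ z₀ hη, evp]
    with q hq1 ⟨hq2, hqV⟩
  have key : ∀ t ∈ Icc t₀ t₁, ‖fderiv ℝ (G q.1 t) (α q.1 q.2 t) -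
      fderiv ℝ (G p₀ t) (α p₀ z₀ t)‖ ≤ ε := fun t ht => by
    have := hab hq2 (hη' (y := α q.1 q.2 t - α p₀ z₀ t)
      (by simpa [dist_eq_norm] using hq1 t ht)) t ht
    simpa using this.le
  have := norm_le_exp_mul_of_norm_deriv_le
    (y := fun t => W q.1 q.2 t - W p₀ z₀ t) (ε := ε * Real.exp K) hK1
    (by positivity) (by linarith : t₁ - t₀ ≤ 1)
    (fun t ht => (hW q.1 hqV q.2 t ht).sub (hW p₀ hp₀ z₀ t ht)) (fun t ht => by
        set A := fderiv ℝ (G q.1 t) (α q.1 q.2 t) with hA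
        set A₀ := fderiv ℝ (G p₀ t) (α p₀ z₀ t) with hA₀
        calc _ = ‖A.comp (W q.1 q.2 t - W p₀ z₀ t) + (A - A₀).comp (W p₀ z₀ t)‖ := by
              congr 1
              rw [ContinuousLinearMap.comp_sub, ContinuousLinearMap.sub_comp]
              abel
          _ ≤ ‖A‖ * ‖W q.1 q.2 t - W p₀ z₀ t‖ + ‖A - A₀‖ * ‖W p₀ z₀ t‖ :=
            (norm_add_le _ _).trans (add_le_add (ContinuousLinearMap.opNorm_comp_le _ _)
              (ContinuousLinearMap.opNorm_comp_le _ _))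
          _ ≤ _ := by
            gcongr
            · exact hK q.1 hqV t (hsub t ht) _
            · exact key t ht
            · exact hbd t ht) t₁ (right_mem_Icc.2 h01)
  simp only [hW0 q.1 hqV, hW0 p₀ hp₀, sub_self, norm_zero, zero_add] at this
  rw [dist_eq_norm]
  refine this.trans_lt ?_
  rw [hε]
  field_simp
  linarith

end

/-- The duration τ and the neighbourhood V do not depend on the initial time, so pieces of this
length can be concatenated later. -/
theorem exists_flow [CompleteSpace Z] (hG : IsCompactC1Field G C) (p₀ : P) {r : ℝ} (hr : 0 < r) :
    ∃ τ > 0, ∃ V, IsOpen V ∧ p₀ ∈ V ∧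
      (∃ K, ∀ p ∈ V, ∀ t ∈ Icc (0 : ℝ) 1, LipschitzWith K (G p t)) ∧
      ∀ t₀ t₁, 0 ≤ t₀ → t₀ ≤ t₁ → t₁ ≤ 1 → t₁ ≤ t₀ + τ → ∃ α : P → Z → ℝ → Z,
        (∀ p ∈ V, ∀ z, α p z t₀ = z ∧ IsIntegralCurveOn (α p z) (G p) (Icc t₀ t₁) ∧
          ∀ t ∈ Icc t₀ t₁, ‖α p z t - z‖ ≤ r) ∧
        ∀ p ∈ V, ∀ z, JointC1At (fun p z => α p z t₁) p z := by
  obtain ⟨K, hK1, V, hV, hpV, hK⟩ := hG.exists_bound p₀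
  have hK0 : 0 < K := by linarith
  have hK' : ∀ p ∈ V, ∀ t ∈ Icc (0 : ℝ) 1, ∀ z, ‖fderiv ℝ (G p t) z‖ ≤ K :=
    fun p hp t ht z => (hK p hp t ht z).2
  -- The first bound confines each curve to distance r from its start; the second is the one
  -- required for the linearized equation.
  refine ⟨min (r / K) (1 / (2 * K)), by positivity, V, hV, hpV,
    ⟨_, fun p hp t ht => hG.lipschitzWith hK0.le (hK' p hp t ht)⟩, ?_⟩
  intro t₀ t₁ h0 h01 h1 hτ
  have hτ1 : t₁ - t₀ ≤ r / K := by linarith [min_le_left (r / K) (1 / (2 * K))]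
  have hτ2 : t₁ - t₀ ≤ 1 / (2 * K) := by linarith [min_le_right (r / K) (1 / (2 * K))]
  have ex : ∀ p z, ∃ a : ℝ → Z, p ∈ V → a t₀ = z ∧ IsIntegralCurveOn a (G p) (Icc t₀ t₁) := by
    intro p z
    by_cases hp : p ∈ V
    · obtain ⟨a, ha⟩ := hG.exists_integralCurve hK1 (hK p hp) h0 h01 h1 z
      exact ⟨a, fun _ => ha⟩
    · exact ⟨fun _ => 0, fun h => absurd h hp⟩
  choose α hα using ex
  have exW : ∀ p z, ∃ B : ℝ → Z →L[ℝ] Z, p ∈ V → B t₀ = ContinuousLinearMap.id ℝ Z ∧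
      IsIntegralCurveOn B (fun t A => (fderiv ℝ (G p t) (α p z t)).comp A) (Icc t₀ t₁) := by
    intro p z
    by_cases hp : p ∈ V
    · obtain ⟨B, hB⟩ := hG.exists_linearized hK1 (hK' p hp) h0 h01 h1
        (by rw [le_div_iff₀ (by positivity)] at hτ2; linarith)
        (α := α p z) (fun t ht => ((hα p z hp).2 t ht).continuousWithinAt)
      exact ⟨B, fun _ => hB⟩
    · exact ⟨fun _ => 0, fun h => absurd h hp⟩
  choose W hW using exW
  refine ⟨α, fun p hp z => ⟨(hα p z hp).1, (hα p z hp).2, fun t ht => ?_⟩, fun p hp z => ?_⟩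
  · have := norm_curve_sub_le (fun t ht z => (hK p hp t ht z).1) h0 h1 (hα p z hp).2 ht
    rw [(hα p z hp).1] at this
    refine this.trans ?_
    rw [le_div_iff₀ hK0] at hτ1
    nlinarith [ht.2]
  · refine .of_hasFDerivAt (g' := fun p z => W p z t₁) ?_ ?_ ?_
    · rw [Metric.continuousAt_iff']
      intro ε hε
      filter_upwards [hG.eventually_curve_near hK1 hV hK' h0 h1 (fun p hp z => (hα p z hp).1)
        (fun p hp z => (hα p z hp).2) hp z hε] with q hq
      rw [dist_eq_norm]
      exact hq t₁ (right_mem_Icc.2 h01)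
    · filter_upwards [continuousAt_fst.eventually (f := fun q : P × Z => q.1)
        (hV.mem_nhds hp)] with q hq
      exact hG.hasFDerivAt_flow hK1 (hK' q.1 hq) h0 h01 h1 (fun z => (hα q.1 z hq).1)
        (fun z => (hα q.1 z hq).2) q.2 (hW q.1 q.2 hq).1 (hW q.1 q.2 hq).2
    · exact hG.continuousAt_linearized hK1 hV hK' h0 h01 h1 (fun p hp z => (hα p z hp).1)
        (fun p hp z => (hα p z hp).2) (fun p hp z => (hW p z hp).1)
        (fun p hp z => (hW p z hp).2) hp z

end IsCompactC1Field

/-! ### Derivatives of charts, and jointly C¹ families on a manifold -/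

section Charts

variable {E : Type*} [NormedAddCommGroup E] [NormedSpace ℝ E]
  {H : Type*} [TopologicalSpace H] {I : ModelWithCorners ℝ E H} [I.Boundaryless]
  {M : Type*} [TopologicalSpace M] [ChartedSpace H M] [IsManifold I 1 M]

omit [I.Boundaryless] in
lemma hasMFDerivAt_extChartAt_of_mem {c x : M} (hx : x ∈ (extChartAt I c).source) :
    HasMFDerivAt I 𝓘(ℝ, E) (extChartAt I c) x (mfderiv I 𝓘(ℝ, E) (extChartAt I c) x) :=
  (mdifferentiableAt_extChartAt (by rwa [extChartAt_source] at hx)).hasMFDerivAt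

lemma hasMFDerivAt_extChartAt_symm {c : M} {y : E} (hy : y ∈ (extChartAt I c).target) :
    HasMFDerivAt 𝓘(ℝ, E) I (extChartAt I c).symm y
      (mfderiv 𝓘(ℝ, E) I (extChartAt I c).symm y) := by
  have h := mdifferentiableWithinAt_extChartAt_symm (I := I) hy
  rw [I.range_eq_univ, mdifferentiableWithinAt_univ] at h
  exact h.hasMFDerivAt

lemma mfderiv_symm_mfderiv_extChartAt {c x : M} (hx : x ∈ (extChartAt I c).source)
    (v : TangentSpace I x) :
    mfderiv 𝓘(ℝ, E) I (extChartAt I c).symm (extChartAt I c x)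
      (mfderiv I 𝓘(ℝ, E) (extChartAt I c) x v) = v := by
  have h := mfderivWithin_extChartAt_symm_comp_mfderiv_extChartAt' (I := I) hx
  rw [I.range_eq_univ, mfderivWithin_univ] at h
  exact congrArg (fun L => L v) h

lemma mfderiv_mfderiv_extChartAt_symm {c x : M} (hx : x ∈ (extChartAt I c).source) (w : E) :
    mfderiv I 𝓘(ℝ, E) (extChartAt I c) x
      (mfderiv 𝓘(ℝ, E) I (extChartAt I c).symm (extChartAt I c x) w) = w := by
  have h := mfderiv_extChartAt_comp_mfderivWithin_extChartAt_symm' (I := I) hx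
  rw [I.range_eq_univ, mfderivWithin_univ] at h
  exact congrArg (fun L => L w) h

variable (I) in
/-- The derivative at `x` of the chart centred at `c`, as a map to the model space. -/
def chartD (c x : M) : TangentSpace I x →L[ℝ] E := mfderiv I 𝓘(ℝ, E) (extChartAt I c) x

omit [I.Boundaryless] in
lemma HasMFDerivWithinAt.hasDerivWithinAt_extChartAt {γ : ℝ → M} {s : Set ℝ} {t : ℝ} {c : M}
    {v : TangentSpace I (γ t)} (ht : γ t ∈ (extChartAt I c).source)
    (h : HasMFDerivWithinAt 𝓘(ℝ, ℝ) I γ s t ((1 : ℝ →L[ℝ] ℝ).smulRight v)) :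
    HasDerivWithinAt (fun r => extChartAt I c (γ r))
      (chartD I c (γ t) v) s t := by
  have h1 := ((hasMFDerivAt_extChartAt_of_mem ht).comp_hasMFDerivWithinAt t h)
  rw [hasMFDerivWithinAt_iff_hasFDerivWithinAt] at h1
  rw [hasDerivWithinAt_iff_hasFDerivWithinAt]
  refine h1.congr_fderiv ?_
  ext
  show mfderiv I 𝓘(ℝ, E) (extChartAt I c) (γ t) ((1 : ℝ) • v) = (1 : ℝ) • _
  exact (congrArg (chartD I c (γ t)) (one_smul ℝ v)).trans (one_smul ℝ (chartD I c (γ t) v)).symm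

lemma HasDerivWithinAt.hasMFDerivWithinAt_extChartAt_symm {α : ℝ → E} {w : E} {s : Set ℝ} {t : ℝ}
    {c x : M} {v : TangentSpace I x} (h : HasDerivWithinAt α w s t)
    (ht : α t ∈ (extChartAt I c).target) (hx : (extChartAt I c).symm (α t) = x)
    (hv : chartD I c x v = w) :
    HasMFDerivWithinAt 𝓘(ℝ, ℝ) I (fun r => (extChartAt I c).symm (α r)) s t
      ((1 : ℝ →L[ℝ] ℝ).smulRight v) := by
  subst hx
  have hs : (extChartAt I c).symm (α t) ∈ (extChartAt I c).source := (extChartAt I c).map_target ht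
  have h1 := h.hasFDerivWithinAt.hasMFDerivWithinAt
  have h2 := (hasMFDerivAt_extChartAt_symm ht).comp_hasMFDerivWithinAt t h1
  refine h2.congr_mfderiv ?_
  ext
  show mfderiv 𝓘(ℝ, E) I (extChartAt I c).symm (α t) ((1 : ℝ) • w) = (1 : ℝ) • v
  have h3 := mfderiv_symm_mfderiv_extChartAt hs v
  rw [(extChartAt I c).right_inv ht] at h3
  subst hv
  have h4 : ∀ u : E, (1 : ℝ) • u = u := one_smul ℝ
  have h5 : (1 : ℝ) • v = v := one_smul ℝ v
  rw [h5]
  exact (congrArg (mfderiv 𝓘(ℝ, E) I (extChartAt I c).symm (α t)) (h4 _)).trans h3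

end Charts

section MC1

variable {P : Type*} [TopologicalSpace P]
  {S : Type*} [NormedAddCommGroup S] [NormedSpace ℝ S]
  {E : Type*} [NormedAddCommGroup E] [NormedSpace ℝ E]
  {M : Type*} [TopologicalSpace M] [ChartedSpace E M] [IsManifold 𝓘(ℝ, E) ∞ M]

/-- The chart expression of a family of maps `M × S → M`. -/
def chartFamily (Φ : P → M → S → M) (c c' : M) (p : P) (z : E × S) : E :=
  extChartAt 𝓘(ℝ, E) c' (Φ p ((extChartAt 𝓘(ℝ, E) c).symm z.1) z.2)

variable (E) in
/-- The family `Φ` of self-maps of `M`, with a topological parameter in `P` and a linear parameter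
in `S`, is jointly `C¹` in the charts centred at `x₀` and at its image. -/
structure MJointC1At (Φ : P → M → S → M) (p₀ : P) (x₀ : M) (s₀ : S) : Prop where
  continuousAt : ContinuousAt (fun q : P × M × S => Φ q.1 q.2.1 q.2.2) (p₀, x₀, s₀)
  jointC1At : JointC1At (chartFamily Φ x₀ (Φ p₀ x₀ s₀)) p₀ (extChartAt 𝓘(ℝ, E) x₀ x₀, s₀)

lemma contDiffAt_extChartAt_coord_change {c c' : M} {x : M}
    (hx : x ∈ (extChartAt 𝓘(ℝ, E) c).source) (hx' : x ∈ (extChartAt 𝓘(ℝ, E) c').source) :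
    ContDiffAt ℝ ∞ (fun y => extChartAt 𝓘(ℝ, E) c' ((extChartAt 𝓘(ℝ, E) c).symm y))
      (extChartAt 𝓘(ℝ, E) c x) := by
  have := contDiffWithinAt_ext_coord_change (I := 𝓘(ℝ, E)) (n := ∞) c' c
    (y := extChartAt 𝓘(ℝ, E) c x) (by
      simp only [PartialEquiv.trans_source, PartialEquiv.symm_source, mem_inter_iff, mem_preimage]
      exact ⟨(extChartAt 𝓘(ℝ, E) c).map_source hx, by rwa [(extChartAt 𝓘(ℝ, E) c).left_inv hx]⟩)
  rw [ModelWithCorners.range_eq_univ, contDiffWithinAt_univ] at this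
  exact this

omit [NormedSpace ℝ S] [IsManifold 𝓘(ℝ, E) ∞ M] in
lemma tendsto_chart_symm {c x : M} (hx : x ∈ (extChartAt 𝓘(ℝ, E) c).source) (p : P) (s : S) :
    ContinuousAt (fun q : P × E × S => (q.1, (extChartAt 𝓘(ℝ, E) c).symm q.2.1, q.2.2))
      (p, extChartAt 𝓘(ℝ, E) c x, s) := by
  have h := continuousAt_extChartAt_symm' (I := 𝓘(ℝ, E)) hx
  exact continuousAt_fst.prodMk ((ContinuousAt.comp (f := fun q : P × E × S => q.2.1)
    (g := (extChartAt 𝓘(ℝ, E) c).symm) h (by fun_prop)).prodMk (by fun_prop))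

omit [NormedSpace ℝ S] [IsManifold 𝓘(ℝ, E) ∞ M] in
lemma eventually_mem_source {Φ : P → M → S → M} {p₀ : P} {x₀ : M} {s₀ : S}
    (h : ContinuousAt (fun q : P × M × S => Φ q.1 q.2.1 q.2.2) (p₀, x₀, s₀)) {c c' : M}
    (hx : x₀ ∈ (extChartAt 𝓘(ℝ, E) c).source)
    (hc' : Φ p₀ x₀ s₀ ∈ (extChartAt 𝓘(ℝ, E) c').source) :
    ∀ᶠ q in 𝓝 (p₀, (extChartAt 𝓘(ℝ, E) c x₀, s₀)),
      Φ q.1 ((extChartAt 𝓘(ℝ, E) c).symm q.2.1) q.2.2 ∈ (extChartAt 𝓘(ℝ, E) c').source := by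
  have h1 := tendsto_chart_symm hx p₀ s₀
  have h2 : ContinuousAt (fun q : P × E × S =>
      Φ q.1 ((extChartAt 𝓘(ℝ, E) c).symm q.2.1) q.2.2) (p₀, (extChartAt 𝓘(ℝ, E) c x₀, s₀)) := by
    refine ContinuousAt.comp (g := fun q : P × M × S => Φ q.1 q.2.1 q.2.2)
      (f := fun q : P × E × S => (q.1, (extChartAt 𝓘(ℝ, E) c).symm q.2.1, q.2.2)) ?_ h1
    simpa only [(extChartAt 𝓘(ℝ, E) c).left_inv hx] using h
  refine h2.eventually_mem ?_
  rw [(extChartAt 𝓘(ℝ, E) c).left_inv hx]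
  exact (isOpen_extChartAt_source c').mem_nhds hc'

/-- Near the point, the two chart expressions differ by composition with smooth coordinate changes
on both sides. Continuity of Φ keeps nearby values in the relevant chart domains. -/
lemma jointC1At_chartFamily_change {Φ : P → M → S → M} {p₀ : P} {x₀ : M} {s₀ : S} {c c' d d' : M}
    (h : ContinuousAt (fun q : P × M × S => Φ q.1 q.2.1 q.2.2) (p₀, x₀, s₀))
    (hc : x₀ ∈ (extChartAt 𝓘(ℝ, E) c).source)
    (hc' : Φ p₀ x₀ s₀ ∈ (extChartAt 𝓘(ℝ, E) c').source)
    (hd : x₀ ∈ (extChartAt 𝓘(ℝ, E) d).source)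
    (hd' : Φ p₀ x₀ s₀ ∈ (extChartAt 𝓘(ℝ, E) d').source)
    (hΦ : JointC1At (chartFamily Φ c c') p₀ (extChartAt 𝓘(ℝ, E) c x₀, s₀)) :
    JointC1At (chartFamily Φ d d') p₀ (extChartAt 𝓘(ℝ, E) d x₀, s₀) := by
  set u : E × S → E × S := fun z =>
    (extChartAt 𝓘(ℝ, E) c ((extChartAt 𝓘(ℝ, E) d).symm z.1), z.2) with hu
  have hu1 : ContDiffAt ℝ 1 u (extChartAt 𝓘(ℝ, E) d x₀, s₀) := by
    have h1 := (contDiffAt_extChartAt_coord_change hd hc).of_le (m := 1) (by simp)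
    refine ContDiffAt.prodMk ?_ contDiffAt_snd
    exact ContDiffAt.comp (f := Prod.fst) (extChartAt 𝓘(ℝ, E) d x₀, s₀) h1 contDiffAt_fst
  have hux : u (extChartAt 𝓘(ℝ, E) d x₀, s₀) = (extChartAt 𝓘(ℝ, E) c x₀, s₀) := by
    simp only [hu, (extChartAt 𝓘(ℝ, E) d).left_inv hd]
  have hw := (contDiffAt_extChartAt_coord_change hc' hd').of_le (m := 1) (by simp)
  have key : JointC1At (fun p z => (fun y => extChartAt 𝓘(ℝ, E) d'
      ((extChartAt 𝓘(ℝ, E) c').symm y)) (chartFamily Φ c c' p (u z))) p₀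
      (extChartAt 𝓘(ℝ, E) d x₀, s₀) := by
    refine JointC1At.comp (h := fun _ y => extChartAt 𝓘(ℝ, E) d'
      ((extChartAt 𝓘(ℝ, E) c').symm y)) (g := fun p z => chartFamily Φ c c' p (u z)) ?_ ?_
    · refine JointC1At.of_contDiffAt ?_
      simp only [hux]
      simpa only [chartFamily, (extChartAt 𝓘(ℝ, E) c).left_inv hc] using hw
    · refine JointC1At.comp (g := fun _ z => u z) (h := chartFamily Φ c c') ?_ (.of_contDiffAt hu1)
      rwa [hux]
  refine key.congr ?_
  have hd2 : ∀ᶠ q in 𝓝 (p₀, (extChartAt 𝓘(ℝ, E) d x₀, s₀)),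
      (extChartAt 𝓘(ℝ, E) d).symm q.2.1 ∈ (extChartAt 𝓘(ℝ, E) c).source := by
    have := eventually_mem_source (P := P) (S := S) (Φ := fun _ x _ => x) (p₀ := p₀) (x₀ := x₀)
      (s₀ := s₀) (by fun_prop) hd hc
    exact this
  filter_upwards [eventually_mem_source h hd hc', hd2] with q hq1 hq2
  simp only [chartFamily, hu]
  rw [(extChartAt 𝓘(ℝ, E) c).left_inv hq2, (extChartAt 𝓘(ℝ, E) c').left_inv hq1]

lemma MJointC1At.of_charts {Φ : P → M → S → M} {p₀ : P} {x₀ : M} {s₀ : S} {c c' : M}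
    (h : ContinuousAt (fun q : P × M × S => Φ q.1 q.2.1 q.2.2) (p₀, x₀, s₀))
    (hc : x₀ ∈ (extChartAt 𝓘(ℝ, E) c).source)
    (hc' : Φ p₀ x₀ s₀ ∈ (extChartAt 𝓘(ℝ, E) c').source)
    (hΦ : JointC1At (chartFamily Φ c c') p₀ (extChartAt 𝓘(ℝ, E) c x₀, s₀)) :
    MJointC1At E Φ p₀ x₀ s₀ :=
  ⟨h, jointC1At_chartFamily_change h hc hc' (mem_extChartAt_source _) (mem_extChartAt_source _) hΦ⟩

lemma MJointC1At.jointC1At_charts {Φ : P → M → S → M} {p₀ : P} {x₀ : M} {s₀ : S} {c c' : M}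
    (hΦ : MJointC1At E Φ p₀ x₀ s₀)
    (hc : x₀ ∈ (extChartAt 𝓘(ℝ, E) c).source)
    (hc' : Φ p₀ x₀ s₀ ∈ (extChartAt 𝓘(ℝ, E) c').source) :
    JointC1At (chartFamily Φ c c') p₀ (extChartAt 𝓘(ℝ, E) c x₀, s₀) :=
  jointC1At_chartFamily_change hΦ.continuousAt (mem_extChartAt_source _) (mem_extChartAt_source _)
    hc hc' hΦ.jointC1At

omit [IsManifold 𝓘(ℝ, E) ∞ M] in
lemma MJointC1At.comp {Φ Ψ : P → M → S → M} {p₀ : P} {x₀ : M} {s₀ : S}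
    (hΨ : MJointC1At E Ψ p₀ (Φ p₀ x₀ s₀) s₀) (hΦ : MJointC1At E Φ p₀ x₀ s₀) :
    MJointC1At E (fun p x s => Ψ p (Φ p x s) s) p₀ x₀ s₀ := by
  refine ⟨?_, ?_⟩
  · exact ContinuousAt.comp (g := fun q : P × M × S => Ψ q.1 q.2.1 q.2.2)
      (f := fun q : P × M × S => (q.1, Φ q.1 q.2.1 q.2.2, q.2.2)) hΨ.continuousAt
      (continuousAt_fst.prodMk (hΦ.continuousAt.prodMk (by fun_prop)))
  · set y₀ := Φ p₀ x₀ s₀ with hy₀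
    have h2 : JointC1At (fun p (z : E × S) => (chartFamily Φ x₀ y₀ p z, z.2)) p₀
        (extChartAt 𝓘(ℝ, E) x₀ x₀, s₀) := hΦ.jointC1At.prodMk (.of_contDiffAt contDiffAt_snd)
    have h3 : JointC1At (fun p z => chartFamily Ψ y₀ (Ψ p₀ y₀ s₀) p
        (chartFamily Φ x₀ y₀ p z, z.2)) p₀ (extChartAt 𝓘(ℝ, E) x₀ x₀, s₀) := by
      refine JointC1At.comp (g := fun p (z : E × S) => (chartFamily Φ x₀ y₀ p z, z.2))
        (h := chartFamily Ψ y₀ (Ψ p₀ y₀ s₀)) ?_ h2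
      have : chartFamily Φ x₀ y₀ p₀ (extChartAt 𝓘(ℝ, E) x₀ x₀, s₀) = extChartAt 𝓘(ℝ, E) y₀ y₀ := by
        simp only [chartFamily, extChartAt_to_inv, ← hy₀]
      rw [this]
      exact hΨ.jointC1At
    refine h3.congr ?_
    filter_upwards [eventually_mem_source hΦ.continuousAt (mem_extChartAt_source x₀)
      (mem_extChartAt_source y₀)] with q hq
    simp only [chartFamily]
    rw [(extChartAt 𝓘(ℝ, E) y₀).left_inv hq]

end MC1

/-! ### Time-dependent vector fields on a manifold and their local flows -/

section Cutoff

variable {P : Type*} [TopologicalSpace P] {Z : Type*} [NormedAddCommGroup Z] [NormedSpace ℝ Z]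

/-- Clamping the time and multiplying by a bump function make the field global. Continuity is
checked separately on the support of χ, which lies in the open set D, and off it, where everything
vanishes locally. -/
lemma isCompactC1Field_cutoff {f : P → ℝ → Z → Z} {D : Set Z} (hD : IsOpen D)
    (hf : ContinuousOn (fun q : P × ℝ × Z => f q.1 q.2.1 q.2.2) (univ ×ˢ Icc (0 : ℝ) 1 ×ˢ D))
    (hd : ∀ p, ∀ t ∈ Icc (0 : ℝ) 1, ∀ z ∈ D, DifferentiableAt ℝ (f p t) z)
    (hf' : ContinuousOn (fun q : P × ℝ × Z => fderiv ℝ (f q.1 q.2.1) q.2.2)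
      (univ ×ˢ Icc (0 : ℝ) 1 ×ˢ D))
    {χ : Z → ℝ} (hχ : ContDiff ℝ 1 χ) (hχc : IsCompact (tsupport χ)) (hχD : tsupport χ ⊆ D) :
    IsCompactC1Field (fun p t z => χ z • f p (projIcc (0 : ℝ) 1 zero_le_one t) z)
      (tsupport χ) := by
  have hproj : ∀ t : ℝ, (projIcc (0 : ℝ) 1 zero_le_one t : ℝ) ∈ Icc (0 : ℝ) 1 := fun t =>
    (projIcc (0 : ℝ) 1 zero_le_one t).2
  have hpc : Continuous fun q : P × ℝ × Z => (q.1, (projIcc (0 : ℝ) 1 zero_le_one q.2.1 : ℝ), q.2.2) :=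
    continuous_fst.prodMk ((continuous_subtype_val.comp
      (continuous_projIcc.comp continuous_snd.fst)).prodMk continuous_snd.snd)
  have hzero : ∀ p t, ∀ z ∉ tsupport χ, χ z • f p (projIcc (0 : ℝ) 1 zero_le_one t) z = 0 := by
    intro p t z hz
    rw [image_eq_zero_of_notMem_tsupport hz, zero_smul]
  have hop : ∀ p t, ∀ z ∉ tsupport χ, ∀ᶠ q : P × ℝ × Z in 𝓝 (p, t, z), q.2.2 ∉ tsupport χ := by
    intro p t z hz
    have h : Continuous fun q : P × ℝ × Z => q.2.2 := by fun_prop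
    exact (h.continuousAt (x := (p, t, z))).eventually_mem
      ((isClosed_tsupport χ).isOpen_compl.mem_nhds hz)
  have hcompD : ∀ {W : Type _} [TopologicalSpace W] (N : P × ℝ × Z → W),
      ContinuousOn N (univ ×ˢ Icc (0 : ℝ) 1 ×ˢ D) → ∀ p t, ∀ z ∈ D,
      ContinuousAt (fun q : P × ℝ × Z =>
        N (q.1, (projIcc (0 : ℝ) 1 zero_le_one q.2.1 : ℝ), q.2.2)) (p, t, z) := by
    intro W _ N hN p t z hz
    have h1 : ContinuousOn (fun q : P × ℝ × Z =>
        N (q.1, (projIcc (0 : ℝ) 1 zero_le_one q.2.1 : ℝ), q.2.2)) (univ ×ˢ univ ×ˢ D) :=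
      hN.comp hpc.continuousOn fun q hq => ⟨trivial, hproj _, hq.2.2⟩
    exact h1.continuousAt ((isOpen_univ.prod (isOpen_univ.prod hD)).mem_nhds ⟨trivial, trivial, hz⟩)
  have hder : ∀ p t, ∀ z, HasFDerivAt (fun z => χ z • f p (projIcc (0 : ℝ) 1 zero_le_one t) z)
      (χ z • fderiv ℝ (f p (projIcc (0 : ℝ) 1 zero_le_one t)) z +
        (fderiv ℝ χ z).smulRight (f p (projIcc (0 : ℝ) 1 zero_le_one t) z)) z := by
    intro p t z
    by_cases hz : z ∈ tsupport χ
    · exact (hχ.differentiable (by simp) z).hasFDerivAt.smul (hd p _ (hproj t) z (hχD hz)).hasFDerivAt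
    · have h0 : χ =ᶠ[𝓝 z] fun _ => 0 := notMem_tsupport_iff_eventuallyEq.1 hz
      have h1 : (fun z => χ z • f p (projIcc (0 : ℝ) 1 zero_le_one t) z) =ᶠ[𝓝 z] fun _ => 0 := by
        filter_upwards [h0] with w hw
        rw [hw, zero_smul]
      rw [h0.fderiv_eq, h0.self_of_nhds]
      simpa using (hasFDerivAt_const (0 : Z) z).congr_of_eventuallyEq h1
  refine ⟨hχc, ?_, fun p t z => (hder p t z).differentiableAt, ?_, hzero⟩
  · rw [continuous_iff_continuousAt]
    rintro ⟨p, t, z⟩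
    by_cases hz : z ∈ tsupport χ
    · exact (hχ.continuous.comp continuous_snd.snd).continuousAt.smul
        (hcompD _ hf p t z (hχD hz))
    · refine (continuousAt_const (y := (0 : Z))).congr ?_
      filter_upwards [hop p t z hz] with q hq
      exact (hzero q.1 q.2.1 q.2.2 hq).symm
  · simp_rw [fun p t z => (hder p t z).fderiv]
    rw [continuous_iff_continuousAt]
    rintro ⟨p, t, z⟩
    by_cases hz : z ∈ tsupport χ
    · refine ContinuousAt.add ((hχ.continuous.comp continuous_snd.snd).continuousAt.smul
        (hcompD _ hf' p t z (hχD hz))) ?_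
      have h1 : Continuous fun q : P × ℝ × Z => fderiv ℝ χ q.2.2 :=
        (hχ.continuous_fderiv (by simp)).comp continuous_snd.snd
      have h2 := (ContinuousLinearMap.smulRightL ℝ Z Z).isBoundedBilinearMap.continuous
      exact h2.continuousAt.comp (h1.continuousAt.prodMk (hcompD _ hf p t z (hχD hz)))
    · refine (continuousAt_const (y := (0 : Z →L[ℝ] Z))).congr ?_
      filter_upwards [hop p t z hz] with q hq
      have h0 : χ =ᶠ[𝓝 q.2.2] fun _ => 0 := notMem_tsupport_iff_eventuallyEq.1 hq
      rw [h0.fderiv_eq, h0.self_of_nhds]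
      ext
      simp

end Cutoff

section Trajectories

variable {P : Type*} [TopologicalSpace P]
  {S : Type*} [NormedAddCommGroup S] [NormedSpace ℝ S] [FiniteDimensional ℝ S]
  {E : Type*} [NormedAddCommGroup E] [NormedSpace ℝ E] [FiniteDimensional ℝ E]
  {M : Type*} [TopologicalSpace M] [ChartedSpace E M] [IsManifold 𝓘(ℝ, E) ∞ M]

/-- `γ` is an integral curve on `[a, b]` of the time-dependent vector field `X`. -/
def IsTrajectory (X : ℝ → (x : M) → TangentSpace 𝓘(ℝ, E) x) (a b : ℝ) (γ : ℝ → M) : Prop :=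
  ∀ t ∈ Icc a b, HasMFDerivWithinAt 𝓘(ℝ, ℝ) 𝓘(ℝ, E) γ (Icc a b) t
    ((1 : ℝ →L[ℝ] ℝ).smulRight (X t (γ t)))

/-- A family of time-dependent vector fields on `M`, with a topological parameter in `P` and a
linear parameter in `S`, whose chart expressions are `C¹` in the space variable and the linear
parameter, all derivatives being jointly continuous. -/
def IsRegularField (X : P → S → ℝ → (x : M) → TangentSpace 𝓘(ℝ, E) x) : Prop :=
  ∀ c : M, ∃ f : P → ℝ → E × S → E,
    (∀ p s, ∀ t ∈ Icc (0 : ℝ) 1, ∀ x ∈ (extChartAt 𝓘(ℝ, E) c).source,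
      f p t (extChartAt 𝓘(ℝ, E) c x, s) = chartD 𝓘(ℝ, E) c x (X p s t x)) ∧
    ContinuousOn (fun q : P × ℝ × E × S => f q.1 q.2.1 q.2.2)
      (univ ×ˢ Icc (0 : ℝ) 1 ×ˢ (extChartAt 𝓘(ℝ, E) c).target ×ˢ univ) ∧
    (∀ p, ∀ t ∈ Icc (0 : ℝ) 1, ∀ z ∈ (extChartAt 𝓘(ℝ, E) c).target ×ˢ (univ : Set S),
      DifferentiableAt ℝ (f p t) z) ∧
    ContinuousOn (fun q : P × ℝ × E × S => fderiv ℝ (f q.1 q.2.1) q.2.2)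
      (univ ×ˢ Icc (0 : ℝ) 1 ×ˢ (extChartAt 𝓘(ℝ, E) c).target ×ˢ univ)

omit [FiniteDimensional ℝ E] [IsManifold 𝓘(ℝ, E) ∞ M] in
lemma IsTrajectory.mono {X : ℝ → (x : M) → TangentSpace 𝓘(ℝ, E) x} {a b a' b' : ℝ} {γ : ℝ → M}
    (h : IsTrajectory X a b γ) (ha : a ≤ a') (hb : b' ≤ b) : IsTrajectory X a' b' γ :=
  fun t ht => (h t ⟨ha.trans ht.1, ht.2.trans hb⟩).mono (Icc_subset_Icc ha hb)

omit [FiniteDimensional ℝ E] [IsManifold 𝓘(ℝ, E) ∞ M] in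
lemma IsTrajectory.continuousOn {X : ℝ → (x : M) → TangentSpace 𝓘(ℝ, E) x} {a b : ℝ} {γ : ℝ → M}
    (h : IsTrajectory X a b γ) : ContinuousOn γ (Icc a b) :=
  fun t ht => (h t ht).continuousWithinAt

omit [FiniteDimensional ℝ E] in
lemma IsTrajectory.hasDerivWithinAt {X : ℝ → (x : M) → TangentSpace 𝓘(ℝ, E) x} {a b : ℝ}
    {γ : ℝ → M} (h : IsTrajectory X a b γ) {t : ℝ} (ht : t ∈ Icc a b) {c : M}
    (hc : γ t ∈ (extChartAt 𝓘(ℝ, E) c).source) :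
    HasDerivWithinAt (fun r => extChartAt 𝓘(ℝ, E) c (γ r))
      (chartD 𝓘(ℝ, E) c (γ t) (X t (γ t))) (Icc a b) t :=
  have : IsManifold 𝓘(ℝ, E) 1 M := IsManifold.of_le (n := ∞) (by simp)
  (h t ht).hasDerivWithinAt_extChartAt hc

omit [IsManifold 𝓘(ℝ, E) ∞ M] in
-- The linear parameter is adjoined as a coordinate with zero velocity. Differentiability of the
-- flow in the parameter thus becomes differentiability in the initial point on E × S.
lemma IsRegularField.exists_cutoff {X : P → S → ℝ → (x : M) → TangentSpace 𝓘(ℝ, E) x}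
    (hX : IsRegularField X) (c : M) (s₀ : S) :
    ∃ R > 0, ∃ (G : P → ℝ → E × S → E × S) (C : Set (E × S)), IsCompactC1Field G C ∧
      Metric.closedBall (extChartAt 𝓘(ℝ, E) c c, s₀) R ⊆
        (extChartAt 𝓘(ℝ, E) c).target ×ˢ (univ : Set S) ∧
      (∀ p t z, (G p t z).2 = 0) ∧
      ∀ p, ∀ t ∈ Icc (0 : ℝ) 1, ∀ x s, x ∈ (extChartAt 𝓘(ℝ, E) c).source →
        (extChartAt 𝓘(ℝ, E) c x, s) ∈ Metric.closedBall (extChartAt 𝓘(ℝ, E) c c, s₀) R →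
        G p t (extChartAt 𝓘(ℝ, E) c x, s) = (chartD 𝓘(ℝ, E) c x (X p s t x), 0) := by
  obtain ⟨f, hf, hfc, hfd, hfc'⟩ := hX c
  have hD : IsOpen ((extChartAt 𝓘(ℝ, E) c).target ×ˢ (univ : Set S)) :=
    (isOpen_extChartAt_target c).prod isOpen_univ
  have hmem : (extChartAt 𝓘(ℝ, E) c c, s₀) ∈ (extChartAt 𝓘(ℝ, E) c).target ×ˢ (univ : Set S) :=
    ⟨mem_extChartAt_target c, trivial⟩
  obtain ⟨r, hr, hrD⟩ := Metric.nhds_basis_closedBall.mem_iff.1 (hD.mem_nhds hmem)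
  let χ : ContDiffBump (extChartAt 𝓘(ℝ, E) c c, s₀) := ⟨r / 2, r, by positivity, by linarith⟩
  have hts : tsupport χ = Metric.closedBall (extChartAt 𝓘(ℝ, E) c c, s₀) r := χ.tsupport_eq
  refine ⟨r / 2, by positivity,
    fun p t z => χ z • (f p (projIcc (0 : ℝ) 1 zero_le_one t) z, (0 : S)), tsupport χ, ?_, ?_, ?_, ?_⟩
  · refine isCompactC1Field_cutoff (f := fun p t z => (f p t z, (0 : S))) hD
      (hfc.prodMk continuousOn_const)
      (fun p t ht z hz => (hfd p t ht z hz).prodMk (differentiableAt_const _)) ?_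
      χ.contDiff (hts ▸ isCompact_closedBall _ _) (hts ▸ hrD)
    have : ContinuousOn (fun q : P × ℝ × E × S =>
        (fderiv ℝ (f q.1 q.2.1) q.2.2).prod (0 : E × S →L[ℝ] S))
        (univ ×ˢ Icc (0 : ℝ) 1 ×ˢ (extChartAt 𝓘(ℝ, E) c).target ×ˢ univ) :=
      (ContinuousLinearMap.prodₗᵢ (𝕜 := ℝ) ℝ).continuous.comp_continuousOn
        (hfc'.prodMk continuousOn_const)
    refine this.congr fun q hq => ?_
    exact ((hfd q.1 q.2.1 hq.2.1 q.2.2 hq.2.2).hasFDerivAt.prodMk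
      (hasFDerivAt_const (0 : S) _)).fderiv
  · exact (Metric.closedBall_subset_closedBall (by linarith)).trans hrD
  · intro p t z
    simp
  · intro p t ht x s hx hxs
    simp only [projIcc_of_mem _ ht]
    rw [χ.one_of_mem_closedBall hxs, one_smul, hf p s t ht x hx]

end Trajectories

section LocalFlow

variable {P : Type*} [TopologicalSpace P]
  {S : Type*} [NormedAddCommGroup S] [NormedSpace ℝ S]
  {E : Type*} [NormedAddCommGroup E] [NormedSpace ℝ E]
  {M : Type*} [TopologicalSpace M] [ChartedSpace E M] [IsManifold 𝓘(ℝ, E) ∞ M]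

/-- `G` agrees with the chart expression of `X` on the closed ball of radius `R` about
`(c, s₀)` in the chart centred at `c`. -/
structure IsChartCutoff (X : P → S → ℝ → (x : M) → TangentSpace 𝓘(ℝ, E) x) (c : M) (s₀ : S)
    (R : ℝ) (G : P → ℝ → E × S → E × S) : Prop where
  closedBall_subset : Metric.closedBall (extChartAt 𝓘(ℝ, E) c c, s₀) R ⊆
    (extChartAt 𝓘(ℝ, E) c).target ×ˢ (univ : Set S)
  snd_eq_zero : ∀ p t z, (G p t z).2 = 0
  eq_chartD : ∀ p, ∀ t ∈ Icc (0 : ℝ) 1, ∀ x s, x ∈ (extChartAt 𝓘(ℝ, E) c).source →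
    (extChartAt 𝓘(ℝ, E) c x, s) ∈ Metric.closedBall (extChartAt 𝓘(ℝ, E) c c, s₀) R →
    G p t (extChartAt 𝓘(ℝ, E) c x, s) = (chartD 𝓘(ℝ, E) c x (X p s t x), 0)

namespace IsChartCutoff

variable {X : P → S → ℝ → (x : M) → TangentSpace 𝓘(ℝ, E) x} {c : M} {s₀ : S} {R : ℝ}
    {G : P → ℝ → E × S → E × S} {p : P} {s : S} {a b : ℝ}

omit [TopologicalSpace P] [IsManifold 𝓘(ℝ, E) ∞ M] in
lemma snd_eq (h : IsChartCutoff X c s₀ R G) {α : ℝ → E × S}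
    (hα : IsIntegralCurveOn α (G p) (Icc a b)) {t : ℝ} (ht : t ∈ Icc a b) :
    (α t).2 = (α a).2 := by
  refine constant_of_has_deriv_right_zero (f := fun t => (α t).2)
    (continuous_snd.comp_continuousOn hα.continuousOn) (fun t ht => ?_) t ht
  have h1 := hasDerivWithinAt_Ici_of_Icc ht (hα t (Ico_subset_Icc_self ht))
  have h2 := (ContinuousLinearMap.snd ℝ E S).hasFDerivAt.comp_hasDerivWithinAt t h1
  have h3 : (ContinuousLinearMap.snd ℝ E S) (G p t (α t)) = 0 := h.snd_eq_zero p t (α t)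
  rw [h3] at h2
  exact h2

omit [TopologicalSpace P] in
lemma isTrajectory (h : IsChartCutoff X c s₀ R G) (ha : 0 ≤ a) (hb : b ≤ 1) {α : ℝ → E × S}
    (hα : IsIntegralCurveOn α (G p) (Icc a b))
    (hball : ∀ t ∈ Icc a b, α t ∈ Metric.closedBall (extChartAt 𝓘(ℝ, E) c c, s₀) R)
    (hs : (α a).2 = s) :
    IsTrajectory (X p s) a b (fun t => (extChartAt 𝓘(ℝ, E) c).symm (α t).1) := by
  have : IsManifold 𝓘(ℝ, E) 1 M := IsManifold.of_le (n := ∞) (by simp)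
  intro t ht
  have htar : (α t).1 ∈ (extChartAt 𝓘(ℝ, E) c).target := (h.closedBall_subset (hball t ht)).1
  set x := (extChartAt 𝓘(ℝ, E) c).symm (α t).1 with hx
  have hxs : x ∈ (extChartAt 𝓘(ℝ, E) c).source := (extChartAt 𝓘(ℝ, E) c).map_target htar
  have hex : extChartAt 𝓘(ℝ, E) c x = (α t).1 := (extChartAt 𝓘(ℝ, E) c).right_inv htar
  have hαt : (extChartAt 𝓘(ℝ, E) c x, s) = α t := by
    rw [hex, ← hs, ← h.snd_eq hα ht]
  have hG := h.eq_chartD p t ⟨ha.trans ht.1, ht.2.trans hb⟩ x s hxs (by rw [hαt]; exact hball t ht)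
  have hd : HasDerivWithinAt (fun t => (α t).1) (chartD 𝓘(ℝ, E) c x (X p s t x)) (Icc a b) t := by
    have := (ContinuousLinearMap.fst ℝ E S).hasFDerivAt.comp_hasDerivWithinAt t (hα t ht)
    have h3 : (ContinuousLinearMap.fst ℝ E S) (G p t (α t)) = chartD 𝓘(ℝ, E) c x (X p s t x) := by
      rw [← hαt, hG]; rfl
    rw [h3] at this
    exact this
  exact hd.hasMFDerivWithinAt_extChartAt_symm htar hx.symm rfl

omit [TopologicalSpace P] in
lemma isIntegralCurveOn (h : IsChartCutoff X c s₀ R G) (ha : 0 ≤ a) (hb : b ≤ 1) {γ : ℝ → M}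
    (hγ : IsTrajectory (X p s) a b γ)
    (hball : ∀ t ∈ Icc a b, γ t ∈ (extChartAt 𝓘(ℝ, E) c).source ∧
      (extChartAt 𝓘(ℝ, E) c (γ t), s) ∈ Metric.closedBall (extChartAt 𝓘(ℝ, E) c c, s₀) R) :
    IsIntegralCurveOn (fun t => (extChartAt 𝓘(ℝ, E) c (γ t), s)) (G p) (Icc a b) := by
  intro t ht
  rw [h.eq_chartD p t ⟨ha.trans ht.1, ht.2.trans hb⟩ (γ t) s (hball t ht).1 (hball t ht).2]
  exact (hγ.hasDerivWithinAt ht (hball t ht).1).prodMk (hasDerivWithinAt_const _ _ _)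

omit [TopologicalSpace P] in
/-- A trajectory starting in a chart agrees with the integral curve of the cut-off field as long as
the latter does not leave the ball where the cut-off is trivial. -/
lemma trajectory_eq [T2Space M] (h : IsChartCutoff X c s₀ R G) (ha : 0 ≤ a)
    (hb : b ≤ 1) {α : ℝ → E × S} {K : NNReal} (hK : ∀ t ∈ Icc (0 : ℝ) 1, LipschitzWith K (G p t))
    (hα : IsIntegralCurveOn α (G p) (Icc a b))
    (hball : ∀ t ∈ Icc a b, α t ∈ Metric.ball (extChartAt 𝓘(ℝ, E) c c, s₀) R)
    (hs : (α a).2 = s) {γ : ℝ → M} (hγ : IsTrajectory (X p s) a b γ)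
    (hγa : γ a = (extChartAt 𝓘(ℝ, E) c).symm (α a).1) :
    ∀ t ∈ Icc a b, γ t = (extChartAt 𝓘(ℝ, E) c).symm (α t).1 := by
  have hcl : ∀ t ∈ Icc a b, α t ∈ Metric.closedBall (extChartAt 𝓘(ℝ, E) c c, s₀) R :=
    fun t ht => Metric.ball_subset_closedBall (hball t ht)
  set β : ℝ → M := fun t => (extChartAt 𝓘(ℝ, E) c).symm (α t).1 with hβ
  have hβt : IsTrajectory (X p s) a b β := h.isTrajectory ha hb hα hcl hs
  have hαs : ∀ t ∈ Icc a b, (α t).2 = s := fun t ht => (h.snd_eq hα ht).trans hs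
  have hclosed : IsClosed ({t | γ t = β t} ∩ Icc a b) := by
    have := (hγ.continuousOn.prodMk hβt.continuousOn).preimage_isClosed_of_isClosed isClosed_Icc
      isClosed_diagonal
    rw [inter_comm]
    exact this
  -- The agreement set is closed; it also extends to the right of each of its points, by uniqueness
  -- for the Lipschitz field in the chart.
  refine hclosed.Icc_subset_of_forall_mem_nhdsWithin hγa ?_
  rintro t ⟨htγ, ht⟩
  have htI : t ∈ Icc a b := Ico_subset_Icc_self ht
  have htar : (α t).1 ∈ (extChartAt 𝓘(ℝ, E) c).target := (h.closedBall_subset (hcl t htI)).1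
  have hts : γ t ∈ (extChartAt 𝓘(ℝ, E) c).source := by
    rw [show γ t = β t from htγ]; exact (extChartAt 𝓘(ℝ, E) c).map_target htar
  have hte : extChartAt 𝓘(ℝ, E) c (γ t) = (α t).1 := by
    rw [show γ t = β t from htγ]; exact (extChartAt 𝓘(ℝ, E) c).right_inv htar
  have hev : ∀ᶠ r in 𝓝[Icc a b] t, γ r ∈ (extChartAt 𝓘(ℝ, E) c).source ∧
      (extChartAt 𝓘(ℝ, E) c (γ r), s) ∈ Metric.ball (extChartAt 𝓘(ℝ, E) c c, s₀) R := by
    have h1 : ContinuousWithinAt γ (Icc a b) t := hγ.continuousOn t htI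
    have h2 : ContinuousWithinAt (fun r => (extChartAt 𝓘(ℝ, E) c (γ r), s)) (Icc a b) t :=
      ((continuousAt_extChartAt' hts).comp_continuousWithinAt h1).prodMk continuousWithinAt_const
    refine (h1.eventually_mem ((isOpen_extChartAt_source c).mem_nhds hts)).and
      (h2.eventually_mem (Metric.isOpen_ball.mem_nhds ?_))
    beta_reduce
    rw [hte, ← hαs t htI]
    exact hball t htI
  have hev' : ∀ᶠ r in 𝓝[≥] t, γ r ∈ (extChartAt 𝓘(ℝ, E) c).source ∧
      (extChartAt 𝓘(ℝ, E) c (γ r), s) ∈ Metric.ball (extChartAt 𝓘(ℝ, E) c c, s₀) R := by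
    rw [← nhdsWithin_Icc_eq_nhdsGE ht.2]
    exact hev.filter_mono (nhdsWithin_mono _ (Icc_subset_Icc_left ht.1))
  obtain ⟨u, hu, hu'⟩ := mem_nhdsGE_iff_exists_Icc_subset.1
    (Filter.inter_mem hev' (Icc_mem_nhdsGE ht.2))
  have hub : u ≤ b := (hu' (right_mem_Icc.2 (le_of_lt hu))).2.2
  have hsub : Icc t u ⊆ Icc a b := Icc_subset_Icc ht.1 hub
  have hγi := h.isIntegralCurveOn (ha.trans ht.1) (hub.trans hb) (hγ.mono ht.1 hub)
    (fun r hr => ⟨(hu' hr).1.1, Metric.ball_subset_closedBall (hu' hr).1.2⟩)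
  have heq := ODE_solution_unique_of_mem_Icc_right (v := G p) (s := fun _ => univ) (K := K)
    (fun r hr => (hK r ⟨ha.trans (ht.1.trans hr.1), (hr.2.le.trans hub).trans hb⟩).lipschitzOnWith)
    hγi.continuousOn (fun r hr => hasDerivWithinAt_Ici_of_Icc hr (hγi r (Ico_subset_Icc_self hr)))
    (fun _ _ => trivial) ((hα.mono hsub).continuousOn)
    (fun r hr => hasDerivWithinAt_Ici_of_Icc hr ((hα.mono hsub) r (Ico_subset_Icc_self hr)))
    (fun _ _ => trivial) (by rw [hte, ← hαs t htI])
  refine Filter.mem_of_superset (Ioc_mem_nhdsGT hu) fun r hr => ?_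
  have hr' : r ∈ Icc t u := Ioc_subset_Icc_self hr
  have := congrArg Prod.fst (heq hr')
  show γ r = (extChartAt 𝓘(ℝ, E) c).symm (α r).1
  rw [← this]
  exact ((extChartAt 𝓘(ℝ, E) c).left_inv (hu' hr').1.1).symm

end IsChartCutoff

variable [FiniteDimensional ℝ S] [FiniteDimensional ℝ E]

/-- Local flows of a regular family of vector fields. -/
theorem IsRegularField.exists_local_flow [T2Space M]
    {X : P → S → ℝ → (x : M) → TangentSpace 𝓘(ℝ, E) x}
    (hX : IsRegularField X) (p₀ : P) (c : M) (s₀ : S) :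
    ∃ τ > 0, ∃ O : Set (P × M × S), IsOpen O ∧ (p₀, c, s₀) ∈ O ∧
      ∀ t₀ t₁, 0 ≤ t₀ → t₀ ≤ t₁ → t₁ ≤ 1 → t₁ ≤ t₀ + τ → ∃ Ψ : P → M → S → M,
        ∀ p x s, (p, x, s) ∈ O →
          (∃ γ, γ t₀ = x ∧ IsTrajectory (X p s) t₀ t₁ γ) ∧
          (∀ γ, γ t₀ = x → IsTrajectory (X p s) t₀ t₁ γ → γ t₁ = Ψ p x s) ∧
          MJointC1At E Ψ p x s := by
  obtain ⟨R, hR, G, C, hG, h1, h2, h3⟩ := hX.exists_cutoff c s₀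
  have hcut : IsChartCutoff X c s₀ R G := ⟨h1, h2, h3⟩
  obtain ⟨τ, hτ, V, hV, hpV, ⟨K, hK⟩, hflow⟩ := hG.exists_flow p₀ (r := R / 3) (by positivity)
  set z₀ := (extChartAt 𝓘(ℝ, E) c c, s₀) with hz₀
  have hcont : ContinuousOn (fun q : P × M × S => (extChartAt 𝓘(ℝ, E) c q.2.1, q.2.2))
      {q | q.2.1 ∈ (extChartAt 𝓘(ℝ, E) c).source} :=
    ((continuousOn_extChartAt c).comp continuous_snd.fst.continuousOn fun q hq => hq).prodMk
      continuous_snd.snd.continuousOn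
  have hsrc : IsOpen {q : P × M × S | q.2.1 ∈ (extChartAt 𝓘(ℝ, E) c).source} :=
    (isOpen_extChartAt_source c).preimage continuous_snd.fst
  -- Starting within R/3 of the centre and moving by at most R/3, the curves stay where the cut-off
  -- field is the true one.
  refine ⟨τ, hτ, ({q | q.2.1 ∈ (extChartAt 𝓘(ℝ, E) c).source} ∩
    (fun q : P × M × S => (extChartAt 𝓘(ℝ, E) c q.2.1, q.2.2)) ⁻¹' Metric.ball z₀ (R / 3)) ∩
    Prod.fst ⁻¹' V, (hcont.isOpen_inter_preimage hsrc Metric.isOpen_ball).inter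
      (hV.preimage continuous_fst), ⟨⟨mem_extChartAt_source c, ?_⟩, hpV⟩, ?_⟩
  · exact Metric.mem_ball_self (by positivity)
  intro t₀ t₁ h0 h01 ht1 hτ1
  obtain ⟨α, hα, hC1⟩ := hflow t₀ t₁ h0 h01 ht1 hτ1
  refine ⟨fun p x s => (extChartAt 𝓘(ℝ, E) c).symm (α p (extChartAt 𝓘(ℝ, E) c x, s) t₁).1, ?_⟩
  rintro p x s ⟨⟨hx, hxs⟩, hp⟩
  simp only [mem_ofPred_eq, mem_preimage] at hx hxs hp
  obtain ⟨hα0, hαi, hαr⟩ := hα p hp (extChartAt 𝓘(ℝ, E) c x, s)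
  have hball : ∀ t ∈ Icc t₀ t₁, α p (extChartAt 𝓘(ℝ, E) c x, s) t ∈ Metric.ball z₀ R := by
    intro t ht
    have := hαr t ht
    rw [← dist_eq_norm] at this
    rw [Metric.mem_ball] at hxs ⊢
    linarith [dist_triangle (α p (extChartAt 𝓘(ℝ, E) c x, s) t) (extChartAt 𝓘(ℝ, E) c x, s) z₀]
  have hs : (α p (extChartAt 𝓘(ℝ, E) c x, s) t₀).2 = s := by rw [hα0]
  have hx0 : (extChartAt 𝓘(ℝ, E) c).symm (α p (extChartAt 𝓘(ℝ, E) c x, s) t₀).1 = x := by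
    rw [hα0]; exact (extChartAt 𝓘(ℝ, E) c).left_inv hx
  have htar : (α p (extChartAt 𝓘(ℝ, E) c x, s) t₁).1 ∈ (extChartAt 𝓘(ℝ, E) c).target :=
    (h1 (Metric.ball_subset_closedBall (hball t₁ (right_mem_Icc.2 h01)))).1
  refine ⟨⟨_, hx0, hcut.isTrajectory h0 ht1 hαi
    (fun t ht => Metric.ball_subset_closedBall (hball t ht)) hs⟩, fun γ hγ0 hγ => ?_, ?_⟩
  · exact hcut.trajectory_eq h0 ht1 (hK p hp) hαi hball hs hγ (hγ0.trans hx0.symm) t₁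
      (right_mem_Icc.2 h01)
  · have hj := hC1 p hp (extChartAt 𝓘(ℝ, E) c x, s)
    have hj' : JointC1At (fun p z => (α p z t₁).1) p (extChartAt 𝓘(ℝ, E) c x, s) :=
      JointC1At.comp (h := fun _ z => z.1) (.of_contDiffAt contDiffAt_fst) hj
    have hce : ContinuousAt (fun q : P × M × S => (q.1, (extChartAt 𝓘(ℝ, E) c q.2.1, q.2.2)))
        (p, x, s) :=
      continuousAt_fst.prodMk (hcont.continuousAt (hsrc.mem_nhds hx))
    have hcα : ContinuousAt (fun q : P × M × S => (α q.1 (extChartAt 𝓘(ℝ, E) c q.2.1, q.2.2) t₁).1)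
        (p, x, s) := by
      exact ContinuousAt.comp (g := fun q : P × E × S => (α q.1 q.2 t₁).1)
        (f := fun q : P × M × S => (q.1, (extChartAt 𝓘(ℝ, E) c q.2.1, q.2.2))) hj'.continuousAt hce
    refine MJointC1At.of_charts (c := c) (c' := c) ?_ hx
      ((extChartAt 𝓘(ℝ, E) c).map_target htar) (hj'.congr ?_)
    · exact ContinuousAt.comp (g := (extChartAt 𝓘(ℝ, E) c).symm)
        (f := fun q : P × M × S => (α q.1 (extChartAt 𝓘(ℝ, E) c q.2.1, q.2.2) t₁).1)
        (continuousAt_extChartAt_symm'' htar) hcα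
    · have e1 : ∀ᶠ q in 𝓝 (p, (extChartAt 𝓘(ℝ, E) c x, s)),
          q.2.1 ∈ (extChartAt 𝓘(ℝ, E) c).target :=
        (show Continuous fun q : P × E × S => q.2.1 by fun_prop).continuousAt.eventually_mem
          ((isOpen_extChartAt_target c).mem_nhds ((extChartAt 𝓘(ℝ, E) c).map_source hx))
      have e2 : ∀ᶠ q in 𝓝 (p, (extChartAt 𝓘(ℝ, E) c x, s)),
          (α q.1 q.2 t₁).1 ∈ (extChartAt 𝓘(ℝ, E) c).target :=
        hj'.continuousAt.eventually_mem ((isOpen_extChartAt_target c).mem_nhds htar)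
      filter_upwards [e1, e2] with q hq1 hq2
      simp only [chartFamily]
      rw [(extChartAt 𝓘(ℝ, E) c).right_inv hq1, (extChartAt 𝓘(ℝ, E) c).right_inv hq2]

/-- A trajectory through a stationary point was there already a little earlier. -/
lemma IsRegularField.eventually_eq_of_stationary
    {X : P → S → ℝ → (x : M) → TangentSpace 𝓘(ℝ, E) x}
    (hX : IsRegularField X) {p : P} {s : S} {γ : ℝ → M} (hγ : IsTrajectory (X p s) 0 1 γ)
    {t : ℝ} (ht : t ∈ Ioc (0 : ℝ) 1) (h0 : ∀ r ∈ Icc (0 : ℝ) 1, X p s r (γ t) = 0) :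
    ∃ u ∈ Ico 0 t, ∀ r ∈ Icc u t, γ r = γ t := by
  obtain ⟨R, hR, G, C, hG, h1, h2, h3⟩ := hX.exists_cutoff (γ t) s
  have hcut : IsChartCutoff X (γ t) s R G := ⟨h1, h2, h3⟩
  obtain ⟨τ, hτ, V, hV, hpV, ⟨K, hK⟩, -⟩ := hG.exists_flow p (r := 1) one_pos
  have htI : t ∈ Icc (0 : ℝ) 1 := Ioc_subset_Icc_self ht
  have hev : ∀ᶠ r in 𝓝[Icc 0 1] t, γ r ∈ (extChartAt 𝓘(ℝ, E) (γ t)).source ∧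
      (extChartAt 𝓘(ℝ, E) (γ t) (γ r), s) ∈
        Metric.ball (extChartAt 𝓘(ℝ, E) (γ t) (γ t), s) R := by
    have h1 : ContinuousWithinAt γ (Icc 0 1) t := hγ.continuousOn t htI
    have h2 : ContinuousWithinAt (fun r => (extChartAt 𝓘(ℝ, E) (γ t) (γ r), s)) (Icc 0 1) t :=
      ((continuousAt_extChartAt (γ t)).comp_continuousWithinAt h1).prodMk continuousWithinAt_const
    exact (h1.eventually_mem (extChartAt_source_mem_nhds _)).and
      (h2.eventually_mem (Metric.ball_mem_nhds _ hR))
  have hev' : ∀ᶠ r in 𝓝[≤] t, γ r ∈ (extChartAt 𝓘(ℝ, E) (γ t)).source ∧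
      (extChartAt 𝓘(ℝ, E) (γ t) (γ r), s) ∈
        Metric.ball (extChartAt 𝓘(ℝ, E) (γ t) (γ t), s) R := by
    rw [← nhdsWithin_Icc_eq_nhdsLE ht.1]
    exact hev.filter_mono (nhdsWithin_mono _ (Icc_subset_Icc_right ht.2))
  obtain ⟨u, hu, hu'⟩ := mem_nhdsLE_iff_exists_Icc_subset.1
    (Filter.inter_mem hev' (Icc_mem_nhdsLE ht.1))
  have hu0 : 0 ≤ u := (hu' (left_mem_Icc.2 (le_of_lt hu))).2.1
  have hγi := hcut.isIntegralCurveOn hu0 ht.2 (hγ.mono hu0 ht.2)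
    (fun r hr => ⟨(hu' hr).1.1, Metric.ball_subset_closedBall (hu' hr).1.2⟩)
  have hIic : ∀ {y : ℝ → E × S} {v : E × S} {r : ℝ}, r ∈ Ioc u t →
      HasDerivWithinAt y v (Icc u t) r → HasDerivWithinAt y v (Iic r) r :=
    fun hr h => h.mono_of_mem_nhdsWithin (Icc_mem_nhdsLE_of_mem hr)
  -- Backward uniqueness against the constant curve, which is a solution because the field vanishes
  -- at that point at all times.
  have heq := ODE_solution_unique_of_mem_Icc_left (v := G p) (s := fun _ => univ) (K := K)
    (g := fun _ => (extChartAt 𝓘(ℝ, E) (γ t) (γ t), s))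
    (fun r hr => (hK p hpV r ⟨hu0.trans hr.1.le, hr.2.trans ht.2⟩).lipschitzOnWith)
    hγi.continuousOn (fun r hr => hIic hr (hγi r (Ioc_subset_Icc_self hr)))
    (fun _ _ => trivial) continuousOn_const
    (fun r hr => by
      have hrI : r ∈ Icc (0 : ℝ) 1 := ⟨hu0.trans hr.1.le, hr.2.trans ht.2⟩
      rw [hcut.eq_chartD p r hrI (γ t) s (mem_extChartAt_source _)
        (Metric.mem_closedBall_self hR.le), h0 r hrI, map_zero]
      exact hasDerivWithinAt_const _ _ _)
    (fun _ _ => trivial) rfl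
  refine ⟨u, ⟨hu0, hu⟩, fun r hr => ?_⟩
  have := congrArg Prod.fst (heq hr)
  exact (extChartAt 𝓘(ℝ, E) (γ t)).injOn (hu' hr).1.1 (mem_extChartAt_source _) this

end LocalFlow

/-! ### Global trajectories and the regularity of the time-one map -/

section GlobalFlow

variable {P : Type*} [TopologicalSpace P]
  {S : Type*} [NormedAddCommGroup S] [NormedSpace ℝ S]
  {E : Type*} [NormedAddCommGroup E] [NormedSpace ℝ E]
  {M : Type*} [TopologicalSpace M] [ChartedSpace E M]

/-- The type of the velocity depends on the base point. The equality of the two velocities is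
therefore expressed in the model space E. -/
lemma hasMFDerivWithinAt_field_congr {X : (x : M) → TangentSpace 𝓘(ℝ, E) x} {γ γ' : ℝ → M}
    {s : Set ℝ} {t : ℝ}
    (h : HasMFDerivWithinAt 𝓘(ℝ, ℝ) 𝓘(ℝ, E) γ s t ((1 : ℝ →L[ℝ] ℝ).smulRight (X (γ t))))
    (heq : EqOn γ' γ s) (ht : t ∈ s) :
    HasMFDerivWithinAt 𝓘(ℝ, ℝ) 𝓘(ℝ, E) γ' s t ((1 : ℝ →L[ℝ] ℝ).smulRight (X (γ' t))) := by
  have h1 := h.congr_of_eventuallyEq (Filter.eventuallyEq_of_mem self_mem_nhdsWithin heq) (heq ht)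
  refine h1.congr_mfderiv ?_
  have : ∀ y z : M, y = z → ((X z : TangentSpace 𝓘(ℝ, E) z) : E) = (X y : E) := by
    rintro y _ rfl; rfl
  have h2 : ((X (γ t) : TangentSpace 𝓘(ℝ, E) (γ t)) : E) = (X (γ' t) : E) := this _ _ (heq ht)
  exact congrArg (fun v : E => ((1 : ℝ →L[ℝ] ℝ).smulRight v : ℝ →L[ℝ] E)) h2

lemma IsTrajectory.congr {X : ℝ → (x : M) → TangentSpace 𝓘(ℝ, E) x} {a b : ℝ} {γ γ' : ℝ → M}
    (h : IsTrajectory X a b γ) (heq : EqOn γ' γ (Icc a b)) : IsTrajectory X a b γ' :=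
  fun t ht => hasMFDerivWithinAt_field_congr (h t ht) heq ht

lemma IsTrajectory.trans {X : ℝ → (x : M) → TangentSpace 𝓘(ℝ, E) x} {a b c : ℝ} {γ γ' : ℝ → M}
    (h : IsTrajectory X a b γ) (h' : IsTrajectory X b c γ') (hb : γ b = γ' b) (hab : a ≤ b)
    (hbc : b ≤ c) :
    ∃ β : ℝ → M, β a = γ a ∧ β c = γ' c ∧ IsTrajectory X a c β := by
  set β : ℝ → M := fun t => if t ≤ b then γ t else γ' t with hβ
  have e1 : EqOn β γ (Icc a b) := fun t ht => if_pos ht.2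
  have e2 : EqOn β γ' (Icc b c) := fun t ht => by
    rcases ht.1.eq_or_lt with rfl | h
    · simp [hβ, hb]
    · exact if_neg (not_le.2 h)
  have t1 := h.congr e1
  have t2 := h'.congr e2
  refine ⟨β, if_pos hab, e2 (right_mem_Icc.2 hbc), fun t ht => ?_⟩
  rcases lt_trichotomy t b with hlt | rfl | hgt
  · refine (t1 t ⟨ht.1, hlt.le⟩).mono_of_mem_nhdsWithin ?_
    rw [← Icc_union_Icc_eq_Icc hab hbc, nhdsWithin_union]
    refine Filter.mem_sup.2 ⟨self_mem_nhdsWithin, ?_⟩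
    exact mem_nhdsWithin_of_mem_nhds (Filter.mem_of_superset (Iio_mem_nhds hlt) fun r hr => hr) |>
      fun (hm : Iio b ∈ 𝓝[Icc b c] t) => by
        filter_upwards [hm, self_mem_nhdsWithin] with r hr hr'
        exact absurd hr (not_lt.2 hr'.1)
  · rw [← Icc_union_Icc_eq_Icc hab hbc]
    exact (t1 t (right_mem_Icc.2 hab)).union (t2 t (left_mem_Icc.2 hbc))
  · refine (t2 t ⟨hgt.le, ht.2⟩).mono_of_mem_nhdsWithin ?_
    rw [← Icc_union_Icc_eq_Icc hab hbc, nhdsWithin_union]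
    refine Filter.mem_sup.2 ⟨?_, self_mem_nhdsWithin⟩
    filter_upwards [mem_nhdsWithin_of_mem_nhds (Ioi_mem_nhds hgt), self_mem_nhdsWithin]
      with r hr hr'
    exact absurd hr (not_lt.2 hr'.2)

lemma isTrajectory_const {X : ℝ → (x : M) → TangentSpace 𝓘(ℝ, E) x} {a b : ℝ} {x : M}
    (h : ∀ t ∈ Icc a b, X t x = 0) : IsTrajectory X a b (fun _ => x) := by
  intro t ht
  refine (hasMFDerivWithinAt_const x _ t).congr_mfderiv ?_
  rw [h t ht]
  ext
  exact (smul_zero (A := E) (1 : ℝ)).symm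

lemma mjointC1At_id (p₀ : P) (x₀ : M) (s₀ : S) :
    MJointC1At E (fun _ x _ => x : P → M → S → M) p₀ x₀ s₀ := by
  refine ⟨by fun_prop, ?_⟩
  refine (JointC1At.of_contDiffAt (g := Prod.fst) contDiffAt_fst).congr ?_
  have : ∀ᶠ q in 𝓝 (p₀, (extChartAt 𝓘(ℝ, E) x₀ x₀, s₀)),
      q.2.1 ∈ (extChartAt 𝓘(ℝ, E) x₀).target :=
    (show Continuous fun q : P × E × S => q.2.1 by fun_prop).continuousAt.eventually_mem
      ((isOpen_extChartAt_target x₀).mem_nhds (mem_extChartAt_target x₀))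
  filter_upwards [this] with q hq
  exact (extChartAt 𝓘(ℝ, E) x₀).right_inv hq

lemma MJointC1At.congr {Φ Ψ : P → M → S → M} {p₀ : P} {x₀ : M} {s₀ : S}
    (h : MJointC1At E Φ p₀ x₀ s₀)
    (heq : ∀ᶠ q in 𝓝 (p₀, x₀, s₀), Ψ q.1 q.2.1 q.2.2 = Φ q.1 q.2.1 q.2.2) :
    MJointC1At E Ψ p₀ x₀ s₀ := by
  refine ⟨h.continuousAt.congr (heq.mono fun _ h => h.symm), ?_⟩
  have h0 : Ψ p₀ x₀ s₀ = Φ p₀ x₀ s₀ := heq.self_of_nhds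
  rw [h0]
  refine h.jointC1At.congr ?_
  have := tendsto_chart_symm (E := E) (mem_extChartAt_source x₀) p₀ s₀
  have h1 : ∀ᶠ q in 𝓝 (p₀, (extChartAt 𝓘(ℝ, E) x₀).symm (extChartAt 𝓘(ℝ, E) x₀ x₀), s₀),
    Ψ q.1 q.2.1 q.2.2 = Φ q.1 q.2.1 q.2.2 := by rwa [extChartAt_to_inv]
  filter_upwards [this.tendsto.eventually h1] with q hq
  simp only [chartFamily]
  rw [hq]

variable [IsManifold 𝓘(ℝ, E) ∞ M] [FiniteDimensional ℝ S] [FiniteDimensional ℝ E] [T2Space M]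

/-- The reference trajectory is compact, so finitely many local flows cover it. Their composition is
jointly C¹, and every trajectory starting nearby must follow it. The map φ is an arbitrary selection
of end points: no uniqueness is assumed, and uniqueness is later deduced from this statement. -/
theorem IsRegularField.mjointC1At_flow {X : P → S → ℝ → (x : M) → TangentSpace 𝓘(ℝ, E) x}
    (hX : IsRegularField X) {φ : P → M → S → M}
    (hφ : ∀ p x s, ∃ γ, γ 0 = x ∧ IsTrajectory (X p s) 0 1 γ ∧ γ 1 = φ p x s)
    (p₀ : P) (x₀ : M) (s₀ : S) : MJointC1At E φ p₀ x₀ s₀ := by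
  obtain ⟨γ, hγ0, hγ, hγ1⟩ := hφ p₀ x₀ s₀
  choose τ hτ O hO hmem hflow using fun c : M => hX.exists_local_flow p₀ c s₀
  have hc : Continuous fun t : Icc (0 : ℝ) 1 => γ t :=
    continuousOn_iff_continuous_domRestrict.1 hγ.continuousOn
  -- With half of τ in the cover, the ends of each subinterval differ by less than τ, so a single
  -- local flow spans it.
  obtain ⟨t, ht0, htm, ⟨m, hm⟩, hcov⟩ := exists_monotone_Icc_subset_open_cover_Icc
    (a := (0 : ℝ)) (b := 1) zero_le_one
    (c := fun u : Icc (0 : ℝ) 1 => {t : Icc (0 : ℝ) 1 | |(t : ℝ) - u| < τ (γ u) / 2} ∩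
      (fun t : Icc (0 : ℝ) 1 => (p₀, γ t, s₀)) ⁻¹' (O (γ u)))
    (fun u => (isOpen_lt (by fun_prop) continuous_const).inter ((hO _).preimage
      (continuous_const.prodMk (hc.prodMk continuous_const))))
    (fun u _ => mem_iUnion.2 ⟨u, by simpa using hτ (γ u), hmem _⟩)
  have claim : ∀ n : ℕ, ∃ Φ : P → M → S → M, MJointC1At E Φ p₀ x₀ s₀ ∧ Φ p₀ x₀ s₀ = γ (t n) ∧
      ∀ᶠ q in 𝓝 (p₀, x₀, s₀), ∀ γ' : ℝ → M, γ' 0 = q.2.1 →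
        IsTrajectory (X q.1 q.2.2) 0 1 γ' → γ' (t n) = Φ q.1 q.2.1 q.2.2 := by
    intro n
    induction n with
    | zero =>
      refine ⟨fun _ x _ => x, mjointC1At_id _ _ _, by simp [ht0, hγ0], .of_forall fun q γ' h0 _ => ?_⟩
      rw [ht0]; exact h0
    | succ n ih =>
      obtain ⟨Φ, hΦ, hΦ0, hev⟩ := ih
      obtain ⟨u, hu⟩ := hcov n
      have hle : t n ≤ t (n + 1) := htm (Nat.le_succ n)
      have hleft := hu (left_mem_Icc.2 hle)
      have hright := hu (right_mem_Icc.2 hle)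
      have hτn : (t (n + 1) : ℝ) ≤ t n + τ (γ u) := by
        have h1 := abs_lt.1 (show |(t n : ℝ) - u| < τ (γ u) / 2 from hleft.1)
        have h2 := abs_lt.1 (show |(t (n + 1) : ℝ) - u| < τ (γ u) / 2 from hright.1)
        linarith [h1.1, h2.2]
      obtain ⟨Ψ, hΨ⟩ := hflow (γ u) (t n) (t (n + 1)) (t n).2.1 hle (t (n + 1)).2.2 hτn
      have hO1 : (p₀, Φ p₀ x₀ s₀, s₀) ∈ O (γ u) := by rw [hΦ0]; exact hleft.2
      refine ⟨fun p x s => Ψ p (Φ p x s) s, (hΨ _ _ _ hO1).2.2.comp hΦ, ?_, ?_⟩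
      · rw [hΦ0] at hO1
        change Ψ p₀ (Φ p₀ x₀ s₀) s₀ = _
        rw [hΦ0]
        exact ((hΨ _ _ _ hO1).2.1 γ rfl (hγ.mono (t n).2.1 (t (n + 1)).2.2)).symm
      · have hcΦ : ContinuousAt (fun q : P × M × S => (q.1, Φ q.1 q.2.1 q.2.2, q.2.2))
            (p₀, x₀, s₀) :=
          continuousAt_fst.prodMk (hΦ.continuousAt.prodMk (by fun_prop))
        filter_upwards [hev, hcΦ.eventually_mem ((hO _).mem_nhds hO1)] with q hq hqO γ' h0 hγ'
        exact (hΨ _ _ _ hqO).2.1 γ' (hq γ' h0 hγ') (hγ'.mono (t n).2.1 (t (n + 1)).2.2)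
  obtain ⟨Φ, hΦ, -, hev⟩ := claim m
  refine hΦ.congr ?_
  filter_upwards [hev] with q hq
  obtain ⟨γ', h0, hγ', h1⟩ := hφ q.1 q.2.1 q.2.2
  have := hq γ' h0 hγ'
  rw [hm m le_rfl] at this
  rw [← h1]
  exact this

/-- Compactness of K gives one existence time τ for all starting points in K, while points off K
stay fixed. Finitely many steps of length τ then reach time 1. -/
theorem IsRegularField.exists_trajectory {X : P → S → ℝ → (x : M) → TangentSpace 𝓘(ℝ, E) x}
    (hX : IsRegularField X) {p : P} {s : S} {K : Set M} (hK : IsCompact K)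
    (h0 : ∀ t ∈ Icc (0 : ℝ) 1, ∀ x ∉ K, X p s t x = 0) (x : M) :
    ∃ γ, γ 0 = x ∧ IsTrajectory (X p s) 0 1 γ := by
  have step : ∃ τ > 0, ∀ x ∈ K, ∀ t₀ t₁ : ℝ, 0 ≤ t₀ → t₀ ≤ t₁ → t₁ ≤ 1 → t₁ ≤ t₀ + τ →
      ∃ γ, γ t₀ = x ∧ IsTrajectory (X p s) t₀ t₁ γ := by
    refine hK.induction_on (p := fun A => ∃ τ > 0, ∀ x ∈ A, ∀ t₀ t₁ : ℝ, 0 ≤ t₀ → t₀ ≤ t₁ →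
      t₁ ≤ 1 → t₁ ≤ t₀ + τ → ∃ γ, γ t₀ = x ∧ IsTrajectory (X p s) t₀ t₁ γ) ?_ ?_ ?_ ?_
    · exact ⟨1, one_pos, fun x hx => absurd hx (notMem_empty x)⟩
    · rintro A B hAB ⟨τ, hτ, h⟩
      exact ⟨τ, hτ, fun x hx => h x (hAB hx)⟩
    · rintro A B ⟨τ, hτ, h⟩ ⟨τ', hτ', h'⟩
      refine ⟨min τ τ', lt_min hτ hτ', fun x hx t₀ t₁ a b c d => ?_⟩
      rcases hx with hx | hx
      · exact h x hx t₀ t₁ a b c (d.trans (by gcongr; exact min_le_left _ _))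
      · exact h' x hx t₀ t₁ a b c (d.trans (by gcongr; exact min_le_right _ _))
    · intro c _
      obtain ⟨τ, hτ, O, hO, hmem, hflow⟩ := hX.exists_local_flow p c s
      refine ⟨(fun x : M => (p, x, s)) ⁻¹' O, mem_nhdsWithin_of_mem_nhds
        ((hO.preimage (by fun_prop)).mem_nhds hmem), τ, hτ, fun x hx t₀ t₁ a b d e => ?_⟩
      obtain ⟨Ψ, hΨ⟩ := hflow t₀ t₁ a b d e
      exact (hΨ p x s hx).1
  obtain ⟨τ, hτ, hstep⟩ := step
  have hstep' : ∀ x, ∀ t₀ t₁ : ℝ, 0 ≤ t₀ → t₀ ≤ t₁ → t₁ ≤ 1 → t₁ ≤ t₀ + τ →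
      ∃ γ, γ t₀ = x ∧ IsTrajectory (X p s) t₀ t₁ γ := by
    intro x t₀ t₁ a b c d
    by_cases hx : x ∈ K
    · exact hstep x hx t₀ t₁ a b c d
    · exact ⟨fun _ => x, rfl, isTrajectory_const fun t ht => h0 t ⟨a.trans ht.1, ht.2.trans c⟩ x hx⟩
  have hn : ∀ n : ℕ, ∃ γ, γ 0 = x ∧ IsTrajectory (X p s) 0 (min (n * τ) 1) γ := by
    intro n
    induction n with
    | zero => exact hstep' x 0 _ le_rfl (by simp) (by simp) (by simp [hτ.le])
    | succ n ih =>
      obtain ⟨γ, hγ0, hγ⟩ := ih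
      have ha : 0 ≤ min (n * τ) 1 := le_min (by positivity) zero_le_one
      have hb : min (n * τ) 1 ≤ min ((n + 1 : ℕ) * τ) 1 := by
        push_cast; gcongr; linarith
      obtain ⟨γ', hγ'0, hγ'⟩ := hstep' (γ (min (n * τ) 1)) (min (n * τ) 1)
        (min ((n + 1 : ℕ) * τ) 1) ha hb (min_le_right _ _) (by
          push_cast
          rcases le_total (n * τ) 1 with h | h
          · rw [min_eq_left h]; exact (min_le_left _ _).trans (by linarith)
          · rw [min_eq_right h]; exact (min_le_right _ _).trans (by linarith))
      obtain ⟨β, hβ0, -, hβ⟩ := hγ.trans hγ' hγ'0.symm ha hb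
      exact ⟨β, hβ0.trans hγ0, hβ⟩
  obtain ⟨n, hn1⟩ := exists_nat_gt (1 / τ)
  obtain ⟨γ, hγ0, hγ⟩ := hn n
  rw [min_eq_right] at hγ
  · exact ⟨γ, hγ0, hγ⟩
  · rw [div_lt_iff₀ hτ] at hn1; exact hn1.le

end GlobalFlow

/-! ### The Hamiltonian vector field and its chart expression -/

section Flat

variable {E : Type*} [NormedAddCommGroup E] [NormedSpace ℝ E]

variable (E) in
/-- The map sending an alternating `2`-form `a` to `u ↦ (v ↦ a (u, v))`. -/
def flatL : (E [⋀^Fin 2]→L[ℝ] ℝ) →L[ℝ] (E →L[ℝ] E →L[ℝ] ℝ) :=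
  (ContinuousLinearMap.compL ℝ E _ _
    ((continuousMultilinearCurryFin1 ℝ E ℝ).toContinuousLinearEquiv.toContinuousLinearMap)).comp
  ((continuousMultilinearCurryLeftEquiv ℝ (fun _ : Fin 2 => E) ℝ
    ).toContinuousLinearEquiv.toContinuousLinearMap.comp
    (ContinuousAlternatingMap.toContinuousMultilinearMapCLM ℝ))

lemma flatL_apply (a : E [⋀^Fin 2]→L[ℝ] ℝ) (u v : E) : flatL E a u v = a ![u, v] := by
  simp only [flatL, ContinuousLinearMap.comp_apply, ContinuousLinearMap.compL_apply]
  show a _ = a _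
  congr 1
  ext i
  fin_cases i <;> rfl

lemma isInvertible_flatL [FiniteDimensional ℝ E] {a : E [⋀^Fin 2]→L[ℝ] ℝ}
    (ha : ∀ u, (∀ v, a ![u, v] = 0) → u = 0) : (flatL E a).IsInvertible := by
  have hinj : Function.Injective (flatL E a) := by
    rw [injective_iff_map_eq_zero]
    intro u hu
    refine ha u fun v => ?_
    rw [← flatL_apply, hu]; rfl
  have hdim : Module.finrank ℝ E = Module.finrank ℝ (E →L[ℝ] ℝ) := by
    rw [← (LinearMap.toContinuousLinearMap (𝕜 := ℝ) (E := E) (F' := ℝ)).finrank_eq]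
    exact (Subspace.dual_finrank_eq (K := ℝ) (V := E)).symm
  refine ⟨(LinearEquiv.ofInjectiveOfFinrankEq (flatL E a).toLinearMap hinj hdim
    ).toContinuousLinearEquiv, ?_⟩
  ext u v
  rfl

lemma contDiffAt_inverse [CompleteSpace E] {F : Type*} [NormedAddCommGroup F] [NormedSpace ℝ F]
    {A : E →L[ℝ] F} (hA : A.IsInvertible) {n : WithTop ℕ∞} :
    ContDiffAt ℝ n (ContinuousLinearMap.inverse : (E →L[ℝ] F) → F →L[ℝ] E) A := by
  obtain ⟨e, rfl⟩ := hA
  exact contDiffAt_map_inverse e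

end Flat

section HamiltonianField

lemma HasMFDerivAt.fderiv_eq {E F : Type*} [NormedAddCommGroup E] [NormedSpace ℝ E]
    [NormedAddCommGroup F] [NormedSpace ℝ F] {f : E → F} {y : E} {L : E →L[ℝ] F}
    (h : HasMFDerivAt 𝓘(ℝ, E) 𝓘(ℝ, F) f y L) : fderiv ℝ f y = L := by
  have h' : HasFDerivAt f L y := hasMFDerivAt_iff_hasFDerivAt.1 h
  exact h'.fderiv

variable {E : Type*} [NormedAddCommGroup E] [NormedSpace ℝ E]
  {M : Type*} [TopologicalSpace M] [ChartedSpace E M]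

/-- The Hamiltonian vector field `X` of `h`, that is `Ω(X, ·) = dh`. -/
def hamiltonianField (Ω : TwoForm 𝓘(ℝ, E) M) (h : M → ℝ) (x : M) : TangentSpace 𝓘(ℝ, E) x :=
  (flatL E (Ω x)).inverse (mfderiv 𝓘(ℝ, E) 𝓘(ℝ, ℝ) h x)

variable [FiniteDimensional ℝ E] {Ω : TwoForm 𝓘(ℝ, E) M}

lemma IsSymplecticForm.isInvertible_flatL (hΩ : IsSymplecticForm Ω) (x : M) :
    (flatL E (Ω x)).IsInvertible := _root_.isInvertible_flatL (hΩ.nondegenerate x)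

lemma IsSymplecticForm.hamiltonianField_apply (hΩ : IsSymplecticForm Ω) (h : M → ℝ) (x : M)
    (v : TangentSpace 𝓘(ℝ, E) x) :
    Ω x ![hamiltonianField Ω h x, v] = mfderiv 𝓘(ℝ, E) 𝓘(ℝ, ℝ) h x v := by
  have h1 := flatL_apply (E := E) (Ω x : E [⋀^Fin 2]→L[ℝ] ℝ) (hamiltonianField Ω h x) v
  have h2 := (hΩ.isInvertible_flatL x).self_apply_inverse (mfderiv 𝓘(ℝ, E) 𝓘(ℝ, ℝ) h x)
  rw [← h2]
  exact h1.symm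

omit [FiniteDimensional ℝ E] in
lemma hamiltonianField_eq_zero {h : M → ℝ} {x : M} (hx : mfderiv 𝓘(ℝ, E) 𝓘(ℝ, ℝ) h x = 0) :
    hamiltonianField Ω h x = 0 := by
  rw [hamiltonianField, hx]
  exact map_zero (flatL E (Ω x)).inverse

variable [IsManifold 𝓘(ℝ, E) ∞ M]

lemma IsSymplecticForm.isInvertible_flatL_inChart (hΩ : IsSymplecticForm Ω) (c : M) {y : E}
    (hy : y ∈ (extChartAt 𝓘(ℝ, E) c).target) : (flatL E (Ω.inChart c y)).IsInvertible := by
  have : IsManifold 𝓘(ℝ, E) 1 M := IsManifold.of_le (n := ∞) (by simp)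
  refine _root_.isInvertible_flatL fun u hu => ?_
  have hs := (extChartAt 𝓘(ℝ, E) c).map_target hy
  have hr := (extChartAt 𝓘(ℝ, E) c).right_inv hy
  set x := (extChartAt 𝓘(ℝ, E) c).symm y with hx
  set A := mfderiv 𝓘(ℝ, E) 𝓘(ℝ, E) (extChartAt 𝓘(ℝ, E) c).symm y with hA
  have h0 : A u = 0 := by
    refine hΩ.nondegenerate x (A u) fun v => ?_
    have h1 := hu (mfderiv 𝓘(ℝ, E) 𝓘(ℝ, E) (extChartAt 𝓘(ℝ, E) c) x v)
    have h2 := mfderiv_symm_mfderiv_extChartAt hs v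
    rw [hr] at h2
    rw [← h2]
    refine Eq.trans ?_ h1
    show Ω x _ = Ω x _
    congr 1
    ext i
    fin_cases i <;> rfl
  have h3 := mfderiv_mfderiv_extChartAt_symm hs u
  rw [hr] at h3
  rw [← h3]
  have h4 : mfderiv 𝓘(ℝ, E) 𝓘(ℝ, E) (extChartAt 𝓘(ℝ, E) c) x (A u) = 0 := by
    rw [h0]; exact map_zero _
  exact h4

/-- Pulling back the equation Ω(X, ·) = dh by the inverse chart and inverting the pulled-back form
exhibits the field as a smooth matrix applied to the coordinate gradient of h. -/
lemma IsSymplecticForm.chartD_hamiltonianField (hΩ : IsSymplecticForm Ω) (c : M) {x : M}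
    (hx : x ∈ (extChartAt 𝓘(ℝ, E) c).source) {h : M → ℝ}
    (hh : MDifferentiableAt 𝓘(ℝ, E) 𝓘(ℝ, ℝ) h x) :
    (flatL E (Ω.inChart c (extChartAt 𝓘(ℝ, E) c x))).inverse
      (fderiv ℝ (fun y => h ((extChartAt 𝓘(ℝ, E) c).symm y)) (extChartAt 𝓘(ℝ, E) c x)) =
      chartD 𝓘(ℝ, E) c x (hamiltonianField Ω h x) := by
  have : IsManifold 𝓘(ℝ, E) 1 M := IsManifold.of_le (n := ∞) (by simp)
  set y := extChartAt 𝓘(ℝ, E) c x with hy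
  have hyt : y ∈ (extChartAt 𝓘(ℝ, E) c).target := (extChartAt 𝓘(ℝ, E) c).map_source hx
  have hyx : (extChartAt 𝓘(ℝ, E) c).symm y = x := (extChartAt 𝓘(ℝ, E) c).left_inv hx
  have hinv := hΩ.isInvertible_flatL_inChart c hyt
  have key : flatL E (Ω.inChart c y) (chartD 𝓘(ℝ, E) c x (hamiltonianField Ω h x)) =
      fderiv ℝ (fun y => h ((extChartAt 𝓘(ℝ, E) c).symm y)) y := by
    ext v
    rw [flatL_apply]
    have h1 : HasMFDerivAt 𝓘(ℝ, E) 𝓘(ℝ, ℝ) (h ∘ (extChartAt 𝓘(ℝ, E) c).symm) y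
        ((mfderiv 𝓘(ℝ, E) 𝓘(ℝ, ℝ) h ((extChartAt 𝓘(ℝ, E) c).symm y)).comp
          (mfderiv 𝓘(ℝ, E) 𝓘(ℝ, E) (extChartAt 𝓘(ℝ, E) c).symm y)) := by
      refine HasMFDerivAt.comp y ?_ (hasMFDerivAt_extChartAt_symm hyt)
      rw [hyx]; exact hh.hasMFDerivAt
    have h2 := HasMFDerivAt.fderiv_eq (E := E) (F := ℝ) h1
    have h3 : (fderiv ℝ (fun y => h ((extChartAt 𝓘(ℝ, E) c).symm y)) y v : ℝ) =
        mfderiv 𝓘(ℝ, E) 𝓘(ℝ, ℝ) h ((extChartAt 𝓘(ℝ, E) c).symm y)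
          (mfderiv 𝓘(ℝ, E) 𝓘(ℝ, E) (extChartAt 𝓘(ℝ, E) c).symm y v) :=
      congrFun (congrArg (fun L : E →L[ℝ] ℝ => (L : E → ℝ)) h2) v
    rw [h3]
    refine Eq.trans ?_ (hΩ.hamiltonianField_apply h ((extChartAt 𝓘(ℝ, E) c).symm y) _)
    show Ω ((extChartAt 𝓘(ℝ, E) c).symm y) _ = Ω ((extChartAt 𝓘(ℝ, E) c).symm y) _
    congr 1
    ext i
    fin_cases i
    · show mfderiv 𝓘(ℝ, E) 𝓘(ℝ, E) (extChartAt 𝓘(ℝ, E) c).symm y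
        (mfderiv 𝓘(ℝ, E) 𝓘(ℝ, E) (extChartAt 𝓘(ℝ, E) c) x (hamiltonianField Ω h x)) =
        hamiltonianField Ω h ((extChartAt 𝓘(ℝ, E) c).symm y)
      refine (mfderiv_symm_mfderiv_extChartAt hx (hamiltonianField Ω h x)).trans ?_
      have : ∀ z w : M, z = w → (hamiltonianField Ω h z : E) = (hamiltonianField Ω h w : E) := by
        rintro z _ rfl; rfl
      exact this _ _ hyx.symm
    · rfl
  rw [← key]
  exact hinv.inverse_apply_self _

end HamiltonianField

/-! ### The C^∞ topology and finite-dimensional perturbations of a Hamiltonian -/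

namespace Hamiltonian

variable {E : Type*} [NormedAddCommGroup E] [NormedSpace ℝ E]
  {M : Type*} [TopologicalSpace M] [ChartedSpace E M] {K : Set M}

/-- The expression of `F` in the chart at `c`. -/
def inChart (F : Hamiltonian E K) (c : M) (q : ℝ × E) : ℝ :=
  F.extend q.1 ((extChartAt 𝓘(ℝ, E) c).symm q.2)

lemma chartDeriv_eq (c : M) (k : ℕ) (F : Hamiltonian E K) :
    chartDeriv c k F = iteratedFDerivWithin ℝ k (F.inChart c) (chartDomain E c) := rfl

lemma uniqueDiffOn_chartDomain (c : M) : UniqueDiffOn ℝ (chartDomain E c) :=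
  (uniqueDiffOn_Icc zero_lt_one).prod (isOpen_extChartAt_target c).uniqueDiffOn

lemma mdifferentiableAt_extend (F : Hamiltonian E K) {t : ℝ} (ht : t ∈ Icc (0 : ℝ) 1) (x : M) :
    MDifferentiableAt 𝓘(ℝ, E) 𝓘(ℝ, ℝ) (F.extend t) x := by
  have h1 := (F.smooth (t, x) ⟨ht, trivial⟩).mdifferentiableWithinAt (by simp)
  have h2 : MDifferentiableAt 𝓘(ℝ, E) (𝓘(ℝ, ℝ).prod 𝓘(ℝ, E)) (fun y : M => (t, y)) x :=
    mdifferentiableAt_const.prodMk mdifferentiableAt_id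
  have h3 := MDifferentiableWithinAt.comp (s := univ) x h1 h2.mdifferentiableWithinAt
    (fun y _ => ⟨ht, trivial⟩)
  exact mdifferentiableWithinAt_univ.1 h3

variable [IsManifold 𝓘(ℝ, E) ∞ M]

lemma contDiffOn_inChart (F : Hamiltonian E K) (c : M) :
    ContDiffOn ℝ ∞ (F.inChart c) (chartDomain E c) := by
  rw [← contMDiffOn_iff_contDiffOn]
  refine ContMDiffOn.comp (t := Icc (0 : ℝ) 1 ×ˢ (univ : Set M)) (I' := 𝓘(ℝ, ℝ).prod 𝓘(ℝ, E))
    (f := fun q : ℝ × E => (q.1, (extChartAt 𝓘(ℝ, E) c).symm q.2)) F.smooth ?_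
    (fun q hq => ⟨hq.1, trivial⟩)
  refine ContMDiffOn.prodMk contDiff_fst.contMDiff.contMDiffOn ?_
  exact (contMDiffOn_extChartAt_symm c).comp (t := (extChartAt 𝓘(ℝ, E) c).target)
    contDiff_snd.contMDiff.contMDiffOn (fun q hq => hq.2)

lemma continuousOn_chartDeriv (c : M) (k : ℕ) (F : Hamiltonian E K) :
    ContinuousOn (chartDeriv c k F) (chartDomain E c) :=
  (F.contDiffOn_inChart c).continuousOn_iteratedFDerivWithin (by exact_mod_cast le_top)
    (uniqueDiffOn_chartDomain c)

omit [IsManifold 𝓘(ℝ, E) ∞ M] in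
lemma tendstoUniformlyOn_chartDeriv (c : M) (k : ℕ) (F : Hamiltonian E K) {C : Set (ℝ × E)}
    (hC : IsCompact C) (hCD : C ⊆ chartDomain E c) :
    TendstoUniformlyOn (fun G : Hamiltonian E K => chartDeriv c k G) (chartDeriv c k F) (𝓝 F) C := by
  have h1 : Continuous (fun G : Hamiltonian E K => UniformOnFun.ofFun
      {C : Set (ℝ × E) | IsCompact C ∧ C ⊆ chartDomain E c} (chartDeriv c k G)) :=
    continuous_iInf_dom (i := c) (continuous_iInf_dom (i := k) continuous_induced_dom)
  exact UniformOnFun.tendsto_iff_tendstoUniformlyOn.1 (h1.tendsto F) C ⟨hC, hCD⟩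

/-- Every point of the chart domain has a compact neighbourhood within it. Uniform convergence
there, with continuity of the derivative of a fixed Hamiltonian, gives joint continuity. -/
lemma continuousOn_uncurry_chartDeriv [FiniteDimensional ℝ E] (c : M) (k : ℕ) :
    ContinuousOn (fun q : Hamiltonian E K × (ℝ × E) => chartDeriv c k q.1 q.2)
      (univ ×ˢ chartDomain E c) := by
  rintro ⟨F, t, y⟩ ⟨-, ht, hy⟩
  obtain ⟨r, hr, hrt⟩ := Metric.nhds_basis_closedBall.mem_iff.1
    ((isOpen_extChartAt_target c).mem_nhds hy)
  have hC : IsCompact (Icc (0 : ℝ) 1 ×ˢ Metric.closedBall y r) :=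
    isCompact_Icc.prod (isCompact_closedBall y r)
  have hCD : Icc (0 : ℝ) 1 ×ˢ Metric.closedBall y r ⊆ chartDomain E c :=
    prod_mono_right hrt
  have hu := tendstoUniformlyOn_chartDeriv c k F hC hCD
  have hc := continuousOn_chartDeriv c k F (t, y) ⟨ht, hy⟩
  rw [Metric.tendstoUniformlyOn_iff] at hu
  rw [ContinuousWithinAt, Metric.tendsto_nhds] at hc ⊢
  intro ε hε
  rw [nhdsWithin_prod_eq, nhdsWithin_univ]
  have hmem : Icc (0 : ℝ) 1 ×ˢ Metric.closedBall y r ∈ 𝓝[chartDomain E c] (t, y) := by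
    rw [chartDomain, nhdsWithin_prod_eq]
    exact Filter.prod_mem_prod self_mem_nhdsWithin
      (mem_nhdsWithin_of_mem_nhds (Metric.closedBall_mem_nhds y hr))
  have h2 : ∀ᶠ q in 𝓝[chartDomain E c] (t, y), dist (chartDeriv c k F q) (chartDeriv c k F (t, y))
      < ε / 2 ∧ q ∈ Icc (0 : ℝ) 1 ×ˢ Metric.closedBall y r :=
    (hc (ε / 2) (by positivity)).and hmem
  filter_upwards [(hu (ε / 2) (by positivity)).prod_mk h2] with q ⟨hq1, hq2, hq3⟩
  have := hq1 q.2 hq3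
  rw [dist_comm] at this
  linarith [dist_triangle (chartDeriv c k q.1 q.2) (chartDeriv c k F q.2)
    (chartDeriv c k F (t, y))]

/-- The spatial derivative of `F` in the chart at `c`. -/
def chartGrad (c : M) (F : Hamiltonian E K) (q : ℝ × E) : E →L[ℝ] ℝ :=
  (fderivWithin ℝ (F.inChart c) (chartDomain E c) q).comp (ContinuousLinearMap.inr ℝ ℝ E)

/-- The second spatial derivative of `F` in the chart at `c`. -/
def chartHess (c : M) (F : Hamiltonian E K) (q : ℝ × E) : E →L[ℝ] E →L[ℝ] ℝ :=
  ((ContinuousLinearMap.compL ℝ E (ℝ × E) ℝ).flip (ContinuousLinearMap.inr ℝ ℝ E)).comp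
    ((fderivWithin ℝ (fderivWithin ℝ (F.inChart c) (chartDomain E c)) (chartDomain E c) q).comp
      (ContinuousLinearMap.inr ℝ ℝ E))

omit [IsManifold 𝓘(ℝ, E) ∞ M] in
lemma hasFDerivAt_slice {V : Type*} [NormedAddCommGroup V] [NormedSpace ℝ V] {c : M}
    {u : ℝ × E → V} {L : ℝ × E →L[ℝ] V} {t : ℝ} {y : E} (ht : t ∈ Icc (0 : ℝ) 1)
    (hy : y ∈ (extChartAt 𝓘(ℝ, E) c).target)
    (hu : HasFDerivWithinAt u L (chartDomain E c) (t, y)) :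
    HasFDerivAt (fun y => u (t, y)) (L.comp (ContinuousLinearMap.inr ℝ ℝ E)) y := by
  have h1 : HasFDerivAt (fun y : E => (t, y)) (ContinuousLinearMap.inr ℝ ℝ E) y :=
    hasFDerivAt_prodMk_right t y
  have h2 := hu.comp (s := (extChartAt 𝓘(ℝ, E) c).target) y h1.hasFDerivWithinAt
    (show MapsTo (fun z : E => (t, z)) (extChartAt 𝓘(ℝ, E) c).target (chartDomain E c) from
      fun z hz => Set.mk_mem_prod ht hz)
  exact h2.hasFDerivAt ((isOpen_extChartAt_target c).mem_nhds hy)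

lemma hasFDerivAt_inChart (c : M) (F : Hamiltonian E K) {t : ℝ} {y : E} (ht : t ∈ Icc (0 : ℝ) 1)
    (hy : y ∈ (extChartAt 𝓘(ℝ, E) c).target) :
    HasFDerivAt (fun y => F.extend t ((extChartAt 𝓘(ℝ, E) c).symm y)) (chartGrad c F (t, y)) y :=
  hasFDerivAt_slice (u := F.inChart c) ht hy
    (((F.contDiffOn_inChart c).differentiableOn (by simp)) (t, y) ⟨ht, hy⟩).hasFDerivWithinAt

lemma hasFDerivAt_chartGrad (c : M) (F : Hamiltonian E K) {t : ℝ} {y : E}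
    (ht : t ∈ Icc (0 : ℝ) 1) (hy : y ∈ (extChartAt 𝓘(ℝ, E) c).target) :
    HasFDerivAt (fun y => chartGrad c F (t, y)) (chartHess c F (t, y)) y := by
  have h1 : ContDiffOn ℝ 1 (fderivWithin ℝ (F.inChart c) (chartDomain E c)) (chartDomain E c) :=
    (F.contDiffOn_inChart c).fderivWithin (uniqueDiffOn_chartDomain c) (m := 1)
      (show ((1 : ℕ∞) + 1 : WithTop ℕ∞) ≤ ((⊤ : ℕ∞) : WithTop ℕ∞) from
        WithTop.coe_le_coe.2 le_top)
  have h2 := hasFDerivAt_slice ht hy ((h1.differentiableOn (by simp)) (t, y) ⟨ht, hy⟩).hasFDerivWithinAt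
  exact (((ContinuousLinearMap.compL ℝ E (ℝ × E) ℝ).flip
    (ContinuousLinearMap.inr ℝ ℝ E)).hasFDerivAt).comp y h2

/-- Such a point is a limit of points of the open complement of K, near which F is identically zero;
the gradient is continuous. Covering boundary points of K lets one show that flows preserve the
interior. -/
lemma mfderiv_extend_eq_zero [T2Space M] (hK : IsCompact K) (F : Hamiltonian E K) {t : ℝ}
    (ht : t ∈ Icc (0 : ℝ) 1) {x : M} (hx : x ∉ interior K) :
    mfderiv 𝓘(ℝ, E) 𝓘(ℝ, ℝ) (F.extend t) x = 0 := by
  have hcont : ContinuousAt (fun z => chartGrad x F (t, extChartAt 𝓘(ℝ, E) x z)) x :=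
    ContinuousAt.comp (g := fun y => chartGrad x F (t, y)) (f := extChartAt 𝓘(ℝ, E) x)
      (hasFDerivAt_chartGrad x F ht (mem_extChartAt_target x)).continuousAt (continuousAt_extChartAt x)
  have hfr : ∃ᶠ z in 𝓝 x, z ∈ Kᶜ := by
    rw [← mem_closure_iff_frequently, closure_compl]; exact hx
  have hzero : chartGrad x F (t, extChartAt 𝓘(ℝ, E) x x) = 0 := by
    refine (isClosed_singleton (x := (0 : E →L[ℝ] ℝ))).mem_of_frequently_of_tendsto ?_ hcont
    refine (hfr.and_eventually (extChartAt_source_mem_nhds (I := 𝓘(ℝ, E)) x)).mono ?_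
    rintro z ⟨hz, hzs⟩
    have h1 := hasFDerivAt_inChart x F ht ((extChartAt 𝓘(ℝ, E) x).map_source hzs)
    refine h1.unique ((hasFDerivAt_const (0 : ℝ) _).congr_of_eventuallyEq ?_)
    have h2 := (continuousAt_extChartAt_symm'' ((extChartAt 𝓘(ℝ, E) x).map_source hzs)).eventually_mem
      (s := Kᶜ) (by rw [(extChartAt 𝓘(ℝ, E) x).left_inv hzs]; exact hK.isClosed.isOpen_compl.mem_nhds hz)
    filter_upwards [h2] with y hy
    exact F.support_subset _ _ hy
  refine (F.mdifferentiableAt_extend ht x).mfderiv.trans ?_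
  show fderivWithin ℝ (fun y => F.extend t ((extChartAt 𝓘(ℝ, E) x).symm y)) (range (𝓘(ℝ, E)))
    (extChartAt 𝓘(ℝ, E) x x) = (0 : E →L[ℝ] ℝ)
  rw [ModelWithCorners.range_eq_univ, fderivWithin_univ]
  exact (hasFDerivAt_inChart x F ht (mem_extChartAt_target x)).fderiv.trans hzero

omit [IsManifold 𝓘(ℝ, E) ∞ M] in
-- The topology controls iterated derivatives as multilinear maps; currying isometries transfer this
-- to the first and second derivatives used in the ODE estimates.
lemma fderivWithin_eq_of_iteratedFDerivWithin {V : Type*} [NormedAddCommGroup V] [NormedSpace ℝ V]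
    (c : M) (u : ℝ × E → V) {q : ℝ × E} (hq : q ∈ chartDomain E c) :
    fderivWithin ℝ u (chartDomain E c) q =
      (continuousMultilinearCurryFin0 ℝ (ℝ × E) ((ℝ × E) →L[ℝ] V))
        (continuousMultilinearCurryRightEquiv' ℝ 0 (ℝ × E) V
          (iteratedFDerivWithin ℝ 1 u (chartDomain E c) q)) := by
  rw [iteratedFDerivWithin_succ_eq_comp_right (n := 0) (uniqueDiffOn_chartDomain c) hq]
  simp only [Function.comp_apply, LinearIsometryEquiv.apply_symm_apply]
  rfl

lemma continuousOn_chartGrad [FiniteDimensional ℝ E] (c : M) :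
    ContinuousOn (fun q : Hamiltonian E K × ℝ × E => chartGrad c q.1 q.2)
      (univ ×ˢ chartDomain E c) := by
  refine ContinuousOn.clm_comp ?_ continuousOn_const
  have h1 := (continuousMultilinearCurryFin0 ℝ (ℝ × E) ((ℝ × E) →L[ℝ] ℝ)).continuous.comp
    (continuousMultilinearCurryRightEquiv' ℝ 0 (ℝ × E) ℝ).continuous
  refine (h1.comp_continuousOn (continuousOn_uncurry_chartDeriv (K := K) c 1)).congr ?_
  rintro ⟨F, q⟩ ⟨-, hq⟩
  exact fderivWithin_eq_of_iteratedFDerivWithin c _ hq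

lemma continuousOn_chartHess [FiniteDimensional ℝ E] (c : M) :
    ContinuousOn (fun q : Hamiltonian E K × ℝ × E => chartHess c q.1 q.2)
      (univ ×ˢ chartDomain E c) := by
  refine continuousOn_const.clm_comp (ContinuousOn.clm_comp ?_ continuousOn_const)
  have h1 := (continuousMultilinearCurryFin0 ℝ (ℝ × E) ((ℝ × E) →L[ℝ] ((ℝ × E) →L[ℝ] ℝ))).continuous.comp
    ((continuousMultilinearCurryRightEquiv' ℝ 0 (ℝ × E) ((ℝ × E) →L[ℝ] ℝ)).continuous.comp
    (continuousMultilinearCurryRightEquiv' ℝ 1 (ℝ × E) ℝ).continuous)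
  refine (h1.comp_continuousOn (continuousOn_uncurry_chartDeriv (K := K) c 2)).congr ?_
  rintro ⟨F, q⟩ ⟨-, hq⟩
  refine (fderivWithin_eq_of_iteratedFDerivWithin c _ hq).trans ?_
  simp only [Function.comp_apply, chartDeriv_eq]
  rw [iteratedFDerivWithin_succ_eq_comp_right (n := 1) (uniqueDiffOn_chartDomain c) hq]
  simp only [Function.comp_apply, LinearIsometryEquiv.apply_symm_apply]

end Hamiltonian

namespace Hamiltonian

variable {E : Type*} [NormedAddCommGroup E] [NormedSpace ℝ E]
  {M : Type*} [TopologicalSpace M] [ChartedSpace E M] {K : Set M}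
  {ι : Type*} [Fintype ι]

/-- The perturbation `H + ∑ i, s i • F i` of `H`. -/
def addFamily (H : Hamiltonian E K) (F : ι → Hamiltonian E K) (s : ι → ℝ) : Hamiltonian E K where
  toFun t x := H.toFun t x + ∑ i, s i * (F i).toFun t x
  smooth := H.smooth.add (contMDiffOn_finsetSum fun i _ => contMDiffOn_const.mul (F i).smooth)
  support_subset t x hx := by
    simp [H.support_subset t x hx, fun i => (F i).support_subset t x hx]

lemma addFamily_extend (H : Hamiltonian E K) (F : ι → Hamiltonian E K) (s : ι → ℝ) (t : ℝ) (x : M) :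
    (H.addFamily F s).extend t x = H.extend t x + ∑ i, s i * (F i).extend t x := rfl

lemma ext_toFun {F G : Hamiltonian E K} (h : F.toFun = G.toFun) : F = G := by
  cases F; cases G; congr

lemma addFamily_zero (H : Hamiltonian E K) (F : ι → Hamiltonian E K) : H.addFamily F 0 = H := by
  apply ext_toFun
  funext t x
  simp [addFamily]

lemma inChart_addFamily (H : Hamiltonian E K) (F : ι → Hamiltonian E K) (s : ι → ℝ) (c : M) :
    (H.addFamily F s).inChart c =
      (H.inChart c) + fun q => ∑ i, (s i • (F i).inChart c) q := rfl

variable [IsManifold 𝓘(ℝ, E) ∞ M]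

lemma chartDeriv_addFamily (H : Hamiltonian E K) (F : ι → Hamiltonian E K) (s : ι → ℝ) (c : M)
    (k : ℕ) {q : ℝ × E} (hq : q ∈ chartDomain E c) :
    chartDeriv c k (H.addFamily F s) q =
      chartDeriv c k H q + ∑ i, s i • chartDeriv c k (F i) q := by
  have hs : ∀ G : Hamiltonian E K, ContDiffWithinAt ℝ k (G.inChart c) (chartDomain E c) q :=
    fun G => ((G.contDiffOn_inChart c).of_le (by exact_mod_cast le_top)) q hq
  have hu := uniqueDiffOn_chartDomain (E := E) c
  have hsum : ContDiffWithinAt ℝ k (fun q => ∑ i, (s i • (F i).inChart c) q) (chartDomain E c) q :=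
    ContDiffWithinAt.sum fun i _ => (hs (F i)).const_smul (s i)
  rw [chartDeriv_eq, inChart_addFamily, iteratedFDerivWithin_add_apply (hs H) hsum hu hq]
  refine congrArg (_ + ·) ((iteratedFDerivWithin_fun_sum_apply hu hq
    (fun i _ => (hs (F i)).const_smul (s i))).trans ?_)
  refine Finset.sum_congr rfl fun i _ => ?_
  exact iteratedFDerivWithin_const_smul_apply (a := s i) (hs (F i)) hu hq

/-- Derivatives of every order enter here; regularity of the flow uses only orders one and two. In
each chart and order the dependence on s is affine, with coefficients bounded on compact sets. -/
lemma continuous_addFamily (H : Hamiltonian E K) (F : ι → Hamiltonian E K) :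
    Continuous (H.addFamily F) := by
  refine continuous_iInf_rng.2 fun c => continuous_iInf_rng.2 fun k => continuous_induced_rng.2 ?_
  rw [continuous_iff_continuousAt]
  intro s
  refine UniformOnFun.tendsto_iff_tendstoUniformlyOn.2 ?_
  rintro C ⟨hC, hCD⟩
  rw [Metric.tendstoUniformlyOn_iff]
  have hb : ∀ i, ∃ B, ∀ q ∈ C, ‖chartDeriv c k (F i) q‖ ≤ B := fun i =>
    hC.exists_bound_of_continuousOn ((continuousOn_chartDeriv c k (F i)).mono hCD)
  choose B hB using hb
  intro ε hε
  have ht : Filter.Tendsto (fun s' : ι → ℝ => ∑ i, |s i - s' i| * B i) (𝓝 s) (𝓝 0) := by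
    have : Continuous (fun s' : ι → ℝ => ∑ i, |s i - s' i| * B i) := by fun_prop
    simpa using this.tendsto s
  filter_upwards [ht.eventually_lt_const hε] with s' hs' q hq
  refine lt_of_le_of_lt ?_ hs'
  show dist (chartDeriv c k (H.addFamily F s) q) (chartDeriv c k (H.addFamily F s') q) ≤ _
  rw [chartDeriv_addFamily H F s c k (hCD hq), chartDeriv_addFamily H F s' c k (hCD hq),
    dist_eq_norm, add_sub_add_left_eq_sub, ← Finset.sum_sub_distrib]
  refine (norm_sum_le _ _).trans (Finset.sum_le_sum fun i _ => ?_)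
  refine (congrArg norm (sub_smul (s i) (s' i) (chartDeriv c k (F i) q))).symm.le.trans ?_
  rw [norm_smul, Real.norm_eq_abs]
  exact mul_le_mul_of_nonneg_left (hB i q hq) (abs_nonneg _)

lemma chartGrad_addFamily (H : Hamiltonian E K) (F : ι → Hamiltonian E K) (s : ι → ℝ) (c : M)
    {t : ℝ} {y : E} (ht : t ∈ Icc (0 : ℝ) 1) (hy : y ∈ (extChartAt 𝓘(ℝ, E) c).target) :
    chartGrad c (H.addFamily F s) (t, y) = chartGrad c H (t, y) + ∑ i, s i • chartGrad c (F i) (t, y) := by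
  refine (hasFDerivAt_inChart c _ ht hy).unique ?_
  exact (hasFDerivAt_inChart c H ht hy).add
    (HasFDerivAt.fun_sum fun i _ => (hasFDerivAt_inChart c (F i) ht hy).const_mul (s i))

variable [FiniteDimensional ℝ E] {Ω : TwoForm 𝓘(ℝ, E) M}

/-- In a chart the field is J(y)(dH + ∑ sᵢ dFᵢ), with J the smooth inverse of the form. Its
derivative in (y, s) involves the first two space derivatives of H, which vary continuously with H.
-/
lemma isRegularField_addFamily (hΩ : IsSymplecticForm Ω) (F : ι → Hamiltonian E K) :
    IsRegularField (fun (H : Hamiltonian E K) (s : ι → ℝ) t x =>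
      hamiltonianField Ω ((H.addFamily F s).extend t) x) := by
  intro c
  set T := (extChartAt 𝓘(ℝ, E) c).target with hT
  have hTo : IsOpen T := isOpen_extChartAt_target c
  set J : E → (E →L[ℝ] ℝ) →L[ℝ] E := fun y => (flatL E (Ω.inChart c y)).inverse with hJ
  have hflat : ContDiff ℝ ∞ (fun a : E [⋀^Fin 2]→L[ℝ] ℝ => flatL E a) :=
    (flatL E).contDiff
  have hJs : ContDiffOn ℝ ∞ J T := fun y hy =>
    (ContDiffAt.comp (g := ContinuousLinearMap.inverse) (f := fun y => flatL E (Ω.inChart c y)) y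
      (contDiffAt_inverse (hΩ.isInvertible_flatL_inChart c hy))
      (hflat.contDiffAt.comp y
        ((hΩ.smooth c).contDiffAt (hTo.mem_nhds hy)))).contDiffWithinAt
  have hJd : ∀ y ∈ T, HasFDerivAt J (fderiv ℝ J y) y := fun y hy =>
    ((hJs.contDiffAt (hTo.mem_nhds hy)).differentiableAt (by simp)).hasFDerivAt
  have hJc : ContinuousOn (fderiv ℝ J) T := hJs.continuousOn_fderiv_of_isOpen hTo (by simp)
  set A : Hamiltonian E K → ℝ → E × (ι → ℝ) → E →L[ℝ] ℝ := fun p t z =>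
    chartGrad c p (t, z.1) + ∑ i, z.2 i • chartGrad c (F i) (t, z.1) with hA
  set A' : Hamiltonian E K → ℝ → E × (ι → ℝ) → E × (ι → ℝ) →L[ℝ] E →L[ℝ] ℝ := fun p t z =>
    (chartHess c p (t, z.1)).comp (ContinuousLinearMap.fst ℝ E (ι → ℝ)) +
      ∑ i, (z.2 i • (chartHess c (F i) (t, z.1)).comp (ContinuousLinearMap.fst ℝ E (ι → ℝ)) +
        ((ContinuousLinearMap.proj i).comp (ContinuousLinearMap.snd ℝ E (ι → ℝ))).smulRight
          (chartGrad c (F i) (t, z.1))) with hA'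
  have hAd : ∀ p, ∀ t ∈ Icc (0 : ℝ) 1, ∀ z ∈ T ×ˢ (univ : Set (ι → ℝ)),
      HasFDerivAt (A p t) (A' p t z) z := by
    intro p t ht z hz
    have hg : ∀ G : Hamiltonian E K, HasFDerivAt (fun z : E × (ι → ℝ) => chartGrad c G (t, z.1))
        ((chartHess c G (t, z.1)).comp (ContinuousLinearMap.fst ℝ E (ι → ℝ))) z := fun G =>
      HasFDerivAt.comp (g := fun y => chartGrad c G (t, y)) z (hasFDerivAt_chartGrad c G ht hz.1)
        hasFDerivAt_fst
    refine (hg p).add (HasFDerivAt.fun_sum fun i _ => ?_)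
    exact HasFDerivAt.fun_smul (((ContinuousLinearMap.proj (R := ℝ) (φ := fun _ : ι => ℝ) i).comp
      (ContinuousLinearMap.snd ℝ E (ι → ℝ))).hasFDerivAt) (hg (F i))
  have hD : MapsTo (fun q : Hamiltonian E K × ℝ × E × (ι → ℝ) => (q.1, q.2.1, q.2.2.1))
      (univ ×ˢ Icc (0 : ℝ) 1 ×ˢ T ×ˢ univ) (univ ×ˢ chartDomain E c) :=
    fun q hq => ⟨trivial, hq.2.1, hq.2.2.1⟩
  have hD' : ∀ i, MapsTo (fun q : Hamiltonian E K × ℝ × E × (ι → ℝ) => (F i, q.2.1, q.2.2.1))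
      (univ ×ˢ Icc (0 : ℝ) 1 ×ˢ T ×ˢ univ) (univ ×ˢ chartDomain E c) :=
    fun i q hq => ⟨trivial, hq.2.1, hq.2.2.1⟩
  have g1 := (continuousOn_chartGrad (K := K) c).comp (by fun_prop) hD
  have g2 := fun i => (continuousOn_chartGrad (K := K) c).comp (by fun_prop) (hD' i)
  have k1 := (continuousOn_chartHess (K := K) c).comp (by fun_prop) hD
  have k2 := fun i => (continuousOn_chartHess (K := K) c).comp (by fun_prop) (hD' i)
  have hs : ∀ i, ContinuousOn (fun q : Hamiltonian E K × ℝ × E × (ι → ℝ) => q.2.2.2 i)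
      (univ ×ˢ Icc (0 : ℝ) 1 ×ˢ T ×ˢ univ) := fun i => by fun_prop
  have hAc : ContinuousOn (fun q : Hamiltonian E K × ℝ × E × (ι → ℝ) => A q.1 q.2.1 q.2.2)
      (univ ×ˢ Icc (0 : ℝ) 1 ×ˢ T ×ˢ univ) :=
    g1.add (continuousOn_finsetSum _ fun i _ => (hs i).smul (g2 i))
  have hA'c : ContinuousOn (fun q : Hamiltonian E K × ℝ × E × (ι → ℝ) => A' q.1 q.2.1 q.2.2)
      (univ ×ˢ Icc (0 : ℝ) 1 ×ˢ T ×ˢ univ) := by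
    refine (k1.clm_comp continuousOn_const).add (continuousOn_finsetSum _ fun i _ =>
      ((hs i).smul ((k2 i).clm_comp continuousOn_const)).add ?_)
    exact ((ContinuousLinearMap.smulRightL ℝ (E × (ι → ℝ)) (E →L[ℝ] ℝ)
      ((ContinuousLinearMap.proj i).comp (ContinuousLinearMap.snd ℝ E (ι → ℝ)))).continuous).comp_continuousOn
        (g2 i)
  have hfd : ∀ p, ∀ t ∈ Icc (0 : ℝ) 1, ∀ z ∈ T ×ˢ (univ : Set (ι → ℝ)),
      HasFDerivAt (fun z => J z.1 (A p t z))
        ((J z.1).comp (A' p t z) +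
          ((fderiv ℝ J z.1).comp (ContinuousLinearMap.fst ℝ E (ι → ℝ))).flip (A p t z)) z :=
    fun p t ht z hz => HasFDerivAt.clm_apply
      (HasFDerivAt.comp (g := J) (f := Prod.fst) z (hJd z.1 hz.1) hasFDerivAt_fst) (hAd p t ht z hz)
  have hpr : MapsTo (fun q : Hamiltonian E K × ℝ × E × (ι → ℝ) => q.2.2.1)
      (univ ×ˢ Icc (0 : ℝ) 1 ×ˢ T ×ˢ univ) T := fun q hq => hq.2.2.1
  have hJ1 : ContinuousOn (fun q : Hamiltonian E K × ℝ × E × (ι → ℝ) => J q.2.2.1)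
      (univ ×ˢ Icc (0 : ℝ) 1 ×ˢ T ×ˢ univ) := hJs.continuousOn.comp (by fun_prop) hpr
  have hJ2 : ContinuousOn (fun q : Hamiltonian E K × ℝ × E × (ι → ℝ) => fderiv ℝ J q.2.2.1)
      (univ ×ˢ Icc (0 : ℝ) 1 ×ˢ T ×ˢ univ) := hJc.comp (by fun_prop) hpr
  refine ⟨fun p t z => J z.1 (A p t z), ?_, hJ1.clm_apply hAc,
    fun p t ht z hz => (hfd p t ht z hz).differentiableAt, ?_⟩
  · intro p s t ht x hx
    have hxt := (extChartAt 𝓘(ℝ, E) c).map_source hx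
    rw [← hΩ.chartD_hamiltonianField c hx (mdifferentiableAt_extend _ ht x)]
    simp only [hJ, hA]
    rw [← chartGrad_addFamily p F s c ht hxt, (hasFDerivAt_inChart c _ ht hxt).fderiv]
  · refine ContinuousOn.congr ?_ fun q hq => (hfd q.1 q.2.1 hq.2.1 q.2.2 hq.2.2).fderiv
    refine (hJ1.clm_comp hA'c).add ?_
    exact ((ContinuousLinearMap.flipₗᵢ ℝ (E × (ι → ℝ)) (E →L[ℝ] ℝ) E).continuous.comp_continuousOn
      (hJ2.clm_comp continuousOn_const)).clm_apply hAc

end Hamiltonian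

/-! ### The time-one flow of a Hamiltonian -/

section Flow

variable {E : Type*} [NormedAddCommGroup E] [NormedSpace ℝ E] [FiniteDimensional ℝ E]
  {M : Type*} [TopologicalSpace M] [T2Space M] [ChartedSpace E M] [IsManifold 𝓘(ℝ, E) ∞ M]
  {K : Set M} {Ω : TwoForm 𝓘(ℝ, E) M}

/-- The family indexed by `Empty` specialises the statements about perturbed Hamiltonians to a
single one. -/
lemma Hamiltonian.exists_trajectory (hΩ : IsSymplecticForm Ω) (hK : IsCompact K)
    (H : Hamiltonian E K) (x : M) :
    ∃ γ : ℝ → M, γ 0 = x ∧ IsTrajectory (fun t x => hamiltonianField Ω (H.extend t) x) 0 1 γ := by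
  have h := (isRegularField_addFamily hΩ (fun i : Empty => (i.elim : Hamiltonian E K))).exists_trajectory
    (p := H) (s := 0) hK (fun t ht x hx => hamiltonianField_eq_zero
      (mfderiv_extend_eq_zero hK _ ht fun h => hx (interior_subset h))) x
  simpa only [addFamily_zero] using h

/-- The time `1` flow of `H`. -/
def Hamiltonian.flow (hΩ : IsSymplecticForm Ω) (hK : IsCompact K) (H : Hamiltonian E K) (x : M) : M :=
  (H.exists_trajectory hΩ hK x).choose 1

lemma Hamiltonian.exists_trajectory_flow (hΩ : IsSymplecticForm Ω) (hK : IsCompact K)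
    (H : Hamiltonian E K) (x : M) :
    ∃ γ : ℝ → M, γ 0 = x ∧ IsTrajectory (fun t x => hamiltonianField Ω (H.extend t) x) 0 1 γ ∧
      γ 1 = H.flow hΩ hK x :=
  ⟨_, (H.exists_trajectory hΩ hK x).choose_spec.1, (H.exists_trajectory hΩ hK x).choose_spec.2, rfl⟩

lemma Hamiltonian.isTimeOneFlow_flow (hΩ : IsSymplecticForm Ω) (hK : IsCompact K)
    (H : Hamiltonian E K) : IsTimeOneFlow Ω H.extend (H.flow hΩ hK) := by
  intro x
  obtain ⟨γ, h0, hγ, h1⟩ := H.exists_trajectory_flow hΩ hK x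
  exact ⟨γ, fun t ht => ⟨_, hΩ.hamiltonianField_apply (H.extend t) (γ t), hγ t ht⟩, h0, h1⟩

omit [FiniteDimensional ℝ E] [T2Space M] [IsManifold 𝓘(ℝ, E) ∞ M] in
lemma isTimeOneFlow_id (Ω : TwoForm 𝓘(ℝ, E) M) : IsTimeOneFlow Ω (fun _ _ => 0) id := by
  intro x
  refine ⟨fun _ => x, fun t ht => ⟨0, fun v => ?_, ?_⟩, rfl, rfl⟩
  · have h1 : (Ω x) ![0, v] = 0 := (Ω x).map_coord_zero (0 : Fin 2) rfl
    have h2 : mfderiv 𝓘(ℝ, E) 𝓘(ℝ, ℝ) (fun _ : M => (0 : ℝ)) x = 0 := mfderiv_const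
    refine h1.trans ?_
    rw [h2]
    rfl
  · refine (hasMFDerivWithinAt_const x (Icc 0 1) t).congr_mfderiv ?_
    ext
    exact (smul_zero (1 : ℝ)).symm

lemma Hamiltonian.mjointC1At_flow (hΩ : IsSymplecticForm Ω) (hK : IsCompact K) {ι : Type*}
    [Fintype ι] (F : ι → Hamiltonian E K) (H : Hamiltonian E K) (x : M) (s : ι → ℝ) :
    MJointC1At E (fun (H : Hamiltonian E K) x s => (H.addFamily F s).flow hΩ hK x) H x s :=
  (isRegularField_addFamily hΩ F).mjointC1At_flow
    (fun _ x _ => exists_trajectory_flow hΩ hK _ x) H x s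

end Flow

/-! ### Operations on regular fields, uniqueness of end points, invariant sets -/

section RegularFields

variable {P P' : Type*} [TopologicalSpace P] [TopologicalSpace P']
  {S : Type*} [NormedAddCommGroup S] [NormedSpace ℝ S]
  {E : Type*} [NormedAddCommGroup E] [NormedSpace ℝ E]
  {M : Type*} [TopologicalSpace M] [ChartedSpace E M]

lemma IsRegularField.comp {X : P → S → ℝ → (x : M) → TangentSpace 𝓘(ℝ, E) x}
    (hX : IsRegularField X) {g : P' → P} (hg : Continuous g) {θ : P' → ℝ → ℝ}
    (hθ : Continuous fun q : P' × ℝ => θ q.1 q.2)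
    (hmap : ∀ p, ∀ t ∈ Icc (0 : ℝ) 1, θ p t ∈ Icc (0 : ℝ) 1) :
    IsRegularField (fun p s t x => X (g p) s (θ p t) x) := by
  intro c
  obtain ⟨f, hf, hfc, hfd, hfc'⟩ := hX c
  have hc : Continuous fun q : P' × ℝ × E × S => (g q.1, θ q.1 q.2.1, q.2.2) :=
    (hg.comp continuous_fst).prodMk ((hθ.comp (continuous_fst.prodMk continuous_snd.fst)).prodMk
      continuous_snd.snd)
  have hm : MapsTo (fun q : P' × ℝ × E × S => (g q.1, θ q.1 q.2.1, q.2.2))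
      (univ ×ˢ Icc (0 : ℝ) 1 ×ˢ (extChartAt 𝓘(ℝ, E) c).target ×ˢ univ)
      (univ ×ˢ Icc (0 : ℝ) 1 ×ˢ (extChartAt 𝓘(ℝ, E) c).target ×ˢ univ) :=
    fun q hq => ⟨trivial, hmap _ _ hq.2.1, hq.2.2⟩
  exact ⟨fun p t z => f (g p) (θ p t) z, fun p s t ht x hx => hf _ _ _ (hmap p t ht) x hx,
    hfc.comp hc.continuousOn hm, fun p t ht z hz => hfd _ _ (hmap p t ht) z hz,
    hfc'.comp hc.continuousOn hm⟩

lemma IsRegularField.smul {X : P → S → ℝ → (x : M) → TangentSpace 𝓘(ℝ, E) x}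
    (hX : IsRegularField X) {a : P → ℝ → ℝ} (ha : Continuous fun q : P × ℝ => a q.1 q.2) :
    IsRegularField (fun p s t x => a p t • X p s t x) := by
  intro c
  obtain ⟨f, hf, hfc, hfd, hfc'⟩ := hX c
  have hc : Continuous fun q : P × ℝ × E × S => a q.1 q.2.1 :=
    ha.comp (continuous_fst.prodMk continuous_snd.fst)
  refine ⟨fun p t z => a p t • f p t z, fun p s t ht x hx => ?_, hc.continuousOn.smul hfc,
    fun p t ht z hz => (hfd p t ht z hz).const_smul _, (hc.continuousOn.smul hfc').congr
      fun q hq => fderiv_fun_const_smul (hfd q.1 q.2.1 hq.2.1 q.2.2 hq.2.2) _⟩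
  have : f p t (extChartAt 𝓘(ℝ, E) c x, s) = _ := hf p s t ht x hx
  simp only [this]
  exact ((chartD 𝓘(ℝ, E) c x).map_smul (a p t) (X p s t x)).symm

lemma IsRegularField.add {X Y : P → S → ℝ → (x : M) → TangentSpace 𝓘(ℝ, E) x}
    (hX : IsRegularField X) (hY : IsRegularField Y) :
    IsRegularField (fun p s t x => X p s t x + Y p s t x) := by
  intro c
  obtain ⟨f, hf, hfc, hfd, hfc'⟩ := hX c
  obtain ⟨f₂, hf₂, hfc₂, hfd₂, hfc₂'⟩ := hY c
  refine ⟨fun p t z => f p t z + f₂ p t z, fun p s t ht x hx => ?_, hfc.add hfc₂,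
    fun p t ht z hz => (hfd p t ht z hz).add (hfd₂ p t ht z hz), (hfc'.add hfc₂').congr
      fun q hq => fderiv_fun_add (hfd q.1 q.2.1 hq.2.1 q.2.2 hq.2.2)
        (hfd₂ q.1 q.2.1 hq.2.1 q.2.2 hq.2.2)⟩
  simp only [hf p s t ht x hx, hf₂ p s t ht x hx]
  exact ((chartD 𝓘(ℝ, E) c x).map_add (X p s t x) (Y p s t x)).symm

lemma IsTrajectory.congr_field {X Y : ℝ → (x : M) → TangentSpace 𝓘(ℝ, E) x} {a b : ℝ}
    {γ : ℝ → M} (h : IsTrajectory X a b γ) (heq : ∀ t ∈ Icc a b, ∀ x, Y t x = X t x) :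
    IsTrajectory Y a b γ := by
  intro t ht
  have := h t ht
  rwa [← heq t ht] at this

lemma IsTrajectory.comp {X : ℝ → (x : M) → TangentSpace 𝓘(ℝ, E) x} {a b a' b' : ℝ} {γ : ℝ → M}
    (h : IsTrajectory X a b γ) {θ θ' : ℝ → ℝ}
    (hθ : ∀ t ∈ Icc a' b', HasDerivWithinAt θ (θ' t) (Icc a' b') t)
    (hmap : MapsTo θ (Icc a' b') (Icc a b)) :
    IsTrajectory (fun t x => θ' t • X (θ t) x) a' b' (γ ∘ θ) := by
  intro t ht
  have h1 := (hθ t ht).hasFDerivWithinAt.hasMFDerivWithinAt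
  have h2 := (h (θ t) (hmap ht)).comp t h1 hmap
  refine h2.congr_mfderiv ?_
  ext
  show ((1 : ℝ) • θ' t) • (X (θ t) (γ (θ t)) : E) = (1 : ℝ) • θ' t • (X (θ t) (γ (θ t)) : E)
  rw [one_smul, one_smul]

variable [FiniteDimensional ℝ S] [FiniteDimensional ℝ E] [T2Space M] [IsManifold 𝓘(ℝ, E) ∞ M]

/-- Uniqueness of the end point follows from the continuous dependence of the end points on a
parameter, whatever the choice of the trajectories. -/
lemma IsRegularField.trajectory_unique {X : P → S → ℝ → (x : M) → TangentSpace 𝓘(ℝ, E) x}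
    (hX : IsRegularField X) {p : P} {s : S}
    (hex : ∀ x s, ∃ γ, γ 0 = x ∧ IsTrajectory (X p s) 0 1 γ) {γ γ' : ℝ → M}
    (hγ : IsTrajectory (X p s) 0 1 γ) (hγ' : IsTrajectory (X p s) 0 1 γ') (h0 : γ 0 = γ' 0) :
    γ 1 = γ' 1 := by
  classical
  have hX' : IsRegularField (fun (_ : ℝ) s t x => X p s t x) :=
    hX.comp (g := fun _ : ℝ => p) continuous_const (θ := fun _ t => t) continuous_snd
      (fun _ _ ht => ht)
  choose β hβ0 hβ using hex
  -- A dummy parameter u selects γ at u = 0 and γ' for all other u. Any selection of end points is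
  -- continuous, so the two values must agree.
  set φ : ℝ → M → S → M := fun u x r =>
    if x = γ 0 ∧ r = s then (if u = 0 then γ 1 else γ' 1) else β x r 1 with hφ
  have hφ' : ∀ u x r, ∃ α, α 0 = x ∧ IsTrajectory (X p r) 0 1 α ∧ α 1 = φ u x r := by
    intro u x r
    simp only [hφ]
    split_ifs with h1 h2
    · obtain ⟨rfl, rfl⟩ := h1
      exact ⟨γ, rfl, hγ, rfl⟩
    · obtain ⟨rfl, rfl⟩ := h1
      exact ⟨γ', h0.symm, hγ', rfl⟩
    · exact ⟨β x r, hβ0 x r, hβ x r, rfl⟩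
  have hc := (hX'.mjointC1At_flow hφ' 0 (γ 0) s).continuousAt
  have hc' : ContinuousAt (fun u : ℝ => φ u (γ 0) s) 0 :=
    ContinuousAt.comp (g := fun q : ℝ × M × S => φ q.1 q.2.1 q.2.2)
      (f := fun u : ℝ => (u, γ 0, s)) hc (by fun_prop)
  have h1 : Filter.Tendsto (fun u : ℝ => φ u (γ 0) s) (𝓝[≠] 0) (𝓝 (γ 1)) := by
    have := hc'.tendsto.mono_left (nhdsWithin_le_nhds (s := {0}ᶜ))
    simpa [hφ] using this
  refine tendsto_nhds_unique h1 (tendsto_const_nhds.congr' ?_)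
  filter_upwards [self_mem_nhdsWithin] with u hu
  have hu' : u ≠ 0 := hu
  simp [hφ, hu']

omit [T2Space M] in
-- At the first time outside U the trajectory sits at a stationary point, hence was already there
-- slightly earlier, a contradiction.
lemma mem_of_isTrajectory {X : P → S → ℝ → (x : M) → TangentSpace 𝓘(ℝ, E) x}
    (hX : IsRegularField X) {p : P} {s : S} {U : Set M} (hU : IsOpen U)
    (h0 : ∀ t ∈ Icc (0 : ℝ) 1, ∀ x ∉ U, X p s t x = 0) {γ : ℝ → M}
    (hγ : IsTrajectory (X p s) 0 1 γ) (hγ0 : γ 0 ∈ U) : γ 1 ∈ U := by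
  by_contra h1
  set A : Set ℝ := Icc 0 1 ∩ γ ⁻¹' Uᶜ with hA
  have hAc : IsClosed A := hγ.continuousOn.preimage_isClosed_of_isClosed isClosed_Icc hU.isClosed_compl
  have hAb : BddBelow A := ⟨0, fun t ht => ht.1.1⟩
  have hmem : sInf A ∈ A := hAc.csInf_mem ⟨1, ⟨zero_le_one, le_rfl⟩, h1⟩ hAb
  have hpos : 0 < sInf A := by
    refine lt_of_le_of_ne hmem.1.1 fun h => ?_
    exact hmem.2 (by rw [← h]; exact hγ0)
  obtain ⟨u, hu, huγ⟩ := hX.eventually_eq_of_stationary hγ (t := sInf A) ⟨hpos, hmem.1.2⟩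
    (fun r hr => h0 r hr _ hmem.2)
  have huA : u ∈ A := ⟨⟨hu.1, hu.2.le.trans hmem.1.2⟩, by
    have h2 := huγ u ⟨le_rfl, hu.2.le⟩
    show γ u ∉ U
    rw [h2]
    exact hmem.2⟩
  exact absurd (csInf_le hAb huA) (not_le.2 hu.2)

end RegularFields

/-! ### Perturbations that move the end point of the flow in every direction -/

section HamiltonianFieldLinear

variable {E : Type*} [NormedAddCommGroup E] [NormedSpace ℝ E]
  {M : Type*} [TopologicalSpace M] [ChartedSpace E M] {Ω : TwoForm 𝓘(ℝ, E) M}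

lemma hamiltonianField_add_mul {h g : M → ℝ} {x : M} (r : ℝ)
    (hh : MDifferentiableAt 𝓘(ℝ, E) 𝓘(ℝ, ℝ) h x) (hg : MDifferentiableAt 𝓘(ℝ, E) 𝓘(ℝ, ℝ) g x) :
    hamiltonianField Ω (fun y => h y + r * g y) x =
      hamiltonianField Ω h x + r • hamiltonianField Ω g x := by
  obtain ⟨A, hA⟩ : ∃ A : E →L[ℝ] ℝ, HasMFDerivAt 𝓘(ℝ, E) 𝓘(ℝ, ℝ) h x A := ⟨_, hh.hasMFDerivAt⟩
  obtain ⟨B, hB⟩ : ∃ B : E →L[ℝ] ℝ, HasMFDerivAt 𝓘(ℝ, E) 𝓘(ℝ, ℝ) g x B := ⟨_, hg.hasMFDerivAt⟩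
  have h1 : HasMFDerivAt 𝓘(ℝ, E) 𝓘(ℝ, ℝ) (fun y => h y + r * g y) x (A + r • B) :=
    hA.add (hB.const_smul r)
  have e1 : (mfderiv 𝓘(ℝ, E) 𝓘(ℝ, ℝ) (fun y => h y + r * g y) x : E →L[ℝ] ℝ) = A + r • B := h1.mfderiv
  have e2 : (mfderiv 𝓘(ℝ, E) 𝓘(ℝ, ℝ) h x : E →L[ℝ] ℝ) = A := hA.mfderiv
  have e3 : (mfderiv 𝓘(ℝ, E) 𝓘(ℝ, ℝ) g x : E →L[ℝ] ℝ) = B := hB.mfderiv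
  have e4 : (flatL E (Ω x)).inverse (A + r • B) =
      (flatL E (Ω x)).inverse A + r • (flatL E (Ω x)).inverse B := by
    rw [map_add, map_smul]
  exact (congrArg (flatL E (Ω x)).inverse e1).trans (e4.trans (congrArg₂ (fun a b : E => a + r • b)
    (congrArg (flatL E (Ω x)).inverse e2.symm) (congrArg (flatL E (Ω x)).inverse e3.symm)))

end HamiltonianFieldLinear

/-- Composing with a fixed right inverse of A gives an endomorphism close to the identity, hence a
unit. -/
lemma eventually_surjective {V W : Type*} [NormedAddCommGroup V] [NormedSpace ℝ V]
    [NormedAddCommGroup W] [NormedSpace ℝ W] [FiniteDimensional ℝ W] {A : V →L[ℝ] W}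
    (hA : Function.Surjective A) : ∀ᶠ B in 𝓝 A, Function.Surjective (B : V →L[ℝ] W) := by
  obtain ⟨R, hR⟩ := A.toLinearMap.exists_rightInverse_of_surjective (LinearMap.range_eq_top.2 hA)
  set R' : W →L[ℝ] V := LinearMap.toContinuousLinearMap R with hR'
  have h1 : A.comp R' = ContinuousLinearMap.id ℝ W := by
    ext w
    exact LinearMap.congr_fun hR w
  have hc : Continuous fun B : V →L[ℝ] W => B.comp R' := continuous_id.clm_comp continuous_const
  have : CompleteSpace W := FiniteDimensional.complete ℝ W
  have h2 : ∀ᶠ B in 𝓝 A, IsUnit (B.comp R' : W →L[ℝ] W) := by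
    refine hc.continuousAt.eventually_mem (Units.isOpen.mem_nhds ?_)
    rw [h1]; exact isUnit_one
  filter_upwards [h2] with B hB
  obtain ⟨u, hu⟩ := hB
  intro w
  refine ⟨R' ((↑u⁻¹ : W →L[ℝ] W) w), ?_⟩
  have : (B.comp R') ((↑u⁻¹ : W →L[ℝ] W) w) = w := by
    rw [← hu, ← mul_apply_eq_comp, Units.mul_inv]; rfl
  exact this

lemma deriv_smoothTransition_of_nonpos {x : ℝ} (hx : x ≤ 0) : deriv Real.smoothTransition x = 0 := by
  refine IsLocalMin.deriv_eq_zero (Filter.Eventually.of_forall fun y => ?_)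
  rw [Real.smoothTransition.zero_of_nonpos hx]
  exact Real.smoothTransition.nonneg y

section ChartChange

variable {S : Type*} [NormedAddCommGroup S] [NormedSpace ℝ S]
  {E : Type*} [NormedAddCommGroup E] [NormedSpace ℝ E]
  {M : Type*} [TopologicalSpace M] [ChartedSpace E M] [IsManifold 𝓘(ℝ, E) ∞ M]

lemma surjective_fderiv_chart_change {g : S → M} {s : S} {c c' : M} (hg : ContinuousAt g s)
    (hc : g s ∈ (extChartAt 𝓘(ℝ, E) c).source) (hc' : g s ∈ (extChartAt 𝓘(ℝ, E) c').source)
    (hd : DifferentiableAt ℝ (fun r => extChartAt 𝓘(ℝ, E) c (g r)) s)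
    (hs : Function.Surjective (fderiv ℝ (fun r => extChartAt 𝓘(ℝ, E) c (g r)) s)) :
    Function.Surjective (fderiv ℝ (fun r => extChartAt 𝓘(ℝ, E) c' (g r)) s) := by
  have h1 := ((contDiffAt_extChartAt_coord_change hc hc').differentiableAt (by simp)).hasFDerivAt
  have h2 := ((contDiffAt_extChartAt_coord_change hc' hc).differentiableAt (by simp)).hasFDerivAt
  set x := g s with hx
  set T := fderiv ℝ (fun y => extChartAt 𝓘(ℝ, E) c' ((extChartAt 𝓘(ℝ, E) c).symm y))
    (extChartAt 𝓘(ℝ, E) c x)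
  set T' := fderiv ℝ (fun y => extChartAt 𝓘(ℝ, E) c ((extChartAt 𝓘(ℝ, E) c').symm y))
    (extChartAt 𝓘(ℝ, E) c' x)
  have e1 : HasFDerivAt (fun r => extChartAt 𝓘(ℝ, E) c' (g r))
      (T.comp (fderiv ℝ (fun r => extChartAt 𝓘(ℝ, E) c (g r)) s)) s := by
    refine (h1.comp s hd.hasFDerivAt).congr_of_eventuallyEq ?_
    filter_upwards [hg.eventually_mem ((isOpen_extChartAt_source c).mem_nhds hc)] with r hr
    exact congrArg (extChartAt 𝓘(ℝ, E) c') ((extChartAt 𝓘(ℝ, E) c).left_inv hr).symm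
  have e2 : T.comp T' = ContinuousLinearMap.id ℝ E := by
    have h3 : HasFDerivAt (fun y => extChartAt 𝓘(ℝ, E) c' ((extChartAt 𝓘(ℝ, E) c).symm y)) T
        (extChartAt 𝓘(ℝ, E) c ((extChartAt 𝓘(ℝ, E) c').symm (extChartAt 𝓘(ℝ, E) c' x))) := by
      rwa [(extChartAt 𝓘(ℝ, E) c').left_inv hc']
    refine (HasFDerivAt.comp (f := fun y => extChartAt 𝓘(ℝ, E) c ((extChartAt 𝓘(ℝ, E) c').symm y))
      (extChartAt 𝓘(ℝ, E) c' x) h3 h2).unique ((hasFDerivAt_id _).congr_of_eventuallyEq ?_)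
    have h4 := (continuousAt_extChartAt_symm' hc').eventually_mem (s := (extChartAt 𝓘(ℝ, E) c).source)
      (by rw [(extChartAt 𝓘(ℝ, E) c').left_inv hc']; exact (isOpen_extChartAt_source c).mem_nhds hc)
    filter_upwards [h4, (isOpen_extChartAt_target c').mem_nhds
      ((extChartAt 𝓘(ℝ, E) c').map_source hc')] with y hy hyt
    simp only [Function.comp_apply, (extChartAt 𝓘(ℝ, E) c).left_inv hy,
      (extChartAt 𝓘(ℝ, E) c').right_inv hyt, id]
  rw [e1.fderiv]
  refine Function.Surjective.comp (g := T) (fun w => ⟨T' w, ?_⟩) hs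
  exact congrArg (fun L : E →L[ℝ] E => L w) e2

end ChartChange

section Bump

variable {E : Type*} [NormedAddCommGroup E] [NormedSpace ℝ E] [FiniteDimensional ℝ E]
  {M : Type*} [TopologicalSpace M] [T2Space M] [ChartedSpace E M] [IsManifold 𝓘(ℝ, E) ∞ M]
  {K : Set M}

lemma exists_contMDiff_hasFDerivAt {q : M} (hq : q ∈ interior K) (ℓ : E →L[ℝ] ℝ) :
    ∃ f : M → ℝ, ContMDiff 𝓘(ℝ, E) 𝓘(ℝ, ℝ) ∞ f ∧ (∀ x ∉ K, f x = 0) ∧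
      HasFDerivAt (fun y => f ((extChartAt 𝓘(ℝ, E) q).symm y)) ℓ (extChartAt 𝓘(ℝ, E) q q) := by
  obtain ⟨ρ, -, hρ⟩ := (SmoothBumpFunction.nhds_basis_tsupport (I := 𝓘(ℝ, E)) q).mem_iff.1
    (isOpen_interior.mem_nhds hq)
  refine ⟨fun x => ρ x • ℓ (extChartAt 𝓘(ℝ, E) q x), ρ.contMDiff_smul ?_, fun x hx => ?_, ?_⟩
  · exact ℓ.contMDiff.comp_contMDiffOn contMDiffOn_extChartAt
  · have : ρ x = 0 := by
      by_contra h
      exact hx (interior_subset (hρ (subset_tsupport _ h)))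
    simp only [this, zero_smul]
  · refine ℓ.hasFDerivAt.congr_of_eventuallyEq ?_
    have h1 := (continuousAt_extChartAt_symm (I := 𝓘(ℝ, E)) q).eventually
      (p := fun x => ρ x = 1) (by rw [extChartAt_to_inv]; exact ρ.eventuallyEq_one)
    filter_upwards [h1, extChartAt_target_mem_nhds (I := 𝓘(ℝ, E)) q] with y hy hyt
    simp only [hy, one_smul, (extChartAt 𝓘(ℝ, E) q).right_inv hyt]

namespace Hamiltonian

omit [FiniteDimensional ℝ E] [T2Space M] [IsManifold 𝓘(ℝ, E) ∞ M]

instance : Zero (Hamiltonian E K) where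
  zero := ⟨fun _ _ => 0, contMDiffOn_const, fun _ _ _ => rfl⟩

lemma zero_extend (t : ℝ) (x : M) : (0 : Hamiltonian E K).extend t x = 0 := rfl

/-- The Hamiltonian `(t, x) ↦ β t * f x`. -/
def ofMul {β : ℝ → ℝ} (hβ : ContDiff ℝ ∞ β) {f : M → ℝ} (hf : ContMDiff 𝓘(ℝ, E) 𝓘(ℝ, ℝ) ∞ f)
    (hK : ∀ x ∉ K, f x = 0) : Hamiltonian E K where
  toFun t x := β t * f x
  smooth := by
    have h : ContMDiffOn (𝓘(ℝ, ℝ).prod 𝓘(ℝ, E)) 𝓘(ℝ, ℝ) ∞ (fun p : ℝ × M => β p.1 * f p.2)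
        (Icc (0 : ℝ) 1 ×ˢ univ) :=
      ((hβ.contMDiff.comp contMDiff_fst).mul (hf.comp contMDiff_snd)).contMDiffOn
    refine h.congr fun p hp => ?_
    rw [projIcc_of_mem zero_le_one hp.1]
  support_subset t x hx := by rw [hK x hx, mul_zero]

lemma ofMul_extend {β : ℝ → ℝ} (hβ : ContDiff ℝ ∞ β) {f : M → ℝ}
    (hf : ContMDiff 𝓘(ℝ, E) 𝓘(ℝ, ℝ) ∞ f) (hK : ∀ x ∉ K, f x = 0) {t : ℝ}
    (ht : t ∈ Icc (0 : ℝ) 1) : (ofMul hβ hf hK).extend t = fun x => β t * f x := by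
  funext x
  simp only [extend, ofMul, projIcc_of_mem zero_le_one ht]

end Hamiltonian

end Bump

lemma hasFDerivAt_chartFamily_param {P S : Type*} [NormedAddCommGroup S]
    [NormedSpace ℝ S] {E : Type*} [NormedAddCommGroup E] [NormedSpace ℝ E]
    {M : Type*} [TopologicalSpace M] [ChartedSpace E M] {Φ : P → M → S → M} {c c' : M} {p : P} {x : M} {s : S}
    (hx : x ∈ (extChartAt 𝓘(ℝ, E) c).source)
    (hd : DifferentiableAt ℝ (chartFamily Φ c c' p) (extChartAt 𝓘(ℝ, E) c x, s)) :
    HasFDerivAt (fun r => extChartAt 𝓘(ℝ, E) c' (Φ p x r))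
      ((fderiv ℝ (chartFamily Φ c c' p) (extChartAt 𝓘(ℝ, E) c x, s)).comp
        (ContinuousLinearMap.inr ℝ E S)) s := by
  have h := hd.hasFDerivAt.comp s (hasFDerivAt_prodMk_right (𝕜 := ℝ) (extChartAt 𝓘(ℝ, E) c x) s)
  refine h.congr_of_eventuallyEq (.of_forall fun r => ?_)
  simp only [Function.comp_apply, chartFamily, (extChartAt 𝓘(ℝ, E) c).left_inv hx]

namespace Hamiltonian

variable {E : Type*} [NormedAddCommGroup E] [NormedSpace ℝ E] [FiniteDimensional ℝ E]
  {M : Type*} [TopologicalSpace M] [T2Space M] [ChartedSpace E M] [IsManifold 𝓘(ℝ, E) ∞ M]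
  {K : Set M} {Ω : TwoForm 𝓘(ℝ, E) M}

lemma flow_eq_of_trajectory (hΩ : IsSymplecticForm Ω) (hK : IsCompact K) (H : Hamiltonian E K)
    {γ : ℝ → M} (hγ : IsTrajectory (fun t x => hamiltonianField Ω (H.extend t) x) 0 1 γ) :
    γ 1 = H.flow hΩ hK (γ 0) := by
  have hX := isRegularField_addFamily (K := K) hΩ (fun i : Empty => (i.elim : Hamiltonian E K))
  obtain ⟨γ', h0, hγ', h1⟩ := H.exists_trajectory_flow hΩ hK (γ 0)
  rw [← h1]
  have e : ∀ s : Empty → ℝ, H.addFamily (fun i : Empty => (i.elim : Hamiltonian E K)) s = H := by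
    intro s
    rw [Subsingleton.elim s 0, addFamily_zero]
  refine hX.trajectory_unique (p := H) (s := 0) (fun x s => ?_) ?_ ?_ h0.symm
  · rw [e]
    exact H.exists_trajectory hΩ hK x
  · simpa only [e] using hγ
  · simpa only [e] using hγ'

lemma flow_mem_interior (hΩ : IsSymplecticForm Ω) (hK : IsCompact K) (H : Hamiltonian E K)
    {x : M} (hx : x ∈ interior K) : H.flow hΩ hK x ∈ interior K := by
  have hX := isRegularField_addFamily (K := K) hΩ (fun i : Empty => (i.elim : Hamiltonian E K))
  obtain ⟨γ, h0, hγ, h1⟩ := H.exists_trajectory_flow hΩ hK x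
  rw [← h1]
  refine mem_of_isTrajectory hX (p := H) (s := 0) isOpen_interior (fun t ht y hy => ?_) ?_ (h0 ▸ hx)
  · exact hamiltonianField_eq_zero (mfderiv_extend_eq_zero hK _ ht hy)
  · simpa only [addFamily_zero] using hγ

/-- The infinitesimal variations of the flow at `x` along the family `F` span the tangent space. -/
def IsSpanningAt (hΩ : IsSymplecticForm Ω) (hK : IsCompact K) (H : Hamiltonian E K) {ι : Type*}
    [Fintype ι] (F : ι → Hamiltonian E K) (x : M) : Prop :=
  ∀ c : M, H.flow hΩ hK x ∈ (extChartAt 𝓘(ℝ, E) c).source →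
    Function.Surjective (fderiv ℝ (fun s : ι → ℝ =>
      extChartAt 𝓘(ℝ, E) c ((H.addFamily F s).flow hΩ hK x)) 0)

end Hamiltonian

section

variable {E : Type*} [NormedAddCommGroup E] [NormedSpace ℝ E] [FiniteDimensional ℝ E]
  {M : Type*} [TopologicalSpace M] [T2Space M] [ChartedSpace E M] [IsManifold 𝓘(ℝ, E) ∞ M]
  {K : Set M} {Ω : TwoForm 𝓘(ℝ, E) M} {ι : Type*} [Fintype ι]

open Hamiltonian

/-- Rescaling time on `[1 - δ, 1]` turns the perturbation of `H` by a family concentrated near time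
`1` into this field, which extends to `δ = 0`. -/
def rescaledField (Ω : TwoForm 𝓘(ℝ, E) M) (H : Hamiltonian E K) (f : ι → Hamiltonian E K)
    (δ : Icc (0 : ℝ) 1) (s : ι → ℝ) (τ : ℝ) (x : M) : TangentSpace 𝓘(ℝ, E) x :=
  (δ : ℝ) • hamiltonianField Ω (H.extend (1 - δ + δ * τ)) x +
    deriv Real.smoothTransition τ • hamiltonianField Ω (((0 : Hamiltonian E K).addFamily f s).extend τ) x

omit [T2Space M] in
lemma isRegularField_rescaledField (hΩ : IsSymplecticForm Ω) (H : Hamiltonian E K)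
    (f : ι → Hamiltonian E K) : IsRegularField (rescaledField Ω H f) := by
  -- The field of H is written as a perturbation by zero Hamiltonians so that both summands have the
  -- same parameter space.
  have h1 := ((isRegularField_addFamily hΩ (fun _ : ι => (0 : Hamiltonian E K))).comp
    (P' := Icc (0 : ℝ) 1) (g := fun _ => H) continuous_const (θ := fun δ τ => 1 - δ + δ * τ)
    (by fun_prop) (fun δ τ hτ => ⟨by nlinarith [δ.2.1, δ.2.2, hτ.1], by nlinarith [δ.2.1, hτ.2]⟩)).smul
    (a := fun δ _ => (δ : ℝ)) (by fun_prop)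
  have hd : Continuous (deriv Real.smoothTransition) :=
    (Real.smoothTransition.contDiff (n := 1)).continuous_deriv (by simp)
  have h2 := ((isRegularField_addFamily hΩ f).comp (P' := Icc (0 : ℝ) 1) (g := fun _ => 0)
    continuous_const (θ := fun _ τ => τ) (by fun_prop) (fun _ _ h => h)).smul
    (a := fun _ τ => deriv Real.smoothTransition τ) (by fun_prop)
  have e : ∀ s : ι → ℝ, H.addFamily (fun _ : ι => (0 : Hamiltonian E K)) s = H := by
    intro s
    apply ext_toFun
    funext t x
    show H.toFun t x + ∑ i, s i * 0 = _
    simp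
  have h3 := h1.add h2
  simp only [e] at h3
  exact h3

lemma exists_trajectory_rescaledField (hΩ : IsSymplecticForm Ω) (hK : IsCompact K)
    (H : Hamiltonian E K) (f : ι → Hamiltonian E K) (δ : Icc (0 : ℝ) 1) (x : M) (s : ι → ℝ) :
    ∃ γ, γ 0 = x ∧ IsTrajectory (rescaledField Ω H f δ s) 0 1 γ := by
  refine (isRegularField_rescaledField hΩ H f).exists_trajectory hK (fun τ hτ x hx => ?_) x
  have hx' : x ∉ interior K := fun h => hx (interior_subset h)
  have hmem : 1 - (δ : ℝ) + δ * τ ∈ Icc (0 : ℝ) 1 :=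
    ⟨by nlinarith [δ.2.1, δ.2.2, hτ.1], by nlinarith [δ.2.1, hτ.2]⟩
  rw [rescaledField, hamiltonianField_eq_zero (mfderiv_extend_eq_zero hK _ hmem hx'),
    hamiltonianField_eq_zero (mfderiv_extend_eq_zero hK _ hτ hx'), smul_zero, smul_zero, add_zero]

omit [T2Space M] [FiniteDimensional ℝ E] [IsManifold 𝓘(ℝ, E) ∞ M] in
lemma addFamily_ofMul_extend {β : ℝ → ℝ} (hβ : ContDiff ℝ ∞ β) {f : ι → M → ℝ}
    (hf : ∀ i, ContMDiff 𝓘(ℝ, E) 𝓘(ℝ, ℝ) ∞ (f i)) (hfK : ∀ i, ∀ x ∉ K, f i x = 0)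
    (H : Hamiltonian E K) (s : ι → ℝ) {t : ℝ} (ht : t ∈ Icc (0 : ℝ) 1) :
    (H.addFamily (fun i => ofMul hβ (hf i) (hfK i)) s).extend t =
      fun x => H.extend t x + β t * ∑ i, s i * f i x := by
  funext x
  rw [addFamily_extend, Finset.mul_sum]
  congr 1
  refine Finset.sum_congr rfl fun i _ => ?_
  rw [ofMul_extend hβ (hf i) (hfK i) ht]
  ring

/-- The time `1` map of the rescaled field at `δ > 0` is that of a perturbation of `H`. -/
lemma flow_addFamily_ofMul (hΩ : IsSymplecticForm Ω) (hK : IsCompact K) (H : Hamiltonian E K)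
    {f : ι → M → ℝ} (hf : ∀ i, ContMDiff 𝓘(ℝ, E) 𝓘(ℝ, ℝ) ∞ (f i))
    (hfK : ∀ i, ∀ x ∉ K, f i x = 0) {δ : Icc (0 : ℝ) 1} (hδ : 0 < (δ : ℝ)) (s : ι → ℝ)
    {β : ℝ → ℝ} (hβ : ContDiff ℝ ∞ β)
    (hβδ : β = fun t => (δ : ℝ)⁻¹ * deriv Real.smoothTransition ((t - 1 + δ) / δ))
    {γ η : ℝ → M} (hγ : IsTrajectory (fun t x => hamiltonianField Ω (H.extend t) x) 0 1 γ)
    (hη : IsTrajectory (rescaledField Ω H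
      (fun i => ofMul (β := fun _ => 1) contDiff_const (hf i) (hfK i)) δ s) 0 1 η)
    (h0 : η 0 = γ (1 - δ)) :
    (H.addFamily (fun i => ofMul hβ (hf i) (hfK i)) s).flow hΩ hK (γ 0) = η 1 := by
  have hδ1 := δ.2.2
  set θ : ℝ → ℝ := fun t => (t - 1 + δ) / δ with hθ
  -- Up to time 1 - δ the profile β vanishes, so γ itself is a trajectory of the perturbed field.
  have t1 : IsTrajectory (fun t x => hamiltonianField Ω
      ((H.addFamily (fun i => ofMul hβ (hf i) (hfK i)) s).extend t) x) 0 (1 - δ) γ := by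
    refine (hγ.mono le_rfl (by linarith)).congr_field fun t ht x => ?_
    have h2 : β t = 0 := by
      rw [hβδ]
      simp only
      rw [deriv_smoothTransition_of_nonpos, mul_zero]
      exact div_nonpos_of_nonpos_of_nonneg (by linarith [ht.2]) hδ.le
    rw [addFamily_ofMul_extend hβ hf hfK H s ⟨ht.1, by linarith [ht.2]⟩]
    simp only [h2, zero_mul, add_zero]
  have hmap : MapsTo θ (Icc (1 - (δ : ℝ)) 1) (Icc 0 1) := fun t ht =>
    ⟨div_nonneg (by linarith [ht.1]) hδ.le, (div_le_one hδ).2 (by linarith [ht.2])⟩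
  -- On the last interval η is traversed at speed 1/δ, which cancels the factor δ before X_H and
  -- produces the factor 1/δ in β.
  have t2 : IsTrajectory (fun t x => hamiltonianField Ω
      ((H.addFamily (fun i => ofMul hβ (hf i) (hfK i)) s).extend t) x) (1 - δ) 1 (η ∘ θ) := by
    have hd : ∀ t : ℝ, HasDerivAt θ ((δ : ℝ)⁻¹) t := fun t => by
      simpa [hθ, div_eq_mul_inv] using (((hasDerivAt_id t).sub_const 1).add_const (δ : ℝ)).mul_const ((δ : ℝ)⁻¹)
    refine (hη.comp (θ := θ) (θ' := fun _ => (δ : ℝ)⁻¹) (fun t _ => (hd t).hasDerivWithinAt)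
      hmap).congr_field fun t ht x => ?_
    have ht' : t ∈ Icc (0 : ℝ) 1 := ⟨by linarith [ht.1], ht.2⟩
    have e1 : 1 - (δ : ℝ) + δ * θ t = t := by simp only [hθ]; field_simp; ring
    have e2 : ∀ (x : M), MDifferentiableAt 𝓘(ℝ, E) 𝓘(ℝ, ℝ) (fun x => ∑ i, s i * f i x) x := by
      intro x
      have : ContMDiff 𝓘(ℝ, E) 𝓘(ℝ, ℝ) ∞ (fun x => ∑ i, s i * f i x) :=
        contMDiff_finsetSum fun i _ => contMDiff_const.mul (hf i)
      exact this.mdifferentiable (by simp) x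
    have e3 : ((0 : Hamiltonian E K).addFamily (fun i => ofMul (β := fun _ => 1) contDiff_const
        (hf i) (hfK i)) s).extend (θ t) = fun x => ∑ i, s i * f i x := by
      rw [addFamily_ofMul_extend _ hf hfK 0 s (hmap ht)]
      funext x
      rw [zero_extend, zero_add, one_mul]
    rw [addFamily_ofMul_extend hβ hf hfK H s ht',
      hamiltonianField_add_mul _ (mdifferentiableAt_extend H ht' x) (e2 x), rescaledField, e1, e3,
      smul_add, smul_smul, smul_smul, inv_mul_cancel₀ hδ.ne', one_smul, hβδ]
  obtain ⟨α, hα0, hα1, hα⟩ := t1.trans t2 (by simp [hθ, h0]) (by linarith) (by linarith)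
  have h3 := flow_eq_of_trajectory hΩ hK _ hα
  rw [hα0, hα1] at h3
  rw [← h3]
  simp [hθ, hδ.ne']


/-- Perturbing only near the final time moves the end point q, in the rescaled limit δ = 0, exactly
along the Hamiltonian vectors of the perturbing functions at q. These can be made to span, and
surjectivity is open in δ. No formula for the derivative of the flow in H is needed. -/
lemma Hamiltonian.exists_isSpanningAt (hΩ : IsSymplecticForm Ω) (hK : IsCompact K)
    (H : Hamiltonian E K) {x₀ : M} (hx₀ : H.flow hΩ hK x₀ ∈ interior K) :
    ∃ (n : ℕ) (F : Fin n → Hamiltonian E K), IsSpanningAt hΩ hK H F x₀ := by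
  set q := H.flow hΩ hK x₀ with hq
  obtain ⟨γ, hγ0, hγ, hγ1⟩ := H.exists_trajectory_flow hΩ hK x₀
  rw [← hq] at hγ1
  set b := Module.finBasis ℝ (E →L[ℝ] ℝ) with hb
  set n := Module.finrank ℝ (E →L[ℝ] ℝ)
  -- The differentials of these functions at q form a basis of the cotangent space.
  choose f hf hfK hfd using fun i => exists_contMDiff_hasFDerivAt (K := K) hx₀ (b i)
  set G : Fin n → Hamiltonian E K := fun i => ofMul (β := fun _ => 1) contDiff_const (hf i) (hfK i)
    with hG
  set y₀ := extChartAt 𝓘(ℝ, E) q q with hy₀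
  have hX := isRegularField_rescaledField hΩ H G
  choose η hη0 hη using exists_trajectory_rescaledField hΩ hK H G
  set φ : Icc (0 : ℝ) 1 → M → (Fin n → ℝ) → M := fun δ x s => η δ x s 1 with hφ
  -- the time `1` map for `δ = 0`
  have hfv : ∀ v : Fin n → ℝ, ContMDiff 𝓘(ℝ, E) 𝓘(ℝ, ℝ) ∞ (fun x => ∑ i, v i * f i x) :=
    fun v => contMDiff_finsetSum fun i _ => contMDiff_const.mul (hf i)
  have hext : ∀ (v : Fin n → ℝ), ∀ t ∈ Icc (0 : ℝ) 1,
      ((0 : Hamiltonian E K).addFamily G v).extend t = fun x => ∑ i, v i * f i x := by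
    intro v t ht
    rw [hG, addFamily_ofMul_extend _ hf hfK 0 v ht]
    funext x
    rw [zero_extend, zero_add, one_mul]
  have hα : ∀ v : Fin n → ℝ, ∃ α : ℝ → M, α 0 = q ∧
      IsTrajectory (fun _ x => hamiltonianField Ω (fun x => ∑ i, v i * f i x) x) 0 1 α := by
    intro v
    obtain ⟨α, h0, h1⟩ := ((0 : Hamiltonian E K).addFamily G v).exists_trajectory hΩ hK q
    exact ⟨α, h0, h1.congr_field fun t ht x => by rw [hext v t ht]⟩
  -- At δ = 0 the field with parameter r v is r σ' times an autonomous field, so its trajectory is α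
  -- ∘ (r σ). Since σ(1) = 1 it ends at α r.
  have hzero : ∀ (v : Fin n → ℝ) (α : ℝ → M), α 0 = q →
      IsTrajectory (fun _ x => hamiltonianField Ω (fun x => ∑ i, v i * f i x) x) 0 1 α →
      ∀ r ∈ Icc (0 : ℝ) 1, φ 0 q (r • v) = α r := by
    intro v α hα0 hα r hr
    have h1 : IsTrajectory (rescaledField Ω H G 0 (r • v)) 0 1
        (α ∘ fun t => r * Real.smoothTransition t) := by
      refine (hα.comp (θ' := fun t => r * deriv Real.smoothTransition t) (fun t _ =>
        ((((Real.smoothTransition.contDiff (n := 1)).differentiable (by simp) t).hasDerivAt).const_mul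
          r).hasDerivWithinAt) (fun t _ => ⟨mul_nonneg hr.1 (Real.smoothTransition.nonneg t),
            mul_le_one₀ hr.2 (Real.smoothTransition.nonneg t)
              (Real.smoothTransition.le_one t)⟩)).congr_field fun t ht x => ?_
      have e1 : (fun x => ∑ i, (r • v) i * f i x) = fun x => (fun _ => (0 : ℝ)) x + r * ∑ i, v i * f i x := by
        funext x
        rw [zero_add, Finset.mul_sum]
        exact Finset.sum_congr rfl fun i _ => by simp [mul_assoc]
      rw [rescaledField, hext _ t ht, e1, hamiltonianField_add_mul r mdifferentiableAt_const
        ((hfv v).mdifferentiable (by simp) x), hamiltonianField_eq_zero (h := fun _ => (0 : ℝ)) mfderiv_const,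
        zero_add, smul_smul, mul_comm (deriv Real.smoothTransition t)]
      show (0 : ℝ) • _ + _ = _
      rw [zero_smul, zero_add]
    have h2 := hX.trajectory_unique (p := 0) (s := r • v)
      (fun x s => exists_trajectory_rescaledField hΩ hK H G 0 x s) (hη 0 q (r • v)) h1
      (by simp [hη0, hα0])
    simpa using h2
  obtain ⟨α0, hα00, hα0⟩ := hα 0
  have hφ0 : φ 0 q 0 = q := by
    have := hzero 0 α0 hα00 hα0 0 ⟨le_rfl, zero_le_one⟩
    rwa [smul_zero, hα00] at this
  have hM := hX.mjointC1At_flow (φ := φ) (fun δ x s => ⟨_, hη0 δ x s, hη δ x s, rfl⟩) 0 q 0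
  have hJ : JointC1At (chartFamily φ q q) 0 (y₀, 0) :=
    hM.jointC1At_charts (mem_extChartAt_source q) (by rw [hφ0]; exact mem_extChartAt_source q)
  set D := (fderiv ℝ (chartFamily φ q q 0) (y₀, 0)).comp
    (ContinuousLinearMap.inr ℝ E (Fin n → ℝ)) with hD
  have hD0 : HasFDerivAt (fun s => extChartAt 𝓘(ℝ, E) q (φ 0 q s)) D 0 :=
    hasFDerivAt_chartFamily_param (mem_extChartAt_source q) hJ.differentiableAt.self_of_nhds
  -- Along the ray r v the end point traces α, whose velocity at 0 is the Hamiltonian vector of ∑ vᵢ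
  -- fᵢ at q. One-sided derivatives at r = 0 suffice.
  have hDv : ∀ v, D v = (flatL E (Ω.inChart q y₀)).inverse (∑ i, v i • b i) := by
    intro v
    obtain ⟨α, hα0, hα⟩ := hα v
    have hc0 : (0 : ℝ) ∈ Icc (0 : ℝ) 1 := ⟨le_rfl, zero_le_one⟩
    have h1 : HasDerivWithinAt (fun r : ℝ => extChartAt 𝓘(ℝ, E) q (φ 0 q (r • v))) (D v)
        (Icc 0 1) 0 := by
      have hl : HasDerivAt (fun r : ℝ => r • v) v 0 := by
        simpa using (hasDerivAt_id (0 : ℝ)).smul_const v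
      have hD0' : HasFDerivAt (fun s => extChartAt 𝓘(ℝ, E) q (φ 0 q s)) D ((0 : ℝ) • v) := by
        rwa [zero_smul]
      exact (hD0'.comp_hasDerivAt (0 : ℝ) hl).hasDerivWithinAt
    have h2 := hα.hasDerivWithinAt hc0 (c := q) (by rw [hα0]; exact mem_extChartAt_source q)
    have h3 := h2.congr (f₁ := fun r : ℝ => extChartAt 𝓘(ℝ, E) q (φ 0 q (r • v)))
      (fun r hr => by rw [hzero v α hα0 hα r hr]) (by rw [hzero v α hα0 hα 0 hc0])
    rw [(uniqueDiffOn_Icc zero_lt_one 0 hc0).eq_deriv _ h1 h3, hα0,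
      ← hΩ.chartD_hamiltonianField q (mem_extChartAt_source q) ((hfv v).mdifferentiable (by simp) q)]
    congr 1
    exact (HasFDerivAt.fun_sum fun i _ => (hfd i).const_mul (v i)).fderiv
  have hDs : Function.Surjective D := by
    intro w
    refine ⟨b.repr (flatL E (Ω.inChart q y₀) w), ?_⟩
    rw [hDv, b.sum_repr]
    exact (hΩ.isInvertible_flatL_inChart q (mem_extChartAt_target q)).inverse_apply_self w
  -- transfer to small `δ > 0`
  have hc : ContinuousAt (fun p : Icc (0 : ℝ) 1 × E × (Fin n → ℝ) =>
      (fderiv ℝ (chartFamily φ q q p.1) p.2).comp (ContinuousLinearMap.inr ℝ E (Fin n → ℝ)))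
      (0, y₀, 0) := hJ.continuousAt_fderiv.clm_comp continuousAt_const
  have hev := (hc.eventually (eventually_surjective hDs)).and hJ.differentiableAt
  have hγc : Filter.Tendsto (fun r : ℝ => γ (1 - r)) (𝓝[>] 0) (𝓝 q) := by
    have h1 : ContinuousWithinAt γ (Icc 0 1) 1 := hγ.continuousOn 1 ⟨zero_le_one, le_rfl⟩
    rw [ContinuousWithinAt, hγ1] at h1
    refine h1.comp (tendsto_nhdsWithin_iff.2 ⟨?_, ?_⟩)
    · have : Continuous fun r : ℝ => 1 - r := by fun_prop
      simpa using (this.tendsto 0).mono_left nhdsWithin_le_nhds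
    · filter_upwards [Ioo_mem_nhdsGT (zero_lt_one (α := ℝ))] with r hr
      exact ⟨by linarith [hr.2], by linarith [hr.1]⟩
  have hδc : Filter.Tendsto (fun r : ℝ => projIcc (0 : ℝ) 1 zero_le_one r) (𝓝[>] 0)
      (𝓝 (0 : Icc (0 : ℝ) 1)) := by
    have h := (continuous_projIcc (a := (0 : ℝ)) (b := 1) (h := zero_le_one)).tendsto 0
    rw [projIcc_left] at h
    exact h.mono_left nhdsWithin_le_nhds
  have hyc : Filter.Tendsto (fun r : ℝ => extChartAt 𝓘(ℝ, E) q (γ (1 - r))) (𝓝[>] 0) (𝓝 y₀) :=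
    (continuousAt_extChartAt (I := 𝓘(ℝ, E)) q).tendsto.comp hγc
  -- For δ = r the last interval is entered at γ (1 - r) instead of q, so the parameter and the
  -- initial point must approach (0, q) together.
  obtain ⟨r, ⟨hr1, hr2⟩, hr3, hr4⟩ := (((hδc.prodMk_nhds (hyc.prodMk_nhds
    (tendsto_const_nhds (x := (0 : Fin n → ℝ))))).eventually hev).and ((hγc.eventually_mem
      ((isOpen_extChartAt_source (I := 𝓘(ℝ, E)) q).mem_nhds (mem_extChartAt_source q))).and
        (Ioo_mem_nhdsGT (zero_lt_one (α := ℝ))))).exists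
  have hrI : r ∈ Icc (0 : ℝ) 1 := ⟨hr4.1.le, hr4.2.le⟩
  simp only [projIcc_of_mem zero_le_one hrI] at hr1 hr2
  set δ : Icc (0 : ℝ) 1 := ⟨r, hrI⟩ with hδ
  have hβ : ContDiff ℝ ∞ (fun t : ℝ => (δ : ℝ)⁻¹ * deriv Real.smoothTransition ((t - 1 + δ) / δ)) := by
    have h1 : ContDiff ℝ ∞ (deriv Real.smoothTransition) :=
      (contDiff_infty_iff_deriv.1 Real.smoothTransition.contDiff).2
    exact contDiff_const.mul (h1.comp (by fun_prop))
  refine ⟨n, fun i => ofMul hβ (hf i) (hfK i), fun c hcs => ?_⟩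
  have hflow : ∀ s, (H.addFamily (fun i => ofMul hβ (hf i) (hfK i)) s).flow hΩ hK x₀ =
      φ δ (γ (1 - δ)) s := by
    intro s
    rw [← hγ0]
    exact flow_addFamily_ofMul hΩ hK H hf hfK hr4.1 s hβ rfl hγ (hη δ _ s) (hη0 δ _ s)
  have h0 : (H.addFamily (fun i => ofMul hβ (hf i) (hfK i)) 0).flow hΩ hK x₀ = q := by
    rw [addFamily_zero]
  have hder : HasFDerivAt (fun s => extChartAt 𝓘(ℝ, E) q
      ((H.addFamily (fun i => ofMul hβ (hf i) (hfK i)) s).flow hΩ hK x₀))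
      ((fderiv ℝ (chartFamily φ q q δ) (extChartAt 𝓘(ℝ, E) q (γ (1 - r)), 0)).comp
        (ContinuousLinearMap.inr ℝ E (Fin n → ℝ))) 0 := by
    simp only [hflow]
    exact hasFDerivAt_chartFamily_param hr3 hr2
  have hcont : ContinuousAt (fun s => (H.addFamily (fun i => ofMul hβ (hf i) (hfK i)) s).flow hΩ hK x₀)
      0 := ContinuousAt.comp (f := fun s : Fin n → ℝ => (H, x₀, s))
        (g := fun p : Hamiltonian E K × M × (Fin n → ℝ) => (p.1.addFamily
          (fun i => ofMul hβ (hf i) (hfK i)) p.2.2).flow hΩ hK p.2.1)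
        (mjointC1At_flow hΩ hK (fun i => ofMul hβ (hf i) (hfK i)) H x₀ 0).continuousAt (by fun_prop)
  refine surjective_fderiv_chart_change hcont (c := q) ?_ ?_ hder.differentiableAt ?_
  · rw [h0]; exact mem_extChartAt_source q
  · rw [h0]; exact hcs
  · rw [hder.fderiv]; exact hr1

end

namespace Hamiltonian

variable {E : Type*} [NormedAddCommGroup E] [NormedSpace ℝ E] [FiniteDimensional ℝ E]
  {M : Type*} [TopologicalSpace M] [T2Space M] [ChartedSpace E M] [IsManifold 𝓘(ℝ, E) ∞ M]
  {K : Set M} {Ω : TwoForm 𝓘(ℝ, E) M} {ι : Type*} [Fintype ι]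

lemma continuous_flow (hΩ : IsSymplecticForm Ω) (hK : IsCompact K) (F : ι → Hamiltonian E K) :
    Continuous fun p : Hamiltonian E K × M × (ι → ℝ) => (p.1.addFamily F p.2.2).flow hΩ hK p.2.1 :=
  continuous_iff_continuousAt.2 fun p => (mjointC1At_flow hΩ hK F p.1 p.2.1 p.2.2).continuousAt

lemma differentiableAt_flow_param (hΩ : IsSymplecticForm Ω) (hK : IsCompact K)
    (F : ι → Hamiltonian E K) (H : Hamiltonian E K) (x : M) (s : ι → ℝ) {c : M}
    (hc : (H.addFamily F s).flow hΩ hK x ∈ (extChartAt 𝓘(ℝ, E) c).source) :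
    DifferentiableAt ℝ (fun s => extChartAt 𝓘(ℝ, E) c ((H.addFamily F s).flow hΩ hK x)) s :=
  (hasFDerivAt_chartFamily_param (Φ := fun (H : Hamiltonian E K) x s => (H.addFamily F s).flow hΩ hK x)
    (mem_extChartAt_source x) (((mjointC1At_flow hΩ hK F H x s).jointC1At_charts
      (mem_extChartAt_source x) hc).differentiableAt.self_of_nhds)).differentiableAt

lemma isSpanningAt_of_surjective {hΩ : IsSymplecticForm Ω} {hK : IsCompact K} {H : Hamiltonian E K}
    {F : ι → Hamiltonian E K} {x c : M}
    (hc : H.flow hΩ hK x ∈ (extChartAt 𝓘(ℝ, E) c).source)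
    (hs : Function.Surjective (fderiv ℝ (fun s : ι → ℝ =>
      extChartAt 𝓘(ℝ, E) c ((H.addFamily F s).flow hΩ hK x)) 0)) : IsSpanningAt hΩ hK H F x := by
  intro c' hc'
  rw [← H.addFamily_zero F] at hc hc'
  refine surjective_fderiv_chart_change ?_ hc hc' (differentiableAt_flow_param hΩ hK F H x 0 hc) hs
  exact ((continuous_flow hΩ hK F).comp (f := fun s : ι → ℝ => (H, x, s)) (by fun_prop)).continuousAt

/-- The derivative in the linear parameter is continuous in the initial point, and surjectivity is
open. -/
lemma IsSpanningAt.eventually {hΩ : IsSymplecticForm Ω} {hK : IsCompact K} {H : Hamiltonian E K}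
    {F : ι → Hamiltonian E K} {x₀ : M} (h : IsSpanningAt hΩ hK H F x₀) :
    ∀ᶠ x in 𝓝 x₀, IsSpanningAt hΩ hK H F x := by
  set Φ : Hamiltonian E K → M → (ι → ℝ) → M := fun H x s => (H.addFamily F s).flow hΩ hK x with hΦ
  set q := H.flow hΩ hK x₀ with hq
  have hΦ0 : ∀ x, Φ H x 0 = H.flow hΩ hK x := fun x => by simp only [hΦ, addFamily_zero]
  have hJ : JointC1At (chartFamily Φ x₀ q) H (extChartAt 𝓘(ℝ, E) x₀ x₀, 0) :=
    (mjointC1At_flow hΩ hK F H x₀ 0).jointC1At_charts (mem_extChartAt_source _)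
      (by rw [addFamily_zero]; exact mem_extChartAt_source q)
  have hs := h q (mem_extChartAt_source q)
  rw [(hasFDerivAt_chartFamily_param (mem_extChartAt_source x₀)
    hJ.differentiableAt.self_of_nhds).fderiv] at hs
  have hc : ContinuousAt (fun p : Hamiltonian E K × E × (ι → ℝ) =>
      (fderiv ℝ (chartFamily Φ x₀ q p.1) p.2).comp (ContinuousLinearMap.inr ℝ E (ι → ℝ)))
      (H, extChartAt 𝓘(ℝ, E) x₀ x₀, 0) := hJ.continuousAt_fderiv.clm_comp continuousAt_const
  have hev := (hc.eventually (eventually_surjective hs)).and hJ.differentiableAt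
  have hx : ContinuousAt (fun x => (H, extChartAt 𝓘(ℝ, E) x₀ x, (0 : ι → ℝ))) x₀ :=
    continuousAt_const.prodMk ((continuousAt_extChartAt x₀).prodMk continuousAt_const)
  have hfl : ContinuousAt (fun x => H.flow hΩ hK x) x₀ := by
    have := ((continuous_flow hΩ hK F).comp (f := fun x : M => (H, x, (0 : ι → ℝ)))
      (by fun_prop)).continuousAt (x := x₀)
    simpa only [Function.comp_def, addFamily_zero] using this
  filter_upwards [hx.eventually hev, (isOpen_extChartAt_source (I := 𝓘(ℝ, E)) x₀).mem_nhds
    (mem_extChartAt_source x₀), hfl.eventually_mem ((isOpen_extChartAt_source (I := 𝓘(ℝ, E)) q).mem_nhds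
      (mem_extChartAt_source q))] with x ⟨hx1, hx2⟩ hxs hxq
  refine isSpanningAt_of_surjective hxq ?_
  rw [(hasFDerivAt_chartFamily_param (Φ := Φ) hxs hx2).fderiv]
  exact hx1

/-- By the chain rule the variation along F factors through that along F'. In particular, enlarging
a family preserves spanning. -/
lemma IsSpanningAt.of_comp {hΩ : IsSymplecticForm Ω} {hK : IsCompact K} {H : Hamiltonian E K}
    {κ : Type*} [Fintype κ] {F : ι → Hamiltonian E K} {F' : κ → Hamiltonian E K}
    (L : (ι → ℝ) →L[ℝ] (κ → ℝ)) (hL : ∀ s, H.addFamily F' (L s) = H.addFamily F s) {x : M}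
    (h : IsSpanningAt hΩ hK H F x) : IsSpanningAt hΩ hK H F' x := by
  intro c hc
  have hd : DifferentiableAt ℝ (fun s => extChartAt 𝓘(ℝ, E) c ((H.addFamily F' s).flow hΩ hK x)) (L 0) := by
    rw [map_zero]
    exact differentiableAt_flow_param hΩ hK F' H x 0 (by rwa [addFamily_zero])
  have h1 := hd.hasFDerivAt.comp (0 : ι → ℝ) L.hasFDerivAt
  simp only [Function.comp_def, hL] at h1
  have h2 := h c hc
  rw [h1.fderiv, map_zero] at h2
  exact Function.Surjective.of_comp (g := L) h2

/-- Finitely many local families cover the compact set, and their disjoint union serves every point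
of it. -/
lemma exists_isSpanningAt_of_isCompact (hΩ : IsSymplecticForm Ω) (hK : IsCompact K)
    (H : Hamiltonian E K) {C : Set M} (hC : IsCompact C)
    (hCK : ∀ x ∈ C, H.flow hΩ hK x ∈ interior K) :
    ∃ (ι : Type) (_ : Fintype ι) (F : ι → Hamiltonian E K), ∀ x ∈ C, IsSpanningAt hΩ hK H F x := by
  refine hC.induction_on (p := fun A => ∃ (ι : Type) (_ : Fintype ι) (F : ι → Hamiltonian E K),
    ∀ x ∈ A, IsSpanningAt hΩ hK H F x) ?_ ?_ ?_ ?_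
  · exact ⟨Empty, inferInstance, fun i => i.elim, fun x hx => absurd hx (notMem_empty x)⟩
  · rintro A B hAB ⟨ι, _, F, h⟩
    exact ⟨ι, inferInstance, F, fun x hx => h x (hAB hx)⟩
  · rintro A B ⟨ι, _, F, h⟩ ⟨κ, _, G, h'⟩
    refine ⟨ι ⊕ κ, inferInstance, Sum.elim F G, ?_⟩
    rintro x (hx | hx)
    · refine (h x hx).of_comp (ContinuousLinearMap.pi (Sum.elim (fun i => ContinuousLinearMap.proj i)
        fun _ => 0)) fun s => ext_toFun ?_
      funext t y
      simp [addFamily]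
    · refine (h' x hx).of_comp (ContinuousLinearMap.pi (Sum.elim (fun _ => 0)
        fun i => ContinuousLinearMap.proj i)) fun s => ext_toFun ?_
      funext t y
      simp [addFamily]
  · intro x hx
    obtain ⟨n, F, hF⟩ := H.exists_isSpanningAt hΩ hK (hCK x hx)
    exact ⟨{y | IsSpanningAt hΩ hK H F y}, mem_nhdsWithin_of_mem_nhds hF.eventually, Fin n,
      inferInstance, F, fun y hy => hy⟩

end Hamiltonian

/-! ### Local defining maps and tangent spaces -/

/-- After composing g with a linear functional, x is a constrained local extremum on the fibre of f,
so Lagrange multipliers apply. -/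
lemma fderiv_apply_eq_zero_of_eventually {V F G : Type*} [NormedAddCommGroup V] [NormedSpace ℝ V]
    [CompleteSpace V] [NormedAddCommGroup F] [NormedSpace ℝ F] [CompleteSpace F]
    [NormedAddCommGroup G] [NormedSpace ℝ G] {f : V → F} {g : V → G} {f' : V →L[ℝ] F}
    {g' : V →L[ℝ] G} {x : V} (hf : HasStrictFDerivAt f f' x) (hs : Function.Surjective f')
    (hg : HasStrictFDerivAt g g' x) (h : ∀ᶠ y in 𝓝 x, f y = f x → g y = g x) {v : V}
    (hv : f' v = 0) : g' v = 0 := by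
  refine SeparatingDual.eq_zero_of_forall_dual_eq_zero (R := ℝ) fun ℓ => ?_
  have hext : IsLocalExtrOn (fun y => ℓ (g y)) {y | f y = f x} x := by
    refine Or.inl ?_
    have h1 : ∀ᶠ y in 𝓝[{y | f y = f x}] x, ℓ (g x) ≤ ℓ (g y) := by
      filter_upwards [mem_nhdsWithin_of_mem_nhds h, self_mem_nhdsWithin] with y hy hyf
      rw [hy hyf]
    exact h1
  obtain ⟨Λ, Λ₀, h0, hΛ⟩ := hext.exists_linear_map_of_hasStrictFDerivAt hf
    (ℓ.hasStrictFDerivAt.comp x hg)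
  -- Otherwise the multiplier Λ would vanish on the range of f', which is everything, and the pair
  -- of multipliers would be zero.
  have hΛ₀ : Λ₀ ≠ 0 := by
    rintro rfl
    refine h0 (Prod.ext (LinearMap.ext fun w => ?_) rfl)
    obtain ⟨u, rfl⟩ := hs w
    simpa using hΛ u
  have := hΛ v
  rw [hv, map_zero, zero_add, smul_eq_mul] at this
  exact (mul_eq_zero.1 this).resolve_left hΛ₀

section DefiningMaps

variable {E : Type*} [NormedAddCommGroup E] [NormedSpace ℝ E]
  {H : Type*} [TopologicalSpace H] {I : ModelWithCorners ℝ E H} [I.Boundaryless]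
  {M : Type*} [TopologicalSpace M] [ChartedSpace H M]

lemma mfderiv_eq_fderiv_chart {G : Type*} [NormedAddCommGroup G] [NormedSpace ℝ G] {g : M → G}
    {x : M} (hg : MDifferentiableAt I 𝓘(ℝ, G) g x) :
    (mfderiv I 𝓘(ℝ, G) g x : E →L[ℝ] G) =
      fderiv ℝ (fun y => g ((extChartAt I x).symm y)) (extChartAt I x x) := by
  refine hg.mfderiv.trans ?_
  show fderivWithin ℝ (fun y => g ((extChartAt I x).symm y)) (range I) (extChartAt I x x) = _
  rw [I.range_eq_univ, fderivWithin_univ]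

variable [IsManifold I ∞ M]

lemma contDiffAt_chart {G : Type*} [NormedAddCommGroup G] [NormedSpace ℝ G] {g : M → G}
    {x : M} {n : WithTop ℕ∞} (hn : n ≤ ∞) (hg : ContMDiffAt I 𝓘(ℝ, G) n g x) :
    ContDiffAt ℝ n (fun y => g ((extChartAt I x).symm y)) (extChartAt I x x) := by
  have : IsManifold I n M := IsManifold.of_le hn
  have h := (contMDiffAt_iff_of_mem_source (mem_chart_source H x) (mem_chart_source G (g x))).1 hg
  have h2 := h.2
  rw [I.range_eq_univ, contDiffWithinAt_univ] at h2
  exact h2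

lemma IsLocalDefiningMap.exists_chart {L : Set M} {x : M} {k : ℕ} {ψ : M → (Fin k → ℝ)}
    (h : IsLocalDefiningMap I L x ψ) : ∃ W : Set E, IsOpen W ∧ extChartAt I x x ∈ W ∧
      W ⊆ (extChartAt I x).target ∧ ContDiffOn ℝ ∞ (fun y => ψ ((extChartAt I x).symm y)) W ∧
      (∀ y ∈ W, Function.Surjective (fderiv ℝ (fun y => ψ ((extChartAt I x).symm y)) y)) ∧
      ∀ y ∈ W, (extChartAt I x).symm y ∈ L ↔ ψ ((extChartAt I x).symm y) = 0 := by
  have : IsManifold I 1 M := IsManifold.of_le (n := ∞) (by simp)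
  obtain ⟨U, hU, hxU, hψ, hs, hL⟩ := h
  refine ⟨(extChartAt I x).target ∩ (extChartAt I x).symm ⁻¹' U,
    (continuousOn_extChartAt_symm x).isOpen_inter_preimage (isOpen_extChartAt_target x) hU,
    ⟨mem_extChartAt_target x, by simpa using hxU⟩, inter_subset_left, ?_, ?_, fun y hy => hL _ hy.2⟩
  · rw [← contMDiffOn_iff_contDiffOn]
    exact hψ.comp ((contMDiffOn_extChartAt_symm x).mono inter_subset_left) fun y hy => hy.2
  · rintro y ⟨hy, hyU⟩
    have h1 := ((hψ.contMDiffAt (hU.mem_nhds hyU)).mdifferentiableAt (by simp)).hasMFDerivAt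
    have h2 := h1.comp y (hasMFDerivAt_extChartAt_symm hy)
    have h3 := HasMFDerivAt.fderiv_eq (E := E) (F := Fin k → ℝ) h2
    intro w
    obtain ⟨v, hv⟩ := hs _ hyU w
    have hsrc := (extChartAt I x).map_target hy
    refine ⟨mfderiv I 𝓘(ℝ, E) (extChartAt I x) ((extChartAt I x).symm y) v, ?_⟩
    have h4 := mfderiv_symm_mfderiv_extChartAt hsrc v
    rw [(extChartAt I x).right_inv hy] at h4
    refine (congrArg (fun L : E →L[ℝ] (Fin k → ℝ) => L _) h3).trans ?_
    exact (congrArg (mfderiv I 𝓘(ℝ, Fin k → ℝ) ψ ((extChartAt I x).symm y)) h4).trans hv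

lemma IsLocalDefiningMap.of_chart {L : Set M} {x : M} {k : ℕ} {u : E → (Fin k → ℝ)} {W : Set E}
    (hW : IsOpen W) (hx : extChartAt I x x ∈ W) (hu : ContDiffOn ℝ ∞ u W)
    (hs : ∀ y ∈ W, Function.Surjective (fderiv ℝ u y))
    (hL : ∀ y ∈ W, y ∈ (extChartAt I x).target → ((extChartAt I x).symm y ∈ L ↔ u y = 0)) :
    IsLocalDefiningMap I L x (fun z => u (extChartAt I x z)) := by
  have : IsManifold I 1 M := IsManifold.of_le (n := ∞) (by simp)
  refine ⟨(extChartAt I x).source ∩ extChartAt I x ⁻¹' W,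
    (continuousOn_extChartAt x).isOpen_inter_preimage (isOpen_extChartAt_source x) hW,
    ⟨mem_extChartAt_source x, hx⟩, ?_, ?_, ?_⟩
  · exact (contMDiffOn_iff_contDiffOn.2 hu).comp ((contMDiffOn_extChartAt (x := x)).mono
      (fun z hz => by simpa only [extChartAt_source] using hz.1)) fun z hz => hz.2
  · rintro z ⟨hz, hzW⟩ w
    obtain ⟨v, hv⟩ := hs _ hzW w
    have h1 : HasMFDerivAt 𝓘(ℝ, E) 𝓘(ℝ, Fin k → ℝ) u (extChartAt I x z)
        (fderiv ℝ u (extChartAt I x z)) :=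
      hasMFDerivAt_iff_hasFDerivAt.2
        ((hu.contDiffAt (hW.mem_nhds hzW)).differentiableAt (by simp)).hasFDerivAt
    have h2 := (h1.comp z (hasMFDerivAt_extChartAt_of_mem hz)).mfderiv
    refine ⟨mfderiv 𝓘(ℝ, E) I (extChartAt I x).symm (extChartAt I x z) v, ?_⟩
    refine (congrArg (fun L : E →L[ℝ] (Fin k → ℝ) =>
      L (mfderiv 𝓘(ℝ, E) I (extChartAt I x).symm (extChartAt I x z) v)) h2).trans ?_
    exact (congrArg (fderiv ℝ u (extChartAt I x z)) (mfderiv_mfderiv_extChartAt_symm hz v)).trans hv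
  · rintro z ⟨hz, hzW⟩
    have := hL _ hzW ((extChartAt I x).map_source hz)
    rwa [(extChartAt I x).left_inv hz] at this

omit [I.Boundaryless] [IsManifold I ∞ M] in
lemma IsLocalDefiningMap.contMDiffAt {L : Set M} {x : M} {k : ℕ} {ψ : M → (Fin k → ℝ)}
    (h : IsLocalDefiningMap I L x ψ) : ContMDiffAt I 𝓘(ℝ, Fin k → ℝ) ∞ ψ x := by
  obtain ⟨U, hU, hxU, hψ, -, -⟩ := h
  exact hψ.contMDiffAt (hU.mem_nhds hxU)

/-- The kernel of one defining map is killed by every smooth map that vanishes on L near x. This is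
how tangency, defined through some defining map, is tested against the chosen one. -/
lemma IsLocalDefiningMap.mfderiv_apply_eq_zero [CompleteSpace E] {L : Set M} {x : M} {k : ℕ}
    {ψ : M → (Fin k → ℝ)} (h : IsLocalDefiningMap I L x ψ) {G : Type*} [NormedAddCommGroup G]
    [NormedSpace ℝ G] {g : M → G} (hg : ContMDiffAt I 𝓘(ℝ, G) ∞ g x) (hx : x ∈ L)
    (hgL : ∀ᶠ y in 𝓝 x, y ∈ L → g y = 0) {v : TangentSpace I x}
    (hv : mfderiv I 𝓘(ℝ, Fin k → ℝ) ψ x v = 0) : mfderiv I 𝓘(ℝ, G) g x v = 0 := by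
  obtain ⟨W, hW, hxW, hWt, hu, hs, hL⟩ := h.exists_chart
  have e1 := mfderiv_eq_fderiv_chart (h.contMDiffAt.mdifferentiableAt (by simp))
  have e2 := mfderiv_eq_fderiv_chart (hg.mdifferentiableAt (by simp))
  have h1 : HasStrictFDerivAt (fun y => ψ ((extChartAt I x).symm y)) _ (extChartAt I x x) :=
    (hu.contDiffAt (hW.mem_nhds hxW)).hasStrictFDerivAt (by simp)
  have h2 : HasStrictFDerivAt (fun y => g ((extChartAt I x).symm y)) _ (extChartAt I x x) :=
    (contDiffAt_chart le_rfl hg).hasStrictFDerivAt (by simp)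
  have hv' : fderiv ℝ (fun y => ψ ((extChartAt I x).symm y)) (extChartAt I x x) v = 0 :=
    (congrArg (fun L : E →L[ℝ] (Fin k → ℝ) => L v) e1).symm.trans hv
  refine (congrArg (fun L : E →L[ℝ] G => L v) e2).trans
    (fderiv_apply_eq_zero_of_eventually h1 (hs _ hxW) h2 ?_ hv')
  have h3 := (continuousAt_extChartAt_symm (I := I) x).eventually
    (p := fun y => y ∈ L → g y = 0) (by rwa [extChartAt_to_inv])
  filter_upwards [h3, hW.mem_nhds hxW] with y hy hyW hyx
  have hx0 : ψ x = 0 := by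
    have := (hL _ hxW).1 (by rwa [extChartAt_to_inv])
    rwa [extChartAt_to_inv] at this
  have hgx : g x = 0 := hgL.self_of_nhds hx
  simp only [extChartAt_to_inv] at hyx ⊢
  rw [hgx]
  exact hy ((hL y hyW).2 (hyx.trans hx0))

lemma IsTangentTo.mfderiv_eq_zero [CompleteSpace E] {L : Set M} {x : M} {G : Type*}
    [NormedAddCommGroup G] [NormedSpace ℝ G] {g : M → G} {v : TangentSpace I x}
    (h : IsTangentTo I L x v) (hg : ContMDiffAt I 𝓘(ℝ, G) ∞ g x) (hx : x ∈ L)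
    (hgL : ∀ᶠ y in 𝓝 x, y ∈ L → g y = 0) : mfderiv I 𝓘(ℝ, G) g x v = 0 := by
  obtain ⟨k, ψ, hψ, hv⟩ := h
  exact hψ.mfderiv_apply_eq_zero hg hx hgL hv

omit [I.Boundaryless] [IsManifold I ∞ M] in
lemma IsLocalDefiningMap.eventually {L : Set M} {x : M} {k : ℕ} {ψ : M → (Fin k → ℝ)}
    (h : IsLocalDefiningMap I L x ψ) : ∀ᶠ y in 𝓝 x, IsLocalDefiningMap I L y ψ := by
  obtain ⟨U, hU, hxU, h1⟩ := h
  filter_upwards [hU.mem_nhds hxU] with y hy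
  exact ⟨U, hU, hy, h1⟩

omit [I.Boundaryless] [IsManifold I ∞ M] in
lemma IsLocalDefiningMap.eventually_eq_zero {L : Set M} {x : M} {k : ℕ} {ψ : M → (Fin k → ℝ)}
    (h : IsLocalDefiningMap I L x ψ) : ∀ᶠ y in 𝓝 x, (y ∈ L ↔ ψ y = 0) := by
  obtain ⟨U, hU, hxU, -, -, h1⟩ := h
  filter_upwards [hU.mem_nhds hxU] with y hy using h1 y hy

end DefiningMaps

/-! ### Linear algebra of composable Lagrangian correspondences -/

section Composition

variable {E₀ E₁ E₂ : Type*}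
  [NormedAddCommGroup E₀] [NormedSpace ℝ E₀] [NormedAddCommGroup E₁] [NormedSpace ℝ E₁]
  [NormedAddCommGroup E₂] [NormedSpace ℝ E₂]
  {M₀ M₁ M₂ : Type*}
  [TopologicalSpace M₀] [ChartedSpace E₀ M₀] [TopologicalSpace M₁] [ChartedSpace E₁ M₁]
  [TopologicalSpace M₂] [ChartedSpace E₂ M₂]

lemma correspondenceForm_apply (ω₀ : TwoForm 𝓘(ℝ, E₀) M₀) (ω₁ : TwoForm 𝓘(ℝ, E₁) M₁)
    (p : M₀ × M₁) (u v : E₀ × E₁) :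
    correspondenceForm ω₀ ω₁ p ![u, v] =
      (ω₁ p.2 : E₁ [⋀^Fin 2]→L[ℝ] ℝ) ![u.2, v.2] - (ω₀ p.1 : E₀ [⋀^Fin 2]→L[ℝ] ℝ) ![u.1, v.1] := by
  have h1 : ∀ w : E₀ × E₁, mfderiv (𝓘(ℝ, E₀).prod 𝓘(ℝ, E₁)) 𝓘(ℝ, E₁)
      (Prod.snd : M₀ × M₁ → M₁) p w = w.2 := fun w =>
    congrArg (fun L : E₀ × E₁ →L[ℝ] E₁ => L w) (mfderiv_snd (x := p))
  have h2 : ∀ w : E₀ × E₁, mfderiv (𝓘(ℝ, E₀).prod 𝓘(ℝ, E₁)) 𝓘(ℝ, E₀)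
      (Prod.fst : M₀ × M₁ → M₀) p w = w.1 := fun w =>
    congrArg (fun L : E₀ × E₁ →L[ℝ] E₀ => L w) (mfderiv_fst (x := p))
  refine congrArg₂ (· - ·) (congrArg (ω₁ p.2) ?_) (congrArg (ω₀ p.1) ?_)
  · ext i
    fin_cases i
    · exact h1 u
    · exact h1 v
  · ext i
    fin_cases i
    · exact h2 u
    · exact h2 v

variable [FiniteDimensional ℝ E₀] [FiniteDimensional ℝ E₁] [FiniteDimensional ℝ E₂]
  [IsManifold 𝓘(ℝ, E₀) ∞ M₀] [IsManifold 𝓘(ℝ, E₁) ∞ M₁] [IsManifold 𝓘(ℝ, E₂) ∞ M₂]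
  {L₀₁ : Set (M₀ × M₁)} {L₁₂ : Set (M₁ × M₂)} {p₀ : M₀} {m₁ : M₁} {m₂ : M₂}
  {b c : ℕ} {ψ₀₁ : M₀ × M₁ → (Fin b → ℝ)} {ψ₁₂ : M₁ × M₂ → (Fin c → ℝ)}
  {A : E₀ × E₁ →L[ℝ] (Fin b → ℝ)} {B : E₁ × E₂ →L[ℝ] (Fin c → ℝ)}

/-- This rewrites transversality in the model spaces: tangent vectors of the product are killed by A
and B, and those of the diagonal have equal middle components. -/
lemma SubmanifoldsTransverse.exists_decomposition
    (hT : SubmanifoldsTransverse ((𝓘(ℝ, E₀).prod 𝓘(ℝ, E₁)).prod (𝓘(ℝ, E₁).prod 𝓘(ℝ, E₂)))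
      (L₀₁ ×ˢ L₁₂) {p : (M₀ × M₁) × (M₁ × M₂) | p.1.2 = p.2.1})
    (h₀₁ : (p₀, m₁) ∈ L₀₁) (h₁₂ : (m₁, m₂) ∈ L₁₂)
    (hψ₀₁ : IsLocalDefiningMap (𝓘(ℝ, E₀).prod 𝓘(ℝ, E₁)) L₀₁ (p₀, m₁) ψ₀₁)
    (hψ₁₂ : IsLocalDefiningMap (𝓘(ℝ, E₁).prod 𝓘(ℝ, E₂)) L₁₂ (m₁, m₂) ψ₁₂)
    (hA : HasMFDerivAt (𝓘(ℝ, E₀).prod 𝓘(ℝ, E₁)) 𝓘(ℝ, Fin b → ℝ) ψ₀₁ (p₀, m₁) A)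
    (hB : HasMFDerivAt (𝓘(ℝ, E₁).prod 𝓘(ℝ, E₂)) 𝓘(ℝ, Fin c → ℝ) ψ₁₂ (m₁, m₂) B)
    (w : (E₀ × E₁) × (E₁ × E₂)) :
    ∃ (u : (E₀ × E₁) × (E₁ × E₂)) (v₀ : E₀) (v₁ : E₁) (v₂ : E₂), A u.1 = 0 ∧ B u.2 = 0 ∧
      u.1 + (v₀, v₁) = w.1 ∧ u.2 + (v₁, v₂) = w.2 := by
  have : CompleteSpace E₀ := FiniteDimensional.complete ℝ E₀
  have : CompleteSpace E₁ := FiniteDimensional.complete ℝ E₁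
  have : CompleteSpace E₂ := FiniteDimensional.complete ℝ E₂
  have : IsManifold 𝓘(ℝ, E₁) 1 M₁ := IsManifold.of_le (n := ∞) (by simp)
  set P : (M₀ × M₁) × (M₁ × M₂) := ((p₀, m₁), (m₁, m₂)) with hP
  have hPA : P ∈ L₀₁ ×ˢ L₁₂ := ⟨h₀₁, h₁₂⟩
  obtain ⟨u, v, hu, hv, huv⟩ := hT P ⟨hPA, rfl⟩ w
  have k1 : A (u : (E₀ × E₁) × (E₁ × E₂)).1 = 0 := by
    have h1 : HasMFDerivAt ((𝓘(ℝ, E₀).prod 𝓘(ℝ, E₁)).prod (𝓘(ℝ, E₁).prod 𝓘(ℝ, E₂)))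
        𝓘(ℝ, Fin b → ℝ) (ψ₀₁ ∘ (Prod.fst : (M₀ × M₁) × (M₁ × M₂) → M₀ × M₁)) P
        (A.comp (ContinuousLinearMap.fst ℝ (E₀ × E₁) (E₁ × E₂))) :=
      HasMFDerivAt.comp P hA (hasMFDerivAt_fst _)
    have h2 := hu.mfderiv_eq_zero (hψ₀₁.contMDiffAt.comp P contMDiffAt_fst) hPA (by
      have := (continuous_fst (X := M₀ × M₁) (Y := M₁ × M₂)).continuousAt (x := P) |>.eventually
        hψ₀₁.eventually_eq_zero
      filter_upwards [this] with y hy hyL using hy.1 hyL.1)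
    rw [h1.mfderiv] at h2
    exact h2
  have k2 : B (u : (E₀ × E₁) × (E₁ × E₂)).2 = 0 := by
    have h1 : HasMFDerivAt ((𝓘(ℝ, E₀).prod 𝓘(ℝ, E₁)).prod (𝓘(ℝ, E₁).prod 𝓘(ℝ, E₂)))
        𝓘(ℝ, Fin c → ℝ) (ψ₁₂ ∘ (Prod.snd : (M₀ × M₁) × (M₁ × M₂) → M₁ × M₂)) P
        (B.comp (ContinuousLinearMap.snd ℝ (E₀ × E₁) (E₁ × E₂))) :=
      HasMFDerivAt.comp P hB (hasMFDerivAt_snd _)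
    have h2 := hu.mfderiv_eq_zero (hψ₁₂.contMDiffAt.comp P contMDiffAt_snd) hPA (by
      have := (continuous_snd (X := M₀ × M₁) (Y := M₁ × M₂)).continuousAt (x := P) |>.eventually
        hψ₁₂.eventually_eq_zero
      filter_upwards [this] with y hy hyL using hy.1 hyL.2)
    rw [h1.mfderiv] at h2
    exact h2
  -- The difference of the chart coordinates of the two middle points vanishes on the diagonal, and
  -- the chart has injective derivative.
  have k3 : (v : (E₀ × E₁) × (E₁ × E₂)).1.2 = (v : (E₀ × E₁) × (E₁ × E₂)).2.1 := by
    obtain ⟨χ, hχ⟩ : ∃ χ : E₁ →L[ℝ] E₁,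
        HasMFDerivAt 𝓘(ℝ, E₁) 𝓘(ℝ, E₁) (extChartAt 𝓘(ℝ, E₁) m₁) m₁ χ :=
      ⟨_, hasMFDerivAt_extChartAt_of_mem (mem_extChartAt_source m₁)⟩
    have hχi : Function.Injective χ := by
      have e : χ = mfderiv 𝓘(ℝ, E₁) 𝓘(ℝ, E₁) (extChartAt 𝓘(ℝ, E₁) m₁) m₁ := hχ.mfderiv.symm
      refine Function.LeftInverse.injective (g := mfderiv 𝓘(ℝ, E₁) 𝓘(ℝ, E₁)
        (extChartAt 𝓘(ℝ, E₁) m₁).symm (extChartAt 𝓘(ℝ, E₁) m₁ m₁)) fun z => ?_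
      rw [e]
      exact mfderiv_symm_mfderiv_extChartAt (mem_extChartAt_source m₁) z
    have h1 : HasMFDerivAt ((𝓘(ℝ, E₀).prod 𝓘(ℝ, E₁)).prod (𝓘(ℝ, E₁).prod 𝓘(ℝ, E₂))) 𝓘(ℝ, E₁)
        (extChartAt 𝓘(ℝ, E₁) m₁ ∘ (Prod.snd : M₀ × M₁ → M₁) ∘
          (Prod.fst : (M₀ × M₁) × (M₁ × M₂) → M₀ × M₁)) P
        (χ.comp ((ContinuousLinearMap.snd ℝ E₀ E₁).comp
          (ContinuousLinearMap.fst ℝ (E₀ × E₁) (E₁ × E₂)))) :=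
      HasMFDerivAt.comp P hχ (HasMFDerivAt.comp (I' := 𝓘(ℝ, E₀).prod 𝓘(ℝ, E₁)) P
        (hasMFDerivAt_snd _) (hasMFDerivAt_fst _))
    have h2 : HasMFDerivAt ((𝓘(ℝ, E₀).prod 𝓘(ℝ, E₁)).prod (𝓘(ℝ, E₁).prod 𝓘(ℝ, E₂))) 𝓘(ℝ, E₁)
        (extChartAt 𝓘(ℝ, E₁) m₁ ∘ (Prod.fst : M₁ × M₂ → M₁) ∘
          (Prod.snd : (M₀ × M₁) × (M₁ × M₂) → M₁ × M₂)) P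
        (χ.comp ((ContinuousLinearMap.fst ℝ E₁ E₂).comp
          (ContinuousLinearMap.snd ℝ (E₀ × E₁) (E₁ × E₂)))) :=
      HasMFDerivAt.comp P hχ (HasMFDerivAt.comp (I' := 𝓘(ℝ, E₁).prod 𝓘(ℝ, E₂)) P
        (hasMFDerivAt_fst _) (hasMFDerivAt_snd _))
    have c1 : ContMDiffAt ((𝓘(ℝ, E₀).prod 𝓘(ℝ, E₁)).prod (𝓘(ℝ, E₁).prod 𝓘(ℝ, E₂))) 𝓘(ℝ, E₁) ∞
        (extChartAt 𝓘(ℝ, E₁) m₁ ∘ (Prod.snd : M₀ × M₁ → M₁) ∘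
          (Prod.fst : (M₀ × M₁) × (M₁ × M₂) → M₀ × M₁)) P :=
      ContMDiffAt.comp P (contMDiffAt_extChartAt (x := m₁))
        (ContMDiffAt.comp (I' := 𝓘(ℝ, E₀).prod 𝓘(ℝ, E₁)) P contMDiffAt_snd contMDiffAt_fst)
    have c2 : ContMDiffAt ((𝓘(ℝ, E₀).prod 𝓘(ℝ, E₁)).prod (𝓘(ℝ, E₁).prod 𝓘(ℝ, E₂))) 𝓘(ℝ, E₁) ∞
        (extChartAt 𝓘(ℝ, E₁) m₁ ∘ (Prod.fst : M₁ × M₂ → M₁) ∘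
          (Prod.snd : (M₀ × M₁) × (M₁ × M₂) → M₁ × M₂)) P :=
      ContMDiffAt.comp P (contMDiffAt_extChartAt (x := m₁))
        (ContMDiffAt.comp (I' := 𝓘(ℝ, E₁).prod 𝓘(ℝ, E₂)) P contMDiffAt_fst contMDiffAt_snd)
    have h3 := hv.mfderiv_eq_zero (c1.sub c2) (show P.1.2 = P.2.1 from rfl)
      (.of_forall fun y (hy : y.1.2 = y.2.1) => by
        show extChartAt 𝓘(ℝ, E₁) m₁ y.1.2 - extChartAt 𝓘(ℝ, E₁) m₁ y.2.1 = 0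
        rw [hy, sub_self])
    have h4 := (congrArg (fun L : (E₀ × E₁) × (E₁ × E₂) →L[ℝ] E₁ => L v) (h1.sub h2).mfderiv).symm.trans h3
    exact hχi (sub_eq_zero.1 h4)
  have huv' : (u : (E₀ × E₁) × (E₁ × E₂)) + v = w := huv
  refine ⟨u, (v : (E₀ × E₁) × (E₁ × E₂)).1.1, (v : (E₀ × E₁) × (E₁ × E₂)).1.2,
    (v : (E₀ × E₁) × (E₁ × E₂)).2.2, k1, k2, congrArg Prod.fst huv', ?_⟩
  rw [k3]
  exact congrArg Prod.snd huv'

/-- A and B are separately onto. The components tangent to L₀₁ and L₁₂ of chosen preimages do not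
contribute, so only the diagonal part remains, and it shares its middle component. -/
lemma SubmanifoldsTransverse.exists_preimage
    (hT : SubmanifoldsTransverse ((𝓘(ℝ, E₀).prod 𝓘(ℝ, E₁)).prod (𝓘(ℝ, E₁).prod 𝓘(ℝ, E₂)))
      (L₀₁ ×ˢ L₁₂) {p : (M₀ × M₁) × (M₁ × M₂) | p.1.2 = p.2.1})
    (h₀₁ : (p₀, m₁) ∈ L₀₁) (h₁₂ : (m₁, m₂) ∈ L₁₂)
    (hψ₀₁ : IsLocalDefiningMap (𝓘(ℝ, E₀).prod 𝓘(ℝ, E₁)) L₀₁ (p₀, m₁) ψ₀₁)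
    (hψ₁₂ : IsLocalDefiningMap (𝓘(ℝ, E₁).prod 𝓘(ℝ, E₂)) L₁₂ (m₁, m₂) ψ₁₂)
    (hA : HasMFDerivAt (𝓘(ℝ, E₀).prod 𝓘(ℝ, E₁)) 𝓘(ℝ, Fin b → ℝ) ψ₀₁ (p₀, m₁) A)
    (hB : HasMFDerivAt (𝓘(ℝ, E₁).prod 𝓘(ℝ, E₂)) 𝓘(ℝ, Fin c → ℝ) ψ₁₂ (m₁, m₂) B)
    (α : Fin b → ℝ) (β : Fin c → ℝ) :
    ∃ (w₀ : E₀) (w₁ : E₁) (w₂ : E₂), A (w₀, w₁) = α ∧ B (w₁, w₂) = β := by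
  have hψ₀₁' := hψ₀₁
  have hψ₁₂' := hψ₁₂
  obtain ⟨U, hU, hxU, -, hs, -⟩ := hψ₀₁'
  obtain ⟨U', hU', hxU', -, hs', -⟩ := hψ₁₂'
  obtain ⟨X, hX⟩ := hs _ hxU α
  obtain ⟨Y, hY⟩ := hs' _ hxU' β
  rw [hA.mfderiv] at hX
  rw [hB.mfderiv] at hY
  obtain ⟨u, v₀, v₁, v₂, h1, h2, h3, h4⟩ := hT.exists_decomposition h₀₁ h₁₂ hψ₀₁ hψ₁₂ hA hB (X, Y)
  refine ⟨v₀, v₁, v₂, ?_, ?_⟩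
  · have : A (u.1 + (v₀, v₁)) = A X := congrArg A h3
    rw [map_add, h1, zero_add] at this
    exact this.trans hX
  · have : B (u.2 + (v₁, v₂)) = B Y := congrArg B h4
    rw [map_add, h2, zero_add] at this
    exact this.trans hY

/-- Transversality writes any w in the middle tangent space as the difference of the middle
components of vectors tangent to L₀₁ and to L₁₂. Isotropy gives ω₁(v, ·) = 0 on both, so v = 0 by
nondegeneracy. Infinitesimally, the projection of the fibre product to M₀ × M₂ is an immersion. -/
lemma IsLagrangian.eq_zero_of_mfderiv_eq_zero {ω₀ : TwoForm 𝓘(ℝ, E₀) M₀}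
    {ω₁ : TwoForm 𝓘(ℝ, E₁) M₁} {ω₂ : TwoForm 𝓘(ℝ, E₂) M₂} (hω₁ : IsSymplecticForm ω₁)
    (lag₀₁ : IsLagrangian (correspondenceForm ω₀ ω₁) L₀₁)
    (lag₁₂ : IsLagrangian (correspondenceForm ω₁ ω₂) L₁₂)
    (hT : SubmanifoldsTransverse ((𝓘(ℝ, E₀).prod 𝓘(ℝ, E₁)).prod (𝓘(ℝ, E₁).prod 𝓘(ℝ, E₂)))
      (L₀₁ ×ˢ L₁₂) {p : (M₀ × M₁) × (M₁ × M₂) | p.1.2 = p.2.1})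
    (h₀₁ : (p₀, m₁) ∈ L₀₁) (h₁₂ : (m₁, m₂) ∈ L₁₂)
    (hψ₀₁ : IsLocalDefiningMap (𝓘(ℝ, E₀).prod 𝓘(ℝ, E₁)) L₀₁ (p₀, m₁) ψ₀₁)
    (hψ₁₂ : IsLocalDefiningMap (𝓘(ℝ, E₁).prod 𝓘(ℝ, E₂)) L₁₂ (m₁, m₂) ψ₁₂)
    (hA : HasMFDerivAt (𝓘(ℝ, E₀).prod 𝓘(ℝ, E₁)) 𝓘(ℝ, Fin b → ℝ) ψ₀₁ (p₀, m₁) A)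
    (hB : HasMFDerivAt (𝓘(ℝ, E₁).prod 𝓘(ℝ, E₂)) 𝓘(ℝ, Fin c → ℝ) ψ₁₂ (m₁, m₂) B)
    {v : E₁} (hv : A (0, v) = 0) (hv' : B (v, 0) = 0) : v = 0 := by
  have tan₀₁ : ∀ z : E₀ × E₁, A z = 0 → IsTangentTo (𝓘(ℝ, E₀).prod 𝓘(ℝ, E₁)) L₀₁ (p₀, m₁) z :=
    fun z hz => ⟨b, ψ₀₁, hψ₀₁, by rw [hA.mfderiv]; exact hz⟩
  have tan₁₂ : ∀ z : E₁ × E₂, B z = 0 → IsTangentTo (𝓘(ℝ, E₁).prod 𝓘(ℝ, E₂)) L₁₂ (m₁, m₂) z :=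
    fun z hz => ⟨c, ψ₁₂, hψ₁₂, by rw [hB.mfderiv]; exact hz⟩
  refine hω₁.nondegenerate m₁ v fun w => ?_
  obtain ⟨u, v₀, v₁, v₂, h1, h2, h3, h4⟩ :=
    hT.exists_decomposition h₀₁ h₁₂ hψ₀₁ hψ₁₂ hA hB ((0, w), 0)
  have e1 := lag₀₁.2 _ h₀₁ _ _ (tan₀₁ _ hv) (tan₀₁ _ h1)
  have e2 := lag₁₂.2 _ h₁₂ _ _ (tan₁₂ _ hv') (tan₁₂ _ h2)
  rw [correspondenceForm_apply] at e1 e2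
  have z0 : ∀ z : E₀, (ω₀ p₀ : E₀ [⋀^Fin 2]→L[ℝ] ℝ) ![0, z] = 0 := fun z =>
    (ω₀ p₀ : E₀ [⋀^Fin 2]→L[ℝ] ℝ).map_coord_zero (0 : Fin 2) rfl
  have z2 : ∀ z : E₂, (ω₂ m₂ : E₂ [⋀^Fin 2]→L[ℝ] ℝ) ![0, z] = 0 := fun z =>
    (ω₂ m₂ : E₂ [⋀^Fin 2]→L[ℝ] ℝ).map_coord_zero (0 : Fin 2) rfl
  have e1' : (ω₁ m₁ : E₁ [⋀^Fin 2]→L[ℝ] ℝ) ![v, u.1.2] = 0 := (sub_eq_zero.1 e1).trans (z0 _)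
  have e2' : (ω₁ m₁ : E₁ [⋀^Fin 2]→L[ℝ] ℝ) ![v, u.2.1] = 0 := (sub_eq_zero.1 e2).symm.trans (z2 _)
  have hw : w = u.1.2 - u.2.1 := by
    have a1 : u.1.2 + v₁ = w := congrArg Prod.snd h3
    have a2 : u.2.1 + v₁ = 0 := congrArg Prod.fst h4
    rw [← a1, eq_neg_of_add_eq_zero_right a2]
    abel
  have key : ∀ a : E₁ [⋀^Fin 2]→L[ℝ] ℝ, a ![v, u.1.2] = 0 → a ![v, u.2.1] = 0 →
      a ![v, u.1.2 - u.2.1] = 0 := by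
    intro a h5 h6
    rw [← flatL_apply, map_sub, flatL_apply, flatL_apply, h5, h6, sub_zero]
  rw [hw]
  exact key _ e1' e2'

end Composition

/-! ### Eliminating the middle variable: the composition as a submanifold -/

section Elimination

variable {Z Y W : Type*} [NormedAddCommGroup Z] [NormedSpace ℝ Z] [CompleteSpace Z]
  [NormedAddCommGroup Y] [NormedSpace ℝ Y] [CompleteSpace Y]
  [NormedAddCommGroup W] [NormedSpace ℝ W]

lemma eventually_isInvertible {A : Y →L[ℝ] W} (hA : A.IsInvertible) :
    ∀ᶠ B in 𝓝 A, (B : Y →L[ℝ] W).IsInvertible := by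
  obtain ⟨e, rfl⟩ := hA
  filter_upwards [ContinuousLinearEquiv.nhds e] with B hB
  exact hB

/-- Being C^∞ at a point does not give one neighbourhood that works for all orders. So the implicit
function is compared with those based at nearby points of its graph, with which it agrees locally.
-/
lemma eventually_contDiffAt_implicitFunction [CompleteSpace W] {f : Z × Y → W} {v : Z × Y}
    (hf : ∀ᶠ w in 𝓝 v, ContDiffAt ℝ ∞ f w)
    (hi : (fderiv ℝ f v ∘L .inr ℝ Z Y).IsInvertible) :
    ∀ᶠ z in 𝓝 v.1, ContDiffAt ℝ ∞ (hf.self_of_nhds.implicitFunction (by simp) hi) z := by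
  set g := hf.self_of_nhds.implicitFunction (by simp) hi with hg
  have h1 : ContDiffAt ℝ ∞ g v.1 := hf.self_of_nhds.contDiffAt_implicitFunction (by simp) hi
  have h2 : ∀ᶠ z in 𝓝 v.1, ContinuousAt g z :=
    ((h1.of_le (by simp : (1 : WithTop ℕ∞) ≤ ∞)).eventually (by simp)).mono fun z hz => hz.continuousAt
  have h3 : ∀ᶠ z in 𝓝 v.1, ∀ᶠ z' in 𝓝 z, f (z', g z') = f v :=
    eventually_eventually_nhds.2 (hf.self_of_nhds.eventually_apply_implicitFunction (by simp) hi)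
  have hgv : g v.1 = v.2 := hf.self_of_nhds.implicitFunction_apply_self (by simp) hi
  have hc : ContinuousAt (fun z => (z, g z)) v.1 := continuousAt_id.prodMk h1.continuousAt
  have hc' : Filter.Tendsto (fun z => (z, g z)) (𝓝 v.1) (𝓝 v) := by
    have := hc.tendsto
    rwa [hgv] at this
  have h4 : ContinuousAt (fun w => fderiv ℝ f w ∘L .inr ℝ Z Y) v :=
    (hf.self_of_nhds.continuousAt_fderiv (by simp)).clm_comp continuousAt_const
  filter_upwards [h2, h3, hc'.eventually hf, hc'.eventually (h4.eventually (eventually_isInvertible hi))]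
    with z hz1 hz2 hz3 hz4
  have h5 := hz3.eventually_apply_eq_iff_implicitFunction (by simp) hz4
  have h6 := (continuousAt_id.prodMk hz1).tendsto.eventually h5
  refine (hz3.contDiffAt_implicitFunction (by simp) hz4).congr_of_eventuallyEq ?_
  filter_upwards [h6, hz2] with z' h7 h8
  exact (h7.1 (h8.trans hz2.self_of_nhds.symm)).symm

/-- Elimination of the variable `y` from the equation `Ψ (z, y) = 0`. -/
lemma exists_elimination [FiniteDimensional ℝ Y] [FiniteDimensional ℝ W] {Ψ : Z × Y → W} {v : Z × Y}
    (hΨ : ∀ᶠ w in 𝓝 v, ContDiffAt ℝ ∞ Ψ w) (hv : Ψ v = 0)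
    (hs : Function.Surjective (fderiv ℝ Ψ v))
    (hi : ∀ y, fderiv ℝ Ψ v (0, y) = 0 → y = 0) {N₀ : Set Y} (hN₀ : N₀ ∈ 𝓝 v.2) :
    ∃ (r : ℕ) (Q : W →L[ℝ] (Fin r → ℝ)) (u : Z → (Fin r → ℝ)) (O : Set Z) (N : Set Y),
      Function.Surjective Q ∧ (∀ y, Q (fderiv ℝ Ψ v (0, y)) = 0) ∧ IsOpen O ∧ v.1 ∈ O ∧
      N ∈ 𝓝 v.2 ∧ N ⊆ N₀ ∧ ContDiffOn ℝ ∞ u O ∧ (∀ z ∈ O, Function.Surjective (fderiv ℝ u z)) ∧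
      (∀ w, fderiv ℝ u v.1 w = Q (fderiv ℝ Ψ v (w, 0))) ∧
      ∀ z ∈ O, u z = 0 ↔ ∃ y ∈ N, Ψ (z, y) = 0 := by
  set D := fderiv ℝ Ψ v with hD
  set A : Y →L[ℝ] W := D.comp (.inr ℝ Z Y) with hA
  -- The equations are split in two: a left inverse P of the y-derivative A selects those solvable
  -- for y, and the cokernel projection Q retains the rest.
  obtain ⟨Pl, hPl⟩ := A.toLinearMap.exists_leftInverse_of_injective (LinearMap.ker_eq_bot.2
    ((injective_iff_map_eq_zero A.toLinearMap).2 fun y hy => hi y hy))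
  have hPlA : ∀ y, Pl (A y) = y := fun y => LinearMap.congr_fun hPl y
  set P : W →L[ℝ] Y := LinearMap.toContinuousLinearMap Pl with hP
  set R := LinearMap.range A.toLinearMap with hR
  set e := (Module.finBasis ℝ (W ⧸ R)).equivFun with he
  set Q : W →L[ℝ] (Fin (Module.finrank ℝ (W ⧸ R)) → ℝ) :=
    LinearMap.toContinuousLinearMap (e.toLinearMap ∘ₗ R.mkQ) with hQ
  have hQs : Function.Surjective Q := e.surjective.comp R.mkQ_surjective
  have hQ0 : ∀ w, Q w = 0 ↔ ∃ y, A y = w := by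
    intro w
    have : Q w = e (R.mkQ w) := rfl
    rw [this, LinearEquiv.map_eq_zero_iff, Submodule.mkQ_apply, Submodule.Quotient.mk_eq_zero]
    exact LinearMap.mem_range
  have hQA : ∀ y, Q (A y) = 0 := fun y => (hQ0 _).2 ⟨y, rfl⟩
  set f : Z × Y → Y := fun w => P (Ψ w) with hf
  have hfc : ∀ᶠ w in 𝓝 v, ContDiffAt ℝ ∞ f w := hΨ.mono fun w hw => P.contDiff.contDiffAt.comp w hw
  have hfD : fderiv ℝ f v = P.comp D :=
    (P.hasFDerivAt.comp v (hΨ.self_of_nhds.differentiableAt (by simp)).hasFDerivAt).fderiv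
  have hinv : (fderiv ℝ f v ∘L .inr ℝ Z Y).IsInvertible := by
    refine ⟨ContinuousLinearEquiv.refl ℝ Y, ?_⟩
    rw [hfD]
    ext y
    exact (hPlA y).symm
  set g := hfc.self_of_nhds.implicitFunction (by simp) hinv with hg
  have hgc := eventually_contDiffAt_implicitFunction hfc hinv
  have hgv : g v.1 = v.2 := hfc.self_of_nhds.implicitFunction_apply_self (by simp) hinv
  have hgf := hfc.self_of_nhds.eventually_apply_implicitFunction (by simp) hinv
  have hiff := hfc.self_of_nhds.eventually_apply_eq_iff_implicitFunction (by simp) hinv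
  have hfv : f v = 0 := by simp only [hf, hv, map_zero]
  simp only [hfv] at hgf hiff
  have hgc0 : ContinuousAt g v.1 := hgc.self_of_nhds.continuousAt
  have hc' : Filter.Tendsto (fun z => (z, g z)) (𝓝 v.1) (𝓝 v) := by
    have := (continuousAt_id.prodMk hgc0).tendsto
    simpa only [id, hgv] using this
  obtain ⟨O₁, hO₁, N₁, hN₁, hON⟩ := mem_nhds_prod_iff.1 hiff
  -- Here y = g z solves P Ψ = 0, and what remains of the system is its image in the cokernel.
  set u : Z → (Fin (Module.finrank ℝ (W ⧸ R)) → ℝ) := fun z => Q (Ψ (z, g z)) with hu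
  have huc : ∀ᶠ z in 𝓝 v.1, ContDiffAt ℝ ∞ u z := by
    filter_upwards [hgc, hc'.eventually hΨ] with z h1 h2
    exact Q.contDiff.contDiffAt.comp z (h2.comp z (contDiffAt_id.prodMk h1))
  have hu' : HasFDerivAt u (Q.comp (D.comp ((ContinuousLinearMap.id ℝ Z).prod (fderiv ℝ g v.1)))) v.1 := by
    have h1 : HasFDerivAt Ψ D (v.1, g v.1) := by
      rw [hgv]
      exact (hΨ.self_of_nhds.differentiableAt (by simp)).hasFDerivAt
    exact Q.hasFDerivAt.comp v.1 (h1.comp v.1 ((hasFDerivAt_id v.1).prodMk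
      (hgc.self_of_nhds.differentiableAt (by simp)).hasFDerivAt))
  have hu'' : ∀ w, fderiv ℝ u v.1 w = Q (D (w, 0)) := by
    intro w
    rw [hu'.fderiv]
    show Q (D (w, fderiv ℝ g v.1 w)) = Q (D (w, 0))
    have : ((w, fderiv ℝ g v.1 w) : Z × Y) = (w, 0) + (0, fderiv ℝ g v.1 w) := by simp
    rw [this, map_add, map_add]
    exact (congrArg _ (hQA _)).trans (add_zero _)
  have hus : Function.Surjective (fderiv ℝ u v.1) := by
    intro κ
    obtain ⟨κ', rfl⟩ := hQs κ
    obtain ⟨⟨w, y⟩, rfl⟩ := hs κ'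
    refine ⟨w, ?_⟩
    rw [hu'']
    have : ((w, y) : Z × Y) = (w, 0) + (0, y) := by simp
    rw [this, map_add, map_add]
    exact ((congrArg _ (hQA _)).trans (add_zero _)).symm
  have hev : ∀ᶠ z in 𝓝 v.1, ContDiffAt ℝ ∞ u z ∧ Function.Surjective (fderiv ℝ u z) ∧
      z ∈ O₁ ∧ g z ∈ N₁ ∩ N₀ ∧ f (z, g z) = 0 := by
    filter_upwards [huc, (huc.self_of_nhds.continuousAt_fderiv (by simp)).eventually
      (eventually_surjective hus), hO₁, hgc0.eventually_mem
        (by rw [hgv]; exact Filter.inter_mem hN₁ hN₀), hgf] with z h1 h2 h3 h4 h5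
    exact ⟨h1, h2, h3, h4, h5⟩
  obtain ⟨O, hOsub, hO, hvO⟩ := mem_nhds_iff.1 hev
  refine ⟨_, Q, u, O, N₁ ∩ N₀, hQs, hQA, hO, hvO, Filter.inter_mem hN₁ hN₀, inter_subset_right,
    fun z hz => (hOsub hz).1.contDiffWithinAt, fun z hz => (hOsub hz).2.1, hu'', fun z hz => ?_⟩
  obtain ⟨-, -, h3, h4, h5⟩ := hOsub hz
  constructor
  -- Q Ψ = 0 puts Ψ (z, g z) in the range of A, on which P is injective; as P Ψ = 0 as well, Ψ
  -- vanishes.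
  · intro h
    obtain ⟨y, hy⟩ := (hQ0 _).1 h
    have h6 : y = 0 := by
      rw [← hPlA y, hy]
      exact h5
    refine ⟨g z, h4, ?_⟩
    rw [← hy, h6, map_zero]
  · rintro ⟨y, hy, hzy⟩
    have h6 : f (z, y) = 0 ↔ g z = y := hON ⟨h3, hy.1⟩
    have h7 : g z = y := h6.1 (by simp only [hf, hzy, map_zero])
    simp only [hu, h7, hzy, map_zero]

end Elimination

/-- The possible middle points outside V form a compact set, on which the incidence conditions fail
at (p₀, m₂) and hence at all nearby pairs. Compactness is what excludes far-away sheets of the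
composition. -/
lemma eventually_forall_mem_of_unique {X₀ X₁ X₂ : Type*} [TopologicalSpace X₀] [TopologicalSpace X₁]
    [TopologicalSpace X₂] [T2Space X₀] [T2Space X₁] [T2Space X₂] {L₀₁ : Set (X₀ × X₁)}
    {L₁₂ : Set (X₁ × X₂)} (h₀₁ : IsCompact L₀₁) (h₁₂ : IsCompact L₁₂) {p₀ : X₀} {m₁ : X₁} {m₂ : X₂}
    (huniq : ∀ x₁, (p₀, x₁) ∈ L₀₁ → (x₁, m₂) ∈ L₁₂ → x₁ = m₁) {V : Set X₁} (hV : V ∈ 𝓝 m₁) :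
    ∀ᶠ z in 𝓝 (p₀, m₂), ∀ x₁, (z.1, x₁) ∈ L₀₁ → (x₁, z.2) ∈ L₁₂ → x₁ ∈ V := by
  have hK : IsCompact (Prod.snd '' L₀₁ \ interior V) := (h₀₁.image continuous_snd).diff isOpen_interior
  have h := hK.eventually_forall_of_forall_eventually (x₀ := (p₀, m₂))
    (P := fun z x₁ => ¬ ((z.1, x₁) ∈ L₀₁ ∧ (x₁, z.2) ∈ L₁₂)) (fun x₁ hx₁ => by
      have hne : ¬ ((p₀, x₁) ∈ L₀₁ ∧ (x₁, m₂) ∈ L₁₂) := by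
        rintro ⟨h1, h2⟩
        rw [huniq x₁ h1 h2] at hx₁
        exact hx₁.2 (mem_interior_iff_mem_nhds.2 hV)
      have c1 : Continuous fun z : (X₀ × X₂) × X₁ => ((z.1.1, z.2) : X₀ × X₁) := by fun_prop
      have c2 : Continuous fun z : (X₀ × X₂) × X₁ => ((z.2, z.1.2) : X₁ × X₂) := by fun_prop
      have hcl := (h₀₁.isClosed.preimage c1).inter (h₁₂.isClosed.preimage c2)
      exact hcl.isOpen_compl.mem_nhds hne)
  filter_upwards [h] with z hz x₁ h1 h2
  by_contra hx
  exact hz x₁ ⟨⟨_, h1, rfl⟩, fun h3 => hx (interior_subset h3)⟩ ⟨h1, h2⟩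

section Composition

variable {E₀ E₁ E₂ : Type*}
  [NormedAddCommGroup E₀] [NormedSpace ℝ E₀] [NormedAddCommGroup E₁] [NormedSpace ℝ E₁]
  [NormedAddCommGroup E₂] [NormedSpace ℝ E₂]
  {M₀ M₁ M₂ : Type*}
  [TopologicalSpace M₀] [ChartedSpace E₀ M₀] [TopologicalSpace M₁] [ChartedSpace E₁ M₁]
  [TopologicalSpace M₂] [ChartedSpace E₂ M₂]
  [FiniteDimensional ℝ E₀] [FiniteDimensional ℝ E₁] [FiniteDimensional ℝ E₂]
  [IsManifold 𝓘(ℝ, E₀) ∞ M₀] [IsManifold 𝓘(ℝ, E₁) ∞ M₁] [IsManifold 𝓘(ℝ, E₂) ∞ M₂]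
  {L₀₁ : Set (M₀ × M₁)} {L₁₂ : Set (M₁ × M₂)}

/-- Elimination of the middle coordinate from the joint equations of L₀₁ and L₁₂. The map Q is
returned as well, since it relates the linearization of the composition to those of its factors. -/
lemma exists_isLocalDefiningMap_geometricComposition [T2Space M₀] [T2Space M₁] [T2Space M₂]
    {p₀ : M₀} {m₁ : M₁} {m₂ : M₂}
    {b c : ℕ} {ψ₀₁ : M₀ × M₁ → (Fin b → ℝ)} {ψ₁₂ : M₁ × M₂ → (Fin c → ℝ)}
    {A : E₀ × E₁ →L[ℝ] (Fin b → ℝ)} {B : E₁ × E₂ →L[ℝ] (Fin c → ℝ)}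
    {ω₀ : TwoForm 𝓘(ℝ, E₀) M₀} {ω₁ : TwoForm 𝓘(ℝ, E₁) M₁} {ω₂ : TwoForm 𝓘(ℝ, E₂) M₂}
    (hω₁ : IsSymplecticForm ω₁)
    (hL₀₁ : IsCompact L₀₁) (hL₁₂ : IsCompact L₁₂)
    (lag₀₁ : IsLagrangian (correspondenceForm ω₀ ω₁) L₀₁)
    (lag₁₂ : IsLagrangian (correspondenceForm ω₁ ω₂) L₁₂)
    (hemb : IsEmbeddedComposition E₀ E₁ E₂ L₀₁ L₁₂)
    (h₀₁ : (p₀, m₁) ∈ L₀₁) (h₁₂ : (m₁, m₂) ∈ L₁₂)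
    (hψ₀₁ : IsLocalDefiningMap (𝓘(ℝ, E₀).prod 𝓘(ℝ, E₁)) L₀₁ (p₀, m₁) ψ₀₁)
    (hψ₁₂ : IsLocalDefiningMap (𝓘(ℝ, E₁).prod 𝓘(ℝ, E₂)) L₁₂ (m₁, m₂) ψ₁₂)
    (hA : HasMFDerivAt (𝓘(ℝ, E₀).prod 𝓘(ℝ, E₁)) 𝓘(ℝ, Fin b → ℝ) ψ₀₁ (p₀, m₁) A)
    (hB : HasMFDerivAt (𝓘(ℝ, E₁).prod 𝓘(ℝ, E₂)) 𝓘(ℝ, Fin c → ℝ) ψ₁₂ (m₁, m₂) B) :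
    ∃ (r : ℕ) (Q : (Fin b → ℝ) × (Fin c → ℝ) →L[ℝ] (Fin r → ℝ)) (ψ₀₂ : M₀ × M₂ → (Fin r → ℝ))
      (C : E₀ × E₂ →L[ℝ] (Fin r → ℝ)), Function.Surjective Q ∧ (∀ y, Q (A (0, y), B (y, 0)) = 0) ∧
      IsLocalDefiningMap (𝓘(ℝ, E₀).prod 𝓘(ℝ, E₂)) (geometricComposition L₀₁ L₁₂) (p₀, m₂) ψ₀₂ ∧
      HasMFDerivAt (𝓘(ℝ, E₀).prod 𝓘(ℝ, E₂)) 𝓘(ℝ, Fin r → ℝ) ψ₀₂ (p₀, m₂) C ∧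
      ∀ w₀ w₂, C (w₀, w₂) = Q (A (w₀, 0), B (0, w₂)) := by
  have : CompleteSpace E₀ := FiniteDimensional.complete ℝ E₀
  have : CompleteSpace E₁ := FiniteDimensional.complete ℝ E₁
  have : CompleteSpace E₂ := FiniteDimensional.complete ℝ E₂
  obtain ⟨W₀₁, hW₀₁, hx₀₁, hWt₀₁, hu₀₁, -, hz₀₁⟩ := hψ₀₁.exists_chart
  obtain ⟨W₁₂, hW₁₂, hx₁₂, hWt₁₂, hu₁₂, -, hz₁₂⟩ := hψ₁₂.exists_chart
  set s₀ := (extChartAt 𝓘(ℝ, E₀) p₀).symm with hs₀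
  set s₁ := (extChartAt 𝓘(ℝ, E₁) m₁).symm with hs₁
  set s₂ := (extChartAt 𝓘(ℝ, E₂) m₂).symm with hs₂
  set y₀ := extChartAt 𝓘(ℝ, E₀) p₀ p₀ with hy₀
  set y₁ := extChartAt 𝓘(ℝ, E₁) m₁ m₁ with hy₁
  set y₂ := extChartAt 𝓘(ℝ, E₂) m₂ m₂ with hy₂
  set u₀₁ : E₀ × E₁ → (Fin b → ℝ) := fun y => ψ₀₁ (s₀ y.1, s₁ y.2) with hu₀₁'
  set u₁₂ : E₁ × E₂ → (Fin c → ℝ) := fun y => ψ₁₂ (s₁ y.1, s₂ y.2) with hu₁₂'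
  replace hx₀₁ : (y₀, y₁) ∈ W₀₁ := hx₀₁
  replace hx₁₂ : (y₁, y₂) ∈ W₁₂ := hx₁₂
  replace hu₀₁ : ContDiffOn ℝ ∞ u₀₁ W₀₁ := hu₀₁
  replace hu₁₂ : ContDiffOn ℝ ∞ u₁₂ W₁₂ := hu₁₂
  replace hz₀₁ : ∀ y ∈ W₀₁, (s₀ y.1, s₁ y.2) ∈ L₀₁ ↔ u₀₁ y = 0 := hz₀₁
  replace hz₁₂ : ∀ y ∈ W₁₂, (s₁ y.1, s₂ y.2) ∈ L₁₂ ↔ u₁₂ y = 0 := hz₁₂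
  have eA : HasFDerivAt u₀₁ A (y₀, y₁) := by
    have h1 : A = fderiv ℝ u₀₁ (y₀, y₁) :=
      hA.mfderiv.symm.trans (mfderiv_eq_fderiv_chart hA.mdifferentiableAt)
    rw [h1]
    exact ((hu₀₁.contDiffAt (hW₀₁.mem_nhds hx₀₁)).differentiableAt (by simp)).hasFDerivAt
  have eB : HasFDerivAt u₁₂ B (y₁, y₂) := by
    have h1 : B = fderiv ℝ u₁₂ (y₁, y₂) :=
      hB.mfderiv.symm.trans (mfderiv_eq_fderiv_chart hB.mdifferentiableAt)
    rw [h1]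
    exact ((hu₁₂.contDiffAt (hW₁₂.mem_nhds hx₁₂)).differentiableAt (by simp)).hasFDerivAt
  set ℓ₁ : (E₀ × E₂) × E₁ →L[ℝ] E₀ × E₁ := ((ContinuousLinearMap.fst ℝ E₀ E₂).comp
    (ContinuousLinearMap.fst ℝ (E₀ × E₂) E₁)).prod (ContinuousLinearMap.snd ℝ (E₀ × E₂) E₁) with hℓ₁
  set ℓ₂ : (E₀ × E₂) × E₁ →L[ℝ] E₁ × E₂ := (ContinuousLinearMap.snd ℝ (E₀ × E₂) E₁).prod
    ((ContinuousLinearMap.snd ℝ E₀ E₂).comp (ContinuousLinearMap.fst ℝ (E₀ × E₂) E₁)) with hℓ₂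
  set Ψ : (E₀ × E₂) × E₁ → (Fin b → ℝ) × (Fin c → ℝ) := fun q => (u₀₁ (ℓ₁ q), u₁₂ (ℓ₂ q)) with hΨ
  set v : (E₀ × E₂) × E₁ := ((y₀, y₂), y₁) with hv
  have hΨD : HasFDerivAt Ψ ((A.comp ℓ₁).prod (B.comp ℓ₂)) v :=
    (HasFDerivAt.comp v (show HasFDerivAt u₀₁ A (ℓ₁ v) from eA) ℓ₁.hasFDerivAt).prodMk
      (HasFDerivAt.comp v (show HasFDerivAt u₁₂ B (ℓ₂ v) from eB) ℓ₂.hasFDerivAt)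
  have hmem : ∀ᶠ q in 𝓝 v, ℓ₁ q ∈ W₀₁ ∧ ℓ₂ q ∈ W₁₂ :=
    (ℓ₁.continuous.continuousAt.eventually_mem (hW₀₁.mem_nhds hx₀₁)).and
      (ℓ₂.continuous.continuousAt.eventually_mem (hW₁₂.mem_nhds hx₁₂))
  have hΨc : ∀ᶠ q in 𝓝 v, ContDiffAt ℝ ∞ Ψ q := by
    filter_upwards [hmem] with q hq
    exact ((hu₀₁.contDiffAt (hW₀₁.mem_nhds hq.1)).comp q ℓ₁.contDiff.contDiffAt).prodMk
      ((hu₁₂.contDiffAt (hW₁₂.mem_nhds hq.2)).comp q ℓ₂.contDiff.contDiffAt)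
  have i₀ : s₀ y₀ = p₀ := extChartAt_to_inv p₀
  have i₁ : s₁ y₁ = m₁ := extChartAt_to_inv m₁
  have i₂ : s₂ y₂ = m₂ := extChartAt_to_inv m₂
  have hΨv : Ψ v = 0 := by
    have h1 : u₀₁ (y₀, y₁) = 0 := (hz₀₁ _ hx₀₁).1 (by simp only [i₀, i₁]; exact h₀₁)
    have h2 : u₁₂ (y₁, y₂) = 0 := (hz₁₂ _ hx₁₂).1 (by simp only [i₁, i₂]; exact h₁₂)
    exact Prod.ext h1 h2
  have hΨs : Function.Surjective (fderiv ℝ Ψ v) := by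
    rintro ⟨α, β⟩
    obtain ⟨w₀, w₁, w₂, h1, h2⟩ := hemb.1.exists_preimage h₀₁ h₁₂ hψ₀₁ hψ₁₂ hA hB α β
    refine ⟨((w₀, w₂), w₁), ?_⟩
    rw [hΨD.fderiv]
    exact Prod.ext h1 h2
  have hΨi : ∀ y, fderiv ℝ Ψ v (0, y) = 0 → y = 0 := by
    intro y hy
    rw [hΨD.fderiv] at hy
    exact IsLagrangian.eq_zero_of_mfderiv_eq_zero hω₁ lag₀₁ lag₁₂ hemb.1 h₀₁ h₁₂ hψ₀₁ hψ₁₂ hA hB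
      (congrArg Prod.fst hy) (congrArg Prod.snd hy)
  obtain ⟨O₁, hO₁, N₀, hN₀, hON⟩ := mem_nhds_prod_iff.1 hmem
  obtain ⟨r, Q, u, O, N, hQs, hQ0, hO, hvO, hN, hNN₀, huc, hus, huD, huz⟩ :=
    exists_elimination hΨc hΨv hΨs hΨi hN₀
  -- Elimination only sees middle points in N. Injectivity of the projection and compactness show
  -- that no others occur nearby.
  have hiso : ∀ᶠ z in 𝓝 (p₀, m₂), ∀ x₁, (z.1, x₁) ∈ L₀₁ → (x₁, z.2) ∈ L₁₂ →
      x₁ ∈ (extChartAt 𝓘(ℝ, E₁) m₁).source ∩ extChartAt 𝓘(ℝ, E₁) m₁ ⁻¹' N := by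
    refine eventually_forall_mem_of_unique hL₀₁ hL₁₂ (fun x₁ h1 h2 => ?_)
      (Filter.inter_mem (extChartAt_source_mem_nhds m₁) ((continuousAt_extChartAt m₁).preimage_mem_nhds hN))
    have := hemb.2
      (show ((p₀, x₁), (x₁, m₂)) ∈ fibreProduct L₀₁ L₁₂ from ⟨⟨h1, h2⟩, rfl⟩)
      (show ((p₀, m₁), (m₁, m₂)) ∈ fibreProduct L₀₁ L₁₂ from ⟨⟨h₀₁, h₁₂⟩, rfl⟩) rfl
    exact congrArg (fun q => q.1.2) this
  have hsc : ContinuousAt (fun z : E₀ × E₂ => (s₀ z.1, s₂ z.2)) (y₀, y₂) :=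
    (ContinuousAt.comp (g := s₀) (f := Prod.fst) (x := (y₀, y₂))
      (continuousAt_extChartAt_symm p₀) continuousAt_fst).prodMk
    (ContinuousAt.comp (g := s₂) (f := Prod.snd) (x := (y₀, y₂))
      (continuousAt_extChartAt_symm m₂) continuousAt_snd)
  have hiso' := hsc.eventually (by simp only [i₀, i₂]; exact hiso)
  obtain ⟨O', hO'sub, hO', hvO'⟩ := mem_nhds_iff.1
    (Filter.inter_mem (Filter.inter_mem (hO.mem_nhds hvO) hO₁) hiso')
  have hdef : IsLocalDefiningMap (𝓘(ℝ, E₀).prod 𝓘(ℝ, E₂)) (geometricComposition L₀₁ L₁₂) (p₀, m₂)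
      (fun z => u (extChartAt (𝓘(ℝ, E₀).prod 𝓘(ℝ, E₂)) (p₀, m₂) z)) := by
    refine IsLocalDefiningMap.of_chart hO' hvO' (huc.mono fun z hz => (hO'sub hz).1.1)
      (fun z hz => hus z (hO'sub hz).1.1) (fun z hz _ => ?_)
    obtain ⟨⟨hzO, hzO₁⟩, hzi⟩ := hO'sub hz
    rw [huz z hzO]
    constructor
    · rintro ⟨x₁, h1, h2⟩
      obtain ⟨h3, h4⟩ := hzi x₁ h1 h2
      refine ⟨extChartAt 𝓘(ℝ, E₁) m₁ x₁, h4, ?_⟩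
      have h5 : s₁ (extChartAt 𝓘(ℝ, E₁) m₁ x₁) = x₁ := (extChartAt 𝓘(ℝ, E₁) m₁).left_inv h3
      obtain ⟨h6, h7⟩ := hON (mk_mem_prod hzO₁ (hNN₀ h4))
      refine Prod.ext ((hz₀₁ _ h6).1 ?_) ((hz₁₂ _ h7).1 ?_)
      · show (s₀ z.1, s₁ (extChartAt 𝓘(ℝ, E₁) m₁ x₁)) ∈ L₀₁
        rw [h5]; exact h1
      · show (s₁ (extChartAt 𝓘(ℝ, E₁) m₁ x₁), s₂ z.2) ∈ L₁₂
        rw [h5]; exact h2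
    · rintro ⟨y, hy, hzy⟩
      obtain ⟨h6, h7⟩ := hON (mk_mem_prod hzO₁ (hNN₀ hy))
      exact ⟨s₁ y, (hz₀₁ _ h6).2 (congrArg Prod.fst hzy), (hz₁₂ _ h7).2 (congrArg Prod.snd hzy)⟩
  have hmd := hdef.contMDiffAt.mdifferentiableAt (by simp)
  refine ⟨r, Q, _, fderiv ℝ u (y₀, y₂), hQs, fun y => ?_, hdef, ?_, fun w₀ w₂ => ?_⟩
  · have := hQ0 y
    rwa [hΨD.fderiv] at this
  · refine hmd.hasMFDerivAt.congr_mfderiv ((mfderiv_eq_fderiv_chart hmd).trans ?_)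
    refine Filter.EventuallyEq.fderiv_eq ?_
    filter_upwards [extChartAt_target_mem_nhds (I := 𝓘(ℝ, E₀).prod 𝓘(ℝ, E₂)) (p₀, m₂)] with z hz
    rw [(extChartAt (𝓘(ℝ, E₀).prod 𝓘(ℝ, E₂)) (p₀, m₂)).right_inv hz]
  · have := huD (w₀, w₂)
    rw [hΨD.fderiv] at this
    exact this

end Composition

lemma HasMFDerivAt.prodMk_normedSpace {E : Type*} [NormedAddCommGroup E] [NormedSpace ℝ E]
    {H : Type*} [TopologicalSpace H] {I : ModelWithCorners ℝ E H}
    {M : Type*} [TopologicalSpace M] [ChartedSpace H M]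
    {F G : Type*} [NormedAddCommGroup F] [NormedSpace ℝ F] [NormedAddCommGroup G] [NormedSpace ℝ G]
    {f : M → F} {g : M → G} {x : M} {f' : E →L[ℝ] F} {g' : E →L[ℝ] G}
    (hf : HasMFDerivAt I 𝓘(ℝ, F) f x f') (hg : HasMFDerivAt I 𝓘(ℝ, G) g x g') :
    HasMFDerivAt I 𝓘(ℝ, F × G) (fun y => (f y, g y)) x (f'.prod g') :=
  ⟨hf.1.prodMk hg.1, hf.2.prodMk hg.2⟩

/-! ### From the four-term to the three-term system -/

section Composition

variable {E₀ E₁ E₂ : Type*}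
  [NormedAddCommGroup E₀] [NormedSpace ℝ E₀] [NormedAddCommGroup E₁] [NormedSpace ℝ E₁]
  [NormedAddCommGroup E₂] [NormedSpace ℝ E₂]
  {M₀ M₁ M₂ : Type*}
  [TopologicalSpace M₀] [ChartedSpace E₀ M₀] [TopologicalSpace M₁] [ChartedSpace E₁ M₁]
  [TopologicalSpace M₂] [ChartedSpace E₂ M₂]

lemma hasMFDerivAt_quadruple {V₀ V₁ V₂ V₃ : Type*}
    [NormedAddCommGroup V₀] [NormedSpace ℝ V₀] [NormedAddCommGroup V₁] [NormedSpace ℝ V₁]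
    [NormedAddCommGroup V₂] [NormedSpace ℝ V₂] [NormedAddCommGroup V₃] [NormedSpace ℝ V₃]
    {φ₀ : M₀ → M₀} {φ₂ : M₂ → M₂} {m : M₀ × M₁ × M₂} {ψ₀ : M₀ → V₀} {ψ₀₁ : M₀ × M₁ → V₁}
    {ψ₁₂ : M₁ × M₂ → V₂} {ψ₂ : M₂ → V₃} {T₀ : E₀ →L[ℝ] E₀} {T₂ : E₂ →L[ℝ] E₂}
    {a : E₀ →L[ℝ] V₀} {A : E₀ × E₁ →L[ℝ] V₁} {B : E₁ × E₂ →L[ℝ] V₂} {d : E₂ →L[ℝ] V₃}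
    (hφ₀ : HasMFDerivAt 𝓘(ℝ, E₀) 𝓘(ℝ, E₀) φ₀ m.1 T₀)
    (hφ₂ : HasMFDerivAt 𝓘(ℝ, E₂) 𝓘(ℝ, E₂) φ₂ m.2.2 T₂)
    (ha : HasMFDerivAt 𝓘(ℝ, E₀) 𝓘(ℝ, V₀) ψ₀ m.1 a)
    (hA : HasMFDerivAt (𝓘(ℝ, E₀).prod 𝓘(ℝ, E₁)) 𝓘(ℝ, V₁) ψ₀₁ (φ₀ m.1, m.2.1) A)
    (hB : HasMFDerivAt (𝓘(ℝ, E₁).prod 𝓘(ℝ, E₂)) 𝓘(ℝ, V₂) ψ₁₂ (m.2.1, m.2.2) B)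
    (hd : HasMFDerivAt 𝓘(ℝ, E₂) 𝓘(ℝ, V₃) ψ₂ (φ₂ m.2.2) d) :
    ∃ D : E₀ × E₁ × E₂ →L[ℝ] V₀ × V₁ × V₂ × V₃,
      HasMFDerivAt (𝓘(ℝ, E₀).prod (𝓘(ℝ, E₁).prod 𝓘(ℝ, E₂))) 𝓘(ℝ, V₀ × V₁ × V₂ × V₃)
        (fun p : M₀ × M₁ × M₂ => (ψ₀ p.1, ψ₀₁ (φ₀ p.1, p.2.1), ψ₁₂ (p.2.1, p.2.2), ψ₂ (φ₂ p.2.2)))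
        m D ∧ ∀ w, D w = (a w.1, A (T₀ w.1, w.2.1), B (w.2.1, w.2.2), d (T₂ w.2.2)) := by
  have f₀ : HasMFDerivAt (𝓘(ℝ, E₀).prod (𝓘(ℝ, E₁).prod 𝓘(ℝ, E₂))) 𝓘(ℝ, E₀)
    (Prod.fst : M₀ × M₁ × M₂ → M₀) m (ContinuousLinearMap.fst ℝ E₀ (E₁ × E₂)) := hasMFDerivAt_fst _
  have f₁ : HasMFDerivAt (𝓘(ℝ, E₀).prod (𝓘(ℝ, E₁).prod 𝓘(ℝ, E₂))) (𝓘(ℝ, E₁).prod 𝓘(ℝ, E₂))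
    (Prod.snd : M₀ × M₁ × M₂ → M₁ × M₂) m (ContinuousLinearMap.snd ℝ E₀ (E₁ × E₂)) :=
    hasMFDerivAt_snd _
  have g₁ : HasMFDerivAt (𝓘(ℝ, E₁).prod 𝓘(ℝ, E₂)) 𝓘(ℝ, E₁)
    (Prod.fst : M₁ × M₂ → M₁) m.2 (ContinuousLinearMap.fst ℝ E₁ E₂) := hasMFDerivAt_fst _
  have g₂ : HasMFDerivAt (𝓘(ℝ, E₁).prod 𝓘(ℝ, E₂)) 𝓘(ℝ, E₂)
    (Prod.snd : M₁ × M₂ → M₂) m.2 (ContinuousLinearMap.snd ℝ E₁ E₂) := hasMFDerivAt_snd _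
  have k₀ := HasMFDerivAt.comp m ha f₀
  have k₁ := HasMFDerivAt.comp m (f := fun p : M₀ × M₁ × M₂ => (φ₀ p.1, p.2.1)) hA
    ((HasMFDerivAt.comp m hφ₀ f₀).prodMk (HasMFDerivAt.comp m g₁ f₁))
  have k₂ := HasMFDerivAt.comp m (f := fun p : M₀ × M₁ × M₂ => (p.2.1, p.2.2)) hB f₁
  have k₃ := HasMFDerivAt.comp m (f := fun p : M₀ × M₁ × M₂ => φ₂ p.2.2) hd
    (HasMFDerivAt.comp m (f := fun p : M₀ × M₁ × M₂ => p.2.2) hφ₂ (HasMFDerivAt.comp m g₂ f₁))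
  exact ⟨_, k₀.prodMk_normedSpace (k₁.prodMk_normedSpace (k₂.prodMk_normedSpace k₃)), fun w => rfl⟩

lemma hasMFDerivAt_triple {V₀ V₁ V₂ : Type*}
    [NormedAddCommGroup V₀] [NormedSpace ℝ V₀] [NormedAddCommGroup V₁] [NormedSpace ℝ V₁]
    [NormedAddCommGroup V₂] [NormedSpace ℝ V₂]
    {φ₀ : M₀ → M₀} {φ₂ : M₂ → M₂} {m : M₀ × M₂} {ψ₀ : M₀ → V₀} {ψ₀₂ : M₀ × M₂ → V₁}
    {ψ₂ : M₂ → V₂} {T₀ : E₀ →L[ℝ] E₀} {T₂ : E₂ →L[ℝ] E₂}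
    {a : E₀ →L[ℝ] V₀} {C : E₀ × E₂ →L[ℝ] V₁} {d : E₂ →L[ℝ] V₂}
    (hφ₀ : HasMFDerivAt 𝓘(ℝ, E₀) 𝓘(ℝ, E₀) φ₀ m.1 T₀)
    (hφ₂ : HasMFDerivAt 𝓘(ℝ, E₂) 𝓘(ℝ, E₂) φ₂ m.2 T₂)
    (ha : HasMFDerivAt 𝓘(ℝ, E₀) 𝓘(ℝ, V₀) ψ₀ m.1 a)
    (hC : HasMFDerivAt (𝓘(ℝ, E₀).prod 𝓘(ℝ, E₂)) 𝓘(ℝ, V₁) ψ₀₂ (φ₀ m.1, m.2) C)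
    (hd : HasMFDerivAt 𝓘(ℝ, E₂) 𝓘(ℝ, V₂) ψ₂ (φ₂ m.2) d) :
    ∃ D : E₀ × E₂ →L[ℝ] V₀ × V₁ × V₂,
      HasMFDerivAt (𝓘(ℝ, E₀).prod 𝓘(ℝ, E₂)) 𝓘(ℝ, V₀ × V₁ × V₂)
        (fun p : M₀ × M₂ => (ψ₀ p.1, ψ₀₂ (φ₀ p.1, p.2), ψ₂ (φ₂ p.2))) m D ∧
        ∀ w, D w = (a w.1, C (T₀ w.1, w.2), d (T₂ w.2)) := by
  have f₀ : HasMFDerivAt (𝓘(ℝ, E₀).prod 𝓘(ℝ, E₂)) 𝓘(ℝ, E₀)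
    (Prod.fst : M₀ × M₂ → M₀) m (ContinuousLinearMap.fst ℝ E₀ E₂) := hasMFDerivAt_fst _
  have f₂ : HasMFDerivAt (𝓘(ℝ, E₀).prod 𝓘(ℝ, E₂)) 𝓘(ℝ, E₂)
    (Prod.snd : M₀ × M₂ → M₂) m (ContinuousLinearMap.snd ℝ E₀ E₂) := hasMFDerivAt_snd _
  have k₀ := HasMFDerivAt.comp m ha f₀
  have k₁ := HasMFDerivAt.comp m (f := fun p : M₀ × M₂ => (φ₀ p.1, p.2)) hC
    ((HasMFDerivAt.comp m hφ₀ f₀).prodMk f₂)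
  have k₂ := HasMFDerivAt.comp m (f := fun p : M₀ × M₂ => φ₂ p.2) hd (HasMFDerivAt.comp m hφ₂ f₂)
  exact ⟨_, k₀.prodMk_normedSpace (k₁.prodMk_normedSpace k₂), fun w => rfl⟩

variable [FiniteDimensional ℝ E₀] [FiniteDimensional ℝ E₁] [FiniteDimensional ℝ E₂]
  [IsManifold 𝓘(ℝ, E₀) ∞ M₀] [IsManifold 𝓘(ℝ, E₁) ∞ M₁] [IsManifold 𝓘(ℝ, E₂) ∞ M₂]
  [T2Space M₀] [T2Space M₁] [T2Space M₂]
  {L₀ : Set M₀} {L₀₁ : Set (M₀ × M₁)} {L₁₂ : Set (M₁ × M₂)} {L₂ : Set M₂}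

/-- Lift the target through Q, solve the four-term linear system, and forget the middle component of
the solution: Q kills its contribution. -/
lemma QuadrupleTransversal.tripleTransversal
    {ω₀ : TwoForm 𝓘(ℝ, E₀) M₀} {ω₁ : TwoForm 𝓘(ℝ, E₁) M₁} {ω₂ : TwoForm 𝓘(ℝ, E₂) M₂}
    (hω₁ : IsSymplecticForm ω₁)
    (hL₀₁ : IsCompact L₀₁) (hL₁₂ : IsCompact L₁₂)
    (lag₀₁ : IsLagrangian (correspondenceForm ω₀ ω₁) L₀₁)
    (lag₁₂ : IsLagrangian (correspondenceForm ω₁ ω₂) L₁₂)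
    (hemb : IsEmbeddedComposition E₀ E₁ E₂ L₀₁ L₁₂) {φ₀ : M₀ → M₀} {φ₂ : M₂ → M₂}
    (hφ₀ : MDifferentiable 𝓘(ℝ, E₀) 𝓘(ℝ, E₀) φ₀) (hφ₂ : MDifferentiable 𝓘(ℝ, E₂) 𝓘(ℝ, E₂) φ₂)
    (h : QuadrupleTransversal E₀ E₁ E₂ φ₀ id φ₂ L₀ L₀₁ L₁₂ L₂) :
    TripleTransversal E₀ E₂ φ₀ φ₂ L₀ (geometricComposition L₀₁ L₁₂) L₂ := by
  rintro ⟨m₀, m₂⟩ ⟨h₀, ⟨m₁, h₀₁, h₁₂⟩, h₂⟩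
  obtain ⟨n₀, n₁, n₂, n₃, ψ₀, ψ₀₁, ψ₁₂, ψ₂, hψ₀, hψ₀₁, hψ₁₂, hψ₂, D, hD, hDs⟩ :=
    h (m₀, m₁, m₂) ⟨h₀, h₀₁, h₁₂, h₂⟩
  obtain ⟨T₀, hT₀⟩ : ∃ T : E₀ →L[ℝ] E₀, HasMFDerivAt 𝓘(ℝ, E₀) 𝓘(ℝ, E₀) φ₀ m₀ T :=
    ⟨_, (hφ₀ m₀).hasMFDerivAt⟩
  obtain ⟨T₂, hT₂⟩ : ∃ T : E₂ →L[ℝ] E₂, HasMFDerivAt 𝓘(ℝ, E₂) 𝓘(ℝ, E₂) φ₂ m₂ T :=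
    ⟨_, (hφ₂ m₂).hasMFDerivAt⟩
  obtain ⟨a, ha⟩ : ∃ a : E₀ →L[ℝ] (Fin n₀ → ℝ), HasMFDerivAt 𝓘(ℝ, E₀) 𝓘(ℝ, Fin n₀ → ℝ) ψ₀ m₀ a :=
    ⟨_, (hψ₀.contMDiffAt.mdifferentiableAt (by simp)).hasMFDerivAt⟩
  obtain ⟨A, hA⟩ : ∃ A : E₀ × E₁ →L[ℝ] (Fin n₁ → ℝ),
      HasMFDerivAt (𝓘(ℝ, E₀).prod 𝓘(ℝ, E₁)) 𝓘(ℝ, Fin n₁ → ℝ) ψ₀₁ (φ₀ m₀, m₁) A :=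
    ⟨_, (hψ₀₁.contMDiffAt.mdifferentiableAt (by simp)).hasMFDerivAt⟩
  obtain ⟨B, hB⟩ : ∃ B : E₁ × E₂ →L[ℝ] (Fin n₂ → ℝ),
      HasMFDerivAt (𝓘(ℝ, E₁).prod 𝓘(ℝ, E₂)) 𝓘(ℝ, Fin n₂ → ℝ) ψ₁₂ (m₁, m₂) B :=
    ⟨_, (hψ₁₂.contMDiffAt.mdifferentiableAt (by simp)).hasMFDerivAt⟩
  obtain ⟨d, hd⟩ : ∃ d : E₂ →L[ℝ] (Fin n₃ → ℝ),
      HasMFDerivAt 𝓘(ℝ, E₂) 𝓘(ℝ, Fin n₃ → ℝ) ψ₂ (φ₂ m₂) d :=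
    ⟨_, (hψ₂.contMDiffAt.mdifferentiableAt (by simp)).hasMFDerivAt⟩
  obtain ⟨D', hD', hDe⟩ := hasMFDerivAt_quadruple (m := (m₀, m₁, m₂)) hT₀ hT₂ ha hA hB hd
  obtain rfl : D = D' := hasMFDerivAt_unique hD hD'
  obtain ⟨r, Q, ψ₀₂, C, hQ, hQ0, hψ₀₂, hC, hCe⟩ :=
    exists_isLocalDefiningMap_geometricComposition hω₁ hL₀₁ hL₁₂ lag₀₁ lag₁₂ hemb h₀₁ h₁₂ hψ₀₁ hψ₁₂
      hA hB
  obtain ⟨D₃, hD₃, hD₃e⟩ := hasMFDerivAt_triple (m := (m₀, m₂)) hT₀ hT₂ ha hC hd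
  refine ⟨n₀, r, n₃, ψ₀, ψ₀₂, ψ₂, hψ₀, hψ₀₂, hψ₂, D₃, hD₃, ?_⟩
  rintro ⟨α, κ, β⟩
  obtain ⟨⟨κ₁, κ₂⟩, rfl⟩ := hQ κ
  obtain ⟨w, hw⟩ := hDs (α, κ₁, κ₂, β)
  have hw' := (hDe w).symm.trans hw
  simp only [Prod.mk.injEq] at hw'
  obtain ⟨w1, w2, w3, w4⟩ := hw'
  refine ⟨((w : E₀ × E₁ × E₂).1, (w : E₀ × E₁ × E₂).2.2), (hD₃e _).trans ?_⟩
  refine Prod.ext w1 (Prod.ext ?_ w4)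
  show C (T₀ (w : E₀ × E₁ × E₂).1, (w : E₀ × E₁ × E₂).2.2) = Q (κ₁, κ₂)
  rw [hCe, ← w2, ← w3]
  have e : ((A (T₀ (w : E₀ × E₁ × E₂).1, (w : E₀ × E₁ × E₂).2.1),
      B ((w : E₀ × E₁ × E₂).2.1, (w : E₀ × E₁ × E₂).2.2)) : (Fin n₁ → ℝ) × (Fin n₂ → ℝ)) =
      (A (T₀ (w : E₀ × E₁ × E₂).1, 0), B (0, (w : E₀ × E₁ × E₂).2.2)) +
      (A (0, (w : E₀ × E₁ × E₂).2.1), B ((w : E₀ × E₁ × E₂).2.1, 0)) := by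
    rw [Prod.mk_add_mk, ← map_add, ← map_add]
    simp
  rw [e, map_add, hQ0, add_zero]

end Composition

/-! ### Parametric transversality in equal dimensions -/

section Sard

open MeasureTheory

variable {E S V : Type*} [NormedAddCommGroup E] [NormedSpace ℝ E] [FiniteDimensional ℝ E]
  [NormedAddCommGroup S] [NormedSpace ℝ S] [FiniteDimensional ℝ S]
  [NormedAddCommGroup V] [NormedSpace ℝ V] [FiniteDimensional ℝ V]

/-- As dim E = dim V, the kernel of A has the dimension of S; L is a projection onto the kernel
followed by an identification with S. -/
lemma exists_equiv_prod_of_surjective (hdim : Module.finrank ℝ E = Module.finrank ℝ V)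
    {A : E × S →L[ℝ] V} (hA : Function.Surjective A) :
    ∃ (L : E × S →L[ℝ] S) (e : (E × S) ≃L[ℝ] V × S), (e : E × S →L[ℝ] V × S) = A.prod L := by
  have h1 := LinearMap.finrank_range_add_finrank_ker A.toLinearMap
  rw [LinearMap.range_eq_top.2 hA, finrank_top, Module.finrank_prod] at h1
  have h2 : Module.finrank ℝ (LinearMap.ker A.toLinearMap) = Module.finrank ℝ S := by omega
  obtain ⟨p, hp⟩ := (LinearMap.ker A.toLinearMap).subtype.exists_leftInverse_of_injective
    (Submodule.ker_subtype _)
  let l := LinearEquiv.ofFinrankEq _ _ h2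
  let L : E × S →L[ℝ] S := LinearMap.toContinuousLinearMap (l.toLinearMap ∘ₗ p)
  have hinj : Function.Injective (A.prod L).toLinearMap := by
    rw [injective_iff_map_eq_zero]
    intro z hz
    have hz1 : A z = 0 := congrArg Prod.fst hz
    have hz2 : l (p z) = 0 := congrArg Prod.snd hz
    have hz3 : p z = ⟨z, hz1⟩ := LinearMap.congr_fun hp ⟨z, hz1⟩
    rw [hz3, LinearEquiv.map_eq_zero_iff] at hz2
    exact congrArg Subtype.val hz2
  have hd : Module.finrank ℝ (E × S) = Module.finrank ℝ (V × S) := by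
    rw [Module.finrank_prod, Module.finrank_prod, hdim]
  refine ⟨L, (LinearEquiv.ofInjectiveOfFinrankEq (A.prod L).toLinearMap hinj hd).toContinuousLinearEquiv,
    ?_⟩
  ext z <;> rfl

/-- The zero set of G near the point is parametrized by S, because dim E = dim V. Its projection to
S is a differentiable map between spaces of equal dimension, so its critical values are null. At a
regular value s, the projection from the tangent space of the zero set onto S is surjective, and
then the partial derivative of G in y is onto. -/
theorem eventually_ae_surjective_fderiv_comp_inl [MeasurableSpace S] [BorelSpace S] (μ : Measure S)
    [μ.IsAddHaarMeasure] (hdim : Module.finrank ℝ E = Module.finrank ℝ V) {G : E × S → V} {y₀ : E}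
    {s₀ : S} (hG : ContDiffAt ℝ 1 G (y₀, s₀))
    (hs : Function.Surjective (fderiv ℝ G (y₀, s₀))) :
    ∃ W ∈ 𝓝 y₀, ∀ᶠ s in 𝓝 s₀ ⊓ ae μ, ∀ y ∈ W, G (y, s) = 0 →
      Function.Surjective ((fderiv ℝ G (y, s)).comp (ContinuousLinearMap.inl ℝ E S)) := by
  have : CompleteSpace E := FiniteDimensional.complete ℝ E
  have : CompleteSpace S := FiniteDimensional.complete ℝ S
  have : CompleteSpace V := FiniteDimensional.complete ℝ V
  obtain ⟨L, e, he⟩ := exists_equiv_prod_of_surjective hdim hs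
  set z₀ : E × S := (y₀, s₀) with hz₀
  set Θ : E × S → V × S := fun z => (G z, L z) with hΘ
  have hΘc : ContDiffAt ℝ 1 Θ z₀ := hG.prodMk L.contDiff.contDiffAt
  have hΘd : HasFDerivAt Θ (e : E × S →L[ℝ] V × S) z₀ := by
    rw [he]
    exact (hG.differentiableAt (by simp)).hasFDerivAt.prodMk L.hasFDerivAt
  have hΘs : HasStrictFDerivAt Θ (e : E × S →L[ℝ] V × S) z₀ := hΘc.hasStrictFDerivAt' hΘd (by simp)
  set Ξ := hΘs.localInverse Θ e z₀ with hΞ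
  have hΞc : ContDiffAt ℝ 1 Ξ (Θ z₀) := hΘc.to_localInverse hΘd (by simp)
  have hl : ∀ᶠ z in 𝓝 z₀, Ξ (Θ z) = z := hΘs.eventually_left_inverse
  have hr : ∀ᶠ w in 𝓝 (Θ z₀), Θ (Ξ w) = w := hΘs.eventually_right_inverse
  have hΞz : Ξ (Θ z₀) = z₀ := hl.self_of_nhds
  have hGd : ∀ᶠ z in 𝓝 z₀, DifferentiableAt ℝ G z :=
    (hG.eventually (by simp)).mono fun z hz => hz.differentiableAt (by simp)
  have hΞd : ∀ᶠ w in 𝓝 (Θ z₀), DifferentiableAt ℝ Ξ w :=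
    (hΞc.eventually (by simp)).mono fun z hz => hz.differentiableAt (by simp)
  have hGΞ : ∀ᶠ w in 𝓝 (Θ z₀), DifferentiableAt ℝ G (Ξ w) :=
    hΞc.continuousAt.eventually (by rwa [hΞz])
  have hgood : ∀ᶠ w in 𝓝 (Θ z₀), DifferentiableAt ℝ Ξ w ∧ DifferentiableAt ℝ G (Ξ w) ∧
      ∀ᶠ w' in 𝓝 w, Θ (Ξ w') = w' := hΞd.and (hGΞ.and (eventually_eventually_nhds.2 hr))
  have hsurj : ∀ᶠ z in 𝓝 z₀, Function.Surjective (fderiv ℝ G z) :=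
    (hG.continuousAt_fderiv (by simp)).eventually (eventually_surjective hs)
  -- The inverse Ξ of (G, L) parametrizes the zero set by t ↦ Ξ (0, t), and σ is the projection of
  -- that set to the parameters.
  set σ : S → S := fun t => (Ξ (0, t)).2 with hσ
  set N : Set S := {t | DifferentiableAt ℝ Ξ (0, t) ∧ DifferentiableAt ℝ G (Ξ (0, t)) ∧
      ∀ᶠ w' in 𝓝 ((0, t) : V × S), Θ (Ξ w') = w'} with hN
  have hΞ' : ∀ t ∈ N, HasFDerivAt (fun t => Ξ (0, t))
      ((fderiv ℝ Ξ (0, t)).comp (ContinuousLinearMap.inr ℝ V S)) t := fun t ht =>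
    HasFDerivAt.comp t (show HasFDerivAt Ξ _ ((0 : V), t) from ht.1.hasFDerivAt)
      (hasFDerivAt_prodMk_right (0 : V) t)
  have hσ' : ∀ t ∈ N, HasFDerivAt σ ((ContinuousLinearMap.snd ℝ E S).comp
      ((fderiv ℝ Ξ (0, t)).comp (ContinuousLinearMap.inr ℝ V S))) t := fun t ht =>
    (ContinuousLinearMap.snd ℝ E S).hasFDerivAt.comp t (hΞ' t ht)
  have hnull : μ (σ '' {t ∈ N | ((ContinuousLinearMap.snd ℝ E S).comp
      ((fderiv ℝ Ξ (0, t)).comp (ContinuousLinearMap.inr ℝ V S))).det = 0}) = 0 :=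
    addHaar_image_eq_zero_of_det_fderivWithin_eq_zero μ
      (fun t ht => (hσ' t ht.1).hasFDerivWithinAt) (fun t ht => ht.2)
  have hΘcont : ContinuousAt Θ z₀ := hΘc.continuousAt
  obtain ⟨W, hW, T, hT, hWT⟩ := mem_nhds_prod_iff.1
    (hl.and ((hΘcont.eventually hgood).and hsurj))
  refine ⟨W, hW, ?_⟩
  filter_upwards [Filter.mem_inf_of_left hT,
    Filter.mem_inf_of_right (compl_mem_ae_iff.2 hnull)] with s hsT hsB y hy hGys
  obtain ⟨h1, h2, h3⟩ := hWT (mk_mem_prod hy hsT)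
  have hΘz : Θ (y, s) = (0, L (y, s)) := Prod.ext hGys rfl
  rw [hΘz] at h1 h2
  have hdet : ((ContinuousLinearMap.snd ℝ E S).comp
      ((fderiv ℝ Ξ (0, L (y, s))).comp (ContinuousLinearMap.inr ℝ V S))).det ≠ 0 := fun hd =>
    hsB ⟨L (y, s), ⟨h2, hd⟩, congrArg Prod.snd h1⟩
  have hσs : Function.Surjective ((ContinuousLinearMap.snd ℝ E S).comp
      ((fderiv ℝ Ξ (0, L (y, s))).comp (ContinuousLinearMap.inr ℝ V S))) :=
    (LinearMap.equivOfDetNeZero _ hdet).surjective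
  have hzero : (fderiv ℝ G (y, s)).comp
      ((fderiv ℝ Ξ (0, L (y, s))).comp (ContinuousLinearMap.inr ℝ V S)) = 0 := by
    have k1 := HasFDerivAt.comp (L (y, s)) (f := fun t => Ξ (0, t)) (g := G)
      (by rw [h1]; rw [h1] at h2; exact h2.2.1.hasFDerivAt) (hΞ' _ h2)
    refine k1.unique ((hasFDerivAt_const (0 : V) (L (y, s))).congr_of_eventuallyEq ?_)
    have hc : ContinuousAt (fun t : S => ((0, t) : V × S)) (L (y, s)) := by fun_prop
    filter_upwards [hc.eventually h2.2.2] with t ht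
    exact congrArg Prod.fst ht
  intro v
  obtain ⟨⟨a, b⟩, hab⟩ := h3 v
  obtain ⟨τ, hτ⟩ := hσs b
  have hz := congrArg (fun l : S →L[ℝ] V => l τ) hzero
  -- The vector c is tangent to the zero set and has S-component b. Subtracting it from (a, b)
  -- removes the S-component without changing the value of dG.
  set c := ((fderiv ℝ Ξ (0, L (y, s))).comp (ContinuousLinearMap.inr ℝ V S)) τ with hc
  have hc2 : c.2 = b := hτ
  refine ⟨a - c.1, ?_⟩
  have : ((a - c.1, 0) : E × S) = (a, b) - c := Prod.ext rfl (by simp [hc2])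
  show fderiv ℝ G (y, s) (a - c.1, 0) = v
  rw [this, map_sub, hab]
  exact (congrArg (v - ·) hz).trans (sub_zero v)

end Sard

lemma exists_hasMFDerivAt_of_chart {E : Type*} [NormedAddCommGroup E] [NormedSpace ℝ E]
    {H : Type*} [TopologicalSpace H] {I : ModelWithCorners ℝ E H} [I.Boundaryless]
    {M : Type*} [TopologicalSpace M] [ChartedSpace H M] [IsManifold I 1 M]
    {V : Type*} [NormedAddCommGroup V] [NormedSpace ℝ V] {g : M → V} {c m : M}
    (hm : m ∈ (extChartAt I c).source) {L : E →L[ℝ] V}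
    (h : HasFDerivAt (fun y => g ((extChartAt I c).symm y)) L (extChartAt I c m))
    (hs : Function.Surjective L) :
    ∃ D : E →L[ℝ] V, HasMFDerivAt I 𝓘(ℝ, V) g m D ∧ Function.Surjective D := by
  have h1 : HasMFDerivAt 𝓘(ℝ, E) 𝓘(ℝ, V) (fun y => g ((extChartAt I c).symm y))
    (extChartAt I c m) L := hasMFDerivAt_iff_hasFDerivAt.2 h
  have h2 := HasMFDerivAt.comp m h1 (hasMFDerivAt_extChartAt_of_mem hm)
  refine ⟨_, h2.congr_of_eventuallyEq ?_, ?_⟩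
  · filter_upwards [extChartAt_source_mem_nhds' (I := I) hm] with z hz
    exact (congrArg g ((extChartAt I c).left_inv hz)).symm
  · intro v
    obtain ⟨w, hw⟩ := hs v
    exact ⟨_, (congrArg L (mfderiv_mfderiv_extChartAt_symm hm w)).trans hw⟩

/-! ### The four-term system for families of flows -/

section Family

variable {E : Type*} [NormedAddCommGroup E] [NormedSpace ℝ E]
  {M : Type*} [TopologicalSpace M] [ChartedSpace E M]
  {P : Type*} [TopologicalSpace P] {S : Type*} [NormedAddCommGroup S] [NormedSpace ℝ S]
  {Φ : P → M → S → M} {p : P} {x : M} {s : S}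

lemma MJointC1At.comp_param {Q : Type*} [TopologicalSpace Q] {u : Q → P} {q : Q}
    (h : MJointC1At E Φ (u q) x s) (hu : ContinuousAt u q) :
    MJointC1At E (fun q x s => Φ (u q) x s) q x s :=
  ⟨ContinuousAt.comp (g := fun r : P × M × S => Φ r.1 r.2.1 r.2.2)
    (f := fun r : Q × M × S => (u r.1, r.2)) h.continuousAt
    ((ContinuousAt.comp (g := u) (f := Prod.fst) (x := (q, x, s)) hu continuousAt_fst).prodMk
      continuousAt_snd), h.jointC1At.comp_param hu⟩

lemma MJointC1At.mdifferentiableAt (h : MJointC1At E Φ p x s) :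
    MDifferentiableAt 𝓘(ℝ, E) 𝓘(ℝ, E) (fun x => Φ p x s) x := by
  have hc : ContinuousAt (fun y => Φ p y s) x :=
    ContinuousAt.comp (g := fun r : P × M × S => Φ r.1 r.2.1 r.2.2)
      (f := fun y : M => (p, y, s)) h.continuousAt (by fun_prop)
  have hd := h.jointC1At.differentiableAt.self_of_nhds
  have := HasFDerivAt.comp (extChartAt 𝓘(ℝ, E) x x) (f := fun y : E => (y, s)) hd.hasFDerivAt
    (hasFDerivAt_prodMk_left _ _)
  exact HasMFDerivAt.mdifferentiableAt ⟨hc, this.hasFDerivWithinAt⟩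

lemma MJointC1At.hasMFDerivAt_param (h : MJointC1At E Φ p x s) :
    HasMFDerivAt 𝓘(ℝ, S) 𝓘(ℝ, E) (fun r => Φ p x r) s
      (fderiv ℝ (fun r => extChartAt 𝓘(ℝ, E) (Φ p x s) (Φ p x r)) s) := by
  have hc : ContinuousAt (fun r => Φ p x r) s :=
    ContinuousAt.comp (g := fun r : P × M × S => Φ r.1 r.2.1 r.2.2)
      (f := fun r : S => (p, x, r)) h.continuousAt (by fun_prop)
  have hd := hasFDerivAt_chartFamily_param (mem_extChartAt_source x)
    h.jointC1At.differentiableAt.self_of_nhds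
  exact ⟨hc, hd.differentiableAt.hasFDerivAt.hasFDerivWithinAt⟩

end Family

lemma JointC1At.of_clm {P E F : Type*} [TopologicalSpace P] [NormedAddCommGroup E]
    [NormedSpace ℝ E] [NormedAddCommGroup F] [NormedSpace ℝ F] {p : P} {x : E} (ℓ : E →L[ℝ] F) :
    JointC1At (fun _ : P => ⇑ℓ) p x :=
  .of_contDiffAt ℓ.contDiff.contDiffAt

section Quadruple

variable {E₀ E₁ E₂ : Type*}
  [NormedAddCommGroup E₀] [NormedSpace ℝ E₀] [NormedAddCommGroup E₁] [NormedSpace ℝ E₁]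
  [NormedAddCommGroup E₂] [NormedSpace ℝ E₂]
  {M₀ M₁ M₂ : Type*}
  [TopologicalSpace M₀] [ChartedSpace E₀ M₀] [TopologicalSpace M₁] [ChartedSpace E₁ M₁]
  [TopologicalSpace M₂] [ChartedSpace E₂ M₂]
  {P : Type*} [TopologicalSpace P]
  {S₀ S₂ : Type*} [NormedAddCommGroup S₀] [NormedSpace ℝ S₀] [NormedAddCommGroup S₂]
  [NormedSpace ℝ S₂]
  {V₀ V₁ V₂ V₃ : Type*}
  [NormedAddCommGroup V₀] [NormedSpace ℝ V₀] [NormedAddCommGroup V₁] [NormedSpace ℝ V₁]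
  [NormedAddCommGroup V₂] [NormedSpace ℝ V₂] [NormedAddCommGroup V₃] [NormedSpace ℝ V₃]

/-- The left hand side of the defining equations of the quadruple fibre product. -/
def quadMap (ψ₀ : M₀ → V₀) (ψ₀₁ : M₀ × M₁ → V₁) (ψ₁₂ : M₁ × M₂ → V₂) (ψ₂ : M₂ → V₃)
    (φ₀ : M₀ → M₀) (φ₂ : M₂ → M₂) (m : M₀ × M₁ × M₂) : V₀ × V₁ × V₂ × V₃ :=
  (ψ₀ m.1, ψ₀₁ (φ₀ m.1, m.2.1), ψ₁₂ (m.2.1, m.2.2), ψ₂ (φ₂ m.2.2))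

/-- The defining equations of the quadruple fibre product for a family of maps, in the chart at `c`. -/
def quadChart (ψ₀ : M₀ → V₀) (ψ₀₁ : M₀ × M₁ → V₁) (ψ₁₂ : M₁ × M₂ → V₂) (ψ₂ : M₂ → V₃)
    (Φ₀ : P → M₀ → S₀ → M₀) (Φ₂ : P → M₂ → S₂ → M₂) (c : M₀ × M₁ × M₂) (p : P)
    (z : (E₀ × E₁ × E₂) × (S₀ × S₂)) : V₀ × V₁ × V₂ × V₃ :=
  quadMap ψ₀ ψ₀₁ ψ₁₂ ψ₂ (fun x => Φ₀ p x z.2.1) (fun x => Φ₂ p x z.2.2)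
    ((extChartAt (𝓘(ℝ, E₀).prod (𝓘(ℝ, E₁).prod 𝓘(ℝ, E₂))) c).symm z.1)

variable [IsManifold 𝓘(ℝ, E₀) ∞ M₀] [IsManifold 𝓘(ℝ, E₁) ∞ M₁] [IsManifold 𝓘(ℝ, E₂) ∞ M₂]
  {ψ₀ : M₀ → V₀} {ψ₀₁ : M₀ × M₁ → V₁} {ψ₁₂ : M₁ × M₂ → V₂} {ψ₂ : M₂ → V₃}
  {Φ₀ : P → M₀ → S₀ → M₀} {Φ₂ : P → M₂ → S₂ → M₂} {c m : M₀ × M₁ × M₂} {p : P} {s : S₀ × S₂}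

omit [TopologicalSpace P] [NormedAddCommGroup S₀] [NormedSpace ℝ S₀] [NormedAddCommGroup S₂]
  [NormedSpace ℝ S₂] in
lemma contDiffAt_comp_extChartAt_symm {E : Type*} [NormedAddCommGroup E] [NormedSpace ℝ E]
    {M : Type*} [TopologicalSpace M] [ChartedSpace E M] [IsManifold 𝓘(ℝ, E) ∞ M]
    {V : Type*} [NormedAddCommGroup V] [NormedSpace ℝ V] {ψ : M → V} {c x : M}
    (hx : x ∈ (extChartAt 𝓘(ℝ, E) c).source) (h : ContMDiffAt 𝓘(ℝ, E) 𝓘(ℝ, V) ∞ ψ x) :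
    ContDiffAt ℝ 1 (fun y => ψ ((extChartAt 𝓘(ℝ, E) c).symm y)) (extChartAt 𝓘(ℝ, E) c x) := by
  have h1 : ContMDiffAt 𝓘(ℝ, E) 𝓘(ℝ, E) ∞ (extChartAt 𝓘(ℝ, E) c).symm (extChartAt 𝓘(ℝ, E) c x) :=
    (contMDiffOn_extChartAt_symm c).contMDiffAt ((isOpen_extChartAt_target c).mem_nhds
      ((extChartAt 𝓘(ℝ, E) c).map_source hx))
  have h2 : ContMDiffAt 𝓘(ℝ, E) 𝓘(ℝ, V) ∞ (fun y => ψ ((extChartAt 𝓘(ℝ, E) c).symm y))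
      (extChartAt 𝓘(ℝ, E) c x) :=
    ContMDiffAt.comp (extChartAt 𝓘(ℝ, E) c x) (g := ψ)
      (by rwa [(extChartAt 𝓘(ℝ, E) c).left_inv hx]) h1
  exact h2.contDiffAt.of_le (by simp)

lemma contDiffAt_comp_extChartAt_symm_prod {E E' : Type*} [NormedAddCommGroup E] [NormedSpace ℝ E]
    [NormedAddCommGroup E'] [NormedSpace ℝ E']
    {M M' : Type*} [TopologicalSpace M] [ChartedSpace E M] [IsManifold 𝓘(ℝ, E) ∞ M]
    [TopologicalSpace M'] [ChartedSpace E' M'] [IsManifold 𝓘(ℝ, E') ∞ M']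
    {V : Type*} [NormedAddCommGroup V] [NormedSpace ℝ V] {ψ : M × M' → V} {c x : M} {c' x' : M'}
    (hx : x ∈ (extChartAt 𝓘(ℝ, E) c).source) (hx' : x' ∈ (extChartAt 𝓘(ℝ, E') c').source)
    (h : ContMDiffAt (𝓘(ℝ, E).prod 𝓘(ℝ, E')) 𝓘(ℝ, V) ∞ ψ (x, x')) :
    ContDiffAt ℝ 1 (fun y : E × E' => ψ ((extChartAt 𝓘(ℝ, E) c).symm y.1,
      (extChartAt 𝓘(ℝ, E') c').symm y.2)) (extChartAt 𝓘(ℝ, E) c x, extChartAt 𝓘(ℝ, E') c' x') := by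
  have h1 : ContMDiffAt 𝓘(ℝ, E) 𝓘(ℝ, E) ∞ (extChartAt 𝓘(ℝ, E) c).symm (extChartAt 𝓘(ℝ, E) c x) :=
    (contMDiffOn_extChartAt_symm c).contMDiffAt ((isOpen_extChartAt_target c).mem_nhds
      ((extChartAt 𝓘(ℝ, E) c).map_source hx))
  have h1' : ContMDiffAt 𝓘(ℝ, E') 𝓘(ℝ, E') ∞ (extChartAt 𝓘(ℝ, E') c').symm
      (extChartAt 𝓘(ℝ, E') c' x') :=
    (contMDiffOn_extChartAt_symm c').contMDiffAt ((isOpen_extChartAt_target c').mem_nhds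
      ((extChartAt 𝓘(ℝ, E') c').map_source hx'))
  have k1 : ContMDiffAt 𝓘(ℝ, E × E') 𝓘(ℝ, E) ∞
      (fun y : E × E' => (extChartAt 𝓘(ℝ, E) c).symm y.1)
      (extChartAt 𝓘(ℝ, E) c x, extChartAt 𝓘(ℝ, E') c' x') :=
    ContMDiffAt.comp (I' := 𝓘(ℝ, E)) (extChartAt 𝓘(ℝ, E) c x, extChartAt 𝓘(ℝ, E') c' x')
      (f := Prod.fst) h1 contDiff_fst.contMDiff.contMDiffAt
  have k1' : ContMDiffAt 𝓘(ℝ, E × E') 𝓘(ℝ, E') ∞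
      (fun y : E × E' => (extChartAt 𝓘(ℝ, E') c').symm y.2)
      (extChartAt 𝓘(ℝ, E) c x, extChartAt 𝓘(ℝ, E') c' x') :=
    ContMDiffAt.comp (I' := 𝓘(ℝ, E')) (extChartAt 𝓘(ℝ, E) c x, extChartAt 𝓘(ℝ, E') c' x')
      (f := Prod.snd) h1' contDiff_snd.contMDiff.contMDiffAt
  have h2 : ContMDiffAt 𝓘(ℝ, E × E') 𝓘(ℝ, V) ∞
      (fun y : E × E' => ψ ((extChartAt 𝓘(ℝ, E) c).symm y.1, (extChartAt 𝓘(ℝ, E') c').symm y.2))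
      (extChartAt 𝓘(ℝ, E) c x, extChartAt 𝓘(ℝ, E') c' x') :=
    ContMDiffAt.comp (extChartAt 𝓘(ℝ, E) c x, extChartAt 𝓘(ℝ, E') c' x') (g := ψ)
      (f := fun y : E × E' => ((extChartAt 𝓘(ℝ, E) c).symm y.1, (extChartAt 𝓘(ℝ, E') c').symm y.2))
      (by simpa only [(extChartAt 𝓘(ℝ, E) c).left_inv hx, (extChartAt 𝓘(ℝ, E') c').left_inv hx']
        using h) (k1.prodMk k1')
  exact h2.contDiffAt.of_le (by simp)

lemma jointC1At_quadChart
    (hm₀ : m.1 ∈ (extChartAt 𝓘(ℝ, E₀) c.1).source)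
    (hm₁ : m.2.1 ∈ (extChartAt 𝓘(ℝ, E₁) c.2.1).source)
    (hm₂ : m.2.2 ∈ (extChartAt 𝓘(ℝ, E₂) c.2.2).source)
    (hΦ₀ : MJointC1At E₀ Φ₀ p m.1 s.1) (hΦ₂ : MJointC1At E₂ Φ₂ p m.2.2 s.2)
    (h₀ : ContMDiffAt 𝓘(ℝ, E₀) 𝓘(ℝ, V₀) ∞ ψ₀ m.1)
    (h₀₁ : ContMDiffAt (𝓘(ℝ, E₀).prod 𝓘(ℝ, E₁)) 𝓘(ℝ, V₁) ∞ ψ₀₁ (Φ₀ p m.1 s.1, m.2.1))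
    (h₁₂ : ContMDiffAt (𝓘(ℝ, E₁).prod 𝓘(ℝ, E₂)) 𝓘(ℝ, V₂) ∞ ψ₁₂ (m.2.1, m.2.2))
    (h₂ : ContMDiffAt 𝓘(ℝ, E₂) 𝓘(ℝ, V₃) ∞ ψ₂ (Φ₂ p m.2.2 s.2)) :
    JointC1At (quadChart (E₀ := E₀) (E₁ := E₁) (E₂ := E₂) ψ₀ ψ₀₁ ψ₁₂ ψ₂ Φ₀ Φ₂ c) p
      ((extChartAt 𝓘(ℝ, E₀) c.1 m.1, extChartAt 𝓘(ℝ, E₁) c.2.1 m.2.1,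
        extChartAt 𝓘(ℝ, E₂) c.2.2 m.2.2), s) := by
  set z : (E₀ × E₁ × E₂) × (S₀ × S₂) := ((extChartAt 𝓘(ℝ, E₀) c.1 m.1,
    extChartAt 𝓘(ℝ, E₁) c.2.1 m.2.1, extChartAt 𝓘(ℝ, E₂) c.2.2 m.2.2), s) with hz
  set x₀ := Φ₀ p m.1 s.1 with hx₀
  set x₂ := Φ₂ p m.2.2 s.2 with hx₂
  let ℓ₀ : (E₀ × E₁ × E₂) × (S₀ × S₂) →L[ℝ] E₀ :=
    (ContinuousLinearMap.fst ℝ E₀ (E₁ × E₂)).comp (ContinuousLinearMap.fst ℝ _ _)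
  let ℓ₁ : (E₀ × E₁ × E₂) × (S₀ × S₂) →L[ℝ] E₁ := (ContinuousLinearMap.fst ℝ E₁ E₂).comp
    ((ContinuousLinearMap.snd ℝ E₀ (E₁ × E₂)).comp (ContinuousLinearMap.fst ℝ _ _))
  let ℓ₂ : (E₀ × E₁ × E₂) × (S₀ × S₂) →L[ℝ] E₂ := (ContinuousLinearMap.snd ℝ E₁ E₂).comp
    ((ContinuousLinearMap.snd ℝ E₀ (E₁ × E₂)).comp (ContinuousLinearMap.fst ℝ _ _))
  let r₀ : (E₀ × E₁ × E₂) × (S₀ × S₂) →L[ℝ] S₀ :=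
    (ContinuousLinearMap.fst ℝ S₀ S₂).comp (ContinuousLinearMap.snd ℝ _ _)
  let r₂ : (E₀ × E₁ × E₂) × (S₀ × S₂) →L[ℝ] S₂ :=
    (ContinuousLinearMap.snd ℝ S₀ S₂).comp (ContinuousLinearMap.snd ℝ _ _)
  have e₀ : (extChartAt 𝓘(ℝ, E₀) c.1).symm (ℓ₀ z) = m.1 := (extChartAt 𝓘(ℝ, E₀) c.1).left_inv hm₀
  have e₂ : (extChartAt 𝓘(ℝ, E₂) c.2.2).symm (ℓ₂ z) = m.2.2 :=
    (extChartAt 𝓘(ℝ, E₂) c.2.2).left_inv hm₂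
  have f₀ : JointC1At (fun p w => chartFamily Φ₀ c.1 x₀ p (ℓ₀ w, r₀ w)) p z :=
    JointC1At.comp (h := chartFamily Φ₀ c.1 x₀) (g := fun _ w => (ℓ₀ w, r₀ w))
      (hΦ₀.jointC1At_charts hm₀ (mem_extChartAt_source x₀)) (.of_clm (ℓ₀.prod r₀))
  have f₂ : JointC1At (fun p w => chartFamily Φ₂ c.2.2 x₂ p (ℓ₂ w, r₂ w)) p z :=
    JointC1At.comp (h := chartFamily Φ₂ c.2.2 x₂) (g := fun _ w => (ℓ₂ w, r₂ w))
      (hΦ₂.jointC1At_charts hm₂ (mem_extChartAt_source x₂)) (.of_clm (ℓ₂.prod r₂))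
  have v₀ : chartFamily Φ₀ c.1 x₀ p (ℓ₀ z, r₀ z) = extChartAt 𝓘(ℝ, E₀) x₀ x₀ := by
    rw [chartFamily, e₀]; rfl
  have v₂ : chartFamily Φ₂ c.2.2 x₂ p (ℓ₂ z, r₂ z) = extChartAt 𝓘(ℝ, E₂) x₂ x₂ := by
    rw [chartFamily, e₂]; rfl
  have k₀ := JointC1At.comp (p₀ := p) (x₀ := z) (g := fun _ => ℓ₀)
    (.of_contDiffAt (contDiffAt_comp_extChartAt_symm hm₀ h₀)) (.of_clm ℓ₀)
  have k₁ := JointC1At.comp (p₀ := p) (x₀ := z)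
    (g := fun p w => (chartFamily Φ₀ c.1 x₀ p (ℓ₀ w, r₀ w), ℓ₁ w))
    (.of_contDiffAt (by
      rw [v₀]
      exact contDiffAt_comp_extChartAt_symm_prod (mem_extChartAt_source x₀) hm₁ h₀₁))
    (f₀.prodMk (.of_clm ℓ₁))
  have k₂ := JointC1At.comp (p₀ := p) (x₀ := z) (g := fun _ w => (ℓ₁ w, ℓ₂ w))
    (.of_contDiffAt (contDiffAt_comp_extChartAt_symm_prod hm₁ hm₂ h₁₂)) (.of_clm (ℓ₁.prod ℓ₂))
  have k₃ := JointC1At.comp (p₀ := p) (x₀ := z)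
    (g := fun p w => chartFamily Φ₂ c.2.2 x₂ p (ℓ₂ w, r₂ w))
    (.of_contDiffAt (by
      rw [v₂]
      exact contDiffAt_comp_extChartAt_symm (mem_extChartAt_source x₂) h₂)) f₂
  refine (k₀.prodMk (k₁.prodMk (k₂.prodMk k₃))).congr ?_
  have n₀ := eventually_mem_source hΦ₀.continuousAt hm₀ (mem_extChartAt_source x₀)
  have n₂ := eventually_mem_source hΦ₂.continuousAt hm₂ (mem_extChartAt_source x₂)
  have t₀ : Continuous fun q : P × ((E₀ × E₁ × E₂) × (S₀ × S₂)) => (q.1, (q.2.1.1, q.2.2.1)) := by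
    fun_prop
  have t₂ : Continuous fun q : P × ((E₀ × E₁ × E₂) × (S₀ × S₂)) =>
      (q.1, (q.2.1.2.2, q.2.2.2)) := by
    fun_prop
  filter_upwards [(t₀.tendsto (p, z)).eventually n₀, (t₂.tendsto (p, z)).eventually n₂]
    with q hq₀ hq₂
  have a₀ := (extChartAt 𝓘(ℝ, E₀) x₀).left_inv hq₀
  have a₂ := (extChartAt 𝓘(ℝ, E₂) x₂).left_inv hq₂
  refine Prod.ext rfl (Prod.ext ?_ (Prod.ext rfl ?_))
  · exact congrArg (fun y => ψ₀₁ (y, _)) a₀.symm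
  · exact congrArg ψ₂ a₂.symm

end Quadruple

section Quadruple

variable {E₀ E₁ E₂ : Type*}
  [NormedAddCommGroup E₀] [NormedSpace ℝ E₀] [NormedAddCommGroup E₁] [NormedSpace ℝ E₁]
  [NormedAddCommGroup E₂] [NormedSpace ℝ E₂]
  {M₀ M₁ M₂ : Type*}
  [TopologicalSpace M₀] [ChartedSpace E₀ M₀] [TopologicalSpace M₁] [ChartedSpace E₁ M₁]
  [TopologicalSpace M₂] [ChartedSpace E₂ M₂]
  {P : Type*} [TopologicalSpace P]
  {S₀ S₂ : Type*} [NormedAddCommGroup S₀] [NormedSpace ℝ S₀] [NormedAddCommGroup S₂]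
  [NormedSpace ℝ S₂]
  {n₀ n₁ n₂ n₃ : ℕ}
  {L₀ : Set M₀} {L₀₁ : Set (M₀ × M₁)} {L₁₂ : Set (M₁ × M₂)} {L₂ : Set M₂}
  {ψ₀ : M₀ → (Fin n₀ → ℝ)} {ψ₀₁ : M₀ × M₁ → (Fin n₁ → ℝ)} {ψ₁₂ : M₁ × M₂ → (Fin n₂ → ℝ)}
  {ψ₂ : M₂ → (Fin n₃ → ℝ)} {φ₀ : M₀ → M₀} {φ₂ : M₂ → M₂}
  {Φ₀ : P → M₀ → S₀ → M₀} {Φ₂ : P → M₂ → S₂ → M₂} {c m : M₀ × M₁ × M₂} {p : P} {s : S₀ × S₂}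

variable (E₀ E₁ E₂) in
/-- The `ψ`s are local defining maps of the `L`s near the points that occur in the defining equations
of the quadruple fibre product at `m`. -/
structure IsDefiningAt (L₀ : Set M₀) (L₀₁ : Set (M₀ × M₁)) (L₁₂ : Set (M₁ × M₂)) (L₂ : Set M₂)
    (ψ₀ : M₀ → (Fin n₀ → ℝ)) (ψ₀₁ : M₀ × M₁ → (Fin n₁ → ℝ)) (ψ₁₂ : M₁ × M₂ → (Fin n₂ → ℝ))
    (ψ₂ : M₂ → (Fin n₃ → ℝ)) (φ₀ : M₀ → M₀) (φ₂ : M₂ → M₂) (m : M₀ × M₁ × M₂) : Prop where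
  left : IsLocalDefiningMap 𝓘(ℝ, E₀) L₀ m.1 ψ₀
  midLeft : IsLocalDefiningMap (𝓘(ℝ, E₀).prod 𝓘(ℝ, E₁)) L₀₁ (φ₀ m.1, m.2.1) ψ₀₁
  midRight : IsLocalDefiningMap (𝓘(ℝ, E₁).prod 𝓘(ℝ, E₂)) L₁₂ (m.2.1, m.2.2) ψ₁₂
  right : IsLocalDefiningMap 𝓘(ℝ, E₂) L₂ (φ₂ m.2.2) ψ₂

variable (E₀ E₁ E₂) in
/-- The defining equations of the quadruple fibre product are transversal at `m`. -/
def QuadrupleTransversalAt (L₀ : Set M₀) (L₀₁ : Set (M₀ × M₁)) (L₁₂ : Set (M₁ × M₂)) (L₂ : Set M₂)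
    (φ₀ : M₀ → M₀) (φ₂ : M₂ → M₂) (m : M₀ × M₁ × M₂) : Prop :=
  ∃ (n₀ n₁ n₂ n₃ : ℕ) (ψ₀ : M₀ → (Fin n₀ → ℝ)) (ψ₀₁ : M₀ × M₁ → (Fin n₁ → ℝ))
    (ψ₁₂ : M₁ × M₂ → (Fin n₂ → ℝ)) (ψ₂ : M₂ → (Fin n₃ → ℝ)),
    IsDefiningAt E₀ E₁ E₂ L₀ L₀₁ L₁₂ L₂ ψ₀ ψ₀₁ ψ₁₂ ψ₂ φ₀ φ₂ m ∧
    ∃ D : E₀ × E₁ × E₂ →L[ℝ] (Fin n₀ → ℝ) × (Fin n₁ → ℝ) × (Fin n₂ → ℝ) × (Fin n₃ → ℝ),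
      HasMFDerivAt (𝓘(ℝ, E₀).prod (𝓘(ℝ, E₁).prod 𝓘(ℝ, E₂)))
        𝓘(ℝ, (Fin n₀ → ℝ) × (Fin n₁ → ℝ) × (Fin n₂ → ℝ) × (Fin n₃ → ℝ))
        (quadMap ψ₀ ψ₀₁ ψ₁₂ ψ₂ φ₀ φ₂) m D ∧ Function.Surjective D

lemma quadrupleTransversal_of_forall
    (h : ∀ m ∈ perturbedQuadruple φ₀ id φ₂ L₀ L₀₁ L₁₂ L₂,
      QuadrupleTransversalAt E₀ E₁ E₂ L₀ L₀₁ L₁₂ L₂ φ₀ φ₂ m) :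
    QuadrupleTransversal E₀ E₁ E₂ φ₀ id φ₂ L₀ L₀₁ L₁₂ L₂ := by
  intro m hm
  obtain ⟨n₀, n₁, n₂, n₃, ψ₀, ψ₀₁, ψ₁₂, ψ₂, hψ, D, hD, hDs⟩ := h m hm
  exact ⟨n₀, n₁, n₂, n₃, ψ₀, ψ₀₁, ψ₁₂, ψ₂, hψ.1, hψ.2, hψ.3, hψ.4, D, hD, hDs⟩

lemma QuadrupleTransversal.transversalAt (h : QuadrupleTransversal E₀ E₁ E₂ φ₀ id φ₂ L₀ L₀₁ L₁₂ L₂)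
    (hm : m ∈ perturbedQuadruple φ₀ id φ₂ L₀ L₀₁ L₁₂ L₂) :
    QuadrupleTransversalAt E₀ E₁ E₂ L₀ L₀₁ L₁₂ L₂ φ₀ φ₂ m := by
  obtain ⟨n₀, n₁, n₂, n₃, ψ₀, ψ₀₁, ψ₁₂, ψ₂, h1, h2, h3, h4, D, hD, hDs⟩ := h m hm
  exact ⟨n₀, n₁, n₂, n₃, ψ₀, ψ₀₁, ψ₁₂, ψ₂, ⟨h1, h2, h3, h4⟩, D, hD, hDs⟩

lemma IsDefiningAt.quadMap_eq_zero
    (h : IsDefiningAt E₀ E₁ E₂ L₀ L₀₁ L₁₂ L₂ ψ₀ ψ₀₁ ψ₁₂ ψ₂ φ₀ φ₂ m)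
    (hm : m ∈ perturbedQuadruple φ₀ id φ₂ L₀ L₀₁ L₁₂ L₂) : quadMap ψ₀ ψ₀₁ ψ₁₂ ψ₂ φ₀ φ₂ m = 0 :=
  Prod.ext (h.left.eventually_eq_zero.self_of_nhds.1 hm.1)
    (Prod.ext (h.midLeft.eventually_eq_zero.self_of_nhds.1 hm.2.1)
      (Prod.ext (h.midRight.eventually_eq_zero.self_of_nhds.1 hm.2.2.1)
        (h.right.eventually_eq_zero.self_of_nhds.1 hm.2.2.2)))

lemma IsDefiningAt.eventually (hΦ₀ : MJointC1At E₀ Φ₀ p m.1 s.1) (hΦ₂ : MJointC1At E₂ Φ₂ p m.2.2 s.2)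
    (h : IsDefiningAt E₀ E₁ E₂ L₀ L₀₁ L₁₂ L₂ ψ₀ ψ₀₁ ψ₁₂ ψ₂ (fun x => Φ₀ p x s.1)
      (fun x => Φ₂ p x s.2) m) :
    ∀ᶠ q in 𝓝 (p, m, s), IsDefiningAt E₀ E₁ E₂ L₀ L₀₁ L₁₂ L₂ ψ₀ ψ₀₁ ψ₁₂ ψ₂
      (fun x => Φ₀ q.1 x q.2.2.1) (fun x => Φ₂ q.1 x q.2.2.2) q.2.1 := by
  have c₀ : ContinuousAt (fun q : P × (M₀ × M₁ × M₂) × (S₀ × S₂) =>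
      Φ₀ q.1 q.2.1.1 q.2.2.1) (p, m, s) :=
    ContinuousAt.comp (g := fun r : P × M₀ × S₀ => Φ₀ r.1 r.2.1 r.2.2)
      (f := fun q : P × (M₀ × M₁ × M₂) × (S₀ × S₂) => (q.1, q.2.1.1, q.2.2.1)) hΦ₀.continuousAt
      (by fun_prop)
  have c₂ : ContinuousAt (fun q : P × (M₀ × M₁ × M₂) × (S₀ × S₂) =>
      Φ₂ q.1 q.2.1.2.2 q.2.2.2) (p, m, s) :=
    ContinuousAt.comp (g := fun r : P × M₂ × S₂ => Φ₂ r.1 r.2.1 r.2.2)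
      (f := fun q : P × (M₀ × M₁ × M₂) × (S₀ × S₂) => (q.1, q.2.1.2.2, q.2.2.2)) hΦ₂.continuousAt
      (by fun_prop)
  have k₀ : ContinuousAt (fun q : P × (M₀ × M₁ × M₂) × (S₀ × S₂) => q.2.1.1) (p, m, s) := by
    fun_prop
  have k₁ : ContinuousAt (fun q : P × (M₀ × M₁ × M₂) × (S₀ × S₂) => q.2.1.2.1) (p, m, s) := by
    fun_prop
  have k₂ : ContinuousAt (fun q : P × (M₀ × M₁ × M₂) × (S₀ × S₂) => (q.2.1.2.1, q.2.1.2.2))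
    (p, m, s) := by fun_prop
  filter_upwards [k₀.eventually h.left.eventually, (c₀.prodMk k₁).eventually h.midLeft.eventually,
    k₂.eventually h.midRight.eventually, c₂.eventually h.right.eventually] with q h1 h2 h3 h4
  exact ⟨h1, h2, h3, h4⟩

variable [IsManifold 𝓘(ℝ, E₀) ∞ M₀] [IsManifold 𝓘(ℝ, E₁) ∞ M₁] [IsManifold 𝓘(ℝ, E₂) ∞ M₂]

lemma IsDefiningAt.jointC1At
    (hm : m ∈ (extChartAt (𝓘(ℝ, E₀).prod (𝓘(ℝ, E₁).prod 𝓘(ℝ, E₂))) c).source)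
    (hΦ₀ : MJointC1At E₀ Φ₀ p m.1 s.1) (hΦ₂ : MJointC1At E₂ Φ₂ p m.2.2 s.2)
    (h : IsDefiningAt E₀ E₁ E₂ L₀ L₀₁ L₁₂ L₂ ψ₀ ψ₀₁ ψ₁₂ ψ₂ (fun x => Φ₀ p x s.1)
      (fun x => Φ₂ p x s.2) m) :
    JointC1At (quadChart (E₀ := E₀) (E₁ := E₁) (E₂ := E₂) ψ₀ ψ₀₁ ψ₁₂ ψ₂ Φ₀ Φ₂ c) p
      (extChartAt (𝓘(ℝ, E₀).prod (𝓘(ℝ, E₁).prod 𝓘(ℝ, E₂))) c m, s) := by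
  rw [extChartAt_prod, PartialEquiv.prod_source, extChartAt_prod, PartialEquiv.prod_source] at hm
  exact jointC1At_quadChart hm.1 hm.2.1 hm.2.2 hΦ₀ hΦ₂ h.left.contMDiffAt h.midLeft.contMDiffAt
    h.midRight.contMDiffAt h.right.contMDiffAt

lemma IsDefiningAt.transversalAt
    (hm : m ∈ (extChartAt (𝓘(ℝ, E₀).prod (𝓘(ℝ, E₁).prod 𝓘(ℝ, E₂))) c).source)
    (hΦ₀ : MJointC1At E₀ Φ₀ p m.1 s.1) (hΦ₂ : MJointC1At E₂ Φ₂ p m.2.2 s.2)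
    (h : IsDefiningAt E₀ E₁ E₂ L₀ L₀₁ L₁₂ L₂ ψ₀ ψ₀₁ ψ₁₂ ψ₂ (fun x => Φ₀ p x s.1)
      (fun x => Φ₂ p x s.2) m)
    (hs : Function.Surjective ((fderiv ℝ (quadChart (E₀ := E₀) (E₁ := E₁) (E₂ := E₂)
      ψ₀ ψ₀₁ ψ₁₂ ψ₂ Φ₀ Φ₂ c p) (extChartAt (𝓘(ℝ, E₀).prod (𝓘(ℝ, E₁).prod 𝓘(ℝ, E₂))) c m, s)).comp
        (ContinuousLinearMap.inl ℝ (E₀ × E₁ × E₂) (S₀ × S₂)))) :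
    QuadrupleTransversalAt E₀ E₁ E₂ L₀ L₀₁ L₁₂ L₂ (fun x => Φ₀ p x s.1) (fun x => Φ₂ p x s.2) m := by
  have : IsManifold 𝓘(ℝ, E₀) 1 M₀ := IsManifold.of_le (n := ∞) (by simp)
  have : IsManifold 𝓘(ℝ, E₁) 1 M₁ := IsManifold.of_le (n := ∞) (by simp)
  have : IsManifold 𝓘(ℝ, E₂) 1 M₂ := IsManifold.of_le (n := ∞) (by simp)
  have hd := (h.jointC1At hm hΦ₀ hΦ₂).differentiableAt.self_of_nhds.hasFDerivAt
  have hd' := HasFDerivAt.comp (f := fun y : E₀ × E₁ × E₂ => (y, s)) _ hd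
    (hasFDerivAt_prodMk_left _ _)
  exact ⟨n₀, n₁, n₂, n₃, ψ₀, ψ₀₁, ψ₁₂, ψ₂, h, exists_hasMFDerivAt_of_chart hm hd' hs⟩

lemma IsDefiningAt.fderiv_comp_inl
    (hΦ₀ : MJointC1At E₀ Φ₀ p m.1 s.1) (hΦ₂ : MJointC1At E₂ Φ₂ p m.2.2 s.2)
    (h : IsDefiningAt E₀ E₁ E₂ L₀ L₀₁ L₁₂ L₂ ψ₀ ψ₀₁ ψ₁₂ ψ₂ (fun x => Φ₀ p x s.1)
      (fun x => Φ₂ p x s.2) m)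
    {D : E₀ × E₁ × E₂ →L[ℝ] (Fin n₀ → ℝ) × (Fin n₁ → ℝ) × (Fin n₂ → ℝ) × (Fin n₃ → ℝ)}
    (hD : HasMFDerivAt (𝓘(ℝ, E₀).prod (𝓘(ℝ, E₁).prod 𝓘(ℝ, E₂)))
        𝓘(ℝ, (Fin n₀ → ℝ) × (Fin n₁ → ℝ) × (Fin n₂ → ℝ) × (Fin n₃ → ℝ))
        (quadMap ψ₀ ψ₀₁ ψ₁₂ ψ₂ (fun x => Φ₀ p x s.1) (fun x => Φ₂ p x s.2)) m D) :
    (fderiv ℝ (quadChart (E₀ := E₀) (E₁ := E₁) (E₂ := E₂) ψ₀ ψ₀₁ ψ₁₂ ψ₂ Φ₀ Φ₂ m p)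
      (extChartAt (𝓘(ℝ, E₀).prod (𝓘(ℝ, E₁).prod 𝓘(ℝ, E₂))) m m, s)).comp
        (ContinuousLinearMap.inl ℝ (E₀ × E₁ × E₂) (S₀ × S₂)) = D := by
  have hd := (h.jointC1At (mem_extChartAt_source m) hΦ₀ hΦ₂).differentiableAt.self_of_nhds.hasFDerivAt
  have hd' := HasFDerivAt.comp (f := fun y : E₀ × E₁ × E₂ => (y, s)) _ hd
    (hasFDerivAt_prodMk_left _ _)
  exact hd'.fderiv.symm.trans ((mfderiv_eq_fderiv_chart hD.mdifferentiableAt).symm.trans hD.mfderiv)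

/-- The defining maps stay valid near m, and the linearization of the system depends continuously on
the flow parameter and the point, so surjectivity persists. -/
lemma eventually_quadrupleTransversalAt
    (hΦ₀ : ∀ p x s, MJointC1At E₀ Φ₀ p x s) (hΦ₂ : ∀ p x s, MJointC1At E₂ Φ₂ p x s)
    (h : QuadrupleTransversalAt E₀ E₁ E₂ L₀ L₀₁ L₁₂ L₂ (fun x => Φ₀ p x s.1) (fun x => Φ₂ p x s.2) m) :
    ∀ᶠ q in 𝓝 (p, m), QuadrupleTransversalAt E₀ E₁ E₂ L₀ L₀₁ L₁₂ L₂ (fun x => Φ₀ q.1 x s.1)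
      (fun x => Φ₂ q.1 x s.2) q.2 := by
  obtain ⟨n₀, n₁, n₂, n₃, ψ₀, ψ₀₁, ψ₁₂, ψ₂, hψ, D, hD, hDs⟩ := h
  have hs := hψ.fderiv_comp_inl (hΦ₀ _ _ _) (hΦ₂ _ _ _) hD
  have hJ := hψ.jointC1At (mem_extChartAt_source m) (hΦ₀ _ _ _) (hΦ₂ _ _ _)
  have hc := hJ.continuousAt_fderiv.clm_comp
    (continuousAt_const (y := ContinuousLinearMap.inl ℝ (E₀ × E₁ × E₂) (S₀ × S₂)))
  have h1 := hc.eventually (eventually_surjective (by subst hs; exact hDs))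
  have hm : ContinuousAt (fun q : P × (M₀ × M₁ × M₂) => ((q.1,
      (extChartAt (𝓘(ℝ, E₀).prod (𝓘(ℝ, E₁).prod 𝓘(ℝ, E₂))) m q.2, s)) :
      P × ((E₀ × E₁ × E₂) × (S₀ × S₂)))) (p, m) :=
    continuousAt_fst.prodMk ((ContinuousAt.comp (g := extChartAt
      (𝓘(ℝ, E₀).prod (𝓘(ℝ, E₁).prod 𝓘(ℝ, E₂))) m) (f := Prod.snd) (x := (p, m))
      (continuousAt_extChartAt m) continuousAt_snd).prodMk continuousAt_const)
  have hm' : ContinuousAt (fun q : P × (M₀ × M₁ × M₂) => (q.1, q.2, s)) (p, m) := by fun_prop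
  filter_upwards [hm.eventually h1, hm'.eventually (hψ.eventually (hΦ₀ _ _ _) (hΦ₂ _ _ _)),
    continuousAt_snd.eventually (extChartAt_source_mem_nhds
      (I := 𝓘(ℝ, E₀).prod (𝓘(ℝ, E₁).prod 𝓘(ℝ, E₂))) m)] with q hq1 hq2 hq3
  exact hq2.transversalAt hq3 (hΦ₀ _ _ _) (hΦ₂ _ _ _) hq1

end Quadruple

section Quadruple

variable {E₀ E₁ E₂ : Type*}
  [NormedAddCommGroup E₀] [NormedSpace ℝ E₀] [NormedAddCommGroup E₁] [NormedSpace ℝ E₁]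
  [NormedAddCommGroup E₂] [NormedSpace ℝ E₂]
  {M₀ M₁ M₂ : Type*}
  [TopologicalSpace M₀] [ChartedSpace E₀ M₀] [TopologicalSpace M₁] [ChartedSpace E₁ M₁]
  [TopologicalSpace M₂] [ChartedSpace E₂ M₂]
  {P : Type*} [TopologicalSpace P]
  {S₀ S₂ : Type*} [NormedAddCommGroup S₀] [NormedSpace ℝ S₀] [NormedAddCommGroup S₂]
  [NormedSpace ℝ S₂]
  {n₀ n₁ n₂ n₃ : ℕ}
  {L₀ : Set M₀} {L₀₁ : Set (M₀ × M₁)} {L₁₂ : Set (M₁ × M₂)} {L₂ : Set M₂}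
  {ψ₀ : M₀ → (Fin n₀ → ℝ)} {ψ₀₁ : M₀ × M₁ → (Fin n₁ → ℝ)} {ψ₁₂ : M₁ × M₂ → (Fin n₂ → ℝ)}
  {ψ₂ : M₂ → (Fin n₃ → ℝ)}
  {Φ₀ : P → M₀ → S₀ → M₀} {Φ₂ : P → M₂ → S₂ → M₂} {m : M₀ × M₁ × M₂} {p : P} {s : S₀ × S₂}

lemma IsLocalDefiningMap.surjective_of_hasMFDerivAt {E : Type*} [NormedAddCommGroup E]
    [NormedSpace ℝ E] {H : Type*} [TopologicalSpace H] {I : ModelWithCorners ℝ E H}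
    {M : Type*} [TopologicalSpace M] [ChartedSpace H M] {L : Set M} {x : M} {k : ℕ}
    {ψ : M → (Fin k → ℝ)} (h : IsLocalDefiningMap I L x ψ) {A : E →L[ℝ] (Fin k → ℝ)}
    (hA : HasMFDerivAt I 𝓘(ℝ, Fin k → ℝ) ψ x A) : Function.Surjective A := by
  obtain ⟨U, -, hxU, -, hs, -⟩ := h
  have := hs x hxU
  rwa [hA.mfderiv] at this

variable [IsManifold 𝓘(ℝ, E₀) ∞ M₀] [IsManifold 𝓘(ℝ, E₁) ∞ M₁] [IsManifold 𝓘(ℝ, E₂) ∞ M₂]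

/-- The unknowns of the middle equations can be prescribed freely: the parameters absorb the
mismatch between the flowed vectors T₀ w₀, T₂ v₂ and the vectors that the other equations require.
-/
lemma IsDefiningAt.surjective_fderiv
    (hΦ₀ : MJointC1At E₀ Φ₀ p m.1 s.1) (hΦ₂ : MJointC1At E₂ Φ₂ p m.2.2 s.2)
    (h : IsDefiningAt E₀ E₁ E₂ L₀ L₀₁ L₁₂ L₂ ψ₀ ψ₀₁ ψ₁₂ ψ₂ (fun x => Φ₀ p x s.1)
      (fun x => Φ₂ p x s.2) m)
    {A : E₀ × E₁ →L[ℝ] (Fin n₁ → ℝ)} {B : E₁ × E₂ →L[ℝ] (Fin n₂ → ℝ)}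
    (hA : HasMFDerivAt (𝓘(ℝ, E₀).prod 𝓘(ℝ, E₁)) 𝓘(ℝ, Fin n₁ → ℝ) ψ₀₁ (Φ₀ p m.1 s.1, m.2.1) A)
    (hB : HasMFDerivAt (𝓘(ℝ, E₁).prod 𝓘(ℝ, E₂)) 𝓘(ℝ, Fin n₂ → ℝ) ψ₁₂ (m.2.1, m.2.2) B)
    (hAB : ∀ α β, ∃ w₀ w₁ w₂, A (w₀, w₁) = α ∧ B (w₁, w₂) = β)
    (hs₀ : Function.Surjective
      (fderiv ℝ (fun r => extChartAt 𝓘(ℝ, E₀) (Φ₀ p m.1 s.1) (Φ₀ p m.1 r)) s.1))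
    (hs₂ : Function.Surjective
      (fderiv ℝ (fun r => extChartAt 𝓘(ℝ, E₂) (Φ₂ p m.2.2 s.2) (Φ₂ p m.2.2 r)) s.2)) :
    Function.Surjective (fderiv ℝ (quadChart (E₀ := E₀) (E₁ := E₁) (E₂ := E₂)
      ψ₀ ψ₀₁ ψ₁₂ ψ₂ Φ₀ Φ₂ m p) (extChartAt (𝓘(ℝ, E₀).prod (𝓘(ℝ, E₁).prod 𝓘(ℝ, E₂))) m m, s)) := by
  obtain ⟨T₀, hT₀⟩ : ∃ T : E₀ →L[ℝ] E₀, HasMFDerivAt 𝓘(ℝ, E₀) 𝓘(ℝ, E₀) (fun x => Φ₀ p x s.1) m.1 T :=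
    ⟨_, hΦ₀.mdifferentiableAt.hasMFDerivAt⟩
  obtain ⟨T₂, hT₂⟩ : ∃ T : E₂ →L[ℝ] E₂,
      HasMFDerivAt 𝓘(ℝ, E₂) 𝓘(ℝ, E₂) (fun x => Φ₂ p x s.2) m.2.2 T :=
    ⟨_, hΦ₂.mdifferentiableAt.hasMFDerivAt⟩
  obtain ⟨τ₀, hτ₀, hτ₀s⟩ : ∃ τ : S₀ →L[ℝ] E₀,
      HasMFDerivAt 𝓘(ℝ, S₀) 𝓘(ℝ, E₀) (fun r => Φ₀ p m.1 r) s.1 τ ∧ Function.Surjective τ :=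
    ⟨_, hΦ₀.hasMFDerivAt_param, hs₀⟩
  obtain ⟨τ₂, hτ₂, hτ₂s⟩ : ∃ τ : S₂ →L[ℝ] E₂,
      HasMFDerivAt 𝓘(ℝ, S₂) 𝓘(ℝ, E₂) (fun r => Φ₂ p m.2.2 r) s.2 τ ∧ Function.Surjective τ :=
    ⟨_, hΦ₂.hasMFDerivAt_param, hs₂⟩
  obtain ⟨a, ha⟩ : ∃ a : E₀ →L[ℝ] (Fin n₀ → ℝ), HasMFDerivAt 𝓘(ℝ, E₀) 𝓘(ℝ, Fin n₀ → ℝ) ψ₀ m.1 a :=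
    ⟨_, (h.left.contMDiffAt.mdifferentiableAt (by simp)).hasMFDerivAt⟩
  obtain ⟨d, hd⟩ : ∃ d : E₂ →L[ℝ] (Fin n₃ → ℝ),
      HasMFDerivAt 𝓘(ℝ, E₂) 𝓘(ℝ, Fin n₃ → ℝ) ψ₂ (Φ₂ p m.2.2 s.2) d :=
    ⟨_, (h.right.contMDiffAt.mdifferentiableAt (by simp)).hasMFDerivAt⟩
  have has := h.left.surjective_of_hasMFDerivAt ha
  have hds := h.right.surjective_of_hasMFDerivAt hd
  obtain ⟨D, hD, hDe⟩ := hasMFDerivAt_quadruple hT₀ hT₂ ha hA hB hd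
  have hl := h.fderiv_comp_inl hΦ₀ hΦ₂ hD
  have hJ := (h.jointC1At (mem_extChartAt_source m) hΦ₀ hΦ₂).differentiableAt.self_of_nhds.hasFDerivAt
  set F := fderiv ℝ (quadChart (E₀ := E₀) (E₁ := E₁) (E₂ := E₂)
      ψ₀ ψ₀₁ ψ₁₂ ψ₂ Φ₀ Φ₂ m p) (extChartAt (𝓘(ℝ, E₀).prod (𝓘(ℝ, E₁).prod 𝓘(ℝ, E₂))) m m, s) with hF
  have hr : ∀ σ : S₀ × S₂, F (0, σ) = (0, A (τ₀ σ.1, 0), 0, d (τ₂ σ.2)) := by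
    have h1 := HasFDerivAt.comp (f := fun r : S₀ × S₂ =>
      (extChartAt (𝓘(ℝ, E₀).prod (𝓘(ℝ, E₁).prod 𝓘(ℝ, E₂))) m m, r)) s hJ
      (hasFDerivAt_prodMk_right _ _)
    have f₀ : HasMFDerivAt 𝓘(ℝ, S₀ × S₂) 𝓘(ℝ, S₀) (Prod.fst : S₀ × S₂ → S₀) s
      (ContinuousLinearMap.fst ℝ S₀ S₂) := hasMFDerivAt_iff_hasFDerivAt.2 hasFDerivAt_fst
    have f₂ : HasMFDerivAt 𝓘(ℝ, S₀ × S₂) 𝓘(ℝ, S₂) (Prod.snd : S₀ × S₂ → S₂) s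
      (ContinuousLinearMap.snd ℝ S₀ S₂) := hasMFDerivAt_iff_hasFDerivAt.2 hasFDerivAt_snd
    have g₀ : HasMFDerivAt 𝓘(ℝ, S₀ × S₂) 𝓘(ℝ, Fin n₁ → ℝ)
        (fun r : S₀ × S₂ => ψ₀₁ (Φ₀ p m.1 r.1, m.2.1)) s
        (A.comp ((τ₀.comp (ContinuousLinearMap.fst ℝ S₀ S₂)).prod 0)) :=
      HasMFDerivAt.comp s (f := fun r : S₀ × S₂ => (Φ₀ p m.1 r.1, m.2.1)) hA
        ((HasMFDerivAt.comp s hτ₀ f₀).prodMk (hasMFDerivAt_const (I := 𝓘(ℝ, S₀ × S₂))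
          (I' := 𝓘(ℝ, E₁)) m.2.1 s))
    have g₂ : HasMFDerivAt 𝓘(ℝ, S₀ × S₂) 𝓘(ℝ, Fin n₃ → ℝ)
        (fun r : S₀ × S₂ => ψ₂ (Φ₂ p m.2.2 r.2)) s
        (d.comp (τ₂.comp (ContinuousLinearMap.snd ℝ S₀ S₂))) :=
      HasMFDerivAt.comp s (f := fun r : S₀ × S₂ => Φ₂ p m.2.2 r.2) hd (HasMFDerivAt.comp s hτ₂ f₂)
    have h2 := (hasFDerivAt_const (ψ₀ m.1) s).prodMk
      ((hasMFDerivAt_iff_hasFDerivAt.1 g₀).prodMk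
      ((hasFDerivAt_const (ψ₁₂ (m.2.1, m.2.2)) s).prodMk (hasMFDerivAt_iff_hasFDerivAt.1 g₂)))
    have h3 : (fun r : S₀ × S₂ => quadChart (E₀ := E₀) (E₁ := E₁) (E₂ := E₂)
        ψ₀ ψ₀₁ ψ₁₂ ψ₂ Φ₀ Φ₂ m p
        (extChartAt (𝓘(ℝ, E₀).prod (𝓘(ℝ, E₁).prod 𝓘(ℝ, E₂))) m m, r)) =
        fun r => (ψ₀ m.1, ψ₀₁ (Φ₀ p m.1 r.1, m.2.1), ψ₁₂ (m.2.1, m.2.2), ψ₂ (Φ₂ p m.2.2 r.2)) := by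
      funext r
      simp only [quadChart, extChartAt_to_inv]
      rfl
    intro σ
    have h4 := h1.unique (h3 ▸ h2)
    exact congrArg (fun ℓ => ℓ σ) h4
  have hl' : ∀ w, F (w, 0) = (a w.1, A (T₀ w.1, w.2.1), B (w.2.1, w.2.2), d (T₂ w.2.2)) := fun w =>
    (congrArg (fun ℓ => ℓ w) hl).trans (hDe w)
  rintro ⟨α, κ, β, γ⟩
  obtain ⟨w₀, rfl⟩ := has α
  obtain ⟨v₀, v₁, v₂, rfl, rfl⟩ := hAB κ β
  obtain ⟨x, rfl⟩ := hds γ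
  -- w₀ serves the L₀ equation while the middle equations want v₀ after the flow; likewise v₂ serves
  -- them while the L₂ equation wants x.
  obtain ⟨σ₀, hσ₀⟩ := hτ₀s (v₀ - T₀ w₀)
  obtain ⟨σ₂, hσ₂⟩ := hτ₂s (x - T₂ v₂)
  refine ⟨((w₀, v₁, v₂), (σ₀, σ₂)), ?_⟩
  have hsum : (((w₀, v₁, v₂), (σ₀, σ₂)) : (E₀ × E₁ × E₂) × (S₀ × S₂)) =
      ((w₀, v₁, v₂), 0) + (0, (σ₀, σ₂)) := by simp
  rw [hsum, map_add, hl', hr]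
  simp only [hσ₀, hσ₂, Prod.mk_add_mk, ← map_add, add_zero, add_sub_cancel]

open MeasureTheory in
-- The parametric theorem is applied to the system in a chart. The filter 𝓝 s ⊓ ae μ expresses "for
-- almost every parameter near s" and keeps the neighbourhood W independent of the parameter.
lemma IsDefiningAt.eventually_ae_transversalAt
    [FiniteDimensional ℝ E₀] [FiniteDimensional ℝ E₁] [FiniteDimensional ℝ E₂]
    [FiniteDimensional ℝ S₀] [FiniteDimensional ℝ S₂]
    [MeasurableSpace (S₀ × S₂)] [BorelSpace (S₀ × S₂)] (μ : Measure (S₀ × S₂)) [μ.IsAddHaarMeasure]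
    (hdim : Module.finrank ℝ (E₀ × E₁ × E₂) = n₀ + (n₁ + (n₂ + n₃)))
    (hΦ₀ : ∀ p x s, MJointC1At E₀ Φ₀ p x s) (hΦ₂ : ∀ p x s, MJointC1At E₂ Φ₂ p x s)
    (h : IsDefiningAt E₀ E₁ E₂ L₀ L₀₁ L₁₂ L₂ ψ₀ ψ₀₁ ψ₁₂ ψ₂ (fun x => Φ₀ p x s.1)
      (fun x => Φ₂ p x s.2) m)
    {A : E₀ × E₁ →L[ℝ] (Fin n₁ → ℝ)} {B : E₁ × E₂ →L[ℝ] (Fin n₂ → ℝ)}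
    (hA : HasMFDerivAt (𝓘(ℝ, E₀).prod 𝓘(ℝ, E₁)) 𝓘(ℝ, Fin n₁ → ℝ) ψ₀₁ (Φ₀ p m.1 s.1, m.2.1) A)
    (hB : HasMFDerivAt (𝓘(ℝ, E₁).prod 𝓘(ℝ, E₂)) 𝓘(ℝ, Fin n₂ → ℝ) ψ₁₂ (m.2.1, m.2.2) B)
    (hAB : ∀ α β, ∃ w₀ w₁ w₂, A (w₀, w₁) = α ∧ B (w₁, w₂) = β)
    (hs₀ : Function.Surjective
      (fderiv ℝ (fun r => extChartAt 𝓘(ℝ, E₀) (Φ₀ p m.1 s.1) (Φ₀ p m.1 r)) s.1))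
    (hs₂ : Function.Surjective
      (fderiv ℝ (fun r => extChartAt 𝓘(ℝ, E₂) (Φ₂ p m.2.2 s.2) (Φ₂ p m.2.2 r)) s.2)) :
    ∃ W ∈ 𝓝 m, ∀ᶠ r in 𝓝 s ⊓ ae μ, ∀ m' ∈ W,
      m' ∈ perturbedQuadruple (fun x => Φ₀ p x r.1) id (fun x => Φ₂ p x r.2) L₀ L₀₁ L₁₂ L₂ →
      QuadrupleTransversalAt E₀ E₁ E₂ L₀ L₀₁ L₁₂ L₂ (fun x => Φ₀ p x r.1) (fun x => Φ₂ p x r.2) m' := by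
  set ext := extChartAt (𝓘(ℝ, E₀).prod (𝓘(ℝ, E₁).prod 𝓘(ℝ, E₂))) m with hext
  have hnear := h.eventually (hΦ₀ _ _ _) (hΦ₂ _ _ _)
  have hcs : ContinuousAt (fun z : (E₀ × E₁ × E₂) × (S₀ × S₂) => (p, ext.symm z.1, z.2)) (ext m, s) :=
    continuousAt_const.prodMk ((ContinuousAt.comp (g := ext.symm) (f := Prod.fst) (x := (ext m, s))
      (continuousAt_extChartAt_symm m) continuousAt_fst).prodMk continuousAt_snd)
  have hG : ContDiffAt ℝ 1 (quadChart (E₀ := E₀) (E₁ := E₁) (E₂ := E₂) ψ₀ ψ₀₁ ψ₁₂ ψ₂ Φ₀ Φ₂ m p)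
      (ext m, s) := by
    refine contDiffAt_one_of_jointC1At ?_
    have e : ext.symm (ext m) = m := extChartAt_to_inv m
    have hnear' : ∀ᶠ q in 𝓝 (p, ext.symm (ext m), s), IsDefiningAt E₀ E₁ E₂ L₀ L₀₁ L₁₂ L₂
        ψ₀ ψ₀₁ ψ₁₂ ψ₂ (fun x => Φ₀ q.1 x q.2.2.1) (fun x => Φ₂ q.1 x q.2.2.2) q.2.1 := by
      rw [e]; exact hnear
    filter_upwards [hcs.eventually hnear',
      continuousAt_fst.eventually (extChartAt_target_mem_nhds
        (I := 𝓘(ℝ, E₀).prod (𝓘(ℝ, E₁).prod 𝓘(ℝ, E₂))) m)] with z hz hzt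
    have := IsDefiningAt.jointC1At (c := m) (ext.map_target hzt) (hΦ₀ _ _ _) (hΦ₂ _ _ _) hz
    rwa [ext.right_inv hzt] at this
  have hsurj := h.surjective_fderiv (hΦ₀ _ _ _) (hΦ₂ _ _ _) hA hB hAB hs₀ hs₂
  obtain ⟨W, hW, hWs⟩ := eventually_ae_surjective_fderiv_comp_inl μ (by
    simpa only [Module.finrank_prod, Module.finrank_fin_fun] using hdim) hG hsurj
  have hpc : ContinuousAt (fun q : (M₀ × M₁ × M₂) × (S₀ × S₂) => (p, q.1, q.2)) (m, s) := by fun_prop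
  obtain ⟨W', hW', T, hT, hWT⟩ := mem_nhds_prod_iff.1 (hpc.eventually hnear)
  refine ⟨W' ∩ (ext.source ∩ ext ⁻¹' W), Filter.inter_mem hW' (Filter.inter_mem
    (extChartAt_source_mem_nhds m) ((continuousAt_extChartAt m).preimage_mem_nhds hW)), ?_⟩
  filter_upwards [hWs, Filter.mem_inf_of_left hT] with r hr hrT m' hm' hmem
  have hdef : IsDefiningAt E₀ E₁ E₂ L₀ L₀₁ L₁₂ L₂ ψ₀ ψ₀₁ ψ₁₂ ψ₂ (fun x => Φ₀ p x r.1)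
    (fun x => Φ₂ p x r.2) m' := hWT (mk_mem_prod hm'.1 hrT)
  refine hdef.transversalAt hm'.2.1 (hΦ₀ _ _ _) (hΦ₂ _ _ _) (hr _ hm'.2.2 ?_)
  rw [quadChart, ext.left_inv hm'.2.1]
  exact hdef.quadMap_eq_zero hmem

end Quadruple

/-! ### Openness and density -/

open MeasureTheory in
lemma neBot_nhds_inf_ae {X : Type*} [TopologicalSpace X] [MeasurableSpace X] (μ : Measure X)
    [μ.IsOpenPosMeasure] (x : X) : (𝓝 x ⊓ ae μ).NeBot := by
  refine Filter.inf_neBot_iff.2 fun {U} hU {A} hA => ?_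
  by_contra h
  have h1 : U ⊆ Aᶜ := disjoint_iff_inter_eq_empty.2 (not_nonempty_iff_eq_empty.1 h) |>.subset_compl_right
  exact (Measure.measure_pos_of_mem_nhds μ hU).ne' (measure_mono_null h1 (mem_ae_iff.1 hA))

/-- The usual compactness argument for an arbitrary filter: the almost-everywhere condition is not a
neighbourhood condition in the parameter. -/
lemma IsCompact.eventually_forall_of_forall_exists_nhds {X Y : Type*} [TopologicalSpace X]
    {C : Set X} (hC : IsCompact C) {l : Filter Y} {p : Y → X → Prop}
    (h : ∀ x ∈ C, ∃ W ∈ 𝓝 x, ∀ᶠ y in l, ∀ x' ∈ W, p y x') : ∀ᶠ y in l, ∀ x ∈ C, p y x := by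
  refine hC.induction_on (p := fun A => ∀ᶠ y in l, ∀ x ∈ A, p y x) ?_ ?_ ?_ ?_
  · exact .of_forall fun y x hx => absurd hx (notMem_empty x)
  · exact fun A B hAB hB => hB.mono fun y hy x hx => hy x (hAB hx)
  · exact fun A B hA hB => (hA.and hB).mono fun y hy x hx => hx.elim (hy.1 x) (hy.2 x)
  · intro x hx
    obtain ⟨W, hW, hWy⟩ := h x hx
    exact ⟨W, mem_nhdsWithin_of_mem_nhds hW, hWy⟩

section Generic

variable {E₀ E₁ E₂ : Type*}
  [NormedAddCommGroup E₀] [NormedSpace ℝ E₀] [FiniteDimensional ℝ E₀]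
  [NormedAddCommGroup E₁] [NormedSpace ℝ E₁] [FiniteDimensional ℝ E₁]
  [NormedAddCommGroup E₂] [NormedSpace ℝ E₂] [FiniteDimensional ℝ E₂]
  {M₀ M₁ M₂ : Type*}
  [TopologicalSpace M₀] [T2Space M₀] [ChartedSpace E₀ M₀] [IsManifold 𝓘(ℝ, E₀) ∞ M₀]
  [TopologicalSpace M₁] [T2Space M₁] [ChartedSpace E₁ M₁] [IsManifold 𝓘(ℝ, E₁) ∞ M₁]
  [TopologicalSpace M₂] [T2Space M₂] [ChartedSpace E₂ M₂] [IsManifold 𝓘(ℝ, E₂) ∞ M₂]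
  {ω₀ : TwoForm 𝓘(ℝ, E₀) M₀} {ω₁ : TwoForm 𝓘(ℝ, E₁) M₁} {ω₂ : TwoForm 𝓘(ℝ, E₂) M₂}
  {L₀ : Set M₀} {L₀₁ : Set (M₀ × M₁)} {L₁₂ : Set (M₁ × M₂)} {L₂ : Set M₂}
  {K₀ : Set M₀} {K₂ : Set M₂}

lemma isClosed_perturbedQuadruple {X : Type*} [TopologicalSpace X]
    {φ₀ : X → M₀ → M₀} {φ₂ : X → M₂ → M₂}
    (hφ₀ : Continuous fun q : X × M₀ => φ₀ q.1 q.2) (hφ₂ : Continuous fun q : X × M₂ => φ₂ q.1 q.2)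
    (hL₀ : IsCompact L₀) (hL₀₁ : IsCompact L₀₁) (hL₁₂ : IsCompact L₁₂) (hL₂ : IsCompact L₂) :
    IsClosed {q : X × (M₀ × M₁ × M₂) |
      q.2 ∈ perturbedQuadruple (φ₀ q.1) id (φ₂ q.1) L₀ L₀₁ L₁₂ L₂} := by
  have c₀ : Continuous fun q : X × (M₀ × M₁ × M₂) => φ₀ q.1 q.2.1 :=
    hφ₀.comp (f := fun q : X × (M₀ × M₁ × M₂) => (q.1, q.2.1)) (by fun_prop)
  have c₂ : Continuous fun q : X × (M₀ × M₁ × M₂) => φ₂ q.1 q.2.2.2 :=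
    hφ₂.comp (f := fun q : X × (M₀ × M₁ × M₂) => (q.1, q.2.2.2)) (by fun_prop)
  exact ((hL₀.isClosed.preimage (by fun_prop : Continuous fun q : X × (M₀ × M₁ × M₂) => q.2.1)).inter
    ((hL₀₁.isClosed.preimage
      (c₀.prodMk (by fun_prop : Continuous fun q : X × (M₀ × M₁ × M₂) => q.2.2.1))).inter
    ((hL₁₂.isClosed.preimage
      (by fun_prop : Continuous fun q : X × (M₀ × M₁ × M₂) => (q.2.2.1, q.2.2.2))).inter
    (hL₂.isClosed.preimage c₂))))

omit [FiniteDimensional ℝ E₀] [FiniteDimensional ℝ E₁] [FiniteDimensional ℝ E₂] [T2Space M₀]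
  [T2Space M₁] [T2Space M₂] [IsManifold 𝓘(ℝ, E₀) ∞ M₀] [IsManifold 𝓘(ℝ, E₁) ∞ M₁]
  [IsManifold 𝓘(ℝ, E₂) ∞ M₂] [TopologicalSpace M₀] [ChartedSpace E₀ M₀] [TopologicalSpace M₁]
  [ChartedSpace E₁ M₁] [TopologicalSpace M₂] [ChartedSpace E₂ M₂]
  [NormedAddCommGroup E₀] [NormedSpace ℝ E₀] [NormedAddCommGroup E₁] [NormedSpace ℝ E₁]
  [NormedAddCommGroup E₂] [NormedSpace ℝ E₂] in
-- For compact L₀, L₀₁ and L₁₂ the right-hand side is a compact set that does not involve the flows.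
lemma perturbedQuadruple_subset {φ₀ : M₀ → M₀} {φ₂ : M₂ → M₂} :
    perturbedQuadruple φ₀ id φ₂ L₀ L₀₁ L₁₂ L₂ ⊆ L₀ ×ˢ (Prod.snd '' L₀₁) ×ˢ (Prod.snd '' L₁₂) :=
  fun _ hm => ⟨hm.1, ⟨_, hm.2.1, rfl⟩, ⟨_, hm.2.2.1, rfl⟩⟩

omit [FiniteDimensional ℝ E₁] in
-- Near a solution transversality persists; near a non-solution there are no solutions, because the
-- incidence set is closed. Compactness makes this uniform in the point.
theorem isOpen_setOf_quadrupleTransversal (hω₀ : IsSymplecticForm ω₀) (hω₂ : IsSymplecticForm ω₂)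
    (hL₀ : IsCompact L₀) (hL₀₁ : IsCompact L₀₁) (hL₁₂ : IsCompact L₁₂) (hL₂ : IsCompact L₂)
    (hK₀ : IsCompact K₀) (hK₂ : IsCompact K₂) :
    IsOpen {H : Hamiltonian E₀ K₀ × Hamiltonian E₂ K₂ | QuadrupleTransversal E₀ E₁ E₂
      (H.1.flow hω₀ hK₀) id (H.2.flow hω₂ hK₂) L₀ L₀₁ L₁₂ L₂} := by
  refine isOpen_iff_mem_nhds.2 fun H hH => ?_
  set F₀ : Empty → Hamiltonian E₀ K₀ := fun i => i.elim with hF₀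
  set F₂ : Empty → Hamiltonian E₂ K₂ := fun i => i.elim with hF₂
  have e₀ : ∀ G : Hamiltonian E₀ K₀, G.addFamily F₀ 0 = G := fun G => G.addFamily_zero F₀
  have e₂ : ∀ G : Hamiltonian E₂ K₂, G.addFamily F₂ 0 = G := fun G => G.addFamily_zero F₂
  have hΦ₀ : ∀ (H : Hamiltonian E₀ K₀ × Hamiltonian E₂ K₂) x s, MJointC1At E₀
      (fun (H : Hamiltonian E₀ K₀ × Hamiltonian E₂ K₂) x s => (H.1.addFamily F₀ s).flow hω₀ hK₀ x)
      H x s := fun H x s => (Hamiltonian.mjointC1At_flow hω₀ hK₀ F₀ H.1 x s).comp_param (u := Prod.fst) continuousAt_fst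
  have hΦ₂ : ∀ (H : Hamiltonian E₀ K₀ × Hamiltonian E₂ K₂) x s, MJointC1At E₂
      (fun (H : Hamiltonian E₀ K₀ × Hamiltonian E₂ K₂) x s => (H.2.addFamily F₂ s).flow hω₂ hK₂ x)
      H x s := fun H x s => (Hamiltonian.mjointC1At_flow hω₂ hK₂ F₂ H.2 x s).comp_param (u := Prod.snd) continuousAt_snd
  have c₀ : Continuous fun q : (Hamiltonian E₀ K₀ × Hamiltonian E₂ K₂) × M₀ =>
      q.1.1.flow hω₀ hK₀ q.2 := by
    have := (Hamiltonian.continuous_flow hω₀ hK₀ F₀).comp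
      (f := fun q : (Hamiltonian E₀ K₀ × Hamiltonian E₂ K₂) × M₀ => (q.1.1, q.2, 0)) (by fun_prop)
    simpa only [Function.comp_def, e₀] using this
  have c₂ : Continuous fun q : (Hamiltonian E₀ K₀ × Hamiltonian E₂ K₂) × M₂ =>
      q.1.2.flow hω₂ hK₂ q.2 := by
    have := (Hamiltonian.continuous_flow hω₂ hK₂ F₂).comp
      (f := fun q : (Hamiltonian E₀ K₀ × Hamiltonian E₂ K₂) × M₂ => (q.1.2, q.2, 0)) (by fun_prop)
    simpa only [Function.comp_def, e₂] using this
  have hcl := isClosed_perturbedQuadruple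
    (φ₀ := fun (H : Hamiltonian E₀ K₀ × Hamiltonian E₂ K₂) x => H.1.flow hω₀ hK₀ x)
    (φ₂ := fun H x => H.2.flow hω₂ hK₂ x) c₀ c₂ hL₀ hL₀₁ hL₁₂ hL₂
  have hC : IsCompact (L₀ ×ˢ (Prod.snd '' L₀₁) ×ˢ (Prod.snd '' L₁₂)) :=
    hL₀.prod ((hL₀₁.image continuous_snd).prod (hL₁₂.image continuous_snd))
  have key := hC.eventually_forall_of_forall_eventually (x₀ := H)
    (P := fun (H : Hamiltonian E₀ K₀ × Hamiltonian E₂ K₂) m =>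
      m ∈ perturbedQuadruple (H.1.flow hω₀ hK₀) id (H.2.flow hω₂ hK₂) L₀ L₀₁ L₁₂ L₂ →
      QuadrupleTransversalAt E₀ E₁ E₂ L₀ L₀₁ L₁₂ L₂ (H.1.flow hω₀ hK₀) (H.2.flow hω₂ hK₂) m)
    (fun m _ => by
      by_cases hm : m ∈ perturbedQuadruple (H.1.flow hω₀ hK₀) id (H.2.flow hω₂ hK₂) L₀ L₀₁ L₁₂ L₂
      · have h1 := hH.transversalAt hm
        have h2 := eventually_quadrupleTransversalAt (p := H) (s := (0, 0)) (m := m)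
          (L₀ := L₀) (L₀₁ := L₀₁) (L₁₂ := L₁₂) (L₂ := L₂) hΦ₀ hΦ₂ (by simpa only [e₀, e₂] using h1)
        simp only [e₀, e₂] at h2
        exact h2.mono fun q hq _ => hq
      · exact (hcl.isOpen_compl.mem_nhds (x := (H, m)) hm |> fun h =>
          Filter.mem_of_superset h fun q hq hq' => absurd hq' hq))
  filter_upwards [key] with H' hH'
  exact quadrupleTransversal_of_forall fun m hm => hH' m (perturbedQuadruple_subset hm) hm

/-- A spanning family of perturbations of H gives transversality for almost every small parameter,
and the perturbed Hamiltonians converge to H as the parameter tends to 0. -/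
theorem dense_setOf_quadrupleTransversal (hω₀ : IsSymplecticForm ω₀) (hω₂ : IsSymplecticForm ω₂)
    (hL₀ : IsCompact L₀) (hL₀₁ : IsCompact L₀₁) (hL₁₂ : IsCompact L₁₂) (hL₂ : IsCompact L₂)
    (lagL₀ : IsLagrangian ω₀ L₀)
    (lagL₀₁ : IsLagrangian (correspondenceForm ω₀ ω₁) L₀₁)
    (lagL₁₂ : IsLagrangian (correspondenceForm ω₁ ω₂) L₁₂)
    (lagL₂ : IsLagrangian (fun x => -ω₂ x) L₂)
    (hemb : IsEmbeddedComposition E₀ E₁ E₂ L₀₁ L₁₂)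
    (hK₀ : IsCompact K₀) (hLK₀ : L₀ ⊆ interior K₀) (hK₂ : IsCompact K₂) (hLK₂ : L₂ ⊆ interior K₂) :
    Dense {H : Hamiltonian E₀ K₀ × Hamiltonian E₂ K₂ | QuadrupleTransversal E₀ E₁ E₂
      (H.1.flow hω₀ hK₀) id (H.2.flow hω₂ hK₂) L₀ L₀₁ L₁₂ L₂} := by
  intro H
  have d₂ : Continuous (H.2.flow hω₂ hK₂) := by
    have := (Hamiltonian.continuous_flow hω₂ hK₂ (fun i : Empty => i.elim)).comp
      (f := fun x : M₂ => (H.2, x, 0)) (by fun_prop)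
    simpa only [Function.comp_def, Hamiltonian.addFamily_zero] using this
  obtain ⟨ι₀, _, F₀, hF₀⟩ := H.1.exists_isSpanningAt_of_isCompact hω₀ hK₀ hL₀
    fun x hx => H.1.flow_mem_interior hω₀ hK₀ (hLK₀ hx)
  -- On this side L₂ constrains the end point, so only initial points that flow into L₂ matter, and
  -- their end points lie in the interior of K₂. On the other side L₀ constrains the initial point
  -- and the flow preserves the interior of K₀.
  obtain ⟨ι₂, _, F₂, hF₂⟩ := H.2.exists_isSpanningAt_of_isCompact hω₂ hK₂
    (C := Prod.snd '' L₁₂ ∩ H.2.flow hω₂ hK₂ ⁻¹' L₂)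
    ((hL₁₂.image continuous_snd).inter_right (hL₂.isClosed.preimage d₂)) fun x hx => hLK₂ hx.2
  set Φ₀ : Hamiltonian E₀ K₀ × Hamiltonian E₂ K₂ → M₀ → (ι₀ → ℝ) → M₀ :=
    fun H x s => (H.1.addFamily F₀ s).flow hω₀ hK₀ x with hΦ₀'
  set Φ₂ : Hamiltonian E₀ K₀ × Hamiltonian E₂ K₂ → M₂ → (ι₂ → ℝ) → M₂ :=
    fun H x s => (H.2.addFamily F₂ s).flow hω₂ hK₂ x with hΦ₂'
  have e₀ : ∀ x, Φ₀ H x 0 = H.1.flow hω₀ hK₀ x := fun x => by simp only [hΦ₀', Hamiltonian.addFamily_zero]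
  have e₂ : ∀ x, Φ₂ H x 0 = H.2.flow hω₂ hK₂ x := fun x => by simp only [hΦ₂', Hamiltonian.addFamily_zero]
  have hΦ₀ : ∀ H x s, MJointC1At E₀ Φ₀ H x s := fun H x s =>
    (Hamiltonian.mjointC1At_flow hω₀ hK₀ F₀ H.1 x s).comp_param (u := Prod.fst) continuousAt_fst
  have hΦ₂ : ∀ H x s, MJointC1At E₂ Φ₂ H x s := fun H x s =>
    (Hamiltonian.mjointC1At_flow hω₂ hK₂ F₂ H.2 x s).comp_param (u := Prod.snd) continuousAt_snd
  have c₀ : Continuous fun q : ((ι₀ → ℝ) × (ι₂ → ℝ)) × M₀ => Φ₀ H q.2 q.1.1 :=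
    (Hamiltonian.continuous_flow hω₀ hK₀ F₀).comp
      (f := fun q : ((ι₀ → ℝ) × (ι₂ → ℝ)) × M₀ => (H.1, q.2, q.1.1)) (by fun_prop)
  have c₂ : Continuous fun q : ((ι₀ → ℝ) × (ι₂ → ℝ)) × M₂ => Φ₂ H q.2 q.1.2 :=
    (Hamiltonian.continuous_flow hω₂ hK₂ F₂).comp
      (f := fun q : ((ι₀ → ℝ) × (ι₂ → ℝ)) × M₂ => (H.2, q.2, q.1.2)) (by fun_prop)
  have hcl := isClosed_perturbedQuadruple (φ₀ := fun (s : (ι₀ → ℝ) × (ι₂ → ℝ)) x => Φ₀ H x s.1)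
    (φ₂ := fun s x => Φ₂ H x s.2) c₀ c₂ hL₀ hL₀₁ hL₁₂ hL₂
  obtain ⟨⟨k₀, hk₀, sub₀⟩, -⟩ := lagL₀
  obtain ⟨⟨k₀₁, hk₀₁, sub₀₁⟩, -⟩ := lagL₀₁
  obtain ⟨⟨k₁₂, hk₁₂, sub₁₂⟩, -⟩ := lagL₁₂
  obtain ⟨⟨k₂, hk₂, sub₂⟩, -⟩ := lagL₂
  have hC : IsCompact (L₀ ×ˢ (Prod.snd '' L₀₁) ×ˢ (Prod.snd '' L₁₂)) :=
    hL₀.prod ((hL₀₁.image continuous_snd).prod (hL₁₂.image continuous_snd))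
  set μ : MeasureTheory.Measure ((ι₀ → ℝ) × (ι₂ → ℝ)) :=
    MeasureTheory.Measure.prod MeasureTheory.volume MeasureTheory.volume with hμ
  have : μ.IsAddHaarMeasure := MeasureTheory.Measure.prod.instIsAddHaarMeasure _ _
  set l := 𝓝 (0 : (ι₀ → ℝ) × (ι₂ → ℝ)) ⊓ MeasureTheory.ae μ with hl
  have : l.NeBot := neBot_nhds_inf_ae _ _
  have key : ∀ᶠ s in l, ∀ m ∈ L₀ ×ˢ (Prod.snd '' L₀₁) ×ˢ (Prod.snd '' L₁₂),
      m ∈ perturbedQuadruple (fun x => Φ₀ H x s.1) id (fun x => Φ₂ H x s.2) L₀ L₀₁ L₁₂ L₂ →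
      QuadrupleTransversalAt E₀ E₁ E₂ L₀ L₀₁ L₁₂ L₂ (fun x => Φ₀ H x s.1) (fun x => Φ₂ H x s.2) m := by
    refine hC.eventually_forall_of_forall_exists_nhds fun m _ => ?_
    by_cases hm : m ∈ perturbedQuadruple (fun x => Φ₀ H x 0) id (fun x => Φ₂ H x 0) L₀ L₀₁ L₁₂ L₂
    · obtain ⟨ψ₀, hψ₀⟩ := sub₀ _ hm.1
      obtain ⟨ψ₀₁, hψ₀₁⟩ := sub₀₁ _ hm.2.1
      obtain ⟨ψ₁₂, hψ₁₂⟩ := sub₁₂ _ hm.2.2.1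
      obtain ⟨ψ₂, hψ₂⟩ := sub₂ _ hm.2.2.2
      obtain ⟨A, hA⟩ : ∃ A : E₀ × E₁ →L[ℝ] (Fin k₀₁ → ℝ), HasMFDerivAt
          (𝓘(ℝ, E₀).prod 𝓘(ℝ, E₁)) 𝓘(ℝ, Fin k₀₁ → ℝ) ψ₀₁ (Φ₀ H m.1 0, m.2.1) A :=
        ⟨_, (hψ₀₁.contMDiffAt.mdifferentiableAt (by simp)).hasMFDerivAt⟩
      obtain ⟨B, hB⟩ : ∃ B : E₁ × E₂ →L[ℝ] (Fin k₁₂ → ℝ), HasMFDerivAt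
          (𝓘(ℝ, E₁).prod 𝓘(ℝ, E₂)) 𝓘(ℝ, Fin k₁₂ → ℝ) ψ₁₂ (m.2.1, m.2.2) B :=
        ⟨_, (hψ₁₂.contMDiffAt.mdifferentiableAt (by simp)).hasMFDerivAt⟩
      refine IsDefiningAt.eventually_ae_transversalAt (s := (0, 0)) μ ?_ hΦ₀ hΦ₂
        ⟨hψ₀, hψ₀₁, hψ₁₂, hψ₂⟩ hA hB
        (hemb.1.exists_preimage hm.2.1 hm.2.2.1 hψ₀₁ hψ₁₂ hA hB) ?_ ?_
      -- Each codimension is half the ambient dimension, and each factor Mⱼ occurs in two of the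
      -- four ambient spaces, so there are as many equations as unknowns.
      · simp only [Module.finrank_prod] at hk₀₁ hk₁₂ ⊢
        omega
      · exact hF₀ m.1 hm.1 _ (by rw [e₀]; exact mem_extChartAt_source _)
      · exact hF₂ m.2.2 ⟨⟨_, hm.2.2.1, rfl⟩, by
          have h : Φ₂ H m.2.2 0 ∈ L₂ := hm.2.2.2
          rwa [e₂] at h⟩ _ (by rw [e₂]; exact mem_extChartAt_source _)
    · obtain ⟨T, hT, W, hW, hTW⟩ := mem_nhds_prod_iff.1
        (hcl.isOpen_compl.mem_nhds (x := ((0, 0), m)) hm)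
      refine ⟨W, hW, Filter.mem_of_superset (Filter.mem_inf_of_left hT) fun s hs m' hm' hmem => ?_⟩
      exact absurd hmem (hTW (mk_mem_prod hs hm'))
  have hlim : Filter.Tendsto (fun s : (ι₀ → ℝ) × (ι₂ → ℝ) =>
      (H.1.addFamily F₀ s.1, H.2.addFamily F₂ s.2)) l (𝓝 H) := by
    have h1 : Continuous fun s : (ι₀ → ℝ) × (ι₂ → ℝ) =>
        (H.1.addFamily F₀ s.1, H.2.addFamily F₂ s.2) :=
      ((Hamiltonian.continuous_addFamily H.1 F₀).comp continuous_fst).prodMk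
        ((Hamiltonian.continuous_addFamily H.2 F₂).comp continuous_snd)
    have h2 := h1.tendsto 0
    simp only [Prod.fst_zero, Prod.snd_zero, Hamiltonian.addFamily_zero] at h2
    exact h2.mono_left inf_le_left
  refine mem_closure_of_tendsto hlim ?_
  filter_upwards [key] with s hs
  exact quadrupleTransversal_of_forall fun m hm => hs m (perturbedQuadruple_subset hm) hm

end Generic

end

theorem proposition2p3
    {E₀ E₁ E₂ : Type*}
    [NormedAddCommGroup E₀] [NormedSpace ℝ E₀] [FiniteDimensional ℝ E₀]
    [NormedAddCommGroup E₁] [NormedSpace ℝ E₁] [FiniteDimensional ℝ E₁]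
    [NormedAddCommGroup E₂] [NormedSpace ℝ E₂] [FiniteDimensional ℝ E₂]
    {M₀ M₁ M₂ : Type*}
    [TopologicalSpace M₀] [T2Space M₀] [SecondCountableTopology M₀]
    [ChartedSpace E₀ M₀] [IsManifold 𝓘(ℝ, E₀) ∞ M₀]
    [TopologicalSpace M₁] [T2Space M₁] [SecondCountableTopology M₁]
    [ChartedSpace E₁ M₁] [IsManifold 𝓘(ℝ, E₁) ∞ M₁]
    [TopologicalSpace M₂] [T2Space M₂] [SecondCountableTopology M₂]
    [ChartedSpace E₂ M₂] [IsManifold 𝓘(ℝ, E₂) ∞ M₂]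
    (ω₀ : TwoForm 𝓘(ℝ, E₀) M₀) (hω₀ : IsSymplecticForm ω₀)
    (ω₁ : TwoForm 𝓘(ℝ, E₁) M₁) (hω₁ : IsSymplecticForm ω₁)
    (ω₂ : TwoForm 𝓘(ℝ, E₂) M₂) (hω₂ : IsSymplecticForm ω₂)
    (L₀ : Set M₀) (L₀₁ : Set (M₀ × M₁)) (L₁₂ : Set (M₁ × M₂)) (L₂ : Set M₂)
    (hL₀ : IsCompact L₀) (hL₀₁ : IsCompact L₀₁) (hL₁₂ : IsCompact L₁₂) (hL₂ : IsCompact L₂)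
    (lagL₀ : IsLagrangian ω₀ L₀)
    (lagL₀₁ : IsLagrangian (correspondenceForm ω₀ ω₁) L₀₁)
    (lagL₁₂ : IsLagrangian (correspondenceForm ω₁ ω₂) L₁₂)
    (lagL₂ : IsLagrangian (fun x => -ω₂ x) L₂)
    (hemb : IsEmbeddedComposition E₀ E₁ E₂ L₀₁ L₁₂)
    (K₀ : Set M₀) (hK₀ : IsCompact K₀) (hLK₀ : L₀ ⊆ interior K₀)
    (K₂ : Set M₂) (hK₂ : IsCompact K₂) (hLK₂ : L₂ ⊆ interior K₂) :
    ∃ Ham : Set (Hamiltonian E₀ K₀ × Hamiltonian E₂ K₂), IsOpen Ham ∧ Dense Ham ∧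
      ∀ H ∈ Ham, ∃ (φ₀ : M₀ → M₀) (φ₁ : M₁ → M₁) (φ₂ : M₂ → M₂),
        IsTimeOneFlow ω₀ H.1.extend φ₀ ∧
        IsTimeOneFlow ω₁ (fun _ _ => 0) φ₁ ∧
        IsTimeOneFlow ω₂ H.2.extend φ₂ ∧
        TripleTransversal E₀ E₂ φ₀ φ₂ L₀ (geometricComposition L₀₁ L₁₂) L₂ ∧
        QuadrupleTransversal E₀ E₁ E₂ φ₀ φ₁ φ₂ L₀ L₀₁ L₁₂ L₂ := by
  have e₀ : ∀ G : Hamiltonian E₀ K₀, MDifferentiable 𝓘(ℝ, E₀) 𝓘(ℝ, E₀) (G.flow hω₀ hK₀) := by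
    intro G x
    have := (Hamiltonian.mjointC1At_flow hω₀ hK₀ (fun i : Empty => i.elim) G x 0).mdifferentiableAt
    simpa only [Hamiltonian.addFamily_zero] using this
  have e₂ : ∀ G : Hamiltonian E₂ K₂, MDifferentiable 𝓘(ℝ, E₂) 𝓘(ℝ, E₂) (G.flow hω₂ hK₂) := by
    intro G x
    have := (Hamiltonian.mjointC1At_flow hω₂ hK₂ (fun i : Empty => i.elim) G x 0).mdifferentiableAt
    simpa only [Hamiltonian.addFamily_zero] using this
  -- No intersection with a second generic set is needed: transversality of the four-term system
  -- already implies that of the three-term one.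
  refine ⟨{H | QuadrupleTransversal E₀ E₁ E₂ (H.1.flow hω₀ hK₀) id (H.2.flow hω₂ hK₂) L₀ L₀₁ L₁₂ L₂},
    isOpen_setOf_quadrupleTransversal hω₀ hω₂ hL₀ hL₀₁ hL₁₂ hL₂ hK₀ hK₂,
    dense_setOf_quadrupleTransversal hω₀ hω₂ hL₀ hL₀₁ hL₁₂ hL₂ lagL₀ lagL₀₁ lagL₁₂ lagL₂ hemb
      hK₀ hLK₀ hK₂ hLK₂, fun H hH => ?_⟩
  exact ⟨H.1.flow hω₀ hK₀, id, H.2.flow hω₂ hK₂, H.1.isTimeOneFlow_flow hω₀ hK₀,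
    isTimeOneFlow_id ω₁, H.2.isTimeOneFlow_flow hω₂ hK₂,
    QuadrupleTransversal.tripleTransversal hω₁ hL₀₁ hL₁₂ lagL₀₁ lagL₁₂ hemb (e₀ H.1) (e₂ H.2) hH, hH⟩
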